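/- Let $\sigma$ be a finite positive Borel measure supported on the closed unit ball of $\mathbb{R}^n$ and let $\mu$ be a finite signed measure with $d\mu=\rho\,d\sigma$ for some bounded measurable density $\rho:\mathbb{R}^n\to\mathbb{R}$ and $\mu(\mathbb{R}^n)=0$. Suppose that there are $\alpha>0$ and $A<\infty$ with $$\max(|\hat\sigma(\xi)|,|\hat\mu(\xi)|)\le A|\xi|^{-\alpha}\qquad(\xi\ne0),$$ and that $1<p<q<\infty$ are exponents such that $f\mapsto\mu*f$ is a bounded operator from $L^p(\mathbb{R}^n)$ to $L^q(\mathbb{R}^n)$. Let $q'=q/(q-1)$. For $j\in\mathbb{Z}$ define $\mu_j$ by $\int f\,d\mu_j=\int f(2^jx)\,d\mu(x)$. For a measurable function $f$, an axis-parallel cube $Q$ and $1\le s<\infty$ put $\langle|f|\rangle_{Q,s}=\left(\frac1{|Q|}\int_Q|f|^s\,dx\right)^{1/s}\in[0,\infty]$, let $f_Q^0=f\cdot 1_{\{x\in Q:\,|f(x)|\le\langle|f|\rangle_{Q,s}\}}$, let $f_Q^m=f\cdot 1_{\{x\in Q:\,2^{m-1}\langle|f|\rangle_{Q,s}<|f(x)|\le2^m\langle|f|\rangle_{Q,s}\}}$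 for $m\ge1$, and define the restricted-type $L^s(\log L)^4$ average $$\langle|f|\rangle_{Q,s^+}=\sum_{m\ge0}(m+1)^4\langle|f_Q^m|\rangle_{Q,s}.$$ Let $3Q$ be the cube with the same centre as $Q$ and three times its side length. A collection $\mathcal{Q}$ of cubes is called sparse if there are pairwise disjoint measurable sets $F_Q\subset Q$ $(Q\in\mathcal{Q})$ with $|F_Q|\ge\frac12|Q|$. Then there is a finite constant $C$, depending only on $n,\mu,\sigma,p,q$, such that the following holds for all complex coefficients $(\epsilon_j)_{j\in\mathbb{Z}}$ with $|\epsilon_j|\le1$, all $1<r<\infty$, and all compactly supported complex-valued $f_1\in L^r(\mathbb{R}^n)$ and $f_2\in L^{r'}(\mathbb{R}^n)$, where $r'=r/(r-1)$ (in particular, for all bounded measurable compactly supported $f_1,f_2$). The series $$T[f_1]=\sum_{j\in\mathbb{Z}}\epsilon_j\,\mu_j*f_1$$ converges unconditionally in $L^r(\mathbb{R}^n)$, and there is a sparse collection $\mathcal{Q}$ of cubes with $$|\langle T[f_1],f_2\rangle|\le C\sum_{Q\in\mathcal{Q}}|Q|\,\langle|f_1|\rangle_{Q,p^+}\,\langle|f_2|\rangle_{3Q,q'^+}.$$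 -/

import Mathlib

open MeasureTheory Filter Topology
open scoped ENNReal NNReal

namespace SparseRadon

noncomputable section

/-! ### Signed measures on `ℝⁿ`: Fourier transform, dilation, convolution -/

/-- The Fourier transform `μ̂(ξ) = ∫ e^{-2πi x·ξ} dμ(x)` of a finite signed measure on `ℝⁿ`. -/
def measureFourier {n : ℕ} (μ : SignedMeasure (EuclideanSpace ℝ (Fin n)))
    (ξ : EuclideanSpace ℝ (Fin n)) : ℂ :=
  ∫ᵛ x, Complex.exp (-(2 * Real.pi * inner ℝ x ξ : ℝ) * Complex.I) ∂<•μ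

/-- The dilate `μ_j`, the image of `μ` under `x ↦ 2^j x`; thus `∫ f dμ_j = ∫ f(2^j x) dμ(x)`. -/
def dilate {n : ℕ} (μ : SignedMeasure (EuclideanSpace ℝ (Fin n))) (j : ℤ) :
    SignedMeasure (EuclideanSpace ℝ (Fin n)) :=
  μ.map (fun x => (2 : ℝ) ^ j • x)

/-- The convolution `(μ * f)(x) = ∫ f(x - y) dμ(y)`. -/
def conv {n : ℕ} (μ : SignedMeasure (EuclideanSpace ℝ (Fin n)))
    (f : EuclideanSpace ℝ (Fin n) → ℂ) (x : EuclideanSpace ℝ (Fin n)) : ℂ :=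
  ∫ᵛ y, f (x - y) ∂<•μ

/-- Convolution with `μ` is a bounded operator from `L^p(ℝⁿ)` to `L^q(ℝⁿ)`. -/
def ConvBounded {n : ℕ} (μ : SignedMeasure (EuclideanSpace ℝ (Fin n))) (p q : ℝ) : Prop :=
  ∃ A : ℝ≥0, ∀ f : EuclideanSpace ℝ (Fin n) → ℂ, MemLp f (ENNReal.ofReal p) volume →
    eLpNorm (conv μ f) (ENNReal.ofReal q) volume ≤ A * eLpNorm f (ENNReal.ofReal p) volume

/-- `g` represents `T[f] = ∑_j ε_j μ_j * f`, where the series over `j ∈ ℤ` converges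
unconditionally in `L^r(ℝⁿ)`. -/
def IsSingularRadon {n : ℕ} (μ : SignedMeasure (EuclideanSpace ℝ (Fin n))) (ε : ℤ → ℂ) (r : ℝ)
    (f g : EuclideanSpace ℝ (Fin n) → ℂ) : Prop :=
  MemLp g (ENNReal.ofReal r) volume ∧
  Tendsto (fun J : Finset ℤ =>
      eLpNorm (fun x => (∑ j ∈ J, ε j * conv (dilate μ j) f x) - g x) (ENNReal.ofReal r) volume)
    atTop (𝓝 0)

/-! ### Cubes and sparse collections -/

/-- An axis-parallel cube in `ℝⁿ`, given by its lower corner and its side length. -/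
structure Cube (n : ℕ) where
  corner : Fin n → ℝ
  side : ℝ
  side_pos : 0 < side

/-- The (half-open) point set of a cube. -/
def Cube.carrier {n : ℕ} (Q : Cube n) : Set (EuclideanSpace ℝ (Fin n)) :=
  {x | ∀ i, Q.corner i ≤ x i ∧ x i < Q.corner i + Q.side}

/-- The cube `3Q` with the same centre as `Q` and three times its side length. -/
def Cube.triple {n : ℕ} (Q : Cube n) : Cube n where
  corner := fun i => Q.corner i - Q.side
  side := 3 * Q.side
  side_pos := mul_pos three_pos Q.side_pos

/-- A collection of cubes is sparse if there are pairwise disjoint measurable sets `F_Q ⊆ Q` with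
`|F_Q| ≥ |Q| / 2`. -/
def IsSparse {n : ℕ} (𝒬 : Set (Cube n)) : Prop :=
  ∃ F : Cube n → Set (EuclideanSpace ℝ (Fin n)),
    (∀ Q ∈ 𝒬, MeasurableSet (F Q) ∧ F Q ⊆ Q.carrier ∧
      volume Q.carrier / 2 ≤ volume (F Q)) ∧
    𝒬.PairwiseDisjoint F

/-! ### Averages -/

/-- `⟨|f|⟩_{Q,p} = (|Q|⁻¹ ∫_Q |f|^p)^{1/p}`, with values in `[0, ∞]`. -/
def avg {n : ℕ} (p : ℝ) (f : EuclideanSpace ℝ (Fin n) → ℂ) (Q : Cube n) : ℝ≥0∞ :=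
  ((∫⁻ x in Q.carrier, ‖f x‖ₑ ^ p) / volume Q.carrier) ^ (1 / p)

/-- The set where the piece `f^m_Q` lives: `{x ∈ Q : |f(x)| ≤ ⟨|f|⟩_{Q,p}}` for `m = 0`, and
`{x ∈ Q : 2^{m-1} ⟨|f|⟩_{Q,p} < |f(x)| ≤ 2^m ⟨|f|⟩_{Q,p}}` for `m > 0`. -/
def levelSet {n : ℕ} (p : ℝ) (f : EuclideanSpace ℝ (Fin n) → ℂ) (Q : Cube n) :
    ℕ → Set (EuclideanSpace ℝ (Fin n))
  | 0 => {x | x ∈ Q.carrier ∧ ‖f x‖ₑ ≤ avg p f Q}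
  | m + 1 => {x | x ∈ Q.carrier ∧ 2 ^ m * avg p f Q < ‖f x‖ₑ ∧ ‖f x‖ₑ ≤ 2 ^ (m + 1) * avg p f Q}

/-- The restricted-type `L^p (log L)^4` average
`⟨|f|⟩_{Q,p⁺} = ∑_{m ≥ 0} (m+1)^4 ⟨|f^m_Q|⟩_{Q,p}`, where `f^m_Q = f · 1_{levelSet m}`. -/
def avgPlus {n : ℕ} (p : ℝ) (f : EuclideanSpace ℝ (Fin n) → ℂ) (Q : Cube n) : ℝ≥0∞ :=
  ∑' m : ℕ, ((m : ℝ≥0∞) + 1) ^ 4 * avg p ((levelSet p f Q m).indicator f) Q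

end

end SparseRadon

open MeasureTheory Filter Topology
open scoped ENNReal NNReal

namespace SparseRadon

noncomputable section

/-! Two properties of `μ = ρ dσ` drive the argument, besides its support in the unit ball and its
finite mass. Since `μ` has mean zero and compact support, its Fourier transform vanishes to first
order at the origin; together with the assumed decay this gives `|μ̂(ξ)| ≤ B min(|ξ|^β, |ξ|^(-β))`
with `β = min 1 α` (`HasDecay`, `exists_hasDecay`). By scaling, the `L^p → L^q` bound holds at every
scale `j` with the factor `|Q|^(-(1/p - 1/q))`, where `Q` has side `2^j` (`Improves`,
`exists_improves`).

Cancellation. Plancherel and a two-sided geometric series bound the finite sums `trunc` on `L²`. The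
same decay shows that `μ_j * f` oscillates little on cubes of side `2^(j-k)`: the squared `L²` norms
of these oscillations, summed over `j`, are at most `C 2^(-βk) ‖f‖²` (`exists_osc_op_bound`). The
dual statement, `exists_sum_op_osc_bound`, says that `∑ μ_j * b_j` gains `2^(-βk)` when `b_j` has
mean zero on cubes of side `2^(j-k)`.

`L^r` bounds. In a Calderón–Zygmund decomposition at height `t`, the piece that scale `j` receives
from stopping cubes of side `2^(j-k)` is cut at height `θ^k t`. Below the cut the `L²` gain
outweighs the growth of the height; above it the triangle inequality in `L¹` suffices, and the sum
over `k` is affordable because `r > 1` (`exists_weak_bound`). Summation over dyadic heights gives `1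
< r < 2`, and duality gives `r > 2` (`exists_trunc_bound`). Convergence in `L²` follows by dominated
convergence on the Fourier side, and in `L^r` by interpolation and density (`exists_tendsto_trunc`).

Sparse domination. Inside a dyadic cube, stop at the maximal subcubes on which the average of
`|f₁|^p`, or the average of `|f₂|^q'` over the triple, is much larger than on the given cube. These
fill at most half of the cube (`volume_children_le`), so iteration produces a sparse family. At
scale `j` the stopping cubes of side at most `2^j` are kept; on a larger stopping cube the remaining
scales pose the same problem again, which is the recursion `enorm_sum_le_tsum_cost`. Scales at or
above that of the initial cube are summed with the `L^p → L^q` bound (`enorm_integral_op_le`).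

The kept part is bounded by one term of the sparse form (`exists_step_bound`). Both functions are
split into a bounded good part and an oscillating bad part. Pairings with a good part use the `L^p`
and `L^q` bounds: the kept sum is a full truncated sum minus sums localized to stopping cubes
(`enorm_sum_integral_stopped_le`). In the pairing of the two bad parts, scale `j` sees only cubes of
sides `2^(j-k)` and `2^(j-l)` with `k, l ≥ 0` (`notMem_A'`). Where both functions are below `θ^(max
k l)` times their averages, cancellation gives a summable bound. Otherwise the `L^p → L^q` bound
leaves the tail of one function above its threshold. A level set `2^m` times above the average
enters for `O(m²)` pairs `(k, l)`, which the weight `(m+1)^4` covers (`exists_sum_tail_le`).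

Finally, the collection is built from `f₁` and `f₂` alone. The same collection therefore serves
every finite set of scales and all bounded functions dominated by `f₁` and `f₂`, and the bound
passes to the limit (`enorm_integral_mul_le`). -/

/-- `n`-dimensional Euclidean space. -/
abbrev Euc (n : ℕ) := EuclideanSpace ℝ (Fin n)

/-! ### Bounded measurable functions of bounded support -/

/-- Bounded measurable functions vanishing outside a ball. -/
structure Nice {n : ℕ} (f : Euc n → ℂ) : Prop where
  meas : Measurable f
  bdd : ∃ C : ℝ, ∀ x, ‖f x‖ ≤ C
  supp : ∃ R : ℝ, ∀ x, R < ‖x‖ → f x = 0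

namespace Nice

variable {n : ℕ} {f g : Euc n → ℂ}

theorem zero : Nice (fun _ : Euc n => (0 : ℂ)) :=
  ⟨measurable_const, ⟨0, by simp⟩, ⟨0, by simp⟩⟩

theorem mono_bound (hf : Nice f) (hg : Measurable g) {C : ℝ} (h : ∀ x, ‖g x‖ ≤ C * ‖f x‖) :
    Nice g := by
  obtain ⟨B, hB⟩ := hf.bdd
  obtain ⟨R, hR⟩ := hf.supp
  refine ⟨hg, ⟨|C| * B, fun x => (h x).trans ?_⟩, ⟨R, fun x hx => ?_⟩⟩
  · exact mul_le_mul (le_abs_self C) (hB x) (norm_nonneg _) (abs_nonneg _)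
  · have := h x
    rw [hR x hx] at this
    simpa using this

theorem add (hf : Nice f) (hg : Nice g) : Nice (fun x => f x + g x) := by
  obtain ⟨B, hB⟩ := hf.bdd
  obtain ⟨R, hR⟩ := hf.supp
  obtain ⟨B', hB'⟩ := hg.bdd
  obtain ⟨R', hR'⟩ := hg.supp
  refine ⟨hf.meas.add hg.meas, ⟨B + B', fun x => (norm_add_le _ _).trans
    (add_le_add (hB x) (hB' x))⟩, ⟨max R R', fun x hx => ?_⟩⟩
  rw [hR x ((le_max_left _ _).trans_lt hx), hR' x ((le_max_right _ _).trans_lt hx), add_zero]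

theorem const_mul (hf : Nice f) (c : ℂ) : Nice (fun x => c * f x) :=
  hf.mono_bound (hf.meas.const_mul c) (C := ‖c‖) (fun x => by simp)

theorem sub (hf : Nice f) (hg : Nice g) : Nice (fun x => f x - g x) := by
  have := hf.add (hg.const_mul (-1))
  simpa [sub_eq_add_neg] using this

theorem indicator (hf : Nice f) {s : Set (Euc n)} (hs : MeasurableSet s) : Nice (s.indicator f) :=
  hf.mono_bound (hf.meas.indicator hs) (C := 1) (fun x => by
    simpa using norm_indicator_le_norm_self f x)

theorem conj (hf : Nice f) : Nice (fun x => (starRingEnd ℂ) (f x)) :=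
  hf.mono_bound (Complex.continuous_conj.measurable.comp hf.meas) (C := 1) (fun x => by simp)

theorem sum {ι : Type*} {s : Finset ι} {F : ι → Euc n → ℂ} (h : ∀ i ∈ s, Nice (F i)) :
    Nice (fun x => ∑ i ∈ s, F i x) := by
  classical
  induction s using Finset.induction_on with
  | empty => simpa using zero
  | insert a s ha ih =>
    have := (h a (by simp)).add (ih fun i hi => h i (by simp [hi]))
    simpa [Finset.sum_insert ha] using this

theorem bdd_nonneg (hf : Nice f) : ∃ C : ℝ, 0 ≤ C ∧ ∀ x, ‖f x‖ ≤ C := by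
  obtain ⟨B, hB⟩ := hf.bdd
  exact ⟨B, (norm_nonneg _).trans (hB 0), hB⟩

theorem memLp (hf : Nice f) (p : ℝ≥0∞) : MemLp f p volume := by
  obtain ⟨B, hB⟩ := hf.bdd
  obtain ⟨R, hR⟩ := hf.supp
  have h : f = (Metric.closedBall 0 R).indicator f := by
    ext x
    by_cases hx : x ∈ Metric.closedBall (0 : Euc n) R
    · simp [hx]
    · rw [Set.indicator_of_notMem hx]
      exact hR x (by simpa using hx)
  rw [h, memLp_indicator_iff_restrict Metric.isClosed_closedBall.measurableSet]
  have : IsFiniteMeasure (volume.restrict (Metric.closedBall (0 : Euc n) R)) :=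
    ⟨by simpa using measure_closedBall_lt_top⟩
  exact MemLp.of_bound hf.meas.aestronglyMeasurable B (Eventually.of_forall hB)

theorem integrable (hf : Nice f) : Integrable f := memLp_one_iff_integrable.1 (hf.memLp 1)

theorem mul_bdd (hf : Nice f) (hg : Measurable g) (h : ∃ C : ℝ, ∀ x, ‖g x‖ ≤ C) :
    Nice (fun x => f x * g x) := by
  obtain ⟨C, hC⟩ := h
  refine hf.mono_bound (hf.meas.mul hg) (C := C) fun x => ?_
  rw [norm_mul, mul_comm]
  exact mul_le_mul_of_nonneg_right (hC x) (norm_nonneg _)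

theorem mul (hf : Nice f) (hg : Nice g) : Nice (fun x => f x * g x) := hf.mul_bdd hg.meas hg.bdd

theorem lintegral_rpow_lt_top (hf : Nice f) {r : ℝ} (hr : 0 < r) :
    ∫⁻ x, ‖f x‖ₑ ^ r < ∞ := by
  have := lintegral_rpow_enorm_lt_top_of_eLpNorm_lt_top (f := f) (p := ENNReal.ofReal r)
    (μ := volume) (by simpa using hr) (by simp) (hf.memLp _).2
  simpa [ENNReal.toReal_ofReal hr.le] using this

end Nice

/-! ### Averaging operators with bounded density -/

/-- A finite measure on the closed unit ball together with a bounded real density. -/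
structure DensityData (n : ℕ) where
  σ : Measure (Euc n)
  fin : IsFiniteMeasure σ
  ρ : Euc n → ℝ
  meas : Measurable ρ
  K : ℝ≥0
  bound : ∀ x, |ρ x| ≤ K
  supp : σ (Metric.closedBall 0 1)ᶜ = 0

namespace DensityData

variable {n : ℕ} (D : DensityData n)

instance : IsFiniteMeasure D.σ := D.fin

/-- The operator `f ↦ ∫ ρ(y) f(x - c y) dσ(y)`. -/
def op (c : ℝ) (f : Euc n → ℂ) (x : Euc n) : ℂ := ∫ y, (D.ρ y : ℂ) * f (x - c • y) ∂D.σ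

/-- An upper bound for the total variation of `ρ dσ`. -/
def mass : ℝ≥0 := D.K * (D.σ Set.univ).toNNReal

theorem coe_mass : (D.mass : ℝ≥0∞) = D.K * D.σ Set.univ := by
  simp [mass, ENNReal.coe_toNNReal (measure_ne_top D.σ _)]

theorem ae_mem_ball : ∀ᵐ y ∂D.σ, y ∈ Metric.closedBall (0 : Euc n) 1 := by
  rw [ae_iff]; exact D.supp

variable {f g : Euc n → ℂ}

theorem enorm_rho_le (y : Euc n) : ‖(D.ρ y : ℂ)‖ₑ ≤ D.K := by
  rw [← ofReal_norm, Complex.norm_real, Real.norm_eq_abs]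
  exact (ENNReal.ofReal_le_ofReal (D.bound y)).trans (by simp)

theorem integrable_op (hf : Nice f) (c : ℝ) (x : Euc n) :
    Integrable (fun y => (D.ρ y : ℂ) * f (x - c • y)) D.σ := by
  obtain ⟨B, hB0, hB⟩ := hf.bdd_nonneg
  refine Integrable.of_bound (C := D.K * B) ?_ ?_
  · have h1 := D.meas
    have h2 := hf.meas
    exact Measurable.aestronglyMeasurable (by fun_prop)
  · refine Eventually.of_forall fun y => ?_
    rw [norm_mul, Complex.norm_real]
    exact mul_le_mul (D.bound y) (hB _) (norm_nonneg _) D.K.2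

theorem enorm_op_le (c : ℝ) (f : Euc n → ℂ) (x : Euc n) :
    ‖D.op c f x‖ₑ ≤ D.K * ∫⁻ y, ‖f (x - c • y)‖ₑ ∂D.σ := by
  refine (enorm_integral_le_lintegral_enorm _).trans ?_
  rw [← lintegral_const_mul' _ _ ENNReal.coe_ne_top]
  refine lintegral_mono fun y => ?_
  rw [enorm_mul]
  exact mul_le_mul_left (D.enorm_rho_le y) _

theorem op_eq_zero {c : ℝ} {x : Euc n}
    (h : ∀ y ∈ Metric.closedBall (0 : Euc n) 1, f (x - c • y) = 0) : D.op c f x = 0 := by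
  unfold op
  rw [integral_eq_zero_of_ae]
  filter_upwards [D.ae_mem_ball] with y hy
  simp [h y hy]

theorem op_nice (hf : Nice f) (c : ℝ) : Nice (D.op c f) := by
  obtain ⟨B, hB0, hB⟩ := hf.bdd_nonneg
  obtain ⟨R, hR⟩ := hf.supp
  refine ⟨?_, ⟨D.K * B * D.σ.real Set.univ, fun x => ?_⟩, ⟨R + |c|, fun x hx => ?_⟩⟩
  · have h1 := D.meas
    have h2 := hf.meas
    refine (StronglyMeasurable.integral_prod_right (ν := D.σ)
      (f := fun x y => (D.ρ y : ℂ) * f (x - c • y)) ?_).measurable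
    exact Measurable.stronglyMeasurable (by fun_prop)
  · refine norm_integral_le_of_norm_le_const (Eventually.of_forall fun y => ?_)
    rw [norm_mul, Complex.norm_real]
    exact mul_le_mul (D.bound y) (hB _) (norm_nonneg _) D.K.2
  · refine D.op_eq_zero fun y hy => hR _ ?_
    have h1 : ‖c • y‖ ≤ |c| := by
      rw [norm_smul, Real.norm_eq_abs]
      exact mul_le_of_le_one_right (abs_nonneg _) (by simpa using hy)
    have := norm_sub_norm_le x (c • y)
    linarith

theorem op_zero (c : ℝ) : D.op c (fun _ => 0) = fun _ => 0 := by
  ext x; simp [op]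

theorem op_add (hf : Nice f) (hg : Nice g) (c : ℝ) (x : Euc n) :
    D.op c (fun x => f x + g x) x = D.op c f x + D.op c g x := by
  simp only [op, mul_add]
  exact integral_add (D.integrable_op hf c x) (D.integrable_op hg c x)

theorem op_sub (hf : Nice f) (hg : Nice g) (c : ℝ) (x : Euc n) :
    D.op c (fun x => f x - g x) x = D.op c f x - D.op c g x := by
  simp only [op, mul_sub]
  exact integral_sub (D.integrable_op hf c x) (D.integrable_op hg c x)

theorem op_sum {ι : Type*} {s : Finset ι} {F : ι → Euc n → ℂ} (h : ∀ i ∈ s, Nice (F i)) (c : ℝ)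
    (x : Euc n) : D.op c (fun x => ∑ i ∈ s, F i x) x = ∑ i ∈ s, D.op c (F i) x := by
  simp only [op, Finset.mul_sum]
  exact integral_finsetSum s fun i hi => D.integrable_op (h i hi) c x

/-- Hölder on the finite measure `σ`, then Fubini and translation invariance. The constant does not
depend on the dilation `c`. -/
theorem lintegral_op_rpow_le (hf : Measurable f) (c : ℝ) {r : ℝ} (hr : 1 ≤ r) :
    ∫⁻ x, ‖D.op c f x‖ₑ ^ r ≤ (D.mass : ℝ≥0∞) ^ r * ∫⁻ x, ‖f x‖ₑ ^ r := by
  have hr0 : 0 < r := by linarith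
  have key : ∀ x, ‖D.op c f x‖ₑ ^ r ≤ (D.K : ℝ≥0∞) ^ r * (D.σ Set.univ) ^ (r - 1) *
      ∫⁻ y, ‖f (x - c • y)‖ₑ ^ r ∂D.σ := by
    intro x
    have hm : AEStronglyMeasurable (fun y => f (x - c • y)) D.σ :=
      Measurable.aestronglyMeasurable (by fun_prop)
    have h2 := eLpNorm_le_eLpNorm_mul_rpow_measure_univ (p := 1) (q := ENNReal.ofReal r)
      (by simpa using hr) hm
    rw [eLpNorm_one_eq_lintegral_enorm, eLpNorm_eq_lintegral_rpow_enorm_toReal (by simpa using hr0)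
      (by simp), ENNReal.toReal_ofReal hr0.le] at h2
    calc ‖D.op c f x‖ₑ ^ r ≤ (D.K * ((∫⁻ y, ‖f (x - c • y)‖ₑ ^ r ∂D.σ) ^ (1 / r) *
          D.σ Set.univ ^ (1 / (1 : ℝ≥0∞).toReal - 1 / r))) ^ r := by
          refine ENNReal.rpow_le_rpow ((D.enorm_op_le c f x).trans ?_) hr0.le
          gcongr
      _ = _ := by
          rw [ENNReal.mul_rpow_of_nonneg _ _ hr0.le, ENNReal.mul_rpow_of_nonneg _ _ hr0.le,
            ← ENNReal.rpow_mul, ← ENNReal.rpow_mul, one_div, inv_mul_cancel₀ hr0.ne',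
            ENNReal.rpow_one]
          have : (1 / (1 : ℝ≥0∞).toReal - r⁻¹) * r = r - 1 := by
            simp; field_simp
          rw [this]; ring
  calc ∫⁻ x, ‖D.op c f x‖ₑ ^ r ≤ ∫⁻ x, (D.K : ℝ≥0∞) ^ r * (D.σ Set.univ) ^ (r - 1) *
      ∫⁻ y, ‖f (x - c • y)‖ₑ ^ r ∂D.σ := lintegral_mono key
    _ = (D.K : ℝ≥0∞) ^ r * (D.σ Set.univ) ^ (r - 1) * ∫⁻ x, ∫⁻ y, ‖f (x - c • y)‖ₑ ^ r ∂D.σ := by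
        rw [lintegral_const_mul]
        exact Measurable.lintegral_prod_right' (f := fun z : Euc n × Euc n =>
          ‖f (z.1 - c • z.2)‖ₑ ^ r) (by fun_prop)
    _ = (D.K : ℝ≥0∞) ^ r * (D.σ Set.univ) ^ (r - 1) * ∫⁻ _, (∫⁻ x, ‖f x‖ₑ ^ r) ∂D.σ := by
        rw [lintegral_lintegral_swap]
        · congr 1
          refine lintegral_congr fun y => ?_
          exact lintegral_sub_right_eq_self (fun x => ‖f x‖ₑ ^ r) (c • y)
        · exact Measurable.aemeasurable (by fun_prop)
    _ = _ := by
        rw [lintegral_const, coe_mass, ENNReal.mul_rpow_of_nonneg _ _ hr0.le]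
        have h1 : (D.σ Set.univ) ^ (r - 1) * D.σ Set.univ = D.σ Set.univ ^ r := by
          rcases eq_or_ne (D.σ Set.univ) 0 with h | h
          · simp [h, ENNReal.zero_rpow_of_pos hr0]
          · rw [ENNReal.rpow_sub _ _ h (measure_ne_top _ _), ENNReal.rpow_one,
              ENNReal.div_mul_cancel h (measure_ne_top _ _)]
        rw [← h1]; ring

/-- The transpose for the bilinear pairing is the reflected operator. For this reason the estimates
for `trunc` carry a sign `s` with `|s| = 1`: they then apply to the transposes as well. -/
theorem integral_op_mul (hf : Nice f) (hg : Nice g) (c : ℝ) :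
    ∫ x, D.op c f x * g x = ∫ x, f x * D.op (-c) g x := by
  obtain ⟨B, hB0, hB⟩ := hf.bdd_nonneg
  have hint : Integrable (fun z : Euc n × Euc n => (D.ρ z.2 : ℂ) * f (z.1 - c • z.2) * g z.1)
      (volume.prod D.σ) := by
    have h1 : Integrable (fun z : Euc n × Euc n => g z.1 * (1 : ℂ)) (volume.prod D.σ) :=
      hg.integrable.mul_prod (integrable_const (1 : ℂ))
    refine (h1.norm.const_mul (D.K * B)).mono' ?_ ?_
    · have h2 := D.meas
      have h3 := hf.meas
      have h4 := hg.meas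
      exact Measurable.aestronglyMeasurable (by fun_prop)
    · refine Eventually.of_forall fun z => ?_
      rw [norm_mul, norm_mul, Complex.norm_real, mul_one]
      gcongr
      · exact D.bound _
      · exact hB _
  have h1 : ∀ x, D.op c f x * g x = ∫ y, (D.ρ y : ℂ) * f (x - c • y) * g x ∂D.σ := fun x => by
    rw [op, integral_mul_const]
  have h2 : ∀ x, f x * D.op (-c) g x = ∫ y, (D.ρ y : ℂ) * f x * g (x + c • y) ∂D.σ := fun x => by
    rw [op, ← integral_const_mul]
    congr 1; ext y
    rw [neg_smul, sub_neg_eq_add]; ring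
  simp_rw [h1, h2]
  have hint2 : Integrable (fun z : Euc n × Euc n => (D.ρ z.2 : ℂ) * f z.1 * g (z.1 + c • z.2))
      (volume.prod D.σ) := by
    obtain ⟨B', hB0', hB'⟩ := hg.bdd_nonneg
    have h1 : Integrable (fun z : Euc n × Euc n => f z.1 * (1 : ℂ)) (volume.prod D.σ) :=
      hf.integrable.mul_prod (integrable_const (1 : ℂ))
    refine (h1.norm.const_mul (D.K * B')).mono' ?_ ?_
    · have h2 := D.meas
      have h3 := hf.meas
      have h4 := hg.meas
      exact Measurable.aestronglyMeasurable (by fun_prop)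
    · refine Eventually.of_forall fun z => ?_
      rw [norm_mul, norm_mul, Complex.norm_real, mul_one, mul_right_comm]
      gcongr
      · exact D.bound _
      · exact hB' _
  calc _ = ∫ y, ∫ x, (D.ρ y : ℂ) * f (x - c • y) * g x ∂volume ∂D.σ := integral_integral_swap hint
    _ = ∫ y, ∫ x, (D.ρ y : ℂ) * f x * g (x + c • y) ∂volume ∂D.σ := by
        congr 1; ext y
        rw [← integral_sub_right_eq_self (fun x => (D.ρ y : ℂ) * f x * g (x + c • y)) (c • y)]
        simp
    _ = _ := (integral_integral_swap hint2).symm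

end DensityData

end

end SparseRadon

namespace SparseRadon

noncomputable section

open scoped FourierTransform RealInnerProductSpace SchwartzMap ContDiff

variable {n : ℕ}

/-! ### Plancherel and Fourier multipliers -/

/-- The transform on `L²` is defined by extension, whereas the symbol calculus needs the integral.
Both agree as distributions: the transform is moved onto a smooth compactly supported test function.
-/
theorem fourier_toLp_ae_eq {f : Euc n → ℂ} (hf : Nice f) :
    ((𝓕 ((hf.memLp 2).toLp f) : Lp ℂ 2 (volume : Measure (Euc n))) : Euc n → ℂ) =ᵐ[volume] 𝓕 f := by
  set F : Lp ℂ 2 (volume : Measure (Euc n)) := (hf.memLp 2).toLp f with hF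
  have hcont : Continuous (𝓕 f) :=
    VectorFourier.fourierIntegral_continuous Real.continuous_fourierChar
      (L := innerₗ (Euc n)) continuous_inner hf.integrable
  refine ae_eq_of_integral_contDiff_smul_eq
    ((Lp.memLp (𝓕 F)).locallyIntegrable (by norm_num)) hcont.locallyIntegrable ?_
  intro g hg hgs
  have hg' : ContDiff ℝ ((⊤ : ℕ∞) : WithTop ℕ∞) (fun x => (g x : ℂ)) := Complex.ofRealCLM.contDiff.comp hg
  have hgs' : HasCompactSupport (fun x => (g x : ℂ)) :=
    hgs.comp_left (g := fun t : ℝ => (t : ℂ)) (by simp)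
  let G : 𝓢(Euc n, ℂ) := hgs'.toSchwartzMap hg'
  have hG : ∀ x, G x = (g x : ℂ) := fun x => rfl
  have h1 := DFunLike.congr_fun (Lp.fourier_toTemperedDistribution_eq F) G
  rw [TemperedDistribution.fourier_apply, Lp.toTemperedDistribution_apply,
    Lp.toTemperedDistribution_apply] at h1
  have h2 : ∫ x, (𝓕 G) x • F x = ∫ x, (𝓕 G) x • f x := by
    refine integral_congr_ae ?_
    filter_upwards [(hf.memLp 2).coeFn_toLp] with x hx
    rw [hx]
  have h3 : ∫ x, (𝓕 G) x • f x = ∫ x, G x • 𝓕 f x := by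
    have := VectorFourier.integral_fourierIntegral_smul_eq_flip (μ := (volume : Measure (Euc n)))
      (ν := volume) (L := innerₗ (Euc n)) (f := G) (g := f) Real.continuous_fourierChar
      continuous_inner G.integrable hf.integrable
    rw [flip_innerₗ] at this
    exact this
  calc ∫ x, g x • (𝓕 F : Lp ℂ 2 (volume : Measure (Euc n))) x
      = ∫ x, G x • (𝓕 F : Lp ℂ 2 (volume : Measure (Euc n))) x := by simp [hG]
    _ = ∫ x, G x • 𝓕 f x := by rw [← h1, h2, h3]
    _ = ∫ x, g x • 𝓕 f x := by simp [hG]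

theorem lintegral_fourier_sq {f : Euc n → ℂ} (hf : Nice f) :
    ∫⁻ ξ, ‖𝓕 f ξ‖ₑ ^ (2 : ℝ) = ∫⁻ x, ‖f x‖ₑ ^ (2 : ℝ) := by
  set F : Lp ℂ 2 (volume : Measure (Euc n)) := (hf.memLp 2).toLp f with hF
  have h1 : ‖𝓕 F‖ₑ = ‖F‖ₑ := by
    rw [← ofReal_norm, ← ofReal_norm, Lp.norm_fourier_eq]
  rw [Lp.enorm_def, Lp.enorm_def, eLpNorm_congr_ae (fourier_toLp_ae_eq hf),
    eLpNorm_congr_ae (hf.memLp 2).coeFn_toLp, eLpNorm_eq_lintegral_rpow_enorm_toReal (by simp)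
    (by simp), eLpNorm_eq_lintegral_rpow_enorm_toReal (by simp) (by simp)] at h1
  simpa using ENNReal.rpow_left_injective (x := 1 / 2) (by simp) (by simpa using h1)

/-- The character `t ↦ e^{2πit}` as a complex number. -/
def echar (t : ℝ) : ℂ := Complex.exp (2 * Real.pi * t * Complex.I)

theorem echar_add (s t : ℝ) : echar (s + t) = echar s * echar t := by
  rw [echar, echar, echar, ← Complex.exp_add]; congr 1; push_cast; ring

theorem norm_echar (t : ℝ) : ‖echar t‖ = 1 := by
  have := Complex.norm_exp_ofReal_mul_I (2 * Real.pi * t)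
  simpa [echar] using this

theorem continuous_echar : Continuous echar := by unfold echar; fun_prop

theorem fourier_eq_echar (f : Euc n → ℂ) (ξ : Euc n) : 𝓕 f ξ = ∫ x, echar (-⟪x, ξ⟫) * f x := by
  rw [Real.fourier_eq]
  simp only [Circle.smul_def, smul_eq_mul, Real.fourierChar_apply, echar]
  congr 1; ext x; push_cast; ring_nf

namespace DensityData

variable (D : DensityData n)

/-- The Fourier transform of `ρ dσ`. -/
def symbol (ξ : Euc n) : ℂ := ∫ y, echar (-⟪y, ξ⟫) * (D.ρ y : ℂ) ∂D.σ

theorem fourier_op {f : Euc n → ℂ} (hf : Nice f) (c : ℝ) (ξ : Euc n) :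
    𝓕 (D.op c f) ξ = D.symbol (c • ξ) * 𝓕 f ξ := by
  have hint : Integrable (fun z : Euc n × Euc n =>
      echar (-⟪z.1, ξ⟫) * ((D.ρ z.2 : ℂ) * f (z.1 - c • z.2))) (volume.prod D.σ) := by
    have h1 := D.meas
    have h2 := hf.meas
    have h3 := continuous_echar.measurable
    have h4 : Integrable (fun z : Euc n × Euc n => f z.1) (volume.prod D.σ) := by
      simpa using hf.integrable.mul_prod (integrable_const (1 : ℂ) (μ := D.σ))
    -- A shear preserves the product measure, so `f (x - c y)` is integrable on the product because
    -- `f` is.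
    have h5 : MeasurePreserving (fun z : Euc n × Euc n => (z.2, z.1 - c • z.2))
        (volume.prod D.σ) (D.σ.prod volume) := by
      refine MeasurePreserving.skew_product (μa := D.σ) (μb := D.σ) (μc := volume)
        (μd := volume) (f := id) (g := fun y x => x - c • y) (.id _) (by fun_prop) ?_ |>.comp
        Measure.measurePreserving_swap
      exact Eventually.of_forall fun y => (measurePreserving_sub_right volume (c • y)).map_eq
    have h6 : Integrable (fun z : Euc n × Euc n => f (z.1 - c • z.2)) (volume.prod D.σ) :=
      h5.integrable_comp_of_integrable h4.swap
    refine (h6.norm.const_mul D.K).mono' (Measurable.aestronglyMeasurable (by fun_prop))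
      (Eventually.of_forall fun z => ?_)
    rw [norm_mul, norm_mul, norm_echar, one_mul, Complex.norm_real]
    gcongr
    exact D.bound _
  rw [fourier_eq_echar, fourier_eq_echar, symbol, ← integral_mul_const]
  simp only [op]
  simp_rw [← integral_const_mul]
  rw [integral_integral_swap hint]
  congr 1; ext y
  rw [← integral_add_right_eq_self _ (c • y)]
  congr 1; ext x
  rw [add_sub_cancel_right, inner_add_left, neg_add, echar_add, real_inner_smul_left,
    real_inner_smul_right]
  ring

end DensityData

theorem Nice.translate {f : Euc n → ℂ} (hf : Nice f) (y : Euc n) : Nice (fun x => f (x - y)) := by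
  obtain ⟨B, hB⟩ := hf.bdd
  obtain ⟨R, hR⟩ := hf.supp
  refine ⟨hf.meas.comp (by fun_prop), ⟨B, fun x => hB _⟩, ⟨R + ‖y‖, fun x hx => hR _ ?_⟩⟩
  have := norm_sub_norm_le x y
  linarith

theorem fourier_sub_translate {f : Euc n → ℂ} (hf : Nice f) (y ξ : Euc n) :
    𝓕 (fun x => f x - f (x - y)) ξ = (1 - echar (-⟪y, ξ⟫)) * 𝓕 f ξ := by
  have h1 : ∀ g : Euc n → ℂ, Nice g → Integrable (fun x => echar (-⟪x, ξ⟫) * g x) := by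
    intro g hg
    refine hg.integrable.norm.mono' ?_ (Eventually.of_forall fun x => by simp [norm_echar])
    have h2 := hg.meas
    have h3 := continuous_echar.measurable
    exact Measurable.aestronglyMeasurable (by fun_prop)
  simp only [fourier_eq_echar]
  simp_rw [mul_sub]
  rw [integral_sub (h1 f hf) (h1 _ (hf.translate y)), sub_mul, one_mul, ← integral_const_mul]
  congr 1
  rw [← integral_add_right_eq_self _ y]
  congr 1; ext x
  rw [add_sub_cancel_right, inner_add_left, neg_add, echar_add]
  ring

theorem norm_one_sub_echar_le (t : ℝ) : ‖1 - echar t‖ ≤ 2 * Real.pi * |t| := by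
  have := Real.norm_exp_I_mul_ofReal_sub_one_le (x := 2 * Real.pi * t)
  rw [norm_sub_rev, echar]
  refine (le_of_eq ?_).trans (this.trans (le_of_eq ?_))
  · congr 3; push_cast; ring
  · rw [Real.norm_eq_abs, abs_mul, abs_of_pos Real.two_pi_pos]

/-- Interpolates between the Lipschitz bound and the trivial bound `2`. A fractional exponent is
needed because the decay of the symbol can absorb only a small power of the frequency. -/
theorem norm_one_sub_echar_le_rpow (t : ℝ) {γ : ℝ} (h0 : 0 ≤ γ) (h1 : γ ≤ 1) :
    ‖1 - echar t‖ ≤ 2 * Real.pi * |t| ^ γ := by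
  rcases le_total |t| 1 with h | h
  · refine (norm_one_sub_echar_le t).trans ?_
    gcongr
    simpa using Real.rpow_le_rpow_of_exponent_ge' (abs_nonneg t) h h0 h1
  · calc ‖1 - echar t‖ ≤ ‖(1 : ℂ)‖ + ‖echar t‖ := norm_sub_le _ _
      _ = 2 := by rw [norm_echar, norm_one]; norm_num
      _ ≤ 2 * Real.pi * 1 := by linarith [Real.pi_gt_three]
      _ ≤ _ := by gcongr; exact Real.one_le_rpow h h0

/-- Two-sided geometric series. -/
theorem exists_geometric_bound {a : ℝ} (ha : 0 < a) : ∃ C : ℝ, 0 ≤ C ∧ ∀ t : ℝ, 0 < t →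
    Summable (fun j : ℤ => min (((2 : ℝ) ^ j * t) ^ a) (((2 : ℝ) ^ j * t) ^ (-a))) ∧
    ∑' j : ℤ, min (((2 : ℝ) ^ j * t) ^ a) (((2 : ℝ) ^ j * t) ^ (-a)) ≤ C := by
  have h2 : (0 : ℝ) < 2 ^ (-a) := by positivity
  have h2' : (2 : ℝ) ^ (-a) < 1 := Real.rpow_lt_one_of_one_lt_of_neg (by norm_num) (by linarith)
  have hsum : Summable (fun j : ℤ => ((2 : ℝ) ^ (-a)) ^ (j.natAbs)) := by
    refine Summable.of_nat_of_neg ?_ ?_ <;>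
    simpa using summable_geometric_of_lt_one h2.le h2'
  refine ⟨2 ^ a * ∑' j : ℤ, ((2 : ℝ) ^ (-a)) ^ (j.natAbs), by positivity, fun t ht => ?_⟩
  -- The dyadic size of `t` only shifts the index `j`, so the constant is independent of `t`.
  obtain ⟨i, hi1, hi2⟩ := exists_mem_Ico_zpow (y := 2) ht (by norm_num)
  have hle : ∀ j : ℤ, min (((2 : ℝ) ^ j * t) ^ a) (((2 : ℝ) ^ j * t) ^ (-a)) ≤
      2 ^ a * ((2 : ℝ) ^ (-a)) ^ ((j + i).natAbs) := by
    intro j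
    have ht2 : (0 : ℝ) < 2 ^ j := by positivity
    have e1 : (2 : ℝ) ^ (j + i) ≤ 2 ^ j * t := by
      rw [zpow_add₀ (by norm_num)]; gcongr
    have e2 : (2 : ℝ) ^ j * t ≤ 2 ^ (j + i) * 2 := by
      rw [zpow_add₀ (by norm_num), mul_assoc]
      gcongr
      rw [zpow_add_one₀ (by norm_num)] at hi2
      exact hi2.le
    rcases le_total 0 (j + i) with h | h
    · refine (min_le_right _ _).trans ?_
      have : ((2 : ℝ) ^ (-a)) ^ (j + i).natAbs = ((2 : ℝ) ^ (j + i)) ^ (-a) := by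
        rw [← Real.rpow_natCast, ← Real.rpow_intCast, ← Real.rpow_mul (by norm_num),
          ← Real.rpow_mul (by norm_num), mul_comm, Nat.cast_natAbs, abs_of_nonneg h]
      rw [this]
      refine (Real.rpow_le_rpow_of_nonpos (by positivity) e1 (by linarith)).trans ?_
      exact le_mul_of_one_le_left (by positivity) (Real.one_le_rpow (by norm_num) ha.le)
    · refine (min_le_left _ _).trans ?_
      have : ((2 : ℝ) ^ (-a)) ^ (j + i).natAbs = ((2 : ℝ) ^ (j + i)) ^ a := by
        rw [← Real.rpow_natCast, ← Real.rpow_intCast, ← Real.rpow_mul (by norm_num),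
          ← Real.rpow_mul (by norm_num), Nat.cast_natAbs, abs_of_nonpos h]
        push_cast
        congr 1; ring
      rw [this, mul_comm ((2 : ℝ) ^ a), ← Real.mul_rpow (by positivity) (by positivity)]
      exact Real.rpow_le_rpow (by positivity) e2 ha.le
  have hs2 : Summable (fun j : ℤ => (2 : ℝ) ^ a * ((2 : ℝ) ^ (-a)) ^ ((j + i).natAbs)) :=
    ((Equiv.addRight i).summable_iff.2 hsum).mul_left _
  have hs1 : Summable (fun j : ℤ => min (((2 : ℝ) ^ j * t) ^ a) (((2 : ℝ) ^ j * t) ^ (-a))) :=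
    hs2.of_nonneg_of_le (fun j => by positivity) hle
  refine ⟨hs1, (hs1.tsum_le_tsum hle hs2).trans ?_⟩
  rw [tsum_mul_left]
  exact (congrArg _ ((Equiv.addRight i).tsum_eq (fun j : ℤ => ((2 : ℝ) ^ (-a)) ^ (j.natAbs)))).le

/-! ### `L²` estimates -/

theorem min_rpow_zero {β : ℝ} (hβ : 0 < β) : min ((0 : ℝ) ^ β) ((0 : ℝ) ^ (-β)) = 0 := by
  rw [Real.zero_rpow hβ.ne', Real.zero_rpow (neg_ne_zero.2 hβ.ne'), min_self]

theorem min_rpow_le_one {t β : ℝ} (ht : 0 ≤ t) (hβ : 0 < β) : min (t ^ β) (t ^ (-β)) ≤ 1 := by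
  rcases le_total t 1 with h | h
  · exact (min_le_left _ _).trans (Real.rpow_le_one ht h hβ.le)
  · exact (min_le_right _ _).trans (Real.rpow_le_one_of_one_le_of_nonpos h (by linarith))

/-- One factor of the squared weight pays for `t ^ β`. The other survives, so that a sum over scales
still converges. -/
theorem min_rpow_sq_mul_le {t β : ℝ} (ht : 0 ≤ t) (hβ : 0 < β) :
    min (t ^ β) (t ^ (-β)) ^ 2 * t ^ β ≤ min (t ^ β) (t ^ (-β)) := by
  have h1 := min_rpow_le_one ht hβ
  have h0 : 0 ≤ min (t ^ β) (t ^ (-β)) := by positivity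
  rcases ht.eq_or_lt with rfl | ht'
  · rw [min_rpow_zero hβ]; simp
  have h2 : min (t ^ β) (t ^ (-β)) * t ^ β ≤ 1 := by
    calc _ ≤ t ^ (-β) * t ^ β := by gcongr; exact min_le_right _ _
      _ = 1 := by rw [← Real.rpow_add ht']; simp
  nlinarith

/-- The weight `min (|2^j ξ|^β) (|2^j ξ|^{-β})`. -/
def scaleWeight (β : ℝ) (j : ℤ) (ξ : Euc n) : ℝ :=
  min (((2 : ℝ) ^ j * ‖ξ‖) ^ β) (((2 : ℝ) ^ j * ‖ξ‖) ^ (-β))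

theorem scaleWeight_nonneg (β : ℝ) (j : ℤ) (ξ : Euc n) : 0 ≤ scaleWeight β j ξ := by
  unfold scaleWeight; positivity

theorem measurable_scaleWeight (β : ℝ) (j : ℤ) : Measurable (scaleWeight (n := n) β j) := by
  unfold scaleWeight; fun_prop

theorem exists_scaleWeight_bound {β : ℝ} (hβ : 0 < β) : ∃ C : ℝ≥0, ∀ (n : ℕ) (ξ : Euc n),
    Summable (fun j => scaleWeight β j ξ) ∧ ∑' j, scaleWeight β j ξ ≤ C := by
  obtain ⟨C, hC, h⟩ := exists_geometric_bound hβ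
  refine ⟨⟨C, hC⟩, fun n ξ => ?_⟩
  rcases eq_or_ne ξ 0 with rfl | hξ
  -- A real power of `0` with nonzero exponent, negative ones included, is `0`; hence all weights
  -- vanish at the origin.
  · simp only [scaleWeight, norm_zero, mul_zero, min_rpow_zero hβ]
    exact ⟨summable_zero, by rw [tsum_zero]; exact hC⟩
  · exact h _ (norm_pos_iff.2 hξ)

namespace DensityData

variable (D : DensityData n)

/-- The symbol decays at the origin and at infinity. -/
structure HasDecay (β : ℝ) (B : ℝ≥0) : Prop where
  pos : 0 < β
  le_one : β ≤ 1
  bound : ∀ ξ, ‖D.symbol ξ‖ ≤ B * min (‖ξ‖ ^ β) (‖ξ‖ ^ (-β))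

/-- The finite sums `∑ ε_j D_{s 2^j}`. -/
def trunc (s : ℝ) (J : Finset ℤ) (ε : ℤ → ℂ) (f : Euc n → ℂ) (x : Euc n) : ℂ :=
  ∑ j ∈ J, ε j * D.op (s * 2 ^ j) f x

variable {D} {β : ℝ} {B : ℝ≥0} {f g : Euc n → ℂ} {s : ℝ} {J : Finset ℤ} {ε : ℤ → ℂ}

theorem trunc_nice (hf : Nice f) : Nice (D.trunc s J ε f) :=
  Nice.sum fun _ _ => (D.op_nice hf _).const_mul _

theorem HasDecay.norm_symbol_le (h : D.HasDecay β B) (hs : |s| = 1) (j : ℤ) (ξ : Euc n) :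
    ‖D.symbol ((s * 2 ^ j) • ξ)‖ ≤ B * scaleWeight β j ξ := by
  have := h.bound ((s * 2 ^ j) • ξ)
  rwa [norm_smul, Real.norm_eq_abs, abs_mul, hs, one_mul, abs_of_pos (by positivity)] at this

theorem fourier_trunc (hf : Nice f) (ξ : Euc n) :
    𝓕 (D.trunc s J ε f) ξ = (∑ j ∈ J, ε j * D.symbol ((s * 2 ^ j) • ξ)) * 𝓕 f ξ := by
  have h1 : ∀ g : Euc n → ℂ, Nice g → Integrable (fun x => echar (-⟪x, ξ⟫) * g x) := by
    intro g hg
    refine hg.integrable.norm.mono' ?_ (Eventually.of_forall fun x => by simp [norm_echar])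
    have h2 := hg.meas
    have h3 := continuous_echar.measurable
    exact Measurable.aestronglyMeasurable (by fun_prop)
  rw [fourier_eq_echar]
  simp only [trunc, Finset.mul_sum]
  rw [integral_finsetSum _ fun j _ => h1 _ ((D.op_nice hf _).const_mul _), Finset.sum_mul]
  refine Finset.sum_congr rfl fun j _ => ?_
  rw [mul_assoc, ← D.fourier_op hf, fourier_eq_echar, ← integral_const_mul]
  congr 1; ext x; ring

theorem HasDecay.norm_sum_symbol_le (h : D.HasDecay β B) (hs : |s| = 1) (hε : ∀ j, ‖ε j‖ ≤ 1)
    (ξ : Euc n) : ‖∑ j ∈ J, ε j * D.symbol ((s * 2 ^ j) • ξ)‖ ≤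
      B * ∑ j ∈ J, scaleWeight β j ξ := by
  rw [Finset.mul_sum]
  refine norm_sum_le_of_le _ fun j _ => ?_
  rw [norm_mul]
  exact (mul_le_of_le_one_left (norm_nonneg _) (hε j)).trans (h.norm_symbol_le hs j ξ)

/-- `L²` boundedness, in a form that also gives `L²` convergence. -/
theorem HasDecay.lintegral_trunc_sq_le (h : D.HasDecay β B) (hs : |s| = 1) (hε : ∀ j, ‖ε j‖ ≤ 1)
    (hf : Nice f) : ∫⁻ x, ‖D.trunc s J ε f x‖ₑ ^ (2 : ℝ) ≤
      ∫⁻ ξ, ENNReal.ofReal (B * ∑ j ∈ J, scaleWeight β j ξ) ^ (2 : ℝ) * ‖𝓕 f ξ‖ₑ ^ (2 : ℝ) := by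
  rw [← lintegral_fourier_sq (trunc_nice hf)]
  refine lintegral_mono fun ξ => ?_
  rw [fourier_trunc hf, enorm_mul, ENNReal.mul_rpow_of_nonneg _ _ (by norm_num)]
  gcongr
  rw [← ofReal_norm]
  exact ENNReal.ofReal_le_ofReal (h.norm_sum_symbol_le hs hε ξ)

theorem HasDecay.exists_trunc_sq_bound (h : D.HasDecay β B) : ∃ C : ℝ≥0,
    ∀ (s : ℝ) (J : Finset ℤ) (ε : ℤ → ℂ) (f : Euc n → ℂ), |s| = 1 → (∀ j, ‖ε j‖ ≤ 1) → Nice f →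
      ∫⁻ x, ‖D.trunc s J ε f x‖ₑ ^ (2 : ℝ) ≤ C * ∫⁻ x, ‖f x‖ₑ ^ (2 : ℝ) := by
  obtain ⟨C, hC⟩ := exists_scaleWeight_bound h.pos
  refine ⟨(B * C) ^ 2, fun s J ε f hs hε hf => (h.lintegral_trunc_sq_le hs hε hf).trans ?_⟩
  rw [← lintegral_fourier_sq hf, ← lintegral_const_mul' _ _ ENNReal.coe_ne_top]
  refine lintegral_mono fun ξ => ?_
  gcongr
  have h1 : ENNReal.ofReal (B * ∑ j ∈ J, scaleWeight β j ξ) ≤ ((B * C : ℝ≥0) : ℝ≥0∞) := by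
    rw [← ENNReal.ofReal_coe_nnreal]
    refine ENNReal.ofReal_le_ofReal ?_
    push_cast
    gcongr
    exact ((hC n ξ).1.sum_le_tsum J fun j _ => scaleWeight_nonneg β j ξ).trans (hC n ξ).2
  calc _ ≤ ((B * C : ℝ≥0) : ℝ≥0∞) ^ (2 : ℝ) := by gcongr
    _ = _ := by norm_cast

/-- Smoothness of `D_{s 2^j} f` at scales below `2^j`, in `L²`. -/
theorem HasDecay.exists_translate_sq_bound (h : D.HasDecay β B) (R : ℝ≥0) : ∃ C : ℝ≥0,
    ∀ (s : ℝ) (j : ℤ) (k : ℕ) (y : Euc n) (f : Euc n → ℂ), |s| = 1 →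
      ‖y‖ ≤ R * 2 ^ (j - k) → Nice f →
      ∫⁻ x, ‖D.op (s * 2 ^ j) f x - D.op (s * 2 ^ j) f (x - y)‖ₑ ^ (2 : ℝ) ≤
        C * ((2 : ℝ≥0∞) ^ (-β)) ^ k *
          ∫⁻ ξ, ENNReal.ofReal (scaleWeight β j ξ) * ‖𝓕 f ξ‖ₑ ^ (2 : ℝ) := by
  refine ⟨(2 * Real.nnabs Real.pi * B * R ^ (β / 2)) ^ 2, fun s j k y f hs hy hf => ?_⟩
  have hn := D.op_nice hf (s * 2 ^ j)
  rw [← lintegral_fourier_sq (hn.sub (hn.translate y)), ← lintegral_const_mul' _ _ (by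
    refine ENNReal.mul_ne_top ENNReal.coe_ne_top (ENNReal.pow_ne_top ?_)
    exact ENNReal.rpow_ne_top_of_ne_zero (by simp) (by simp))]
  refine lintegral_mono fun ξ => ?_
  rw [fourier_sub_translate hn, D.fourier_op hf, ← mul_assoc, enorm_mul,
    ENNReal.mul_rpow_of_nonneg _ _ (by norm_num), ← mul_assoc]
  gcongr
  have hw := scaleWeight_nonneg β j ξ
  have e1 : ‖(1 - echar (-⟪y, ξ⟫)) * D.symbol ((s * 2 ^ j) • ξ)‖ ≤
      2 * Real.pi * (R * 2 ^ (j - k) * ‖ξ‖) ^ (β / 2) * (B * scaleWeight β j ξ) := by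
    rw [norm_mul]
    refine mul_le_mul ?_ (h.norm_symbol_le hs j ξ) (norm_nonneg _) (by positivity)
    -- After squaring, the exponent `β / 2` costs `(2^j |ξ|)^β`, which is what one copy of the
    -- weight can pay, and yields `2^(-βk)`.
    refine (norm_one_sub_echar_le_rpow _ (γ := β / 2) (by linarith [h.pos])
      (by linarith [h.le_one])).trans ?_
    have := h.pos
    gcongr
    rw [abs_neg]
    exact (abs_real_inner_le_norm _ _).trans (by gcongr)
  have e2 : ‖(1 - echar (-⟪y, ξ⟫)) * D.symbol ((s * 2 ^ j) • ξ)‖ ^ 2 ≤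
      (2 * Real.pi * B * R ^ (β / 2)) ^ 2 * ((2 : ℝ) ^ (-β)) ^ k * scaleWeight β j ξ := by
    refine (pow_le_pow_left₀ (norm_nonneg _) e1 2).trans ?_
    have e3 : ((R : ℝ) * 2 ^ (j - k) * ‖ξ‖) ^ (β / 2) =
        (R : ℝ) ^ (β / 2) * (((2 : ℝ) ^ (-(β / 2))) ^ k * ((2 : ℝ) ^ j * ‖ξ‖) ^ (β / 2)) := by
      rw [zpow_sub₀ (by norm_num), zpow_natCast, ← Real.rpow_natCast ((2 : ℝ) ^ (-(β / 2))),
        ← Real.rpow_mul (by norm_num), neg_mul, mul_comm (β / 2) (k : ℝ), ← mul_neg,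
        Real.rpow_mul (by norm_num), Real.rpow_natCast,
        Real.rpow_neg (by positivity), ← Real.inv_rpow (by positivity),
        ← Real.mul_rpow (by positivity) (by positivity),
        ← Real.mul_rpow (by positivity) (by positivity)]
      congr 1; ring
    have e4 : (((2 : ℝ) ^ (-(β / 2))) ^ k) ^ 2 = ((2 : ℝ) ^ (-β)) ^ k := by
      rw [← pow_mul, mul_comm, pow_mul, ← Real.rpow_natCast ((2 : ℝ) ^ (-(β / 2))),
        ← Real.rpow_mul (by norm_num)]
      congr 2; push_cast; ring
    have e5 : ((((2 : ℝ) ^ j * ‖ξ‖) ^ (β / 2))) ^ 2 = ((2 : ℝ) ^ j * ‖ξ‖) ^ β := by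
      rw [← Real.rpow_natCast, ← Real.rpow_mul (by positivity)]
      congr 1; push_cast; ring
    have e6 := min_rpow_sq_mul_le (t := (2 : ℝ) ^ j * ‖ξ‖) (by positivity) h.pos
    change scaleWeight β j ξ ^ 2 * _ ≤ scaleWeight β j ξ at e6
    calc _ = (2 * Real.pi * B * R ^ (β / 2)) ^ 2 * ((((2 : ℝ) ^ (-(β / 2))) ^ k) ^ 2) *
          (scaleWeight β j ξ ^ 2 * ((((2 : ℝ) ^ j * ‖ξ‖) ^ (β / 2))) ^ 2) := by rw [e3]; ring
      _ ≤ _ := by rw [e4, e5]; gcongr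
  rw [← ofReal_norm, ENNReal.ofReal_rpow_of_nonneg (norm_nonneg _) (by norm_num)]
  rw [show ((2 : ℝ)) = ((2 : ℕ) : ℝ) by norm_num, Real.rpow_natCast]
  refine (ENNReal.ofReal_le_ofReal e2).trans (le_of_eq ?_)
  rw [ENNReal.ofReal_mul (by positivity), ENNReal.ofReal_mul (by positivity),
    ENNReal.ofReal_pow (by positivity) k, ← ENNReal.ofReal_rpow_of_pos (by norm_num)]
  congr 2
  · rw [← ENNReal.ofReal_coe_nnreal]
    congr 1
    push_cast
    rw [abs_of_pos Real.pi_pos]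
  · simp

theorem HasDecay.exists_sum_scaleWeight_bound (h : D.HasDecay β B) : ∃ C : ℝ≥0,
    ∀ (J : Finset ℤ) (f : Euc n → ℂ), Nice f →
      ∑ j ∈ J, ∫⁻ ξ, ENNReal.ofReal (scaleWeight β j ξ) * ‖𝓕 f ξ‖ₑ ^ (2 : ℝ) ≤
        C * ∫⁻ x, ‖f x‖ₑ ^ (2 : ℝ) := by
  obtain ⟨C, hC⟩ := exists_scaleWeight_bound h.pos
  refine ⟨C, fun J f hf => ?_⟩
  have hcont : Continuous (𝓕 f) :=
    VectorFourier.fourierIntegral_continuous Real.continuous_fourierChar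
      (L := innerₗ (Euc n)) continuous_inner hf.integrable
  have hm := hcont.measurable
  rw [← lintegral_finsetSum _ fun j _ => by
    have := measurable_scaleWeight (n := n) β j
    fun_prop]
  rw [← lintegral_fourier_sq hf, ← lintegral_const_mul' _ _ ENNReal.coe_ne_top]
  refine lintegral_mono fun ξ => ?_
  rw [← Finset.sum_mul, ← ENNReal.ofReal_sum_of_nonneg fun j _ => scaleWeight_nonneg β j ξ]
  gcongr
  rw [← ENNReal.ofReal_coe_nnreal]
  exact ENNReal.ofReal_le_ofReal
    (((hC n ξ).1.sum_le_tsum J fun j _ => scaleWeight_nonneg β j ξ).trans (hC n ξ).2)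

end DensityData

end

end SparseRadon

namespace SparseRadon

noncomputable section

variable {n : ℕ}

/-! ### Dyadic grids -/

/-- The index of the dyadic cube of side `2^i` containing `x`, in the grid with corner `a`. -/
def idx (a : Fin n → ℝ) (i : ℤ) (x : Euc n) : Fin n → ℤ := fun t => ⌊(x t - a t) / 2 ^ i⌋

/-- The dyadic cubes of side `2^i`, in the grid with corner `a`. -/
def dyadic (a : Fin n → ℝ) (i : ℤ) (m : Fin n → ℤ) : Cube n where
  corner := fun t => a t + 2 ^ i * m t
  side := 2 ^ i
  side_pos := by positivity

/-- The point set of a dyadic cube. -/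
def cell (a : Fin n → ℝ) (i : ℤ) (m : Fin n → ℤ) : Set (Euc n) := {x | idx a i x = m}

/-- The point set of the triple of a dyadic cube. -/
def tripleCell (a : Fin n → ℝ) (i : ℤ) (m : Fin n → ℤ) : Set (Euc n) :=
  {x | ∀ t, |idx a i x t - m t| ≤ 1}

/-- The volume of a cube of side `2^i` in `ℝⁿ`. -/
def vol (n : ℕ) (i : ℤ) : ℝ≥0 := ((2 : ℝ≥0) ^ i) ^ n

theorem vol_pos (i : ℤ) : 0 < vol n i := by unfold vol; positivity

theorem vol_ne_zero (i : ℤ) : (vol n i : ℝ≥0∞) ≠ 0 := by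
  simpa using (vol_pos (n := n) i).ne'

theorem vol_add (i k : ℤ) : vol n (i + k) = vol n i * ((2 : ℝ≥0) ^ k) ^ n := by
  rw [vol, vol, zpow_add₀ (by norm_num), mul_pow]

theorem vol_succ (i : ℤ) : vol n (i + 1) = 2 ^ n * vol n i := by
  rw [vol_add, zpow_one, mul_comm]

theorem vol_mono {i j : ℤ} (h : i ≤ j) : vol n i ≤ vol n j := by
  unfold vol
  gcongr
  exact one_le_two

variable (a : Fin n → ℝ)

theorem measurable_idx (i : ℤ) : Measurable (idx a i) := by
  refine measurable_pi_iff.2 fun t => ?_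
  unfold idx
  fun_prop

theorem mem_cell {i : ℤ} {m : Fin n → ℤ} {x : Euc n} : x ∈ cell a i m ↔ idx a i x = m := Iff.rfl

theorem measurableSet_cell (i : ℤ) (m : Fin n → ℤ) : MeasurableSet (cell a i m) :=
  measurable_idx a i (measurableSet_singleton m)

theorem measurableSet_tripleCell (i : ℤ) (m : Fin n → ℤ) : MeasurableSet (tripleCell a i m) :=
  measurable_idx a i (Set.to_countable {v : Fin n → ℤ | ∀ t, |v t - m t| ≤ 1}).measurableSet

theorem carrier_dyadic (i : ℤ) (m : Fin n → ℤ) : (dyadic a i m).carrier = cell a i m := by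
  ext x
  simp only [Cube.carrier, dyadic, cell, idx, Set.mem_ofPred_eq, funext_iff, Int.floor_eq_iff]
  refine forall_congr' fun t => ?_
  have h : (0 : ℝ) < 2 ^ i := by positivity
  rw [le_div_iff₀ h, div_lt_iff₀ h]
  constructor <;> rintro ⟨h1, h2⟩ <;> constructor <;> nlinarith

theorem carrier_triple_dyadic (i : ℤ) (m : Fin n → ℤ) :
    (dyadic a i m).triple.carrier = tripleCell a i m := by
  ext x
  simp only [Cube.carrier, Cube.triple, dyadic, tripleCell, idx, Set.mem_ofPred_eq]
  refine forall_congr' fun t => ?_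
  have h : (0 : ℝ) < 2 ^ i := by positivity
  rw [abs_le]
  have e1 : -1 ≤ ⌊(x t - a t) / 2 ^ i⌋ - m t ↔ a t + 2 ^ i * m t - 2 ^ i ≤ x t := by
    rw [show -1 ≤ ⌊(x t - a t) / 2 ^ i⌋ - m t ↔ m t - 1 ≤ ⌊(x t - a t) / 2 ^ i⌋ by
      constructor <;> intro <;> linarith, Int.le_floor, le_div_iff₀ h]
    push_cast
    constructor <;> intro <;> linarith
  have e2 : ⌊(x t - a t) / 2 ^ i⌋ - m t ≤ 1 ↔ x t < a t + 2 ^ i * m t - 2 ^ i + 3 * 2 ^ i := by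
    rw [show ⌊(x t - a t) / 2 ^ i⌋ - m t ≤ 1 ↔ ⌊(x t - a t) / 2 ^ i⌋ < m t + 2 by
      constructor <;> intro <;> linarith, Int.floor_lt, div_lt_iff₀ h]
    push_cast
    constructor <;> intro <;> linarith
  rw [e1, e2]

theorem volume_carrier (Q : Cube n) : volume Q.carrier = ENNReal.ofReal Q.side ^ n := by
  have h1 : Q.carrier = (@WithLp.ofLp 2 (Fin n → ℝ)) ⁻¹'
      (Set.pi Set.univ fun t => Set.Ico (Q.corner t) (Q.corner t + Q.side)) := by
    ext x; simp [Cube.carrier]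
  rw [h1, (PiLp.volume_preserving_ofLp (Fin n)).measure_preimage
    (MeasurableSet.univ_pi fun t => measurableSet_Ico).nullMeasurableSet, Real.volume_pi_Ico]
  simp

theorem volume_cell (i : ℤ) (m : Fin n → ℤ) : volume (cell a i m) = vol n i := by
  rw [← carrier_dyadic, volume_carrier]
  simp only [dyadic, vol]
  push_cast
  congr 1
  rw [← ENNReal.ofReal_coe_nnreal]
  simp

theorem volume_tripleCell (i : ℤ) (m : Fin n → ℤ) :
    volume (tripleCell a i m) = 3 ^ n * vol n i := by
  rw [← volume_cell a i m, ← carrier_triple_dyadic, ← carrier_dyadic, volume_carrier,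
    volume_carrier, Cube.triple, ENNReal.ofReal_mul (by norm_num), mul_pow]
  simp

theorem cell_subset_tripleCell (i : ℤ) (m : Fin n → ℤ) : cell a i m ⊆ tripleCell a i m := by
  intro x hx t
  rw [mem_cell] at hx
  simp [hx]

/-- Nestedness of the grid: a coarser index is an integer quotient of the finer one, so inclusions
between cells become integer arithmetic. -/
theorem idx_add (i : ℤ) (k : ℕ) (x : Euc n) (t : Fin n) :
    idx a (i + k) x t = idx a i x t / 2 ^ k := by
  refine eq_of_forall_le_iff fun z => ?_
  unfold idx
  have h : (0 : ℝ) < 2 ^ i := by positivity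
  have h' : (0 : ℝ) < 2 ^ (i + k) := by positivity
  rw [Int.le_floor, le_div_iff₀ h', Int.le_ediv_iff_mul_le (by positivity), Int.le_floor,
    le_div_iff₀ h, zpow_add₀ (by norm_num)]
  push_cast
  rw [zpow_natCast, mul_assoc, mul_comm ((2 : ℝ) ^ k)]

theorem idx_of_le {i j : ℤ} (h : i ≤ j) (x : Euc n) (t : Fin n) :
    idx a j x t = idx a i x t / 2 ^ (j - i).toNat := by
  rw [← idx_add]
  congr 1
  rw [Int.toNat_of_nonneg (by omega)]; ring_nf

theorem idx_eq_of_le {i j : ℤ} (h : i ≤ j) {x y : Euc n} (hxy : idx a i x = idx a i y) :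
    idx a j x = idx a j y := by
  ext t
  rw [idx_of_le a h, idx_of_le a h, hxy]

/-- Integer division by `2^k` is monotone, and adding `2^k` raises it by one; hence neighbours have
equal or neighbouring ancestors. This makes the tripled cubes nested too. -/
theorem idx_near_of_le {i j : ℤ} (h : i ≤ j) {x y : Euc n}
    (hxy : ∀ t, |idx a i x t - idx a i y t| ≤ 1) (t : Fin n) : |idx a j x t - idx a j y t| ≤ 1 := by
  have key : ∀ u v : ℤ, ∀ k : ℕ, u ≤ v + 1 → u / 2 ^ k ≤ v / 2 ^ k + 1 := by
    intro u v k huv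
    have h1 : (1 : ℤ) ≤ 2 ^ k := one_le_pow₀ (by norm_num)
    calc u / 2 ^ k ≤ (v + 1 * 2 ^ k) / 2 ^ k :=
          Int.ediv_le_ediv (by linarith) (by linarith)
      _ = v / 2 ^ k + 1 := Int.add_mul_ediv_right _ _ (by linarith)
  have h2 := abs_le.1 (hxy t)
  rw [idx_of_le a h, idx_of_le a h, abs_le]
  have h3 := key (idx a i x t) (idx a i y t) (j - i).toNat (by linarith)
  have h4 := key (idx a i y t) (idx a i x t) (j - i).toNat (by linarith)
  constructor <;> linarith

theorem idx_near_of_norm_le {i : ℤ} {x y : Euc n} (h : ∀ t, |x t - y t| ≤ 2 ^ i) (t : Fin n) :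
    |idx a i x t - idx a i y t| ≤ 1 := by
  have h0 : (0 : ℝ) < 2 ^ i := by positivity
  have key : ∀ u v : ℝ, u ≤ v + 2 ^ i → ⌊(u - a t) / 2 ^ i⌋ ≤ ⌊(v - a t) / 2 ^ i⌋ + 1 := by
    intro u v huv
    rw [← Int.floor_add_one]
    refine Int.floor_mono ?_
    rw [div_add_one h0.ne']
    gcongr
    linarith
  have h1 := abs_le.1 (h t)
  have h3 := key (x t) (y t) (by linarith)
  have h4 := key (y t) (x t) (by linarith)
  unfold idx
  rw [abs_le]
  constructor <;> linarith

theorem abs_apply_le_norm (x : Euc n) (t : Fin n) : |x t| ≤ ‖x‖ := by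
  simpa using PiLp.norm_apply_le x t

theorem nonempty_cell (i : ℤ) (m : Fin n → ℤ) : (cell a i m).Nonempty := by
  refine nonempty_of_measure_ne_zero (μ := volume) ?_
  rw [volume_cell]
  exact vol_ne_zero i

/-- Sets that are unions of dyadic cubes of side `2^i`. -/
def Sat (i : ℤ) (S : Set (Euc n)) : Prop := ∀ x y, idx a i x = idx a i y → x ∈ S → y ∈ S

variable {a}

theorem Sat.measurableSet {i : ℤ} {S : Set (Euc n)} (h : Sat a i S) : MeasurableSet S := by
  have : S = idx a i ⁻¹' (idx a i '' S) := by
    ext x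
    refine ⟨fun hx => ⟨x, hx, rfl⟩, ?_⟩
    rintro ⟨y, hy, hxy⟩
    exact h y x hxy hy
  rw [this]
  exact measurable_idx a i (Set.to_countable _).measurableSet

theorem Sat.mono {i j : ℤ} {S : Set (Euc n)} (h : Sat a j S) (hij : i ≤ j) : Sat a i S :=
  fun x y hxy hx => h x y (idx_eq_of_le a hij hxy) hx

theorem sat_cell (i : ℤ) (m : Fin n → ℤ) : Sat a i (cell a i m) := by
  intro x y hxy hx
  rw [mem_cell] at hx ⊢
  rw [← hxy, hx]

theorem sat_tripleCell (i : ℤ) (m : Fin n → ℤ) : Sat a i (tripleCell a i m) := by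
  intro x y hxy hx t
  rw [← hxy]
  exact hx t

theorem Sat.inter {i : ℤ} {S T : Set (Euc n)} (h : Sat a i S) (h' : Sat a i T) :
    Sat a i (S ∩ T) := fun x y hxy hx => ⟨h x y hxy hx.1, h' x y hxy hx.2⟩

variable (a)

theorem lintegral_eq_tsum_cell (i : ℤ) (F : Euc n → ℝ≥0∞) :
    ∫⁻ x, F x = ∑' m, ∫⁻ x in cell a i m, F x := by
  rw [← lintegral_iUnion (measurableSet_cell a i)]
  · have : ⋃ m, cell a i m = Set.univ := by
      ext x; simp [mem_cell]
    rw [this, setLIntegral_univ]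
  · intro m m' hne
    rw [Function.onFun, Set.disjoint_left]
    intro x hx hx'
    rw [mem_cell] at hx hx'
    exact hne (hx.symm.trans hx')

theorem setLIntegral_eq_tsum_cell (i : ℤ) {S : Set (Euc n)} (hS : MeasurableSet S)
    (F : Euc n → ℝ≥0∞) : ∫⁻ x in S, F x = ∑' m, ∫⁻ x in S ∩ cell a i m, F x := by
  rw [← lintegral_indicator hS, lintegral_eq_tsum_cell a i]
  refine tsum_congr fun m => ?_
  rw [setLIntegral_indicator hS]

theorem card_near (v : Fin n → ℤ) :
    ∑' m : Fin n → ℤ, (if ∀ t, |v t - m t| ≤ 1 then (1 : ℝ≥0∞) else 0) = 3 ^ n := by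
  classical
  rw [tsum_eq_sum (s := Fintype.piFinset fun t => Finset.Icc (v t - 1) (v t + 1))]
  · rw [Finset.sum_congr rfl (g := fun _ => 1)]
    · rw [Finset.sum_const, Fintype.card_piFinset]
      have : ∀ t, (Finset.Icc (v t - 1) (v t + 1)).card = 3 := fun t => by
        rw [Int.card_Icc, show v t + 1 + 1 - (v t - 1) = 3 by ring]; rfl
      simp [this]
    · intro m hm
      rw [if_pos]
      intro t
      have := Finset.mem_Icc.1 (Fintype.mem_piFinset.1 hm t)
      rw [abs_le]
      constructor <;> linarith
  · intro m hm
    rw [if_neg]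
    contrapose! hm
    refine Fintype.mem_piFinset.2 fun t => Finset.mem_Icc.2 ?_
    have := abs_le.1 (hm t)
    constructor <;> linarith

theorem tsum_setLIntegral_tripleCell (i : ℤ) {F : Euc n → ℝ≥0∞} (hF : Measurable F) :
    ∑' m, ∫⁻ x in tripleCell a i m, F x = 3 ^ n * ∫⁻ x, F x := by
  classical
  simp_rw [← lintegral_indicator (measurableSet_tripleCell a i _)]
  rw [← lintegral_tsum fun m => (hF.indicator (measurableSet_tripleCell a i m)).aemeasurable,
    ← lintegral_const_mul _ hF]
  refine lintegral_congr fun x => ?_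
  rw [← card_near (idx a i x), ← ENNReal.tsum_mul_right]
  refine tsum_congr fun m => ?_
  by_cases h : ∀ t, |idx a i x t - m t| ≤ 1 <;> simp [Set.indicator, tripleCell, h]

theorem setLIntegral_tripleCell_eq (i : ℤ) (m : Fin n → ℤ) (F : Euc n → ℝ≥0∞) :
    ∫⁻ x in tripleCell a i m, F x =
      ∑' m', if ∀ t, |m t - m' t| ≤ 1 then ∫⁻ x in cell a i m', F x else 0 := by
  classical
  rw [setLIntegral_eq_tsum_cell a i (measurableSet_tripleCell a i m)]
  refine tsum_congr fun m' => ?_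
  split_ifs with h
  · congr 2
    refine Set.inter_eq_self_of_subset_right fun x hx t => ?_
    rw [mem_cell] at hx
    rw [hx, abs_sub_comm]
    exact h t
  · have : tripleCell a i m ∩ cell a i m' = ∅ := by
      ext x
      simp only [Set.mem_inter_iff, Set.mem_empty_iff_false, iff_false, not_and]
      intro h1 h2
      rw [mem_cell] at h2
      refine h fun t => ?_
      rw [abs_sub_comm, ← h2]
      exact h1 t
    simp [this]

end

end SparseRadon

namespace SparseRadon

noncomputable section

variable {n : ℕ}

/-! ### Averages over dyadic cubes -/

theorem lintegral_rpow_le_measure_mul {X : Type*} [MeasurableSpace X] (μ : Measure X)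
    [IsFiniteMeasure μ] {F : X → ℝ≥0∞} (hF : AEMeasurable F μ) {r : ℝ} (hr : 1 ≤ r) :
    (∫⁻ x, F x ∂μ) ^ r ≤ μ Set.univ ^ (r - 1) * ∫⁻ x, F x ^ r ∂μ := by
  have hr0 : 0 < r := by linarith
  have h2 := eLpNorm_le_eLpNorm_mul_rpow_measure_univ (p := 1) (q := ENNReal.ofReal r)
      (by simpa using hr) hF.aestronglyMeasurable
  rw [eLpNorm_one_eq_lintegral_enorm, eLpNorm_eq_lintegral_rpow_enorm_toReal (by simpa using hr0)
      (by simp), ENNReal.toReal_ofReal hr0.le] at h2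
  simp only [enorm_eq_self] at h2
  refine (ENNReal.rpow_le_rpow h2 hr0.le).trans (le_of_eq ?_)
  rw [ENNReal.mul_rpow_of_nonneg _ _ hr0.le, ← ENNReal.rpow_mul, ← ENNReal.rpow_mul, one_div,
    inv_mul_cancel₀ hr0.ne', ENNReal.rpow_one]
  have : (1 / (1 : ℝ≥0∞).toReal - r⁻¹) * r = r - 1 := by
    simp; field_simp
  rw [this, mul_comm]

/-- The conditional expectation on the dyadic cubes of side `2^i`. -/
def condAvg (a : Fin n → ℝ) (i : ℤ) (u : Euc n → ℂ) (x : Euc n) : ℂ :=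
  ((vol n i : ℝ) : ℂ)⁻¹ * ∫ y in cell a i (idx a i x), u y

/-- The oscillation of a function over the dyadic cubes of side `2^i`. -/
def osc (a : Fin n → ℝ) (i : ℤ) (u : Euc n → ℂ) (x : Euc n) : ℂ := u x - condAvg a i u x

variable (a : Fin n → ℝ) (i : ℤ) {u v : Euc n → ℂ}

theorem enorm_vol_inv : ‖((vol n i : ℝ) : ℂ)⁻¹‖ₑ = (vol n i : ℝ≥0∞)⁻¹ := by
  rw [enorm_inv (by simpa using (vol_pos i).ne'), ← ofReal_norm, Complex.norm_real,
    Real.norm_of_nonneg (by positivity), ENNReal.ofReal_coe_nnreal]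

theorem enorm_condAvg_le (x : Euc n) :
    ‖condAvg a i u x‖ₑ ≤ (vol n i : ℝ≥0∞)⁻¹ * ∫⁻ y in cell a i (idx a i x), ‖u y‖ₑ := by
  rw [condAvg, enorm_mul, enorm_vol_inv]
  gcongr
  exact enorm_integral_le_lintegral_enorm _

theorem rpow_avg_le {F : Euc n → ℝ≥0∞} (hF : Measurable F) (m : Fin n → ℤ) {r : ℝ} (hr : 1 ≤ r) :
    ((vol n i : ℝ≥0∞)⁻¹ * ∫⁻ y in cell a i m, F y) ^ r ≤
      (vol n i : ℝ≥0∞)⁻¹ * ∫⁻ y in cell a i m, F y ^ r := by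
  have hr0 : 0 < r := by linarith
  have hfin : IsFiniteMeasure (volume.restrict (cell a i m)) :=
    ⟨by rw [Measure.restrict_apply_univ, volume_cell]; exact ENNReal.coe_lt_top⟩
  have h1 := lintegral_rpow_le_measure_mul (volume.restrict (cell a i m)) hF.aemeasurable hr
  rw [Measure.restrict_apply_univ, volume_cell] at h1
  rw [ENNReal.mul_rpow_of_nonneg _ _ hr0.le]
  refine (mul_le_mul_right h1 _).trans (le_of_eq ?_)
  rw [← mul_assoc]
  congr 1
  rw [ENNReal.inv_rpow, ENNReal.rpow_sub _ _ (vol_ne_zero i) ENNReal.coe_ne_top, ENNReal.rpow_one,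
    ENNReal.div_eq_inv_mul, mul_comm, mul_assoc, ENNReal.mul_inv_cancel, mul_one]
  · simp [(vol_pos (n := n) i).ne']
  · exact ENNReal.rpow_ne_top_of_nonneg hr0.le ENNReal.coe_ne_top

theorem enorm_condAvg_rpow_le (hu : Measurable u) (x : Euc n) {r : ℝ} (hr : 1 ≤ r) :
    ‖condAvg a i u x‖ₑ ^ r ≤
      (vol n i : ℝ≥0∞)⁻¹ * ∫⁻ y in cell a i (idx a i x), ‖u y‖ₑ ^ r :=
  (ENNReal.rpow_le_rpow (enorm_condAvg_le a i x) (by linarith)).trans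
    (rpow_avg_le a i hu.enorm _ hr)

theorem measurable_condAvg : Measurable (condAvg a i u) :=
  (measurable_of_countable fun m : Fin n → ℤ =>
    ((vol n i : ℝ) : ℂ)⁻¹ * ∫ y in cell a i m, u y).comp (measurable_idx a i)

theorem condAvg_eq_zero {x : Euc n} (h : ∀ y, idx a i y = idx a i x → u y = 0) :
    condAvg a i u x = 0 := by
  rw [condAvg, setIntegral_eq_zero_of_forall_eq_zero, mul_zero]
  exact fun y hy => h y hy

theorem norm_sub_le_of_idx_eq {x y : Euc n} (h : idx a i x = idx a i y) : ‖x - y‖ ≤ n * 2 ^ i := by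
  have h0 : (0 : ℝ) < 2 ^ i := by positivity
  have h1 : ∀ t, |(x - y) t| ≤ 2 ^ i := by
    intro t
    have h2 := congrFun h t
    have h3 := Int.abs_sub_lt_one_of_floor_eq_floor h2
    rw [← sub_div, abs_div, abs_of_pos h0, div_lt_one h0] at h3
    simpa using h3.le
  rw [EuclideanSpace.norm_eq, Real.sqrt_le_left (by positivity)]
  calc ∑ t, ‖(x - y) t‖ ^ 2 ≤ ∑ _t : Fin n, ((2 : ℝ) ^ i) ^ 2 := by
        gcongr with t; exact h1 t
    _ = n * ((2 : ℝ) ^ i) ^ 2 := by simp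
    _ ≤ (n : ℝ) ^ 2 * ((2 : ℝ) ^ i) ^ 2 := by
        gcongr
        exact_mod_cast Nat.le_self_pow (by norm_num) n
    _ = _ := by ring

theorem Nice.condAvg (hu : Nice u) : Nice (condAvg a i u) := by
  obtain ⟨B, hB0, hB⟩ := hu.bdd_nonneg
  obtain ⟨R, hR⟩ := hu.supp
  refine ⟨measurable_condAvg a i, ⟨B, fun x => ?_⟩, ⟨R + n * 2 ^ i, fun x hx => ?_⟩⟩
  · have h1 : ‖SparseRadon.condAvg a i u x‖ₑ ≤ ENNReal.ofReal B := by
      refine (enorm_condAvg_le a i x).trans ?_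
      calc (vol n i : ℝ≥0∞)⁻¹ * ∫⁻ y in cell a i (idx a i x), ‖u y‖ₑ
          ≤ (vol n i : ℝ≥0∞)⁻¹ * ∫⁻ y in cell a i (idx a i x), ENNReal.ofReal B := by
            gcongr with y
            rw [← ofReal_norm]
            exact ENNReal.ofReal_le_ofReal (hB y)
        _ = ENNReal.ofReal B := by
            rw [setLIntegral_const, volume_cell, mul_comm, mul_assoc,
              ENNReal.mul_inv_cancel (vol_ne_zero i) ENNReal.coe_ne_top, mul_one]
    rwa [← ofReal_norm, ENNReal.ofReal_le_ofReal_iff hB0] at h1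
  · refine condAvg_eq_zero a i fun y hy => hR y ?_
    have h1 := norm_sub_le_of_idx_eq a i hy.symm
    have h2 := norm_sub_norm_le x (x - y)
    rw [sub_sub_cancel] at h2
    linarith

theorem Nice.osc (hu : Nice u) : Nice (osc a i u) := hu.sub (hu.condAvg a i)

theorem osc_eq_zero {x : Euc n} (h : ∀ y, idx a i y = idx a i x → u y = 0) : osc a i u x = 0 := by
  rw [osc, condAvg_eq_zero a i h, h x rfl, sub_zero]

theorem condAvg_add (hu : Nice u) (hv : Nice v) (x : Euc n) :
    condAvg a i (fun x => u x + v x) x = condAvg a i u x + condAvg a i v x := by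
  rw [condAvg, integral_add hu.integrable.integrableOn hv.integrable.integrableOn, mul_add]
  rfl

theorem osc_add (hu : Nice u) (hv : Nice v) (x : Euc n) :
    osc a i (fun x => u x + v x) x = osc a i u x + osc a i v x := by
  simp only [osc]
  rw [condAvg_add a i hu hv]; ring

theorem lintegral_condAvg_rpow_le (hu : Measurable u) {r : ℝ} (hr : 1 ≤ r) :
    ∫⁻ x, ‖condAvg a i u x‖ₑ ^ r ≤ ∫⁻ x, ‖u x‖ₑ ^ r := by
  rw [lintegral_eq_tsum_cell a i, lintegral_eq_tsum_cell a i (fun x => ‖u x‖ₑ ^ r)]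
  refine ENNReal.tsum_le_tsum fun m => ?_
  calc ∫⁻ x in cell a i m, ‖condAvg a i u x‖ₑ ^ r
      ≤ ∫⁻ x in cell a i m, (vol n i : ℝ≥0∞)⁻¹ * ∫⁻ y in cell a i m, ‖u y‖ₑ ^ r := by
        refine setLIntegral_mono' (measurableSet_cell a i m) fun x hx => ?_
        have := enorm_condAvg_rpow_le a i hu x hr
        rw [mem_cell] at hx
        rwa [hx] at this
    _ = _ := by
        rw [setLIntegral_const, volume_cell, mul_right_comm,
          ENNReal.inv_mul_cancel (vol_ne_zero i) ENNReal.coe_ne_top, one_mul]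

theorem lintegral_osc_rpow_le (hu : Measurable u) {r : ℝ} (hr : 1 ≤ r) :
    ∫⁻ x, ‖osc a i u x‖ₑ ^ r ≤ 2 ^ r * ∫⁻ x, ‖u x‖ₑ ^ r := by
  have hr0 : 0 < r := by linarith
  calc ∫⁻ x, ‖osc a i u x‖ₑ ^ r
      ≤ ∫⁻ x, 2 ^ (r - 1) * (‖u x‖ₑ ^ r + ‖condAvg a i u x‖ₑ ^ r) := by
        refine lintegral_mono fun x => ?_
        refine (ENNReal.rpow_le_rpow (enorm_sub_le) hr0.le).trans ?_
        exact ENNReal.rpow_add_le_mul_rpow_add_rpow _ _ hr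
    _ = 2 ^ (r - 1) * ((∫⁻ x, ‖u x‖ₑ ^ r) + ∫⁻ x, ‖condAvg a i u x‖ₑ ^ r) := by
        rw [lintegral_const_mul' _ _ (ENNReal.rpow_ne_top_of_nonneg (by linarith) (by simp)),
          lintegral_add_left (by fun_prop)]
    _ ≤ 2 ^ (r - 1) * ((∫⁻ x, ‖u x‖ₑ ^ r) + ∫⁻ x, ‖u x‖ₑ ^ r) := by
        exact mul_le_mul_right (add_le_add_right (lintegral_condAvg_rpow_le a i hu hr) _) _
    _ = _ := by
        rw [← two_mul, ← mul_assoc, ENNReal.rpow_sub _ _ (by simp) (by simp), ENNReal.rpow_one,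
          ENNReal.div_mul_cancel (by simp) (by simp)]

theorem integral_eq_zero_of_cell {F : Euc n → ℂ} (hF : Integrable F)
    (h : ∀ m, ∫ x in cell a i m, F x = 0) : ∫ x, F x = 0 := by
  have hU : ⋃ m, cell a i m = Set.univ := by
    ext x; simp [mem_cell]
  have h1 := hasSum_integral_iUnion (μ := volume) (f := F) (measurableSet_cell a i) (fun m m' hne => by
    rw [Function.onFun, Set.disjoint_left]
    intro x hx hx'
    rw [mem_cell] at hx hx'
    exact hne (hx.symm.trans hx')) (by rw [hU]; exact hF.integrableOn)
  rw [hU, setIntegral_univ] at h1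
  simp only [h] at h1
  exact h1.unique hasSum_zero

theorem setIntegral_cell_osc (hu : Nice u) (m : Fin n → ℤ) : ∫ x in cell a i m, osc a i u x = 0 := by
  simp only [osc]
  rw [integral_sub hu.integrable.integrableOn (hu.condAvg a i).integrable.integrableOn]
  have : ∫ x in cell a i m, condAvg a i u x =
      ∫ x in cell a i m, ((vol n i : ℝ) : ℂ)⁻¹ * ∫ y in cell a i m, u y := by
    refine setIntegral_congr_fun (measurableSet_cell a i m) fun x hx => ?_
    rw [mem_cell] at hx
    simp only [condAvg, hx]
  rw [this, setIntegral_const, measureReal_def, volume_cell, Complex.real_smul, ← mul_assoc]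
  simp [(vol_pos (n := n) i).ne']

theorem integral_condAvg_mul_osc (hu : Nice u) (hv : Nice v) :
    ∫ x, condAvg a i u x * osc a i v x = 0 := by
  refine integral_eq_zero_of_cell a i ((hu.condAvg a i).mul (hv.osc a i)).integrable fun m => ?_
  have : ∫ x in cell a i m, condAvg a i u x * osc a i v x =
      ∫ x in cell a i m, (((vol n i : ℝ) : ℂ)⁻¹ * ∫ y in cell a i m, u y) * osc a i v x := by
    refine setIntegral_congr_fun (measurableSet_cell a i m) fun x hx => ?_
    rw [mem_cell] at hx
    simp only [condAvg, hx]
  rw [this, integral_const_mul, setIntegral_cell_osc a i hv, mul_zero]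

/-- `osc` is a projection whose range is orthogonal to functions constant on cells. It can therefore
be placed on the second factor as well, where it will act on a smooth average. -/
theorem integral_osc_mul (hu : Nice u) (hv : Nice v) :
    ∫ x, osc a i u x * v x = ∫ x, osc a i u x * osc a i v x := by
  have h1 : ∀ x, osc a i u x * v x =
      osc a i u x * osc a i v x + condAvg a i v x * osc a i u x := by
    intro x; simp only [osc]; ring
  simp_rw [h1]
  rw [integral_add ((hu.osc a i).mul (hv.osc a i)).integrable
    ((hv.condAvg a i).mul (hu.osc a i)).integrable, integral_condAvg_mul_osc a i hv hu, add_zero]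

/-- Local oscillation is controlled by translations. -/
theorem lintegral_osc_sq_le (hu : Nice u) {G : ℝ≥0∞}
    (h : ∀ y : Euc n, ‖y‖ ≤ n * 2 ^ i → ∫⁻ x, ‖u x - u (x - y)‖ₑ ^ (2 : ℝ) ≤ G) :
    ∫⁻ x, ‖osc a i u x‖ₑ ^ (2 : ℝ) ≤ 3 ^ n * G := by
  have hum := hu.meas
  have hm := measurable_idx a i
  -- `S` contains every difference of two points of one cell, does not depend on the cell, and has
  -- volume at most `3^n` times that of a cell.
  set S : Set (Euc n) := tripleCell (fun _ => 0) i (idx (fun _ => 0) i 0) ∩ {y | ‖y‖ ≤ n * 2 ^ i}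
    with hS
  have hSm : MeasurableSet S := (measurableSet_tripleCell _ _ _).inter
    (measurableSet_le measurable_norm measurable_const)
  have hpt : ∀ x, ‖osc a i u x‖ₑ ^ (2 : ℝ) ≤
      (vol n i : ℝ≥0∞)⁻¹ * ∫⁻ y in S, ‖u x - u (x - y)‖ₑ ^ (2 : ℝ) := by
    intro x
    have e1 : osc a i u x =
        ((vol n i : ℝ) : ℂ)⁻¹ * ∫ y in cell a i (idx a i x), (u x - u y) := by
      have hc : IntegrableOn (fun _ => u x) (cell a i (idx a i x)) volume := by
        refine integrableOn_const ?_ (by simp)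
        rw [volume_cell]; exact ENNReal.coe_ne_top
      rw [integral_sub hc hu.integrable.integrableOn, setIntegral_const,
        measureReal_def, volume_cell, Complex.real_smul, mul_sub, ← mul_assoc]
      simp [(vol_pos (n := n) i).ne', osc, condAvg]
    have e2 : ‖osc a i u x‖ₑ ≤
        (vol n i : ℝ≥0∞)⁻¹ * ∫⁻ y in cell a i (idx a i x), ‖u x - u y‖ₑ := by
      rw [e1, enorm_mul, enorm_vol_inv]
      gcongr
      exact enorm_integral_le_lintegral_enorm _
    refine (ENNReal.rpow_le_rpow e2 (by norm_num)).trans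
      ((rpow_avg_le a i (by fun_prop) _ (by norm_num)).trans ?_)
    refine mul_le_mul_right ?_ _
    rw [← lintegral_indicator (measurableSet_cell a i _), ← lintegral_indicator hSm,
      ← lintegral_sub_left_eq_self _ x]
    refine lintegral_mono fun y => ?_
    by_cases hy : x - y ∈ cell a i (idx a i x)
    · have hyS : y ∈ S := by
        rw [mem_cell] at hy
        refine ⟨idx_near_of_norm_le _ fun t => ?_, ?_⟩
        · have h3 := Int.abs_sub_lt_one_of_floor_eq_floor (congrFun hy t)
          have h0 : (0 : ℝ) < 2 ^ i := by positivity
          rw [← sub_div, abs_div, abs_of_pos h0, div_lt_one h0] at h3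
          simpa using h3.le
        · have := norm_sub_le_of_idx_eq a i hy
          simpa using this
      rw [Set.indicator_of_mem hy, Set.indicator_of_mem hyS]
    · rw [Set.indicator_of_notMem hy]
      exact zero_le
  calc ∫⁻ x, ‖osc a i u x‖ₑ ^ (2 : ℝ)
      ≤ ∫⁻ x, (vol n i : ℝ≥0∞)⁻¹ * ∫⁻ y in S, ‖u x - u (x - y)‖ₑ ^ (2 : ℝ) := lintegral_mono hpt
    _ = (vol n i : ℝ≥0∞)⁻¹ * ∫⁻ y in S, ∫⁻ x, ‖u x - u (x - y)‖ₑ ^ (2 : ℝ) := by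
        rw [lintegral_const_mul' _ _ (by simpa using vol_ne_zero i), lintegral_lintegral_swap]
        exact Measurable.aemeasurable (by fun_prop)
    _ ≤ (vol n i : ℝ≥0∞)⁻¹ * ∫⁻ y in S, G := by
        gcongr _ * ?_
        exact setLIntegral_mono' hSm fun y hy => h y hy.2
    _ ≤ (vol n i : ℝ≥0∞)⁻¹ * (G * (3 ^ n * vol n i)) := by
        rw [setLIntegral_const, ← volume_tripleCell (fun _ => 0) i (idx (fun _ => 0) i 0)]
        gcongr
        exact Set.inter_subset_left
    _ = _ := by
        rw [mul_comm G, ← mul_assoc, ← mul_assoc, mul_comm _ ((3 : ℝ≥0∞) ^ n), mul_assoc (3 ^ n),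
          ENNReal.inv_mul_cancel (vol_ne_zero i) ENNReal.coe_ne_top, mul_one]

/-! ### Almost orthogonality -/

namespace DensityData

variable {D : DensityData n} {β : ℝ} {B : ℝ≥0}

/-- Oscillation on cubes of side `2^(j-k)` is controlled by translations of length at most `n
2^(j-k)`, each gaining `2^(-βk)`. The weight left over in the translation bound makes the sum over
`j` converge. -/
theorem HasDecay.exists_osc_op_bound (h : D.HasDecay β B) : ∃ C : ℝ≥0,
    ∀ (s : ℝ) (J : Finset ℤ) (k : ℕ) (a : Fin n → ℝ) (f : Euc n → ℂ), |s| = 1 → Nice f →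
      ∑ j ∈ J, ∫⁻ x, ‖osc a (j - k) (D.op (s * 2 ^ j) f) x‖ₑ ^ (2 : ℝ) ≤
        C * ((2 : ℝ≥0∞) ^ (-β)) ^ k * ∫⁻ x, ‖f x‖ₑ ^ (2 : ℝ) := by
  obtain ⟨C₁, h₁⟩ := h.exists_translate_sq_bound n
  obtain ⟨C₂, h₂⟩ := h.exists_sum_scaleWeight_bound
  refine ⟨3 ^ n * C₁ * C₂, fun s J k a f hs hf => ?_⟩
  calc ∑ j ∈ J, ∫⁻ x, ‖osc a (j - k) (D.op (s * 2 ^ j) f) x‖ₑ ^ (2 : ℝ)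
      ≤ ∑ j ∈ J, 3 ^ n * (C₁ * ((2 : ℝ≥0∞) ^ (-β)) ^ k *
          ∫⁻ ξ, ENNReal.ofReal (scaleWeight β j ξ) * ‖FourierTransform.fourier f ξ‖ₑ ^ (2 : ℝ)) :=
        Finset.sum_le_sum fun j _ => lintegral_osc_sq_le a _ (D.op_nice hf _) fun y hy =>
          h₁ s j k y f hs (by simpa using hy) hf
    _ = 3 ^ n * C₁ * ((2 : ℝ≥0∞) ^ (-β)) ^ k * ∑ j ∈ J,
          ∫⁻ ξ, ENNReal.ofReal (scaleWeight β j ξ) * ‖FourierTransform.fourier f ξ‖ₑ ^ (2 : ℝ) := by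
        rw [Finset.mul_sum]
        refine Finset.sum_congr rfl fun j _ => ?_
        ring
    _ ≤ 3 ^ n * C₁ * ((2 : ℝ≥0∞) ^ (-β)) ^ k * (C₂ * ∫⁻ x, ‖f x‖ₑ ^ (2 : ℝ)) := by
        gcongr
        exact h₂ J f hf
    _ = _ := by push_cast; ring

end DensityData

/-- Cauchy–Schwarz for `lintegral`. -/
theorem lintegral_mul_le_sqrt {X : Type*} [MeasurableSpace X] {μ : Measure X} {F G : X → ℝ≥0∞}
    (hF : AEMeasurable F μ) (hG : AEMeasurable G μ) : ∫⁻ x, F x * G x ∂μ ≤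
      (∫⁻ x, F x ^ (2 : ℝ) ∂μ) ^ (1 / 2 : ℝ) * (∫⁻ x, G x ^ (2 : ℝ) ∂μ) ^ (1 / 2 : ℝ) :=
  ENNReal.lintegral_mul_le_Lp_mul_Lq μ Real.HolderConjugate.two_two hF hG

theorem sum_mul_le_sqrt {ι : Type*} (s : Finset ι) (F G : ι → ℝ≥0∞) : ∑ i ∈ s, F i * G i ≤
    (∑ i ∈ s, F i ^ (2 : ℝ)) ^ (1 / 2 : ℝ) * (∑ i ∈ s, G i ^ (2 : ℝ)) ^ (1 / 2 : ℝ) :=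
  ENNReal.inner_le_Lp_mul_Lq s F G Real.HolderConjugate.two_two

theorem ENNReal.rpow_half_rpow_two (x : ℝ≥0∞) : (x ^ (1 / 2 : ℝ)) ^ (2 : ℝ) = x := by
  rw [← ENNReal.rpow_mul]; norm_num

theorem ENNReal.le_of_le_sqrt_mul_sqrt {X A : ℝ≥0∞} (hX : X ≠ ∞)
    (h : X ≤ A ^ (1 / 2 : ℝ) * X ^ (1 / 2 : ℝ)) : X ≤ A := by
  rcases eq_or_ne X 0 with h0 | h0
  · simp [h0]
  have h1 : X = X ^ (1 / 2 : ℝ) * X ^ (1 / 2 : ℝ) := by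
    rw [← ENNReal.rpow_add _ _ h0 hX]; norm_num
  have h2 : X ^ (1 / 2 : ℝ) ≠ 0 := by simp [h0, hX]
  have h3 : X ^ (1 / 2 : ℝ) ≠ ∞ := by simp [h0, hX]
  have h4 : X ^ (1 / 2 : ℝ) ≤ A ^ (1 / 2 : ℝ) := by
    have h5 : X ^ (1 / 2 : ℝ) * X ^ (1 / 2 : ℝ) ≤ A ^ (1 / 2 : ℝ) * X ^ (1 / 2 : ℝ) := h1 ▸ h
    exact (ENNReal.mul_le_mul_iff_left h2 h3).1 h5
  have := ENNReal.rpow_le_rpow h4 (z := 2) (by norm_num)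
  rwa [ENNReal.rpow_half_rpow_two, ENNReal.rpow_half_rpow_two] at this

theorem enorm_integral_mul_le {f g : Euc n → ℂ} (hf : Measurable f) (hg : Measurable g) :
    ‖∫ x, f x * g x‖ₑ ≤
      (∫⁻ x, ‖f x‖ₑ ^ (2 : ℝ)) ^ (1 / 2 : ℝ) * (∫⁻ x, ‖g x‖ₑ ^ (2 : ℝ)) ^ (1 / 2 : ℝ) := by
  refine (enorm_integral_le_lintegral_enorm _).trans ?_
  simp_rw [enorm_mul]
  exact lintegral_mul_le_sqrt (by fun_prop) (by fun_prop)

namespace DensityData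

variable {D : DensityData n} {β : ℝ} {B : ℝ≥0}

/-- Dual to `exists_osc_op_bound`. The sum `G` is paired with its own conjugate, and each averaging
operator and each oscillation is moved to the second factor. Cauchy–Schwarz leaves one factor
`‖G‖₂`, which cancels since it is finite. -/
theorem HasDecay.exists_sum_op_osc_bound (h : D.HasDecay β B) : ∃ C : ℝ≥0,
    ∀ (s : ℝ) (J : Finset ℤ) (k : ℕ) (a : Fin n → ℝ) (ε : ℤ → ℂ) (b : ℤ → Euc n → ℂ), |s| = 1 →
      (∀ j, ‖ε j‖ ≤ 1) → (∀ j, Nice (b j)) →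
      ∫⁻ x, ‖∑ j ∈ J, ε j * D.op (s * 2 ^ j) (osc a (j - k) (b j)) x‖ₑ ^ (2 : ℝ) ≤
        C * ((2 : ℝ≥0∞) ^ (-β)) ^ k * ∑ j ∈ J, ∫⁻ x, ‖b j x‖ₑ ^ (2 : ℝ) := by
  obtain ⟨C, hC⟩ := h.exists_osc_op_bound
  refine ⟨C * 4, fun s J k a ε b hs hε hb => ?_⟩
  set G : Euc n → ℂ := fun x => ∑ j ∈ J, ε j * D.op (s * 2 ^ j) (osc a (j - k) (b j)) x with hG
  have hO : ∀ j, Nice (osc a (j - k) (b j)) := fun j => (hb j).osc a _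
  have hn : ∀ j, Nice (fun x => D.op (s * 2 ^ j) (osc a (j - k) (b j)) x) :=
    fun j => D.op_nice (hO j) _
  have hGn : Nice G := Nice.sum fun j _ => (hn j).const_mul _
  have hGc := hGn.conj
  set X := ∫⁻ x, ‖G x‖ₑ ^ (2 : ℝ) with hX
  have hXtop : X ≠ ∞ := (hGn.lintegral_rpow_lt_top (by norm_num)).ne
  have e1 : X = ‖∫ x, G x * (starRingEnd ℂ) (G x)‖ₑ := by
    have : ∀ x, G x * (starRingEnd ℂ) (G x) = ((‖G x‖ ^ 2 : ℝ) : ℂ) := fun x => by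
      rw [Complex.mul_conj, Complex.normSq_eq_norm_sq]
    simp_rw [this]
    rw [integral_complex_ofReal, ← ofReal_norm, Complex.norm_real, Real.norm_of_nonneg
      (integral_nonneg fun x => by positivity), ofReal_integral_eq_lintegral_ofReal
      ((hGn.memLp 2).integrable_norm_pow (by norm_num)) (Eventually.of_forall fun x => by positivity)]
    refine lintegral_congr fun x => ?_
    rw [ENNReal.ofReal_pow (norm_nonneg _), ofReal_norm]
    norm_cast
  have e2 : ∫ x, G x * (starRingEnd ℂ) (G x) = ∑ j ∈ J, ε j * ∫ x, osc a (j - k) (b j) x *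
      osc a (j - k) (D.op (-s * 2 ^ j) (fun x => (starRingEnd ℂ) (G x))) x := by
    calc ∫ x, G x * (starRingEnd ℂ) (G x)
        = ∫ x, ∑ j ∈ J, ε j * (D.op (s * 2 ^ j) (osc a (j - k) (b j)) x * (starRingEnd ℂ) (G x)) := by
          congr 1; ext x
          conv_lhs => rw [hG]
          simp only [Finset.sum_mul, mul_assoc]
          rfl
      _ = ∑ j ∈ J, ε j * ∫ x, (D.op (s * 2 ^ j) (osc a (j - k) (b j)) x * (starRingEnd ℂ) (G x)) := by
          rw [integral_finsetSum _ fun j _ => (((hn j).mul hGc).const_mul _).integrable]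
          simp_rw [integral_const_mul]
      _ = _ := by
          refine Finset.sum_congr rfl fun j _ => ?_
          rw [D.integral_op_mul (hO j) hGc, integral_osc_mul a _ (hb j) (D.op_nice hGc _)]
          simp only [neg_mul]
  have e3 : X ≤ (C * 4 * ((2 : ℝ≥0∞) ^ (-β)) ^ k * ∑ j ∈ J, ∫⁻ x, ‖b j x‖ₑ ^ (2 : ℝ)) ^ (1 / 2 : ℝ) *
      X ^ (1 / 2 : ℝ) := by
    calc X ≤ ∑ j ∈ J, (∫⁻ x, ‖osc a (j - k) (b j) x‖ₑ ^ (2 : ℝ)) ^ (1 / 2 : ℝ) *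
          (∫⁻ x, ‖osc a (j - k) (D.op (-s * 2 ^ j) (fun x => (starRingEnd ℂ) (G x))) x‖ₑ ^ (2 : ℝ))
            ^ (1 / 2 : ℝ) := by
          rw [e1, e2]
          refine (enorm_sum_le _ _).trans (Finset.sum_le_sum fun j _ => ?_)
          rw [enorm_mul]
          refine (mul_le_of_le_one_left zero_le ?_).trans
            (enorm_integral_mul_le (hO j).meas ((D.op_nice hGc _).osc a _).meas)
          rw [← ofReal_norm]
          exact (ENNReal.ofReal_le_ofReal (hε j)).trans (by simp)
      _ ≤ (∑ j ∈ J, ∫⁻ x, ‖osc a (j - k) (b j) x‖ₑ ^ (2 : ℝ)) ^ (1 / 2 : ℝ) *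
          (∑ j ∈ J, ∫⁻ x, ‖osc a (j - k) (D.op (-s * 2 ^ j) (fun x => (starRingEnd ℂ) (G x))) x‖ₑ
            ^ (2 : ℝ)) ^ (1 / 2 : ℝ) := by
          refine (sum_mul_le_sqrt J _ _).trans (le_of_eq ?_)
          simp_rw [ENNReal.rpow_half_rpow_two]
      _ ≤ (∑ j ∈ J, 4 * ∫⁻ x, ‖b j x‖ₑ ^ (2 : ℝ)) ^ (1 / 2 : ℝ) *
          (C * ((2 : ℝ≥0∞) ^ (-β)) ^ k * X) ^ (1 / 2 : ℝ) := by
          gcongr with j hj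
          · refine (lintegral_osc_rpow_le a _ (hb j).meas (by norm_num)).trans (le_of_eq ?_)
            norm_num
          · refine (hC (-s) J k a _ (by rwa [abs_neg]) hGc).trans (le_of_eq ?_)
            congr 1
            refine lintegral_congr fun x => ?_
            rw [← ofReal_norm, RCLike.norm_conj, ofReal_norm]
      _ = _ := by
          rw [← Finset.mul_sum, ← ENNReal.mul_rpow_of_nonneg _ _ (by norm_num),
            ← ENNReal.mul_rpow_of_nonneg _ _ (by norm_num)]
          congr 1; ring
  have := ENNReal.le_of_le_sqrt_mul_sqrt hXtop e3
  push_cast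
  exact this

end DensityData

end

end SparseRadon

namespace SparseRadon

noncomputable section

variable {n : ℕ}

/-! ### Maximal dyadic cubes -/

/-- The union of those cubes of side `2^i` that are maximal among the cubes of side at most `2^U`
satisfying `S`. -/
def topSet (a : Fin n → ℝ) (U : ℤ) (S : ℤ → (Fin n → ℤ) → Prop) (i : ℤ) : Set (Euc n) :=
  {x | i ≤ U ∧ S i (idx a i x) ∧ ∀ i', i < i' → i' ≤ U → ¬ S i' (idx a i' x)}

variable {a : Fin n → ℝ} {U : ℤ} {S : ℤ → (Fin n → ℤ) → Prop}

theorem sat_topSet (i : ℤ) : Sat a i (topSet a U S i) := by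
  rintro x y hxy ⟨h1, h2, h3⟩
  refine ⟨h1, hxy ▸ h2, fun i' hi' hU => ?_⟩
  rw [← idx_eq_of_le a hi'.le hxy]
  exact h3 i' hi' hU

theorem measurableSet_topSet (i : ℤ) : MeasurableSet (topSet a U S i) :=
  (sat_topSet i).measurableSet

theorem topSet_unique {i j : ℤ} {x : Euc n} (hi : x ∈ topSet a U S i) (hj : x ∈ topSet a U S j) :
    i = j := by
  rcases lt_trichotomy i j with h | h | h
  · exact absurd hj.2.1 (hi.2.2 j h hj.1)
  · exact h
  · exact absurd hi.2.1 (hj.2.2 i h hi.1)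

theorem disjoint_topSet {i j : ℤ} (h : i ≠ j) : Disjoint (topSet a U S i) (topSet a U S j) :=
  Set.disjoint_left.2 fun _ hi hj => h (topSet_unique hi hj)

theorem exists_mem_topSet {i : ℤ} {x : Euc n} (hi : i ≤ U) (hS : S i (idx a i x)) :
    ∃ j, i ≤ j ∧ x ∈ topSet a U S j := by
  obtain ⟨j, ⟨h1, h2⟩, h3⟩ := Int.exists_greatest_of_bdd (P := fun j => j ≤ U ∧ S j (idx a j x))
    ⟨U, fun z hz => hz.1⟩ ⟨i, hi, hS⟩
  refine ⟨j, h3 i ⟨hi, hS⟩, h1, h2, fun i' hi' hU hS' => ?_⟩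
  have := h3 i' ⟨hU, hS'⟩
  omega

theorem sum_setLIntegral_topSet_le (T : Finset ℤ) (F : Euc n → ℝ≥0∞) :
    ∑ i ∈ T, ∫⁻ x in topSet a U S i, F x ≤ ∫⁻ x, F x := by
  rw [← lintegral_biUnion_finset (fun i _ j _ h => disjoint_topSet h)
    (fun i _ => measurableSet_topSet i)]
  exact setLIntegral_le_lintegral _ _

theorem tsum_setLIntegral_topSet_le (F : Euc n → ℝ≥0∞) :
    ∑' i, ∫⁻ x in topSet a U S i, F x ≤ ∫⁻ x, F x := by
  rw [← lintegral_iUnion (fun i => measurableSet_topSet i) (fun i j h => disjoint_topSet h)]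
  exact setLIntegral_le_lintegral _ _

/-- Weak-type bound for the tripled dyadic maximal function. -/
theorem mul_volume_iUnion_tripleCell_le (hU : ∀ i m, S i m → i ≤ U) {t : ℝ≥0∞}
    {w : Euc n → ℝ≥0∞} (h : ∀ i m, S i m → t * vol n i ≤ ∫⁻ x in cell a i m, w x) :
    t * volume (⋃ (i : ℤ) (m : Fin n → ℤ) (_ : S i m), tripleCell a i m) ≤ 3 ^ n * ∫⁻ x, w x := by
  classical
  -- The maximal cubes are disjoint, and since triples are nested, their triples cover the triples
  -- of all other selected cubes.
  set W : ℤ → (Fin n → ℤ) → Set (Euc n) := fun i m =>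
    if cell a i m ⊆ topSet a U S i then tripleCell a i m else ∅ with hW
  have h1 : (⋃ (i : ℤ) (m : Fin n → ℤ) (_ : S i m), tripleCell a i m) ⊆ ⋃ i, ⋃ m, W i m := by
    intro x hx
    simp only [Set.mem_iUnion] at hx
    obtain ⟨i, m, hS, hx⟩ := hx
    obtain ⟨z, hz⟩ := nonempty_cell a i m
    rw [mem_cell] at hz
    obtain ⟨j, hij, hj⟩ := exists_mem_topSet (a := a) (x := z) (hU i m hS) (hz ▸ hS)
    refine Set.mem_iUnion.2 ⟨j, Set.mem_iUnion.2 ⟨idx a j z, ?_⟩⟩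
    have : cell a j (idx a j z) ⊆ topSet a U S j := fun y hy => sat_topSet j z y hy.symm hj
    simp only [hW, if_pos this]
    refine idx_near_of_le a hij fun t => ?_
    rw [hz]
    exact hx t
  have h2 : ∀ i m, t * volume (W i m) ≤ 3 ^ n * ∫⁻ x in topSet a U S i ∩ cell a i m, w x := by
    intro i m
    simp only [hW]
    split_ifs with hc
    · rw [volume_tripleCell, mul_left_comm, Set.inter_eq_self_of_subset_right hc]
      gcongr
      obtain ⟨z, hz⟩ := nonempty_cell a i m
      have := (hc hz).2.1
      rw [mem_cell] at hz
      exact h i m (hz ▸ this)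
    · simp
  calc t * volume (⋃ (i : ℤ) (m : Fin n → ℤ) (_ : S i m), tripleCell a i m)
      ≤ t * ∑' i, ∑' m, volume (W i m) := by
        gcongr
        refine (measure_mono h1).trans ((measure_iUnion_le _).trans ?_)
        exact ENNReal.tsum_le_tsum fun i => measure_iUnion_le _
    _ = ∑' i, ∑' m, t * volume (W i m) := by simp_rw [ENNReal.tsum_mul_left]
    _ ≤ ∑' i, ∑' m, 3 ^ n * ∫⁻ x in topSet a U S i ∩ cell a i m, w x :=
        ENNReal.tsum_le_tsum fun i => ENNReal.tsum_le_tsum fun m => h2 i m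
    _ = 3 ^ n * ∑' i, ∫⁻ x in topSet a U S i, w x := by
        simp_rw [ENNReal.tsum_mul_left, ← setLIntegral_eq_tsum_cell a _ (measurableSet_topSet _)]
    _ ≤ _ := by
        gcongr
        exact tsum_setLIntegral_topSet_le w

/-- Cubes of side at least `2^L` that satisfy `S`, and all cubes of side `2^L`. -/
def withFloor (L : ℤ) (S : ℤ → (Fin n → ℤ) → Prop) (i : ℤ) (m : Fin n → ℤ) : Prop :=
  L ≤ i ∧ (i = L ∨ S i m)

variable {L : ℤ}

/-- With the floor, the maximal cubes partition the whole space and use finitely many scales. All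
decompositions below are therefore finite sums, and no differentiation theorem is needed. -/
theorem exists_mem_topSet_withFloor (h : L ≤ U) (x : Euc n) :
    ∃ j, L ≤ j ∧ j ≤ U ∧ x ∈ topSet a U (withFloor L S) j := by
  obtain ⟨j, h1, h2⟩ := exists_mem_topSet (a := a) (x := x) (S := withFloor L S) h
    ⟨le_rfl, Or.inl rfl⟩
  exact ⟨j, h1, h2.1, h2⟩

theorem not_of_mem_topSet_withFloor {i j : ℤ} {x : Euc n}
    (hx : x ∈ topSet a U (withFloor L S) i) (hij : i < j) (hj : j ≤ U) : ¬ S j (idx a j x) := by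
  intro hS
  have := hx.2.1.1
  exact hx.2.2 j hij hj ⟨by omega, Or.inr hS⟩

theorem topSet_withFloor_eq_empty {i : ℤ} (h : i < L ∨ U < i) :
    topSet a U (withFloor L S) i = ∅ := by
  ext x
  simp only [Set.mem_empty_iff_false, iff_false]
  intro hx
  have h1 := hx.1
  have h2 := hx.2.1.1
  omega

theorem sum_indicator_topSet (h : L ≤ U) (u : Euc n → ℂ) (x : Euc n) :
    ∑ i ∈ Finset.Icc L U, (topSet a U (withFloor L S) i).indicator u x = u x := by
  obtain ⟨j, h1, h2, h3⟩ := exists_mem_topSet_withFloor (a := a) (S := S) h x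
  rw [Finset.sum_eq_single j]
  · rw [Set.indicator_of_mem h3]
  · intro i _ hij
    rw [Set.indicator_of_notMem]
    exact fun hi => hij (topSet_unique hi h3)
  · intro hj
    exact absurd (Finset.mem_Icc.2 ⟨h1, h2⟩) hj

/-- Reindexing by the depth `k = j - i` gives a range that is common to all scales `j`, so the sums
over `k` and `j` can be exchanged. The surplus terms lie below the floor. -/
theorem sum_range_sub_eq {M : Type*} [AddCommMonoid M] {F : ℤ → M} {j : ℤ} {N : ℕ}
    (hF : ∀ i, i < L → F i = 0) (hj : j ≤ U) (hN : j < L + N) :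
    ∑ i ∈ Finset.Icc L U with i ≤ j, F i = ∑ k ∈ Finset.range N, F (j - k) := by
  have h1 : ∑ k ∈ Finset.range N, F (j - k) =
      ∑ k ∈ Finset.range N with L ≤ j - ((k : ℕ) : ℤ), F (j - k) := by
    rw [Finset.sum_filter]
    refine Finset.sum_congr rfl fun k _ => ?_
    split_ifs with h
    · rfl
    · exact hF _ (by omega)
  rw [h1]
  refine Finset.sum_bij' (fun i _ => (j - i).toNat) (fun k _ => j - k) ?_ ?_ ?_ ?_ ?_
  · intro i hi
    simp only [Finset.mem_filter, Finset.mem_Icc] at hi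
    simp only [Finset.mem_filter, Finset.mem_range]
    omega
  · intro k hk
    simp only [Finset.mem_filter, Finset.mem_range] at hk
    simp only [Finset.mem_filter, Finset.mem_Icc]
    omega
  · intro i hi
    simp only [Finset.mem_filter, Finset.mem_Icc] at hi
    omega
  · intro k hk
    simp only [Finset.mem_filter, Finset.mem_range] at hk
    omega
  · intro i hi
    simp only [Finset.mem_filter, Finset.mem_Icc] at hi
    congr 1
    omega

/-- The average of a nonnegative function over the dyadic cube of side `2^i` around `x`. -/
def lavg (a : Fin n → ℝ) (i : ℤ) (F : Euc n → ℝ≥0∞) (x : Euc n) : ℝ≥0∞ :=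
  (vol n i : ℝ≥0∞)⁻¹ * ∫⁻ y in cell a i (idx a i x), F y

theorem setLIntegral_lavg {i : ℤ} {E : Set (Euc n)} (hE : Sat a i E) (F : Euc n → ℝ≥0∞) :
    ∫⁻ x in E, lavg a i F x = ∫⁻ x in E, F x := by
  rw [setLIntegral_eq_tsum_cell a i hE.measurableSet,
    setLIntegral_eq_tsum_cell a i hE.measurableSet F]
  refine tsum_congr fun m => ?_
  rcases (E ∩ cell a i m).eq_empty_or_nonempty with h | ⟨z, hz, hzm⟩
  · simp [h]
  · have : cell a i m ⊆ E := fun y hy => hE z y (by rw [mem_cell] at *; rw [hy, hzm]) hz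
    rw [Set.inter_eq_self_of_subset_right this]
    calc ∫⁻ x in cell a i m, lavg a i F x
        = ∫⁻ x in cell a i m, (vol n i : ℝ≥0∞)⁻¹ * ∫⁻ y in cell a i m, F y := by
          refine setLIntegral_congr_fun (measurableSet_cell a i m) fun x hx => ?_
          rw [mem_cell] at hx
          simp only [lavg, hx]
      _ = _ := by
          rw [setLIntegral_const, volume_cell, mul_right_comm,
            ENNReal.inv_mul_cancel (vol_ne_zero i) ENNReal.coe_ne_top, one_mul]

theorem cell_subset_cell {i j : ℤ} (h : i ≤ j) (x : Euc n) :
    cell a i (idx a i x) ⊆ cell a j (idx a j x) := fun _ hy => idx_eq_of_le a h hy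

theorem indicator_eq_zero_of_sat {i : ℤ} {E : Set (Euc n)} (hE : Sat a i E) (u : Euc n → ℂ)
    {x : Euc n} (hx : x ∉ E) (y : Euc n) (hy : idx a i y = idx a i x) : E.indicator u y = 0 :=
  Set.indicator_of_notMem (fun h => hx (hE y x hy h)) u

namespace DensityData

variable {D : DensityData n}

/-- The measure lives in the unit ball, so scale `j` moves values by at most `2^j`, that is, into
the same or a neighbouring cell of any grid of side at least `2^j`. -/
theorem exists_ne_zero_of_op_ne_zero {u : Euc n → ℂ} {s : ℝ} (hs : |s| = 1) {i j : ℤ} (hij : j ≤ i)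
    {x : Euc n} (h : D.op (s * 2 ^ j) u x ≠ 0) (a : Fin n → ℝ) :
    ∃ y, u y ≠ 0 ∧ ∀ t, |idx a i x t - idx a i y t| ≤ 1 := by
  by_contra! hc
  refine h (D.op_eq_zero fun y hy => ?_)
  by_contra hne
  obtain ⟨t, ht⟩ := hc _ hne
  refine absurd (idx_near_of_norm_le a (fun t => ?_) t) (not_le.2 ht)
  have h1 : |y t| ≤ 1 := (abs_apply_le_norm y t).trans (by simpa using hy)
  have h2 : x t - (x - (s * 2 ^ j) • y) t = s * 2 ^ j * y t := by simp
  rw [h2, abs_mul, abs_mul, hs, one_mul, abs_of_pos (by positivity)]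
  calc (2 : ℝ) ^ j * |y t| ≤ 2 ^ j * 1 := by gcongr
    _ ≤ 2 ^ i := by rw [mul_one]; exact zpow_le_zpow_right₀ (by norm_num) hij

end DensityData

end

end SparseRadon

namespace SparseRadon

noncomputable section

variable {n : ℕ}

/-! ### `L^r` bounds for truncated sums -/

theorem eLpNorm_two_rpow {f : Euc n → ℂ} :
    eLpNorm f 2 volume ^ (2 : ℝ) = ∫⁻ x, ‖f x‖ₑ ^ (2 : ℝ) := by
  rw [eLpNorm_eq_lintegral_rpow_enorm_toReal (by simp) (by simp), ← ENNReal.rpow_mul]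
  simp

theorem lintegral_sum_sq_le {F : ℕ → Euc n → ℂ} (hF : ∀ k, Measurable (F k)) {A q : ℝ≥0∞}
    (h : ∀ k, ∫⁻ x, ‖F k x‖ₑ ^ (2 : ℝ) ≤ A * (q ^ k) ^ (2 : ℝ)) (N : ℕ) :
    ∫⁻ x, ‖∑ k ∈ Finset.range N, F k x‖ₑ ^ (2 : ℝ) ≤ A * (∑' k : ℕ, q ^ k) ^ (2 : ℝ) := by
  have h1 : ∀ k, eLpNorm (F k) 2 volume ≤ A ^ (1 / 2 : ℝ) * q ^ k := by
    intro k
    have := ENNReal.rpow_le_rpow (h k) (z := 1 / 2) (by norm_num)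
    rw [← eLpNorm_two_rpow, ENNReal.mul_rpow_of_nonneg _ _ (by norm_num), ← ENNReal.rpow_mul,
      ← ENNReal.rpow_mul] at this
    simpa using this
  have h2 : eLpNorm (fun x => ∑ k ∈ Finset.range N, F k x) 2 volume ≤
      A ^ (1 / 2 : ℝ) * ∑' k : ℕ, q ^ k := by
    have h3 := eLpNorm_sum_le (μ := volume) (s := Finset.range N) (f := F) (p := 2)
      (fun k _ => (hF k).aestronglyMeasurable) (by norm_num)
    have h4 : (∑ k ∈ Finset.range N, F k) = fun x => ∑ k ∈ Finset.range N, F k x := by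
      ext x; simp
    rw [h4] at h3
    calc _ ≤ ∑ k ∈ Finset.range N, A ^ (1 / 2 : ℝ) * q ^ k :=
          h3.trans (Finset.sum_le_sum fun k _ => h1 k)
      _ ≤ _ := by
          rw [← Finset.mul_sum]
          gcongr
          exact ENNReal.sum_le_tsum _
  rw [← eLpNorm_two_rpow]
  refine (ENNReal.rpow_le_rpow h2 (by norm_num)).trans (le_of_eq ?_)
  rw [ENNReal.mul_rpow_of_nonneg _ _ (by norm_num), ENNReal.rpow_half_rpow_two]

theorem exists_vol_ge (hn : 0 < n) {M : ℝ≥0∞} (hM : M ≠ ∞) (U₀ : ℤ) :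
    ∃ U, U₀ ≤ U ∧ M ≤ vol n U := by
  lift M to ℝ≥0 using hM
  obtain ⟨k, hk⟩ := pow_unbounded_of_one_lt M (one_lt_two)
  refine ⟨max U₀ k, le_max_left _ _, ?_⟩
  rw [ENNReal.coe_le_coe]
  refine (hk.le.trans ?_).trans (vol_mono (le_max_right U₀ k))
  rw [vol, zpow_natCast]
  exact le_self_pow₀ (one_le_pow₀ one_le_two) hn.ne'

variable {a : Fin n → ℝ} {U L : ℤ} {S : ℤ → (Fin n → ℤ) → Prop}

theorem enorm_indicator_rpow (E : Set (Euc n)) (f : Euc n → ℂ) {r : ℝ} (hr : 0 < r) (x : Euc n) :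
    ‖E.indicator f x‖ₑ ^ r = E.indicator (fun x => ‖f x‖ₑ ^ r) x := by
  by_cases hx : x ∈ E <;> simp [hx, hr]

theorem sum_lintegral_indicator_topSet_le {W : Set (Euc n)} (hW : MeasurableSet W)
    (f : Euc n → ℂ) {r : ℝ} (hr : 0 < r) (J : Finset ℤ) (k : ℤ) :
    ∑ j ∈ J, ∫⁻ x, ‖(topSet a U S (j - k) ∩ W).indicator f x‖ₑ ^ r ≤
      ∫⁻ x in W, ‖f x‖ₑ ^ r := by
  simp_rw [enorm_indicator_rpow _ _ hr]
  have h1 : ∀ j ∈ J, ∫⁻ x, (topSet a U S (j - k) ∩ W).indicator (fun x => ‖f x‖ₑ ^ r) x =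
      ∫⁻ x in topSet a U S (j - k), W.indicator (fun x => ‖f x‖ₑ ^ r) x := by
    intro j _
    rw [lintegral_indicator ((measurableSet_topSet _).inter hW), setLIntegral_indicator hW,
      Set.inter_comm]
  rw [Finset.sum_congr rfl h1, ← lintegral_indicator hW]
  have := sum_setLIntegral_topSet_le (a := a) (U := U) (S := S)
    (J.map (Equiv.subRight k).toEmbedding) (W.indicator (fun x => ‖f x‖ₑ ^ r))
  simpa [Finset.sum_map] using this

/-- The quantity that controls the distribution function of a truncated sum. -/
def distBound (θ : ℝ≥0) (f : Euc n → ℂ) (t : ℝ≥0) : ℝ≥0∞ :=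
  ((t : ℝ≥0∞) ^ (2 : ℝ))⁻¹ * (∫⁻ x, min ‖f x‖ₑ t ^ (2 : ℝ)) +
    (t : ℝ≥0∞)⁻¹ * ∑' k : ℕ, ∫⁻ x in {x | ((θ ^ k * t / 2 : ℝ≥0) : ℝ≥0∞) < ‖f x‖ₑ}, ‖f x‖ₑ

/-- Where `|f| ≤ θ^k t` one has `|f| ≤ θ^k min(|f|, t)`. The loss `θ^(2k)` will be beaten by the
`L²` gain at depth `k`. -/
theorem small_part_le {θ : ℝ≥0} (hθ : 1 ≤ θ) {f : Euc n → ℂ} (t : ℝ≥0) (k : ℕ)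
    (hf : Measurable f) :
    ∫⁻ x in {x | ‖f x‖ₑ ≤ ((θ ^ k * t : ℝ≥0) : ℝ≥0∞)}, ‖f x‖ₑ ^ (2 : ℝ) ≤
      (((θ : ℝ≥0∞) ^ k) ^ (2 : ℝ)) * ∫⁻ x, min ‖f x‖ₑ t ^ (2 : ℝ) := by
  have hm : MeasurableSet {x | ‖f x‖ₑ ≤ ((θ ^ k * t : ℝ≥0) : ℝ≥0∞)} :=
    measurableSet_le hf.enorm measurable_const
  have h1 : (1 : ℝ≥0∞) ≤ (θ : ℝ≥0∞) ^ k := one_le_pow₀ (by exact_mod_cast hθ)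
  rw [← lintegral_const_mul _ (by fun_prop)]
  refine (setLIntegral_mono' hm fun x hx => ?_).trans (setLIntegral_le_lintegral _ _)
  rw [← ENNReal.mul_rpow_of_nonneg _ _ (by norm_num)]
  gcongr
  rcases le_total ‖f x‖ₑ t with h | h
  · rw [min_eq_left h]
    exact le_mul_of_one_le_left zero_le h1
  · rw [min_eq_right h]
    refine (show ‖f x‖ₑ ≤ _ from hx).trans (by push_cast; rfl)

theorem large_part_le {θ : ℝ≥0} {f : Euc n → ℂ} (t : ℝ≥0) (N : ℕ) :
    ∑ k ∈ Finset.range N, ∫⁻ x in {x | ‖f x‖ₑ ≤ ((θ ^ k * t : ℝ≥0) : ℝ≥0∞)}ᶜ, ‖f x‖ₑ ≤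
      ∑' k : ℕ, ∫⁻ x in {x | ((θ ^ k * t / 2 : ℝ≥0) : ℝ≥0∞) < ‖f x‖ₑ}, ‖f x‖ₑ := by
  refine (Finset.sum_le_sum fun k _ => ?_).trans (ENNReal.sum_le_tsum _)
  refine lintegral_mono_set fun x hx => ?_
  simp only [Set.mem_compl_iff, Set.mem_ofPred_eq, not_le] at hx ⊢
  exact lt_of_le_of_lt (by exact_mod_cast half_le_self (zero_le)) hx

/-! ### Calderón–Zygmund decomposition at a fixed height -/

section Stopping

variable {f : Euc n → ℂ} {t : ℝ≥0}

/-- The cubes on which the average of `|f|` exceeds `t`. -/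
def bigAvg (a : Fin n → ℝ) (f : Euc n → ℂ) (t : ℝ≥0) (i : ℤ) (m : Fin n → ℤ) : Prop :=
  t * vol n i < ∫⁻ x in cell a i m, ‖f x‖ₑ

/-- The parent of a maximal cube, floor cubes included, is not selected, which costs the factor
`2^n`. At the top scale the assumption on `U` takes the place of the parent. -/
theorem lavg_le_of_mem_topSet (hU : ∫⁻ x, ‖f x‖ₑ ≤ t * vol n U) {i : ℤ} {x : Euc n}
    (hx : x ∈ topSet a U (withFloor L (bigAvg a f t)) i) :
    lavg a i (fun y => ‖f y‖ₑ) x ≤ 2 ^ n * t := by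
  have key : ∫⁻ y in cell a i (idx a i x), ‖f y‖ₑ ≤ 2 ^ n * t * vol n i := by
    rcases hx.1.eq_or_lt with h | h
    · rw [h]
      refine (setLIntegral_le_lintegral _ _).trans (hU.trans ?_)
      gcongr
      exact le_mul_of_one_le_left zero_le (one_le_pow₀ one_le_two)
    · have h1 := not_of_mem_topSet_withFloor hx (lt_add_one i) h
      rw [bigAvg, not_lt, vol_succ] at h1
      refine (lintegral_mono_set (cell_subset_cell (by omega) x)).trans (h1.trans (le_of_eq ?_))
      push_cast; ring
  rw [lavg, ← ENNReal.div_eq_inv_mul]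
  exact ENNReal.div_le_of_le_mul key

/-- `|f|` is split at height `t`: Jensen for the lower part, and for the upper part one of the two
factors is at most `2^n t`. The usual bound by `t ‖f‖₁` would not be summable over dyadic `t`
afterwards; this truncated form is. -/
theorem condAvg_sq_le (hf : Measurable f) (hU : ∫⁻ x, ‖f x‖ₑ ≤ t * vol n U) {i : ℤ} {x : Euc n}
    (hx : x ∈ topSet a U (withFloor L (bigAvg a f t)) i) :
    ‖condAvg a i f x‖ₑ ^ (2 : ℝ) ≤
      2 * lavg a i (fun y => min ‖f y‖ₑ t ^ (2 : ℝ)) x +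
      2 ^ (n + 1) * t * lavg a i ({y | (t : ℝ≥0∞) < ‖f y‖ₑ}.indicator (fun y => ‖f y‖ₑ)) x := by
  have hm : MeasurableSet {y | (t : ℝ≥0∞) < ‖f y‖ₑ} := measurableSet_lt measurable_const hf.enorm
  set c₁ := lavg a i (fun y => min ‖f y‖ₑ t) x
  set c₂ := lavg a i ({y | (t : ℝ≥0∞) < ‖f y‖ₑ}.indicator (fun y => ‖f y‖ₑ)) x
  have h0 : ‖condAvg a i f x‖ₑ ≤ c₁ + c₂ := by
    refine (enorm_condAvg_le a i x).trans ?_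
    simp only [c₁, c₂, lavg]
    rw [← mul_add, ← lintegral_add_left (by fun_prop)]
    gcongr with y
    by_cases hy : (t : ℝ≥0∞) < ‖f y‖ₑ
    · rw [Set.indicator_of_mem (by exact hy)]
      exact le_add_self
    · rw [min_eq_left (not_lt.1 hy)]
      exact le_self_add
  have h2 : c₂ ≤ 2 ^ n * t := by
    refine le_trans ?_ (lavg_le_of_mem_topSet hU hx)
    simp only [c₂, lavg]
    gcongr with y
    exact Set.indicator_le_self _ _ y
  have h1 : c₁ ^ (2 : ℝ) ≤ lavg a i (fun y => min ‖f y‖ₑ t ^ (2 : ℝ)) x :=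
    rpow_avg_le a i (by fun_prop) _ (by norm_num)
  calc ‖condAvg a i f x‖ₑ ^ (2 : ℝ) ≤ (c₁ + c₂) ^ (2 : ℝ) := by gcongr
    _ ≤ 2 ^ ((2 : ℝ) - 1) * (c₁ ^ (2 : ℝ) + c₂ ^ (2 : ℝ)) :=
        ENNReal.rpow_add_le_mul_rpow_add_rpow _ _ (by norm_num)
    _ = 2 * c₁ ^ (2 : ℝ) + 2 * (c₂ * c₂) := by
        norm_num [mul_add, sq]
    _ ≤ 2 * lavg a i (fun y => min ‖f y‖ₑ t ^ (2 : ℝ)) x + 2 * (2 ^ n * t * c₂) := by gcongr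
    _ = _ := by rw [pow_succ]; ring

/-- The good part of the Calderón–Zygmund decomposition. -/
def goodPart (a : Fin n → ℝ) (U L : ℤ) (S : ℤ → (Fin n → ℤ) → Prop) (f : Euc n → ℂ) (x : Euc n) :
    ℂ := ∑ i ∈ Finset.Icc L U,
  condAvg a i ((topSet a U (withFloor L S) i).indicator f) x

theorem goodPart_nice (hf : Nice f) : Nice (goodPart a U L S f) :=
  Nice.sum fun i _ => (hf.indicator (measurableSet_topSet i)).condAvg a i

theorem condAvg_indicator_of_mem {i : ℤ} {E : Set (Euc n)} (hE : Sat a i E) {x : Euc n}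
    (hx : x ∈ E) : condAvg a i (E.indicator f) x = condAvg a i f x := by
  rw [condAvg, condAvg]
  congr 1
  refine setIntegral_congr_fun (measurableSet_cell a i _) fun y hy => ?_
  exact Set.indicator_of_mem (hE x y hy.symm hx) f

theorem condAvg_indicator_of_notMem {i : ℤ} {E : Set (Euc n)} (hE : Sat a i E) {x : Euc n}
    (hx : x ∉ E) : condAvg a i (E.indicator f) x = 0 :=
  condAvg_eq_zero a i (indicator_eq_zero_of_sat hE f hx)

theorem goodPart_of_mem {i : ℤ} {x : Euc n} (hx : x ∈ topSet a U (withFloor L S) i) :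
    goodPart a U L S f x = condAvg a i f x := by
  rw [goodPart, Finset.sum_eq_single i]
  · exact condAvg_indicator_of_mem (sat_topSet i) hx
  · intro j _ hj
    exact condAvg_indicator_of_notMem (sat_topSet j) fun h => hj (topSet_unique h hx)
  · intro hi
    rw [Finset.mem_Icc] at hi
    exact absurd ⟨hx.2.1.1, hx.1⟩ hi

theorem eq_goodPart_add (h : L ≤ U) (x : Euc n) :
    f x = goodPart a U L S f x +
      ∑ i ∈ Finset.Icc L U, osc a i ((topSet a U (withFloor L S) i).indicator f) x := by
  rw [goodPart, ← Finset.sum_add_distrib]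
  simp only [osc, add_sub_cancel]
  exact (sum_indicator_topSet h f x).symm

theorem lintegral_goodPart_sq_le (hf : Nice f) (hLU : L ≤ U)
    (hU : ∫⁻ x, ‖f x‖ₑ ≤ t * vol n U) :
    ∫⁻ x, ‖goodPart a U L (bigAvg a f t) f x‖ₑ ^ (2 : ℝ) ≤
      2 * (∫⁻ x, min ‖f x‖ₑ t ^ (2 : ℝ)) +
      2 ^ (n + 1) * t * ∫⁻ x in {y | (t : ℝ≥0∞) < ‖f y‖ₑ}, ‖f x‖ₑ := by
  have hfm := hf.meas
  have hm : MeasurableSet {y | (t : ℝ≥0∞) < ‖f y‖ₑ} := measurableSet_lt measurable_const hfm.enorm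
  set A := fun i => topSet a U (withFloor L (bigAvg a f t)) i
  have hcov : ⋃ i, A i = Set.univ := by
    refine Set.eq_univ_of_forall fun x => ?_
    obtain ⟨j, -, -, h⟩ := exists_mem_topSet_withFloor (a := a) (S := bigAvg a f t) hLU x
    exact Set.mem_iUnion.2 ⟨j, h⟩
  have hsplit : ∀ F : Euc n → ℝ≥0∞, ∫⁻ x, F x = ∑' i, ∫⁻ x in A i, F x := fun F => by
    rw [← setLIntegral_univ, ← hcov, lintegral_iUnion (fun i => measurableSet_topSet i)
      (fun i j h => disjoint_topSet h)]
  rw [hsplit, ← lintegral_indicator hm, hsplit (fun x => min ‖f x‖ₑ t ^ (2 : ℝ)),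
    hsplit ({y | (t : ℝ≥0∞) < ‖f y‖ₑ}.indicator (fun y => ‖f y‖ₑ)), ← ENNReal.tsum_mul_left,
    ← ENNReal.tsum_mul_left, ← ENNReal.tsum_add]
  refine ENNReal.tsum_le_tsum fun i => ?_
  have hmeas : ∀ F : Euc n → ℝ≥0∞, Measurable (lavg a i F) := fun F =>
    (measurable_of_countable fun m : Fin n → ℤ =>
      (vol n i : ℝ≥0∞)⁻¹ * ∫⁻ y in cell a i m, F y).comp (measurable_idx a i)
  calc ∫⁻ x in A i, ‖goodPart a U L (bigAvg a f t) f x‖ₑ ^ (2 : ℝ)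
      ≤ ∫⁻ x in A i, (2 * lavg a i (fun y => min ‖f y‖ₑ t ^ (2 : ℝ)) x +
      2 ^ (n + 1) * t * lavg a i ({y | (t : ℝ≥0∞) < ‖f y‖ₑ}.indicator (fun y => ‖f y‖ₑ)) x) := by
        refine setLIntegral_mono' (measurableSet_topSet i) fun x hx => ?_
        rw [goodPart_of_mem hx]
        exact condAvg_sq_le hfm hU hx
    _ = _ := by
        rw [lintegral_add_left ((hmeas _).const_mul _), lintegral_const_mul _ (hmeas _),
          lintegral_const_mul _ (hmeas _), setLIntegral_lavg (sat_topSet i),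
          setLIntegral_lavg (sat_topSet i)]

/-- An average above `t` forces the part of `|f|` above `t / 2` to have average at least `t / 2`.
The weak-type bound for the tripled maximal function is applied to that part. -/
theorem mul_volume_bigAvg_le (hf : Measurable f)
    (hU : ∫⁻ x, ‖f x‖ₑ ≤ t * vol n U) :
    (t / 2 : ℝ≥0) * volume (⋃ (i : ℤ) (m : Fin n → ℤ) (_ : bigAvg a f t i m), tripleCell a i m) ≤
      3 ^ n * ∫⁻ x in {y | ((t / 2 : ℝ≥0) : ℝ≥0∞) < ‖f y‖ₑ}, ‖f x‖ₑ := by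
  have hm : MeasurableSet {y | ((t / 2 : ℝ≥0) : ℝ≥0∞) < ‖f y‖ₑ} :=
    measurableSet_lt measurable_const hf.enorm
  rw [← lintegral_indicator hm]
  refine mul_volume_iUnion_tripleCell_le (U := U) (fun i m h => ?_) (fun i m h => ?_)
  · by_contra! hi
    refine absurd h (not_lt.2 ((setLIntegral_le_lintegral _ _).trans (hU.trans ?_)))
    gcongr
    exact vol_mono hi.le
  · have h1 : ∫⁻ x in cell a i m, ‖f x‖ₑ ≤ (t / 2 : ℝ≥0) * vol n i +
        ∫⁻ x in cell a i m, {y | ((t / 2 : ℝ≥0) : ℝ≥0∞) < ‖f y‖ₑ}.indicator (fun y => ‖f y‖ₑ) x := by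
      rw [← volume_cell a i m, ← setLIntegral_const, ← lintegral_add_left measurable_const]
      refine lintegral_mono fun y => ?_
      by_cases hy : ((t / 2 : ℝ≥0) : ℝ≥0∞) < ‖f y‖ₑ
      · rw [Set.indicator_of_mem (by exact hy)]
        exact le_add_self
      · exact (not_lt.1 hy).trans le_self_add
    have h2 : (t : ℝ≥0∞) * vol n i = (t / 2 : ℝ≥0) * vol n i + (t / 2 : ℝ≥0) * vol n i := by
      rw [← add_mul, ← ENNReal.coe_add, add_halves]
    have h3 : (((t / 2 : ℝ≥0) * vol n i : ℝ≥0) : ℝ≥0∞) ≠ ∞ := ENNReal.coe_ne_top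
    rw [ENNReal.coe_mul] at h3
    refine (ENNReal.add_le_add_iff_left h3).1 ?_
    rw [← h2]
    exact (le_of_lt h).trans h1

end Stopping

end

end SparseRadon

/-! ### Distributional estimate for truncated sums -/

namespace SparseRadon

noncomputable section

variable {n : ℕ} {D : DensityData n} {β : ℝ} {B : ℝ≥0}

/-- Off the tripled cubes on which `S` holds, only the oscillations at scales at most `j` are seen
by averages at scale `j`. -/
theorem DensityData.op_eq_sum_osc {a : Fin n → ℝ} {U L : ℤ} {S : ℤ → (Fin n → ℤ) → Prop}
    {f : Euc n → ℂ} (hf : Nice f) {s : ℝ} (hs : |s| = 1) {j : ℤ} (hLj : L ≤ j) (hjU : j ≤ U)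
    {N : ℕ} (hN : j < L + N) {x : Euc n}
    (hx : ∀ i, j < i → ∀ m, S i m → x ∉ tripleCell a i m) :
    D.op (s * 2 ^ j) f x = D.op (s * 2 ^ j) (goodPart a U L S f) x + ∑ k ∈ Finset.range N,
      D.op (s * 2 ^ j) (osc a (j - k) ((topSet a U (withFloor L S) (j - k)).indicator f)) x := by
  have hLU : L ≤ U := hLj.trans hjU
  have hnice : ∀ i, Nice (osc a i ((topSet a U (withFloor L S) i).indicator f)) := fun i =>
    (hf.indicator (measurableSet_topSet i)).osc a i
  have h1 : f = fun x => goodPart a U L S f x +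
      ∑ i ∈ Finset.Icc L U, osc a i ((topSet a U (withFloor L S) i).indicator f) x :=
    funext fun x => eq_goodPart_add hLU x
  conv_lhs => rw [h1]
  rw [D.op_add (goodPart_nice hf) (Nice.sum fun i _ => hnice i), D.op_sum fun i _ => hnice i]
  congr 1
  have h2 : ∀ i ∈ Finset.Icc L U, ¬ i ≤ j →
      D.op (s * 2 ^ j) (osc a i ((topSet a U (withFloor L S) i).indicator f)) x = 0 := by
    intro i _ hij
    rw [not_le] at hij
    by_contra hne
    obtain ⟨y, hy, hnear⟩ := DensityData.exists_ne_zero_of_op_ne_zero hs hij.le hne a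
    have hyA : y ∈ topSet a U (withFloor L S) i := by
      by_contra hyA
      exact hy (osc_eq_zero a i (indicator_eq_zero_of_sat (sat_topSet i) f hyA))
    -- The cube of side `2^i` around `y` lies above the floor, since `i > j ≥ L`. It is thus a
    -- genuine stopping cube, and `x` would lie in its triple.
    rcases hyA.2.1.2 with h | h
    · omega
    · exact hx i hij _ h hnear
  rw [← sum_range_sub_eq (L := L) (U := U) (j := j) (N := N)
    (F := fun i => D.op (s * 2 ^ j) (osc a i ((topSet a U (withFloor L S) i).indicator f)) x)
    ?_ hjU hN, Finset.sum_filter]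
  · refine Finset.sum_congr rfl fun i hi => ?_
    split_ifs with hij
    · rfl
    · exact h2 i hi hij
  · intro i hi
    have h3 : osc a i ((topSet a U (withFloor L S) i).indicator f) = fun _ => 0 := by
      funext y
      refine osc_eq_zero a i fun z _ => ?_
      rw [topSet_withFloor_eq_empty (Or.inl hi), Set.indicator_empty]
    simp only [h3, D.op_zero]

theorem lintegral_enorm_sum_op_osc_le {a : Fin n → ℝ} {s : ℝ} {J : Finset ℤ} {ε : ℤ → ℂ}
    (hε : ∀ j, ‖ε j‖ ≤ 1) {b : ℤ → Euc n → ℂ} (hb : ∀ j, Nice (b j)) (k : ℕ) :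
    ∫⁻ x, ‖∑ j ∈ J, ε j * D.op (s * 2 ^ j) (osc a (j - k) (b j)) x‖ₑ ≤
      2 * D.mass * ∑ j ∈ J, ∫⁻ x, ‖b j x‖ₑ := by
  have hm : ∀ j, Measurable (fun x => ‖D.op (s * 2 ^ j) (osc a (j - k) (b j)) x‖ₑ) := fun j =>
    (D.op_nice ((hb j).osc a _) _).meas.enorm
  calc _ ≤ ∫⁻ x, ∑ j ∈ J, ‖D.op (s * 2 ^ j) (osc a (j - k) (b j)) x‖ₑ := by
        refine lintegral_mono fun x => (enorm_sum_le _ _).trans (Finset.sum_le_sum fun j _ => ?_)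
        rw [enorm_mul]
        exact mul_le_of_le_one_left zero_le (by
          rw [← ofReal_norm]; exact ENNReal.ofReal_le_one.2 (hε j))
    _ = ∑ j ∈ J, ∫⁻ x, ‖D.op (s * 2 ^ j) (osc a (j - k) (b j)) x‖ₑ :=
        lintegral_finsetSum _ fun j _ => hm j
    _ ≤ ∑ j ∈ J, 2 * D.mass * ∫⁻ x, ‖b j x‖ₑ := by
        refine Finset.sum_le_sum fun j _ => ?_
        have h1 := D.lintegral_op_rpow_le ((hb j).osc a (j - k)).meas (s * 2 ^ j) (r := 1) le_rfl
        have h2 := lintegral_osc_rpow_le a (j - k) (hb j).meas (r := 1) le_rfl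
        simp only [ENNReal.rpow_one] at h1 h2
        refine h1.trans ((mul_le_mul_right h2 _).trans (le_of_eq ?_))
        ring
    _ = _ := by rw [Finset.mul_sum]

theorem mul_volume_lt_le {F : Euc n → ℂ} (hF : Measurable F) {t : ℝ≥0} (ht : t ≠ 0) {r : ℝ}
    (hr : 0 < r) : volume {x | (t : ℝ≥0∞) < ‖F x‖ₑ} ≤
      ((t : ℝ≥0∞) ^ r)⁻¹ * ∫⁻ x, ‖F x‖ₑ ^ r := by
  have h0 : (t : ℝ≥0∞) ^ r ≠ 0 := by simp [ht]
  have h1 : (t : ℝ≥0∞) ^ r ≠ ∞ := by simp [hr.le]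
  rw [← ENNReal.div_eq_inv_mul, ENNReal.le_div_iff_mul_le (Or.inl h0) (Or.inl h1), mul_comm]
  refine le_trans ?_ (mul_meas_ge_le_lintegral (by fun_prop) ((t : ℝ≥0∞) ^ r))
  exact mul_le_mul_right (measure_mono fun x hx => ENNReal.rpow_le_rpow (le_of_lt hx) hr.le) _

theorem indicator_eq_inter_add_inter_compl {X : Type*} (E F : Set X) (f : X → ℂ) (x : X) :
    E.indicator f x = (E ∩ F).indicator f x + (E ∩ Fᶜ).indicator f x := by
  by_cases h : x ∈ E <;> by_cases h' : x ∈ F <;> simp [h, h']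

/-- Outside the tripled stopping cubes `Ω`, the sum splits into the good part `g` and, for each
depth `k`, pieces `P k` with `|f| ≤ θ^k t` and pieces `Q k` with `|f| > θ^k t`. The first two kinds,
`g` and `P k`, are estimated in `L²`, the pieces `P k` with almost orthogonality; `Q k` is estimated
in `L¹`, the stopping cubes of different scales being disjoint. The exceptional set `Ω` is small by
the maximal bound. -/
theorem DensityData.HasDecay.exists_weak_bound (hn : 0 < n) (h : D.HasDecay β B) : ∃ C θ : ℝ≥0, 1 < θ ∧
    ∀ (s : ℝ) (J : Finset ℤ) (ε : ℤ → ℂ) (f : Euc n → ℂ) (t : ℝ≥0), |s| = 1 →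
      (∀ j, ‖ε j‖ ≤ 1) → Nice f → t ≠ 0 →
      volume {x | (3 * t : ℝ≥0∞) < ‖D.trunc s J ε f x‖ₑ} ≤ C * distBound θ f t := by
  obtain ⟨C₂, hC₂⟩ := h.exists_trunc_sq_bound
  obtain ⟨C₃, hC₃⟩ := h.exists_sum_op_osc_bound
  -- The squared norm at depth `k` gains `2^(-βk) = θ^(-4k)` and loses `θ^(2k)` to the truncation.
  -- The norm is left with `θ^(-k)`, a convergent series.
  set θ : ℝ≥0 := 2 ^ (β / 4) with hθ
  have hβ := h.pos
  have hθ1 : 1 < θ := NNReal.one_lt_rpow one_lt_two (by positivity)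
  have hθE : (2 : ℝ≥0∞) ^ (-β) = ((θ : ℝ≥0∞)⁻¹) ^ 4 := by
    rw [hθ, ENNReal.coe_rpow_of_nonneg _ (by positivity), ← ENNReal.rpow_neg,
      ← ENNReal.rpow_natCast, ← ENNReal.rpow_mul]
    congr 1
    push_cast; ring
  have hθ0 : (θ : ℝ≥0∞) ≠ 0 := by simpa using (zero_lt_one.trans hθ1).ne'
  have hG : ∑' k : ℕ, ((θ : ℝ≥0∞)⁻¹) ^ k ≠ ∞ := by
    rw [ENNReal.tsum_geometric, ENNReal.inv_ne_top]
    refine (tsub_pos_iff_lt.2 (ENNReal.inv_lt_one.2 ?_)).ne'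
    exact_mod_cast hθ1
  lift (∑' k : ℕ, ((θ : ℝ≥0∞)⁻¹) ^ k) to ℝ≥0 using hG with G hG'
  refine ⟨2 * 3 ^ n + C₂ * 2 ^ (n + 1) + C₃ * G ^ 2 + 2 * D.mass, θ, hθ1, ?_⟩
  intro s J ε f t hs hε hf ht
  have ht' : (t : ℝ≥0∞) ≠ 0 := by simpa using ht
  have hfm := hf.meas
  set Φ := ∫⁻ x, min ‖f x‖ₑ t ^ (2 : ℝ) with hΦ
  set Λ := ∑' k : ℕ, ∫⁻ x in {x | ((θ ^ k * t / 2 : ℝ≥0) : ℝ≥0∞) < ‖f x‖ₑ}, ‖f x‖ₑ with hΛ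
  have hΛ0 : ∫⁻ x in {x | ((t / 2 : ℝ≥0) : ℝ≥0∞) < ‖f x‖ₑ}, ‖f x‖ₑ ≤ Λ := by
    refine le_trans (le_of_eq ?_) (ENNReal.le_tsum 0)
    simp
  have hΛ1 : ∫⁻ x in {x | (t : ℝ≥0∞) < ‖f x‖ₑ}, ‖f x‖ₑ ≤ Λ := by
    refine (lintegral_mono_set fun x hx => ?_).trans hΛ0
    exact lt_of_le_of_lt (ENNReal.coe_le_coe.2 (half_le_self (zero_le))) hx
  -- the scales
  obtain ⟨L, hL⟩ : ∃ L : ℤ, ∀ j ∈ J, L ≤ j := (J.finite_toSet.bddBelow)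
  obtain ⟨U₀, hU₀⟩ : ∃ L : ℤ, ∀ j ∈ J, j ≤ L := (J.finite_toSet.bddAbove)
  have hfin : (t : ℝ≥0∞)⁻¹ * ∫⁻ x, ‖f x‖ₑ ≠ ∞ := by
    refine ENNReal.mul_ne_top (by simp [ht]) ?_
    have := hf.lintegral_rpow_lt_top (r := 1) one_pos
    simpa using this.ne
  -- At this top scale no cube can have average above `t`. Positive dimension enters here, since the
  -- volumes must be unbounded.
  obtain ⟨U, hU, hUv⟩ := exists_vol_ge hn hfin (max U₀ L)
  have hUt : ∫⁻ x, ‖f x‖ₑ ≤ t * vol n U := by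
    rw [← ENNReal.div_eq_inv_mul] at hUv
    rw [mul_comm]
    exact (ENNReal.div_le_iff ht' (by simp)).1 hUv
  have hLU : L ≤ U := (le_max_right _ _).trans hU
  have hJU : ∀ j ∈ J, j ≤ U := fun j hj => (hU₀ j hj).trans ((le_max_left _ _).trans hU)
  set N := (U - L + 1).toNat
  have hN : ∀ j ∈ J, j < L + N := fun j hj => by have := hJU j hj; omega
  set a : Fin n → ℝ := 0
  set S := bigAvg a f t
  set W : ℕ → Set (Euc n) := fun k => {x | ‖f x‖ₑ ≤ ((θ ^ k * t : ℝ≥0) : ℝ≥0∞)}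
  have hW : ∀ k, MeasurableSet (W k) := fun k => measurableSet_le hfm.enorm measurable_const
  set A := fun i => topSet a U (withFloor L S) i with hA
  have hAm : ∀ i, MeasurableSet (A i) := fun i => measurableSet_topSet i
  set Ω := ⋃ (i : ℤ) (m : Fin n → ℤ) (_ : S i m), tripleCell a i m
  have hn1 : ∀ k j, Nice ((A (j - (k : ℕ)) ∩ W k).indicator f) := fun k j =>
    hf.indicator ((hAm _).inter (hW k))
  have hn2 : ∀ k j, Nice ((A (j - (k : ℕ)) ∩ (W k)ᶜ).indicator f) := fun k j =>
    hf.indicator ((hAm _).inter (hW k).compl)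
  set P : ℕ → Euc n → ℂ := fun k x => ∑ j ∈ J, ε j *
    D.op (s * 2 ^ j) (osc a (j - k) ((A (j - k) ∩ W k).indicator f)) x with hP
  set Q : ℕ → Euc n → ℂ := fun k x => ∑ j ∈ J, ε j *
    D.op (s * 2 ^ j) (osc a (j - k) ((A (j - k) ∩ (W k)ᶜ).indicator f)) x with hQ
  have hPn : ∀ k, Nice (P k) := fun k =>
    Nice.sum fun j _ => (D.op_nice ((hn1 k j).osc a _) _).const_mul _
  have hQn : ∀ k, Nice (Q k) := fun k =>
    Nice.sum fun j _ => (D.op_nice ((hn2 k j).osc a _) _).const_mul _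
  set g := goodPart a U L S f
  have hg : Nice g := goodPart_nice hf
  have hdec : ∀ x ∉ Ω, D.trunc s J ε f x = D.trunc s J ε g x +
      ((∑ k ∈ Finset.range N, P k x) + ∑ k ∈ Finset.range N, Q k x) := by
    intro x hx
    have hx' : ∀ i m, S i m → x ∉ tripleCell a i m := fun i m him hmem =>
      hx (Set.mem_iUnion.2 ⟨i, Set.mem_iUnion.2 ⟨m, Set.mem_iUnion.2 ⟨him, hmem⟩⟩⟩)
    simp only [DensityData.trunc, hP, hQ]
    rw [← Finset.sum_add_distrib]
    simp_rw [← Finset.sum_add_distrib]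
    rw [Finset.sum_comm, ← Finset.sum_add_distrib]
    refine Finset.sum_congr rfl fun j hj => ?_
    rw [D.op_eq_sum_osc hf hs (hL j hj) (hJU j hj) (hN j hj) fun i _ m him => hx' i m him,
      mul_add, Finset.mul_sum]
    congr 1
    refine Finset.sum_congr rfl fun k _ => ?_
    rw [← mul_add, ← D.op_add ((hn1 k j).osc a _) ((hn2 k j).osc a _)]
    congr 2
    funext y
    rw [← osc_add a _ (hn1 k j) (hn2 k j)]
    congr 1
    funext z
    exact indicator_eq_inter_add_inter_compl (A (j - k)) (W k) f z
  -- the four sets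
  have hv1 : volume Ω ≤ 2 * 3 ^ n * ((t : ℝ≥0∞)⁻¹ * Λ) := by
    have h1 := (mul_volume_bigAvg_le (a := a) hfm hUt).trans (mul_le_mul_right hΛ0 _)
    have h2 : ((t / 2 : ℝ≥0) : ℝ≥0∞) ≠ 0 := by simpa using ht
    rw [mul_comm, ← ENNReal.le_div_iff_mul_le (Or.inl h2) (Or.inl ENNReal.coe_ne_top)] at h1
    refine h1.trans (le_of_eq ?_)
    rw [ENNReal.div_eq_inv_mul, ENNReal.coe_div two_ne_zero, ENNReal.inv_div (by simp) (by simp),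
      ENNReal.div_eq_inv_mul]
    push_cast; ring
  have hv2 : volume {x | (t : ℝ≥0∞) < ‖D.trunc s J ε g x‖ₑ} ≤
      C₂ * (2 * (((t : ℝ≥0∞) ^ (2 : ℝ))⁻¹ * Φ) + 2 ^ (n + 1) * ((t : ℝ≥0∞)⁻¹ * Λ)) := by
    refine (mul_volume_lt_le (DensityData.trunc_nice hg).meas ht (r := 2) two_pos).trans ?_
    calc _ ≤ ((t : ℝ≥0∞) ^ (2 : ℝ))⁻¹ * (C₂ * (2 * Φ + 2 ^ (n + 1) * t * Λ)) := by
          refine mul_le_mul_right ((hC₂ s J ε g hs hε hg).trans (mul_le_mul_right ?_ _)) _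
          exact (lintegral_goodPart_sq_le hf hLU hUt).trans
            (add_le_add_right (mul_le_mul_right hΛ1 _) _)
      _ = C₂ * (2 * (((t : ℝ≥0∞) ^ (2 : ℝ))⁻¹ * Φ) +
          2 ^ (n + 1) * (((t : ℝ≥0∞) ^ (2 : ℝ))⁻¹ * t * Λ)) := by ring
      _ = _ := by
          congr 4
          rw [ENNReal.rpow_two, sq, ENNReal.mul_inv (Or.inl ht') (Or.inl (by simp)), mul_assoc,
            ENNReal.inv_mul_cancel ht' (by simp), mul_one]
  have hv3 : volume {x | (t : ℝ≥0∞) < ‖∑ k ∈ Finset.range N, P k x‖ₑ} ≤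
      C₃ * G ^ 2 * (((t : ℝ≥0∞) ^ (2 : ℝ))⁻¹ * Φ) := by
    refine (mul_volume_lt_le (Nice.sum fun k _ => hPn k).meas ht (r := 2) two_pos).trans ?_
    have h1 : ∀ k, ∫⁻ x, ‖P k x‖ₑ ^ (2 : ℝ) ≤
        (C₃ * Φ) * (((θ : ℝ≥0∞)⁻¹ ^ k) ^ (2 : ℝ)) := by
      intro k
      refine (hC₃ s J k a ε _ hs hε (hn1 k)).trans ?_
      have h2 := (sum_lintegral_indicator_topSet_le (a := a) (U := U) (S := withFloor L S) (hW k) f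
        (r := 2) two_pos J k).trans (small_part_le hθ1.le t k hfm)
      refine (mul_le_mul_right h2 _).trans (le_of_eq ?_)
      rw [hθE, ENNReal.rpow_two, ENNReal.rpow_two]
      calc _ = C₃ * Φ * ((θ : ℝ≥0∞)⁻¹ ^ k) ^ 2 * (((θ : ℝ≥0∞)⁻¹ * θ) ^ k) ^ 2 := by
            rw [mul_pow]; ring
        _ = _ := by rw [ENNReal.inv_mul_cancel hθ0 (by simp)]; simp
    refine (mul_le_mul_right (lintegral_sum_sq_le (fun k => (hPn k).meas) h1 N) _).trans
      (le_of_eq ?_)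
    rw [← hG', ENNReal.rpow_two (G : ℝ≥0∞)]; ring
  have hv4 : volume {x | (t : ℝ≥0∞) < ‖∑ k ∈ Finset.range N, Q k x‖ₑ} ≤
      2 * D.mass * ((t : ℝ≥0∞)⁻¹ * Λ) := by
    refine (mul_volume_lt_le (Nice.sum fun k _ => hQn k).meas ht (r := 1) one_pos).trans ?_
    simp only [ENNReal.rpow_one]
    have h1 : ∫⁻ x, ‖∑ k ∈ Finset.range N, Q k x‖ₑ ≤ 2 * D.mass * Λ := by
      calc _ ≤ ∫⁻ x, ∑ k ∈ Finset.range N, ‖Q k x‖ₑ := lintegral_mono fun x => enorm_sum_le _ _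
        _ = ∑ k ∈ Finset.range N, ∫⁻ x, ‖Q k x‖ₑ :=
            lintegral_finsetSum _ fun k _ => (hQn k).meas.enorm
        _ ≤ ∑ k ∈ Finset.range N, 2 * D.mass * ∫⁻ x in (W k)ᶜ, ‖f x‖ₑ := by
            refine Finset.sum_le_sum fun k _ => ?_
            refine (lintegral_enorm_sum_op_osc_le hε (hn2 k) k).trans (mul_le_mul_right ?_ _)
            have := sum_lintegral_indicator_topSet_le (a := a) (U := U) (S := withFloor L S)
              (hW k).compl f (r := 1) one_pos J k
            simpa only [ENNReal.rpow_one] using this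
        _ ≤ _ := by
            rw [← Finset.mul_sum]
            exact mul_le_mul_right (large_part_le t N) _
    refine (mul_le_mul_right h1 _).trans (le_of_eq ?_)
    ring
  have hsub : {x | (3 * t : ℝ≥0∞) < ‖D.trunc s J ε f x‖ₑ} ⊆
      Ω ∪ ({x | (t : ℝ≥0∞) < ‖D.trunc s J ε g x‖ₑ} ∪
        ({x | (t : ℝ≥0∞) < ‖∑ k ∈ Finset.range N, P k x‖ₑ} ∪
          {x | (t : ℝ≥0∞) < ‖∑ k ∈ Finset.range N, Q k x‖ₑ})) := by
    intro x hx
    by_contra hnot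
    simp only [Set.mem_union, Set.mem_ofPred_eq, not_or, not_lt] at hnot
    obtain ⟨h1, h2, h3, h4⟩ := hnot
    rw [Set.mem_ofPred_eq, hdec x h1] at hx
    refine absurd hx (not_lt.2 ?_)
    calc _ ≤ ‖D.trunc s J ε g x‖ₑ + (‖∑ k ∈ Finset.range N, P k x‖ₑ +
          ‖∑ k ∈ Finset.range N, Q k x‖ₑ) :=
          (enorm_add_le _ _).trans (add_le_add_right (enorm_add_le _ _) _)
      _ ≤ (t : ℝ≥0∞) + (t + t) := by gcongr
      _ = 3 * t := by ring
  refine (measure_mono hsub).trans ((measure_union_le _ _).trans ?_)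
  refine (add_le_add_right ((measure_union_le _ _).trans
    (add_le_add_right (measure_union_le _ _) _)) _).trans ?_
  refine (add_le_add hv1 (add_le_add hv2 (add_le_add hv3 hv4))).trans ?_
  rw [distBound, ← hΦ, ← hΛ]
  set X := ((t : ℝ≥0∞) ^ (2 : ℝ))⁻¹ * Φ
  set Y := (t : ℝ≥0∞)⁻¹ * Λ
  push_cast
  have h2n : (2 : ℝ≥0∞) ≤ 2 ^ (n + 1) := by
    rw [pow_succ]; exact le_mul_of_one_le_left zero_le (one_le_pow₀ one_le_two)
  calc _ ≤ 2 * 3 ^ n * Y + (C₂ * (2 ^ (n + 1) * X + 2 ^ (n + 1) * Y) + (C₃ * G ^ 2 * X +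
        2 * D.mass * Y)) := by gcongr
    -- Nonnegative terms are added so that `X` and `Y` carry the same constant.
    _ ≤ (2 * 3 ^ n * Y + (C₂ * (2 ^ (n + 1) * X + 2 ^ (n + 1) * Y) + (C₃ * G ^ 2 * X +
        2 * D.mass * Y))) + (2 * 3 ^ n * X + (C₃ * G ^ 2 * Y + 2 * D.mass * X)) := le_self_add
    _ = _ := by ring

end

end SparseRadon

/-! ### From the distributional estimate to `L^r`, and duality -/

namespace SparseRadon

noncomputable section

variable {n : ℕ} {D : DensityData n} {β : ℝ} {B : ℝ≥0}

theorem exists_tsum_geometric_bound {c : ℝ} (hc : 0 < c) : ∃ C : ℝ≥0, ∀ u : ℝ, 0 < u →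
    ∑' j : ℤ, ENNReal.ofReal (min (((2 : ℝ) ^ j * u) ^ c) (((2 : ℝ) ^ j * u) ^ (-c))) ≤ C := by
  obtain ⟨C, hC0, hC⟩ := exists_geometric_bound hc
  refine ⟨C.toNNReal, fun u hu => ?_⟩
  obtain ⟨h1, h2⟩ := hC u hu
  rw [← ENNReal.ofReal_tsum_of_nonneg (fun j => by positivity) h1]
  exact ENNReal.ofReal_le_ofReal h2

/-- With `x = t / v`, the left side is `v^r x^r` for `x ≤ 1` and `v^r x^(r-2)` for `x ≥ 1`. Both
decay geometrically as `r < 2`, and `r > 1` permits the common exponent `2 - r`. -/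
theorem rpow_mul_min_sq_le {r t v : ℝ} (hr1 : 1 < r) (hr2 : r < 2) (ht : 0 < t) (hv : 0 < v) :
    t ^ r * ((t ^ (2 : ℝ))⁻¹ * min v t ^ (2 : ℝ)) ≤
      v ^ r * min ((t * v⁻¹) ^ (2 - r)) ((t * v⁻¹) ^ (-(2 - r))) := by
  have hx : 0 < t * v⁻¹ := by positivity
  have htx : t = v * (t * v⁻¹) := by field_simp
  rcases le_total t v with h | h
  · have hx1 : t * v⁻¹ ≤ 1 := by
      rw [← div_eq_mul_inv]; exact (div_le_one hv).2 h
    rw [min_eq_right h, inv_mul_cancel₀ (by positivity), mul_one]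
    conv_lhs => rw [htx, Real.mul_rpow hv.le hx.le]
    refine mul_le_mul_of_nonneg_left (le_min ?_ ?_) (by positivity)
    · exact Real.rpow_le_rpow_of_exponent_ge hx hx1 (by linarith)
    · exact Real.rpow_le_rpow_of_exponent_ge hx hx1 (by linarith)
  · have hx1 : 1 ≤ t * v⁻¹ := by
      rw [← div_eq_mul_inv]; exact (one_le_div hv).2 h
    have h1 : t ^ r * ((t ^ (2 : ℝ))⁻¹ * v ^ (2 : ℝ)) = v ^ r * (t * v⁻¹) ^ (-(2 - r)) := by
      rw [Real.mul_rpow ht.le (by positivity), Real.inv_rpow hv.le, ← Real.rpow_neg ht.le,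
        ← Real.rpow_neg hv.le, ← mul_assoc, ← Real.rpow_add ht, mul_left_comm, ← Real.rpow_add hv]
      congr 2 <;> ring
    rw [min_eq_left h, h1]
    refine mul_le_mul_of_nonneg_left (le_min ?_ le_rfl) (by positivity)
    exact Real.rpow_le_rpow_of_exponent_le hx1 (by linarith)

/-- Over dyadic `t < v / b`, the sum of `t^(r-1) v` is comparable to its largest term, of size
`b^(-(r-1)) v^r`. With `b = θ^k / 2` this is summable in `k` because `r > 1`. -/
theorem rpow_mul_le_of_mul_lt {r t v b : ℝ} (hr1 : 1 < r) (ht : 0 < t) (hv : 0 < v) (hb : 0 < b)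
    (h : b * t < v) :
    t ^ r * (t⁻¹ * v) ≤ b ^ (-(r - 1)) * v ^ r *
      min ((t * (b * v⁻¹)) ^ (r - 1)) ((t * (b * v⁻¹)) ^ (-(r - 1))) := by
  have hx : 0 < t * (b * v⁻¹) := by positivity
  have hx1 : t * (b * v⁻¹) ≤ 1 := by
    rw [← mul_assoc, ← div_eq_mul_inv, mul_comm]; exact (div_le_one hv).2 h.le
  have h1 : t ^ r * (t⁻¹ * v) = b ^ (-(r - 1)) * v ^ r * (t * (b * v⁻¹)) ^ (r - 1) := by
    rw [Real.mul_rpow ht.le (by positivity), Real.mul_rpow hb.le (by positivity),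
      Real.inv_rpow hv.le, ← Real.rpow_neg hv.le, ← mul_assoc, ← Real.rpow_neg_one t,
      ← Real.rpow_add ht]
    calc t ^ (r + -1) * v = t ^ (r - 1) * (b ^ (-(r - 1)) * b ^ (r - 1)) *
          (v ^ r * v ^ (-(r - 1))) := by
          rw [← Real.rpow_add hb, ← Real.rpow_add hv]
          norm_num [← sub_eq_add_neg]
      _ = _ := by ring
  rw [h1]
  refine mul_le_mul_of_nonneg_left (le_min le_rfl ?_) (by positivity)
  exact Real.rpow_le_rpow_of_exponent_ge hx hx1 (by linarith)

/-- Powers of two, as nonnegative real numbers. -/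
def two_zpow (i : ℤ) : ℝ≥0 := 2 ^ i

theorem coe_two_zpow (i : ℤ) : (two_zpow i : ℝ≥0∞) = ENNReal.ofReal ((2 : ℝ) ^ i) := by
  rw [← ENNReal.ofReal_coe_nnreal]
  simp [two_zpow]

theorem two_zpow_ne_zero (i : ℤ) : two_zpow i ≠ 0 := by
  rw [two_zpow]; positivity

theorem exists_tsum_min_sq_le {r : ℝ} (hr1 : 1 < r) (hr2 : r < 2) : ∃ C : ℝ≥0, ∀ z : ℂ,
    ∑' i : ℤ, (two_zpow i : ℝ≥0∞) ^ r *
      (((two_zpow i : ℝ≥0∞) ^ (2 : ℝ))⁻¹ * min ‖z‖ₑ (two_zpow i) ^ (2 : ℝ)) ≤ C * ‖z‖ₑ ^ r := by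
  obtain ⟨C, hC⟩ := exists_tsum_geometric_bound (c := 2 - r) (by linarith)
  refine ⟨C, fun z => ?_⟩
  rcases eq_or_ne z 0 with rfl | hz
  · simp
  have hv : 0 < ‖z‖ := norm_pos_iff.2 hz
  calc _ ≤ ∑' i : ℤ, ENNReal.ofReal (‖z‖ ^ r) * ENNReal.ofReal
        (min (((2 : ℝ) ^ i * ‖z‖⁻¹) ^ (2 - r)) (((2 : ℝ) ^ i * ‖z‖⁻¹) ^ (-(2 - r)))) := by
        refine ENNReal.tsum_le_tsum fun i => ?_
        have ht : (0 : ℝ) < 2 ^ i := by positivity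
        rw [← ENNReal.ofReal_mul (by positivity), coe_two_zpow, ← ofReal_norm,
          ← ENNReal.ofReal_min, ENNReal.ofReal_rpow_of_nonneg (p := r) ht.le (by linarith),
          ENNReal.ofReal_rpow_of_nonneg ht.le (by norm_num),
          ENNReal.ofReal_rpow_of_nonneg (by positivity) (by norm_num),
          ← ENNReal.ofReal_inv_of_pos (by positivity), ← ENNReal.ofReal_mul (by positivity),
          ← ENNReal.ofReal_mul (by positivity)]
        exact ENNReal.ofReal_le_ofReal (rpow_mul_min_sq_le hr1 hr2 ht hv)
    _ ≤ _ := by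
        rw [ENNReal.tsum_mul_left, ← ofReal_norm, ENNReal.ofReal_rpow_of_nonneg hv.le (by linarith),
          mul_comm]
        exact mul_le_mul_left (hC _ (by positivity)) _

theorem exists_tsum_indicator_le {r : ℝ} (hr1 : 1 < r) {θ : ℝ≥0} (hθ : 1 < θ) : ∃ C : ℝ≥0, ∀ z : ℂ,
    ∑' i : ℤ, (two_zpow i : ℝ≥0∞) ^ r * ((two_zpow i : ℝ≥0∞)⁻¹ * ∑' k : ℕ,
      if ((θ ^ k * two_zpow i / 2 : ℝ≥0) : ℝ≥0∞) < ‖z‖ₑ then ‖z‖ₑ else 0) ≤ C * ‖z‖ₑ ^ r := by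
  obtain ⟨C, hC⟩ := exists_tsum_geometric_bound (c := r - 1) (by linarith)
  set x : ℝ≥0 := θ ^ (-(r - 1)) with hx
  have hx1 : x < 1 := NNReal.rpow_lt_one_of_one_lt_of_neg hθ (by linarith)
  have hG : ∑' k : ℕ, (x : ℝ≥0∞) ^ k ≠ ∞ := by
    rw [ENNReal.tsum_geometric, ENNReal.inv_ne_top]
    refine (tsub_pos_iff_lt.2 ?_).ne'
    exact_mod_cast hx1
  lift (∑' k : ℕ, (x : ℝ≥0∞) ^ k) to ℝ≥0 using hG with G hG'
  refine ⟨2 ^ (r - 1) * G * C, fun z => ?_⟩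
  rcases eq_or_ne z 0 with rfl | hz
  · simp
  have hv : 0 < ‖z‖ := norm_pos_iff.2 hz
  have hθ0 : (0 : ℝ) < θ := by exact_mod_cast zero_lt_one.trans hθ
  set u : ℕ → ℝ := fun k => (θ : ℝ) ^ k / 2 * ‖z‖⁻¹
  set m : ℕ → ℤ → ℝ≥0∞ := fun k i => ENNReal.ofReal
    (min (((2 : ℝ) ^ i * u k) ^ (r - 1)) (((2 : ℝ) ^ i * u k) ^ (-(r - 1))))
  have key : ∀ (i : ℤ) (k : ℕ), (two_zpow i : ℝ≥0∞) ^ r * ((two_zpow i : ℝ≥0∞)⁻¹ *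
      if ((θ ^ k * two_zpow i / 2 : ℝ≥0) : ℝ≥0∞) < ‖z‖ₑ then ‖z‖ₑ else 0) ≤
      2 ^ (r - 1) * ‖z‖ₑ ^ r * ((x : ℝ≥0∞) ^ k * m k i) := by
    intro i k
    split_ifs with hlt
    · have ht : (0 : ℝ) < 2 ^ i := by positivity
      have hb : (0 : ℝ) < (θ : ℝ) ^ k / 2 := by positivity
      have hlt' : (θ : ℝ) ^ k / 2 * 2 ^ i < ‖z‖ := by
        rw [← ofReal_norm, ← ENNReal.ofReal_coe_nnreal, ENNReal.ofReal_lt_ofReal_iff hv] at hlt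
        refine lt_of_eq_of_lt ?_ hlt
        simp [two_zpow]; ring
      have h1 := rpow_mul_le_of_mul_lt hr1 ht hv hb hlt'
      have h2 : ((θ : ℝ) ^ k / 2) ^ (-(r - 1)) = 2 ^ (r - 1) * (x : ℝ) ^ k := by
        rw [Real.div_rpow (by positivity) (by norm_num), Real.rpow_neg zero_le_two, div_inv_eq_mul,
          mul_comm, hx, NNReal.coe_rpow, ← Real.rpow_natCast, ← Real.rpow_natCast,
          ← Real.rpow_mul hθ0.le, ← Real.rpow_mul hθ0.le]
        congr 2; ring
      rw [h2] at h1
      have h3 := ENNReal.ofReal_le_ofReal h1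
      rw [ENNReal.ofReal_mul (by positivity), ENNReal.ofReal_mul (by positivity),
        ENNReal.ofReal_mul (by positivity), ENNReal.ofReal_mul (by positivity),
        ENNReal.ofReal_mul (by positivity), ENNReal.ofReal_inv_of_pos ht, ← coe_two_zpow,
        ← ENNReal.ofReal_rpow_of_nonneg ht.le (by linarith), ← coe_two_zpow, ofReal_norm,
        ← ENNReal.ofReal_rpow_of_nonneg hv.le (by linarith), ofReal_norm,
        ← ENNReal.ofReal_rpow_of_nonneg zero_le_two (by linarith),
        ENNReal.ofReal_pow (by positivity), ENNReal.ofReal_coe_nnreal] at h3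
      refine h3.trans (le_of_eq ?_)
      simp only [m, u, ENNReal.ofReal_ofNat]
      ring
    · simp
  calc _ ≤ ∑' i : ℤ, ∑' k : ℕ, 2 ^ (r - 1) * ‖z‖ₑ ^ r * ((x : ℝ≥0∞) ^ k * m k i) := by
        refine ENNReal.tsum_le_tsum fun i => ?_
        rw [← ENNReal.tsum_mul_left, ← ENNReal.tsum_mul_left]
        exact ENNReal.tsum_le_tsum fun k => key i k
    _ = 2 ^ (r - 1) * ‖z‖ₑ ^ r * ∑' k : ℕ, (x : ℝ≥0∞) ^ k * ∑' i, m k i := by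
        rw [ENNReal.tsum_comm, ← ENNReal.tsum_mul_left]
        refine tsum_congr fun k => ?_
        rw [ENNReal.tsum_mul_left, ENNReal.tsum_mul_left]
    _ ≤ 2 ^ (r - 1) * ‖z‖ₑ ^ r * ∑' k : ℕ, (x : ℝ≥0∞) ^ k * C := by
        gcongr with k
        exact hC _ (by positivity)
    _ = _ := by
        rw [ENNReal.tsum_mul_right, ← hG']
        push_cast
        rw [ENNReal.coe_rpow_of_nonneg _ (by linarith)]
        push_cast
        ring

/-- A layer-cake bound for the integral of a power, over dyadic heights. -/
theorem lintegral_rpow_le_tsum_volume {F : Euc n → ℂ} (hF : Measurable F) {r : ℝ} (hr : 0 < r) :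
    ∫⁻ x, ‖F x‖ₑ ^ r ≤ 6 ^ r * ∑' i : ℤ, (two_zpow i : ℝ≥0∞) ^ r *
      volume {x | (3 * two_zpow i : ℝ≥0∞) < ‖F x‖ₑ} := by
  have hm : ∀ i, MeasurableSet {x | (3 * two_zpow i : ℝ≥0∞) < ‖F x‖ₑ} := fun i =>
    measurableSet_lt measurable_const hF.enorm
  calc ∫⁻ x, ‖F x‖ₑ ^ r ≤ ∫⁻ x, 6 ^ r * ∑' i : ℤ, (two_zpow i : ℝ≥0∞) ^ r *
        {x | (3 * two_zpow i : ℝ≥0∞) < ‖F x‖ₑ}.indicator 1 x := by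
        refine lintegral_mono fun x => ?_
        rcases eq_or_ne (F x) 0 with h0 | h0
        · simp [h0, hr]
        have hv : 0 < ‖F x‖ / 3 := by have := norm_pos_iff.2 h0; positivity
        -- This gives `3 · 2^i < |F x| ≤ 6 · 2^i`. The factor `3` matches the weak bound, which is
        -- stated at height `3 t`.
        obtain ⟨i, hi1, hi2⟩ := exists_mem_Ioc_zpow hv (one_lt_two)
        refine le_trans ?_ (mul_le_mul_right (ENNReal.le_tsum i) _)
        have h1 : x ∈ {x | (3 * two_zpow i : ℝ≥0∞) < ‖F x‖ₑ} := by
          rw [Set.mem_ofPred_eq, coe_two_zpow, ← ofReal_norm,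
            show (3 : ℝ≥0∞) = ENNReal.ofReal 3 by simp, ← ENNReal.ofReal_mul (by norm_num),
            ENNReal.ofReal_lt_ofReal_iff (by linarith)]
          linarith
        rw [Set.indicator_of_mem h1, Pi.one_apply, mul_one, ← ENNReal.mul_rpow_of_nonneg _ _ hr.le]
        refine ENNReal.rpow_le_rpow ?_ hr.le
        rw [coe_two_zpow, ← ofReal_norm, show (6 : ℝ≥0∞) = ENNReal.ofReal 6 by simp,
            ← ENNReal.ofReal_mul (by norm_num)]
        refine ENNReal.ofReal_le_ofReal ?_
        rw [zpow_add_one₀ two_ne_zero] at hi2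
        linarith
    _ = _ := by
        rw [lintegral_const_mul _ (Measurable.tsum fun i =>
            (measurable_one.indicator (hm i)).const_mul _),
          lintegral_tsum fun i => ((measurable_one.indicator (hm i)).const_mul _).aemeasurable]
        congr 1
        refine tsum_congr fun i => ?_
        rw [lintegral_const_mul _ (measurable_one.indicator (hm i)), lintegral_indicator_one (hm i)]

theorem exists_tsum_distBound_le {r : ℝ} (hr1 : 1 < r) (hr2 : r < 2) {θ : ℝ≥0} (hθ : 1 < θ) :
    ∃ C : ℝ≥0, ∀ f : Euc n → ℂ, Measurable f →
      ∑' i : ℤ, (two_zpow i : ℝ≥0∞) ^ r * distBound θ f (two_zpow i) ≤ C * ∫⁻ x, ‖f x‖ₑ ^ r := by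
  obtain ⟨C₁, hC₁⟩ := exists_tsum_min_sq_le hr1 hr2
  obtain ⟨C₂, hC₂⟩ := exists_tsum_indicator_le hr1 hθ
  refine ⟨C₁ + C₂, fun f hf => ?_⟩
  have hm : ∀ (k : ℕ) (i : ℤ),
      MeasurableSet {x | ((θ ^ k * two_zpow i / 2 : ℝ≥0) : ℝ≥0∞) < ‖f x‖ₑ} := fun k i =>
    measurableSet_lt measurable_const hf.enorm
  have hm' : ∀ (k : ℕ) (i : ℤ), Measurable fun x =>
      if ((θ ^ k * two_zpow i / 2 : ℝ≥0) : ℝ≥0∞) < ‖f x‖ₑ then ‖f x‖ₑ else 0 := fun k i =>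
    Measurable.ite (hm k i) hf.enorm measurable_const
  have hms : ∀ i : ℤ, Measurable fun x => ∑' k : ℕ,
      if ((θ ^ k * two_zpow i / 2 : ℝ≥0) : ℝ≥0∞) < ‖f x‖ₑ then ‖f x‖ₑ else 0 := fun i =>
    Measurable.tsum fun k => hm' k i
  have h1 : ∑' i : ℤ, (two_zpow i : ℝ≥0∞) ^ r * (((two_zpow i : ℝ≥0∞) ^ (2 : ℝ))⁻¹ *
      ∫⁻ x, min ‖f x‖ₑ (two_zpow i) ^ (2 : ℝ)) ≤ C₁ * ∫⁻ x, ‖f x‖ₑ ^ r := by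
    rw [← lintegral_const_mul _ (by fun_prop)]
    refine le_trans (le_of_eq ?_) (lintegral_mono fun x => hC₁ (f x))
    rw [lintegral_tsum fun i => by fun_prop]
    refine tsum_congr fun i => ?_
    rw [lintegral_const_mul _ (by fun_prop), lintegral_const_mul _ (by fun_prop)]
  have h2 : ∑' i : ℤ, (two_zpow i : ℝ≥0∞) ^ r * ((two_zpow i : ℝ≥0∞)⁻¹ *
      ∑' k : ℕ, ∫⁻ x in {x | ((θ ^ k * two_zpow i / 2 : ℝ≥0) : ℝ≥0∞) < ‖f x‖ₑ}, ‖f x‖ₑ) ≤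
      C₂ * ∫⁻ x, ‖f x‖ₑ ^ r := by
    rw [← lintegral_const_mul _ (by fun_prop)]
    refine le_trans (le_of_eq ?_) (lintegral_mono fun x => hC₂ (f x))
    rw [lintegral_tsum fun i => (((hms i).const_mul _).const_mul _).aemeasurable]
    refine tsum_congr fun i => ?_
    rw [lintegral_const_mul _ ((hms i).const_mul _), lintegral_const_mul _ (hms i),
      lintegral_tsum fun k => (hm' k i).aemeasurable]
    congr 3
    refine funext fun k => ?_
    rw [← lintegral_indicator (hm k i)]
    refine lintegral_congr fun x => ?_
    rw [Set.indicator_apply]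
    rfl
  simp only [distBound, mul_add]
  rw [ENNReal.tsum_add]
  refine (add_le_add h1 h2).trans (le_of_eq ?_)
  push_cast; ring

/-- Marcinkiewicz interpolation: the weak bound is expressed through truncations of `f` at the same
height, and summing it against `t^r` over dyadic heights returns `‖f‖_r^r`. -/
theorem DensityData.HasDecay.exists_trunc_bound_of_lt_two (hn : 0 < n) (h : D.HasDecay β B) {r : ℝ}
    (hr1 : 1 < r) (hr2 : r < 2) : ∃ C : ℝ≥0,
    ∀ (s : ℝ) (J : Finset ℤ) (ε : ℤ → ℂ) (f : Euc n → ℂ), |s| = 1 → (∀ j, ‖ε j‖ ≤ 1) → Nice f →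
      ∫⁻ x, ‖D.trunc s J ε f x‖ₑ ^ r ≤ C * ∫⁻ x, ‖f x‖ₑ ^ r := by
  obtain ⟨C₁, θ, hθ, hC₁⟩ := h.exists_weak_bound hn
  obtain ⟨C₂, hC₂⟩ := exists_tsum_distBound_le (n := n) hr1 hr2 hθ
  refine ⟨6 ^ r * C₁ * C₂, fun s J ε f hs hε hf => ?_⟩
  refine (lintegral_rpow_le_tsum_volume (DensityData.trunc_nice hf).meas (by linarith)).trans ?_
  calc _ ≤ 6 ^ r * ∑' i : ℤ, (two_zpow i : ℝ≥0∞) ^ r * (C₁ * distBound θ f (two_zpow i)) := by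
        gcongr with i
        exact hC₁ s J ε f _ hs hε hf (two_zpow_ne_zero i)
    _ = 6 ^ r * C₁ * ∑' i : ℤ, (two_zpow i : ℝ≥0∞) ^ r * distBound θ f (two_zpow i) := by
        rw [mul_assoc, ← ENNReal.tsum_mul_left (a := (C₁ : ℝ≥0∞))]
        congr 1
        exact tsum_congr fun i => by ring
    _ ≤ 6 ^ r * C₁ * (C₂ * ∫⁻ x, ‖f x‖ₑ ^ r) := mul_le_mul_right (hC₂ f hf.meas) _
    _ = _ := by
        rw [ENNReal.coe_mul, ENNReal.coe_mul, ENNReal.coe_rpow_of_nonneg _ (by linarith)]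
        push_cast; ring

theorem DensityData.integral_trunc_mul {f g : Euc n → ℂ} (hf : Nice f) (hg : Nice g) (s : ℝ)
    (J : Finset ℤ) (ε : ℤ → ℂ) :
    ∫ x, D.trunc s J ε f x * g x = ∫ x, f x * D.trunc (-s) J ε g x := by
  simp only [DensityData.trunc, Finset.sum_mul, Finset.mul_sum]
  rw [integral_finsetSum _ fun j _ => (((D.op_nice hf _).const_mul _).mul hg).integrable,
    integral_finsetSum _ fun j _ => (hf.mul ((D.op_nice hg _).const_mul _)).integrable]
  refine Finset.sum_congr rfl fun j _ => ?_
  simp only [mul_assoc, mul_left_comm _ (ε j)]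
  rw [integral_const_mul, integral_const_mul, D.integral_op_mul hf hg, neg_mul]

theorem enorm_integral_mul_le_Lp {f g : Euc n → ℂ} (hf : Measurable f) (hg : Measurable g)
    {p q : ℝ} (hpq : p.HolderConjugate q) : ‖∫ x, f x * g x‖ₑ ≤
      (∫⁻ x, ‖f x‖ₑ ^ p) ^ (1 / p) * (∫⁻ x, ‖g x‖ₑ ^ q) ^ (1 / q) := by
  refine (enorm_integral_le_lintegral_enorm _).trans ?_
  simp_rw [enorm_mul]
  exact ENNReal.lintegral_mul_le_Lp_mul_Lq volume hpq hf.enorm.aemeasurable hg.enorm.aemeasurable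

theorem ENNReal.le_of_le_rpow_mul_rpow {X A : ℝ≥0∞} {p q : ℝ} (hpq : p.HolderConjugate q)
    (hX : X ≠ ∞) (h : X ≤ A ^ (1 / p) * X ^ (1 / q)) : X ≤ A := by
  rcases eq_or_ne X 0 with rfl | h0
  · exact zero_le
  have hp := hpq.pos
  have h1 : X = X ^ (1 / p) * X ^ (1 / q) := by
    rw [← ENNReal.rpow_add _ _ h0 hX, one_div, one_div, hpq.inv_add_inv_eq_one, ENNReal.rpow_one]
  have h2 : X ^ (1 / q) ≠ 0 := by simp [h0, hX]
  have h3 : X ^ (1 / q) ≠ ∞ := ENNReal.rpow_ne_top_of_nonneg (by simpa using hpq.symm.nonneg) hX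
  have h4 : X ^ (1 / p) ≤ A ^ (1 / p) := by
    rw [← ENNReal.mul_le_mul_iff_left h2 h3, ← h1]
    exact h
  exact (ENNReal.rpow_le_rpow_iff (by positivity)).1 h4

/-- The function dual to `F` in `L^r`. -/
def dualFn (r : ℝ) (F : Euc n → ℂ) (x : Euc n) : ℂ :=
  ((‖F x‖ ^ (r - 2) : ℝ) : ℂ) * (starRingEnd ℂ) (F x)

theorem dualFn_nice {r : ℝ} (hr : 2 ≤ r) {F : Euc n → ℂ} (hF : Nice F) : Nice (dualFn r F) := by
  have hm := hF.meas
  have h1 : dualFn r F = fun x => (starRingEnd ℂ) (F x) * ((‖F x‖ ^ (r - 2) : ℝ) : ℂ) :=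
    funext fun x => mul_comm _ _
  rw [h1]
  refine hF.conj.mul_bdd (by fun_prop) ?_
  obtain ⟨C, hC0, hC⟩ := hF.bdd_nonneg
  refine ⟨C ^ (r - 2), fun x => ?_⟩
  rw [Complex.norm_real, Real.norm_of_nonneg (by positivity)]
  exact Real.rpow_le_rpow (norm_nonneg _) (hC x) (by linarith)

theorem norm_dualFn {r : ℝ} (hr : 1 < r) (F : Euc n → ℂ) (x : Euc n) :
    ‖dualFn r F x‖ = ‖F x‖ ^ (r - 1) := by
  rw [dualFn, norm_mul, RCLike.norm_conj, Complex.norm_real, Real.norm_of_nonneg (by positivity)]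
  rcases eq_or_ne (F x) 0 with h | h
  · rw [h, norm_zero, mul_zero, Real.zero_rpow (by linarith)]
  · rw [← Real.rpow_add_one (norm_ne_zero_iff.2 h)]
    congr 1; ring

theorem mul_dualFn {r : ℝ} (hr : 0 < r) (F : Euc n → ℂ) (x : Euc n) :
    F x * dualFn r F x = ((‖F x‖ ^ r : ℝ) : ℂ) := by
  rw [dualFn, mul_left_comm, Complex.mul_conj, Complex.normSq_eq_norm_sq, ← Complex.ofReal_mul]
  rcases eq_or_ne (F x) 0 with h | h
  · simp [h, Real.zero_rpow hr.ne']
  · rw [← Real.rpow_natCast, ← Real.rpow_add (norm_pos_iff.2 h)]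
    congr 2; push_cast; ring

/-- For `r > 2`, the sum `F` is tested against `dualFn r F`, the operator is transposed, and the
case `r' < 2` is applied to the test function. The powers of `‖F‖_r` then cancel, as `F` is bounded
with bounded support. -/
theorem DensityData.HasDecay.exists_trunc_bound (hn : 0 < n) (h : D.HasDecay β B) {r : ℝ} (hr : 1 < r) :
    ∃ C : ℝ≥0, ∀ (s : ℝ) (J : Finset ℤ) (ε : ℤ → ℂ) (f : Euc n → ℂ), |s| = 1 →
      (∀ j, ‖ε j‖ ≤ 1) → Nice f →
      ∫⁻ x, ‖D.trunc s J ε f x‖ₑ ^ r ≤ C * ∫⁻ x, ‖f x‖ₑ ^ r := by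
  rcases lt_trichotomy r 2 with hr2 | rfl | hr2
  · exact h.exists_trunc_bound_of_lt_two hn hr hr2
  · exact h.exists_trunc_sq_bound
  have hpq := Real.HolderConjugate.conjExponent hr
  set r' := Real.conjExponent r with hr'
  have hr'2 : r' < 2 := by
    rw [hr', Real.conjExponent, div_lt_iff₀ (by linarith)]; linarith
  obtain ⟨C, hC⟩ := h.exists_trunc_bound_of_lt_two hn hpq.symm.lt hr'2
  -- The dual estimate contributes `C^(1/r')`, and `1/r' = (r-1)/r` makes this the `r`-th root of
  -- `C^(r-1)`.
  refine ⟨C ^ (r - 1), fun s J ε f hs hε hf => ?_⟩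
  have hFn : Nice (D.trunc s J ε f) := DensityData.trunc_nice hf
  set F := D.trunc s J ε f
  set H := dualFn r F
  have hHn : Nice H := dualFn_nice hr2.le hFn
  set X := ∫⁻ x, ‖F x‖ₑ ^ r with hX
  have hXfin : X ≠ ∞ := (hFn.lintegral_rpow_lt_top (by linarith)).ne
  have h1 : ∫⁻ x, ‖H x‖ₑ ^ r' = X := by
    refine lintegral_congr fun x => ?_
    rw [← ofReal_norm, norm_dualFn hr, ENNReal.ofReal_rpow_of_nonneg (by positivity)
      hpq.symm.nonneg, ← Real.rpow_mul (norm_nonneg _), ← ofReal_norm,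
      ENNReal.ofReal_rpow_of_nonneg (by positivity) (by linarith), hpq.sub_one_mul_conj]
  have h2 : ‖∫ x, F x * H x‖ₑ = X := by
    simp only [H, mul_dualFn (show 0 < r by linarith)]
    rw [integral_complex_ofReal, ← ofReal_norm, Complex.norm_real, Real.norm_of_nonneg
      (integral_nonneg fun x => by positivity), ofReal_integral_eq_lintegral_ofReal]
    · refine lintegral_congr fun x => ?_
      rw [← ofReal_norm, ENNReal.ofReal_rpow_of_nonneg (norm_nonneg _) (by linarith)]
    · have := (hFn.memLp (ENNReal.ofReal r)).integrable_norm_rpow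
        (by simpa using (by linarith : 0 < r)) (by simp)
      rwa [ENNReal.toReal_ofReal (by linarith)] at this
    · exact ae_of_all _ fun x => by positivity
  have h3 : X ≤ (∫⁻ x, ‖f x‖ₑ ^ r) ^ (1 / r) * (C * X) ^ (1 / r') := by
    calc X = ‖∫ x, f x * D.trunc (-s) J ε H x‖ₑ := by
          rw [← h2, DensityData.integral_trunc_mul hf hHn]
      _ ≤ _ := enorm_integral_mul_le_Lp hf.meas (DensityData.trunc_nice hHn).meas hpq
      _ ≤ _ := by
          refine mul_le_mul_right (ENNReal.rpow_le_rpow ?_ (by simpa using hpq.symm.nonneg)) _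
          rw [← h1]
          exact hC (-s) J ε H (by rwa [abs_neg]) hε hHn
  refine ENNReal.le_of_le_rpow_mul_rpow hpq hXfin (h3.trans (le_of_eq ?_))
  rw [ENNReal.mul_rpow_of_nonneg _ _ (by simpa using hpq.symm.nonneg),
    ENNReal.mul_rpow_of_nonneg _ _ (by simpa using hpq.nonneg),
    ENNReal.coe_rpow_of_nonneg _ (by linarith), ← ENNReal.rpow_mul, mul_comm (r - 1)]
  have h4 : 1 / r' = 1 / r * (r - 1) := by
    rw [hr', Real.conjExponent]; field_simp
  rw [← h4]
  ring

end

end SparseRadon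

namespace SparseRadon

noncomputable section

open scoped FourierTransform

variable {n : ℕ} {D : DensityData n} {β : ℝ} {B : ℝ≥0} {f g : Euc n → ℂ}

/-! ### Unconditional convergence -/

theorem eLpNorm_ofReal_eq (f : Euc n → ℂ) {r : ℝ} (hr : 0 < r) :
    eLpNorm f (ENNReal.ofReal r) volume = (∫⁻ x, ‖f x‖ₑ ^ r) ^ (1 / r) := by
  rw [eLpNorm_eq_lintegral_rpow_enorm_toReal (by simpa using hr) (by simp),
    ENNReal.toReal_ofReal hr.le]

theorem eLpNorm_le_of_lintegral_le {C : ℝ≥0} {r : ℝ} (hr : 0 < r)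
    (h : ∫⁻ x, ‖g x‖ₑ ^ r ≤ C * ∫⁻ x, ‖f x‖ₑ ^ r) :
    eLpNorm g (ENNReal.ofReal r) volume ≤
      (C ^ (1 / r) : ℝ≥0) * eLpNorm f (ENNReal.ofReal r) volume := by
  rw [eLpNorm_ofReal_eq _ hr, eLpNorm_ofReal_eq _ hr, ENNReal.coe_rpow_of_nonneg _ (by positivity),
    ← ENNReal.mul_rpow_of_nonneg _ _ (by positivity)]
  exact ENNReal.rpow_le_rpow h (by positivity)

theorem exists_nice_seq {r : ℝ} (hf : MemLp f (ENNReal.ofReal r) volume) :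
    ∃ u : ℕ → Euc n → ℂ, (∀ k, Nice (u k)) ∧
      Tendsto (fun k => eLpNorm (f - u k) (ENNReal.ofReal r) volume) atTop (𝓝 0) := by
  have h1 : ∀ k : ℕ, ∃ u : Euc n → ℂ, Nice u ∧
      eLpNorm (f - u) (ENNReal.ofReal r) volume ≤ (k + 1 : ℝ≥0∞)⁻¹ := by
    intro k
    obtain ⟨u, hu1, hu2, hu3, -⟩ := hf.exists_hasCompactSupport_eLpNorm_sub_le (by simp)
      (ε := (k + 1 : ℝ≥0∞)⁻¹) (by simp)
    refine ⟨u, ⟨hu3.measurable, ?_, ?_⟩, hu2⟩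
    · exact hu3.bounded_above_of_compact_support hu1
    · obtain ⟨R, hR⟩ := hu1.isCompact.isBounded.subset_closedBall 0
      refine ⟨R, fun x hx => ?_⟩
      by_contra hne
      have := hR (subset_tsupport _ hne)
      rw [mem_closedBall_zero_iff] at this
      linarith
  choose u hu1 hu2 using h1
  refine ⟨u, hu1, tendsto_of_tendsto_of_tendsto_of_le_of_le tendsto_const_nhds ?_
    (fun k => zero_le) hu2⟩
  have := (ENNReal.tendsto_inv_nat_nhds_zero).comp (tendsto_add_atTop_nat 1)
  refine this.congr fun k => ?_
  simp

namespace DensityData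

theorem measurable_op (hf : Measurable f) (c : ℝ) : Measurable (D.op c f) := by
  have h1 := D.meas
  refine (StronglyMeasurable.integral_prod_right (ν := D.σ)
    (f := fun x y => (D.ρ y : ℂ) * f (x - c • y)) ?_).measurable
  exact Measurable.stronglyMeasurable (by fun_prop)

theorem measurable_trunc (hf : Measurable f) (s : ℝ) (J : Finset ℤ) (ε : ℤ → ℂ) :
    Measurable (D.trunc s J ε f) :=
  Finset.measurable_fun_sum _ fun _ _ => (measurable_op hf _).const_mul _

/-- By Fubini the integral of `|f(x - c y)|^r` over both variables is finite. For unbounded `f` the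
convolution integral therefore converges for almost every `x`, and linearity of `op` is available
almost everywhere. -/
theorem ae_integrable_translate (hf : Measurable f) {r : ℝ} (hr : 1 ≤ r)
    (hfr : MemLp f (ENNReal.ofReal r) volume) (c : ℝ) :
    ∀ᵐ x, Integrable (fun y => f (x - c • y)) D.σ := by
  have hr0 : 0 < r := by linarith
  have h1 : ∫⁻ x, ‖f x‖ₑ ^ r < ∞ := by
    have := lintegral_rpow_enorm_lt_top_of_eLpNorm_lt_top (by simpa using hr0) (by simp) hfr.2
    rwa [ENNReal.toReal_ofReal hr0.le] at this
  have h2 : ∫⁻ x, ∫⁻ y, ‖f (x - c • y)‖ₑ ^ r ∂D.σ ≠ ∞ := by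
    rw [lintegral_lintegral_swap (Measurable.aemeasurable (by fun_prop))]
    have h3 : ∀ y, ∫⁻ x, ‖f (x - c • y)‖ₑ ^ r = ∫⁻ x, ‖f x‖ₑ ^ r := fun y =>
      lintegral_sub_right_eq_self (fun x => ‖f x‖ₑ ^ r) (c • y)
    simp_rw [h3, lintegral_const]
    exact ENNReal.mul_ne_top h1.ne (measure_ne_top _ _)
  have h3 := ae_lt_top (Measurable.lintegral_prod_right' (f := fun z : Euc n × Euc n =>
    ‖f (z.1 - c • z.2)‖ₑ ^ r) (ν := D.σ) (by fun_prop)) h2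
  filter_upwards [h3] with x hx
  have h4 : MemLp (fun y => f (x - c • y)) (ENNReal.ofReal r) D.σ := by
    refine ⟨Measurable.aestronglyMeasurable (by fun_prop), ?_⟩
    rw [eLpNorm_lt_top_iff_lintegral_rpow_enorm_lt_top (by simpa using hr0) (by simp),
      ENNReal.toReal_ofReal hr0.le]
    exact hx
  exact h4.integrable (by simpa using hr)

theorem integrable_rho_mul {F : Euc n → ℂ} (hF : Integrable F D.σ) :
    Integrable (fun y => (D.ρ y : ℂ) * F y) D.σ := by
  have := D.meas
  refine hF.bdd_mul (c := D.K) (Measurable.aestronglyMeasurable (by fun_prop)) (ae_of_all _ ?_)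
  intro y
  rw [Complex.norm_real]
  exact D.bound y

theorem op_add_ae (hf : Measurable f) (hg : Measurable g) {r : ℝ} (hr : 1 ≤ r)
    (hfr : MemLp f (ENNReal.ofReal r) volume) (hgr : MemLp g (ENNReal.ofReal r) volume) (c : ℝ) :
    D.op c (fun x => f x + g x) =ᵐ[volume] fun x => D.op c f x + D.op c g x := by
  filter_upwards [ae_integrable_translate (D := D) hf hr hfr c,
    ae_integrable_translate (D := D) hg hr hgr c] with x h1 h2
  simp only [op, mul_add]
  exact integral_add (integrable_rho_mul h1) (integrable_rho_mul h2)

theorem trunc_add_ae (hf : Measurable f) (hg : Measurable g) {r : ℝ} (hr : 1 ≤ r)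
    (hfr : MemLp f (ENNReal.ofReal r) volume) (hgr : MemLp g (ENNReal.ofReal r) volume)
    (s : ℝ) (J : Finset ℤ) (ε : ℤ → ℂ) : D.trunc s J ε (fun x => f x + g x) =ᵐ[volume]
      fun x => D.trunc s J ε f x + D.trunc s J ε g x := by
  have h1 : ∀ᵐ x, ∀ j : ℤ, D.op (s * 2 ^ j) (fun x => f x + g x) x =
      D.op (s * 2 ^ j) f x + D.op (s * 2 ^ j) g x :=
    ae_all_iff.2 fun j => op_add_ae hf hg hr hfr hgr _
  filter_upwards [h1] with x hx
  simp only [trunc, ← Finset.sum_add_distrib]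
  exact Finset.sum_congr rfl fun j _ => by rw [hx j, mul_add]

theorem eLpNorm_op_le (hf : Measurable f) {r : ℝ} (hr : 1 ≤ r) (c : ℝ) :
    eLpNorm (D.op c f) (ENNReal.ofReal r) volume ≤
      D.mass * eLpNorm f (ENNReal.ofReal r) volume := by
  have hr0 : 0 < r := by linarith
  have h1 := eLpNorm_le_of_lintegral_le (C := D.mass ^ r) hr0 (f := f) (g := D.op c f) (by
    rw [ENNReal.coe_rpow_of_nonneg _ hr0.le]; exact D.lintegral_op_rpow_le hf c hr)
  rwa [← NNReal.rpow_mul, one_div, mul_inv_cancel₀ hr0.ne', NNReal.rpow_one] at h1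

theorem memLp_op (hf : Measurable f) {r : ℝ} (hr : 1 ≤ r)
    (hfr : MemLp f (ENNReal.ofReal r) volume) (c : ℝ) :
    MemLp (D.op c f) (ENNReal.ofReal r) volume :=
  ⟨(measurable_op hf c).aestronglyMeasurable, (eLpNorm_op_le hf hr c).trans_lt
    (ENNReal.mul_lt_top (by simp) hfr.2)⟩

/-- The constant grows with `J`. The bound only serves to remove the approximation error for a fixed
`J`, when the uniform bound is extended from nice functions to `L^r`. -/
theorem eLpNorm_trunc_le_card (hf : Measurable f) {r : ℝ} (hr : 1 ≤ r) (s : ℝ) (J : Finset ℤ)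
    {ε : ℤ → ℂ} (hε : ∀ j, ‖ε j‖ ≤ 1) : eLpNorm (D.trunc s J ε f) (ENNReal.ofReal r) volume ≤
      (J.card * D.mass : ℝ≥0) * eLpNorm f (ENNReal.ofReal r) volume := by
  have h1 : D.trunc s J ε f = ∑ j ∈ J, ε j • D.op (s * 2 ^ j) f := by
    ext x; simp [trunc]
  rw [h1]
  refine (eLpNorm_sum_le (fun j _ =>
    ((measurable_op hf _).aestronglyMeasurable.const_smul _)) (by simpa using hr)).trans ?_
  calc _ ≤ ∑ j ∈ J, (D.mass : ℝ≥0∞) * eLpNorm f (ENNReal.ofReal r) volume := by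
        refine Finset.sum_le_sum fun j _ => ?_
        rw [eLpNorm_const_smul]
        refine (mul_le_of_le_one_left zero_le ?_).trans (eLpNorm_op_le hf hr _)
        rw [← ofReal_norm]; exact ENNReal.ofReal_le_one.2 (hε j)
    _ = _ := by
        rw [Finset.sum_const, nsmul_eq_mul]
        push_cast; ring

theorem HasDecay.exists_eLpNorm_trunc_le (hn : 0 < n) (h : D.HasDecay β B) {r : ℝ} (hr : 1 < r) :
    ∃ C : ℝ≥0, ∀ (s : ℝ) (J : Finset ℤ) (ε : ℤ → ℂ) (f : Euc n → ℂ), |s| = 1 →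
      (∀ j, ‖ε j‖ ≤ 1) → Measurable f → MemLp f (ENNReal.ofReal r) volume →
      eLpNorm (D.trunc s J ε f) (ENNReal.ofReal r) volume ≤
        C * eLpNorm f (ENNReal.ofReal r) volume := by
  obtain ⟨C, hC⟩ := h.exists_trunc_bound hn hr
  have hr0 : 0 < r := by linarith
  refine ⟨C ^ (1 / r), fun s J ε f hs hε hf hfr => ?_⟩
  obtain ⟨u, hu1, hu2⟩ := exists_nice_seq hfr
  set C' : ℝ≥0 := C ^ (1 / r)
  set e := fun k => eLpNorm (f - u k) (ENNReal.ofReal r) volume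
  have h1r : 1 ≤ ENNReal.ofReal r := by simpa using hr.le
  have hle : ∀ k, eLpNorm (D.trunc s J ε f) (ENNReal.ofReal r) volume ≤
      (J.card * D.mass : ℝ≥0) * e k +
        C' * (eLpNorm f (ENNReal.ofReal r) volume + e k) := by
    intro k
    have huk := (hu1 k).memLp (ENNReal.ofReal r)
    have hm : Measurable (f - u k) := hf.sub (hu1 k).meas
    have h1 : D.trunc s J ε f =ᵐ[volume]
        D.trunc s J ε (f - u k) + D.trunc s J ε (u k) := by
      have := trunc_add_ae (D := D) hm (hu1 k).meas hr.le (hfr.sub huk) huk s J ε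
      simp only [Pi.sub_apply, sub_add_cancel] at this
      exact this
    rw [eLpNorm_congr_ae h1]
    refine (eLpNorm_add_le (measurable_trunc hm s J ε).aestronglyMeasurable
      (measurable_trunc (hu1 k).meas s J ε).aestronglyMeasurable h1r).trans
      (add_le_add (eLpNorm_trunc_le_card hm hr.le s J hε) ?_)
    refine (eLpNorm_le_of_lintegral_le hr0 (hC s J ε (u k) hs hε (hu1 k))).trans
      (mul_le_mul_right ?_ _)
    have h2 : u k = f - (f - u k) := by simp
    rw [h2]
    exact eLpNorm_sub_le hfr.1 (hfr.sub huk).1 h1r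
  refine ge_of_tendsto' (x := atTop) ?_ hle
  have h2 := (ENNReal.Tendsto.const_mul hu2 (Or.inr ENNReal.coe_ne_top)
    (a := ((J.card * D.mass : ℝ≥0) : ℝ≥0∞))).add (ENNReal.Tendsto.const_mul
    (tendsto_const_nhds (x := eLpNorm f (ENNReal.ofReal r) volume).add hu2)
    (Or.inr ENNReal.coe_ne_top) (a := (C' : ℝ≥0∞)))
  simpa using h2

/-- Dominated convergence on the Fourier side: the tails of the weight series tend to `0` at each
frequency and stay below the full sum. One set `J₀` works for every `J` disjoint from it, which is
the Cauchy criterion for unconditional convergence. -/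
theorem HasDecay.exists_trunc_sq_small (h : D.HasDecay β B) (hf : Nice f) {η : ℝ≥0∞} (hη : η ≠ 0) :
    ∃ J₀ : Finset ℤ, ∀ (s : ℝ) (J : Finset ℤ) (ε : ℤ → ℂ), |s| = 1 → (∀ j, ‖ε j‖ ≤ 1) →
      Disjoint J J₀ → ∫⁻ x, ‖D.trunc s J ε f x‖ₑ ^ (2 : ℝ) ≤ η := by
  obtain ⟨C, hC⟩ := exists_scaleWeight_bound h.pos
  set tail : Finset ℤ → Euc n → ℝ := fun J₀ ξ =>
    ∑' j, scaleWeight β j ξ - ∑ j ∈ J₀, scaleWeight β j ξ with htail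
  have htail_le : ∀ J₀ ξ, tail J₀ ξ ≤ C := fun J₀ ξ =>
    (sub_le_self _ (Finset.sum_nonneg fun j _ => scaleWeight_nonneg β j ξ)).trans (hC n ξ).2
  have htail_ge : ∀ J J₀ ξ, Disjoint J J₀ → ∑ j ∈ J, scaleWeight β j ξ ≤ tail J₀ ξ := by
    intro J J₀ ξ hd
    rw [htail, le_sub_iff_add_le, ← Finset.sum_union hd]
    exact (hC n ξ).1.sum_le_tsum _ fun j _ => scaleWeight_nonneg β j ξ
  have hmt : ∀ J₀, Measurable (tail J₀) := fun J₀ =>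
    (Measurable.tsum fun j => measurable_scaleWeight β j).sub
      (Finset.measurable_fun_sum _ fun j _ => measurable_scaleWeight β j)
  have hmF : Measurable (𝓕 f) := (VectorFourier.fourierIntegral_continuous
    Real.continuous_fourierChar (by exact continuous_inner) hf.integrable).measurable
  have hlim : Tendsto (fun J₀ : Finset ℤ =>
      ∫⁻ ξ, ENNReal.ofReal (B * tail J₀ ξ) ^ (2 : ℝ) * ‖𝓕 f ξ‖ₑ ^ (2 : ℝ)) atTop (𝓝 0) := by
    have h0 : (0 : ℝ≥0∞) = ∫⁻ _ : Euc n, 0 := by simp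
    rw [h0]
    refine tendsto_lintegral_filter_of_dominated_convergence
      (fun ξ => ENNReal.ofReal (B * C) ^ (2 : ℝ) * ‖𝓕 f ξ‖ₑ ^ (2 : ℝ)) ?_ ?_ ?_ ?_
    · exact Eventually.of_forall fun J₀ => by
        have := hmt J₀
        fun_prop
    · refine Eventually.of_forall fun J₀ => ae_of_all _ fun ξ => ?_
      gcongr
      exact htail_le J₀ ξ
    · rw [lintegral_const_mul _ (by fun_prop), lintegral_fourier_sq hf]
      exact ENNReal.mul_ne_top (ENNReal.rpow_ne_top_of_nonneg (by norm_num) ENNReal.ofReal_ne_top)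
        (hf.lintegral_rpow_lt_top two_pos).ne
    · refine ae_of_all _ fun ξ => ?_
      have h1 : Tendsto (fun J₀ => tail J₀ ξ) atTop (𝓝 0) := by
        have := (hC n ξ).1.hasSum
        have h2 := tendsto_const_nhds (x := ∑' j, scaleWeight β j ξ).sub this
        simpa [htail] using h2
      have h2 : Tendsto (fun J₀ => ENNReal.ofReal (B * tail J₀ ξ) ^ (2 : ℝ)) atTop (𝓝 0) := by
        have h3 := ENNReal.tendsto_ofReal (h1.const_mul (B : ℝ))
        have h4 := h3.ennrpow_const 2
        simpa using h4
      have h3 := ENNReal.Tendsto.mul_const h2 (Or.inr (by simp : ‖𝓕 f ξ‖ₑ ^ (2 : ℝ) ≠ ∞))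
      simpa using h3
  obtain ⟨J₀, hJ₀⟩ := (hlim.eventually_le_const (pos_iff_ne_zero.2 hη)).exists
  refine ⟨J₀, fun s J ε hs hε hd => (h.lintegral_trunc_sq_le hs hε hf).trans (le_trans ?_ hJ₀)⟩
  gcongr with ξ
  exact htail_ge J J₀ ξ hd

/-- `r₁` lies beyond `r` as seen from `2`. The condition `θ < 1` leaves a positive power of the
small `L²` quantity. -/
theorem exists_interpolation_exponent {r : ℝ} (hr : 1 < r) :
    ∃ r₁ θ : ℝ, 1 < r₁ ∧ 0 ≤ θ ∧ θ < 1 ∧ 2 * (1 - θ) + r₁ * θ = r := by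
  rcases le_or_gt 2 r with h | h
  · refine ⟨r + 1, (r - 2) / (r - 1), by linarith, div_nonneg (by linarith) (by linarith), ?_, ?_⟩
    · rw [div_lt_one (by linarith)]; linarith
    · have : r - 1 ≠ 0 := by linarith
      field_simp; ring
  · refine ⟨(1 + r) / 2, (2 - r) / ((3 - r) / 2), by linarith,
      div_nonneg (by linarith) (by linarith), ?_, ?_⟩
    · rw [div_lt_one (by linarith)]; linarith
    · have : 3 - r ≠ 0 := by linarith
      field_simp; ring

theorem HasDecay.exists_trunc_small (hn : 0 < n) (h : D.HasDecay β B) {r : ℝ} (hr : 1 < r)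
    (hf : Nice f) {η : ℝ≥0∞} (hη : η ≠ 0) :
    ∃ J₀ : Finset ℤ, ∀ (s : ℝ) (J : Finset ℤ) (ε : ℤ → ℂ), |s| = 1 → (∀ j, ‖ε j‖ ≤ 1) →
      Disjoint J J₀ → ∫⁻ x, ‖D.trunc s J ε f x‖ₑ ^ r ≤ η := by
  obtain ⟨r₁, θ, hr₁, hθ0, hθ1, hrθ⟩ := exists_interpolation_exponent hr
  obtain ⟨C, hC⟩ := h.exists_trunc_bound hn hr₁
  set M := (C * ∫⁻ x, ‖f x‖ₑ ^ r₁) ^ θ with hM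
  have hMtop : M ≠ ∞ := ENNReal.rpow_ne_top_of_nonneg hθ0
    (ENNReal.mul_ne_top (by simp) (hf.lintegral_rpow_lt_top (by linarith)).ne)
  obtain ⟨δ, hδ0, hδ⟩ : ∃ δ : ℝ≥0∞, δ ≠ 0 ∧ δ ^ (1 - θ) * M ≤ η := by
    have h1 : Tendsto (fun δ : ℝ≥0∞ => δ ^ (1 - θ) * M) (𝓝 0) (𝓝 0) := by
      have h2 : Tendsto (fun δ : ℝ≥0∞ => δ ^ (1 - θ)) (𝓝 0) (𝓝 0) := by
        have := (ENNReal.continuous_rpow_const (y := 1 - θ)).tendsto 0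
        rwa [ENNReal.zero_rpow_of_pos (by linarith)] at this
      have h3 := ENNReal.Tendsto.mul_const h2 (Or.inr hMtop)
      simpa using h3
    have h2 := h1.eventually_le_const (pos_iff_ne_zero.2 hη)
    obtain ⟨δ, hδ1, hδ2⟩ := ((h2.filter_mono nhdsWithin_le_nhds).and
      (self_mem_nhdsWithin (a := (0 : ℝ≥0∞)) (s := Set.Ioi 0))).exists
    exact ⟨δ, (pos_iff_ne_zero.1 hδ2), hδ1⟩
  obtain ⟨J₀, hJ₀⟩ := h.exists_trunc_sq_small hf hδ0
  refine ⟨J₀, fun s J ε hs hε hd => le_trans ?_ hδ⟩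
  have hm : Measurable (D.trunc s J ε f) := (trunc_nice hf).meas
  calc ∫⁻ x, ‖D.trunc s J ε f x‖ₑ ^ r = ∫⁻ x, (‖D.trunc s J ε f x‖ₑ ^ (2 : ℝ)) ^ (1 - θ) *
        (‖D.trunc s J ε f x‖ₑ ^ r₁) ^ θ := by
        refine lintegral_congr fun x => ?_
        rw [← ENNReal.rpow_mul, ← ENNReal.rpow_mul, ← ENNReal.rpow_add_of_nonneg _ _
          (by nlinarith) (by nlinarith), hrθ]
    _ ≤ (∫⁻ x, ‖D.trunc s J ε f x‖ₑ ^ (2 : ℝ)) ^ (1 - θ) *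
        (∫⁻ x, ‖D.trunc s J ε f x‖ₑ ^ r₁) ^ θ :=
        ENNReal.lintegral_mul_norm_pow_le (by fun_prop) (by fun_prop) (by linarith) hθ0 (by ring)
    _ ≤ _ := by
        refine mul_le_mul' (ENNReal.rpow_le_rpow (hJ₀ s J ε hs hε hd) (by linarith)) ?_
        exact ENNReal.rpow_le_rpow (hC s J ε f hs hε hf) hθ0

/-- The Cauchy criterion in the complete space `L^r`: `f` is approximated by a nice `u`, the uniform
bound controls `f - u`, and the tails of the series for `u` are small by `exists_trunc_small`. -/
theorem HasDecay.exists_tendsto_trunc (hn : 0 < n) (h : D.HasDecay β B) {r : ℝ} (hr : 1 < r)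
    (hf : Measurable f) (hfr : MemLp f (ENNReal.ofReal r) volume) {ε : ℤ → ℂ}
    (hε : ∀ j, ‖ε j‖ ≤ 1) : ∃ g : Euc n → ℂ, MemLp g (ENNReal.ofReal r) volume ∧
      Tendsto (fun J : Finset ℤ => eLpNorm (fun x => D.trunc 1 J ε f x - g x)
        (ENNReal.ofReal r) volume) atTop (𝓝 0) := by
  have h1r : 1 ≤ ENNReal.ofReal r := by simpa using hr.le
  have hr0 : 0 < r := by linarith
  have : Fact (1 ≤ ENNReal.ofReal r) := ⟨h1r⟩
  obtain ⟨C, hC⟩ := h.exists_eLpNorm_trunc_le hn hr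
  have hmem : ∀ j, MemLp (fun x => ε j * D.op (1 * 2 ^ j) f x) (ENNReal.ofReal r) volume :=
    fun j => (memLp_op hf hr.le hfr _).const_mul _
  set F : ℤ → Lp ℂ (ENNReal.ofReal r) (volume : Measure (Euc n)) := fun j => (hmem j).toLp
  have hsum : ∀ J : Finset ℤ, ((∑ j ∈ J, F j : Lp ℂ (ENNReal.ofReal r) volume) : Euc n → ℂ)
      =ᵐ[volume] D.trunc 1 J ε f := by
    intro J
    have h1 : ∀ᵐ x, ∀ j : ℤ, F j x = ε j * D.op (1 * 2 ^ j) f x :=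
      ae_all_iff.2 fun j => (hmem j).coeFn_toLp
    filter_upwards [Lp.coeFn_finsetSum J F, h1] with x hx1 hx2
    rw [hx1, Finset.sum_apply]
    exact Finset.sum_congr rfl fun j _ => hx2 j
  have hvan : Summable F := by
    rw [summable_iff_vanishing_norm]
    intro η hη
    obtain ⟨u, hu1, hu2⟩ := exists_nice_seq hfr
    have hη' : ENNReal.ofReal (η / 3) ≠ 0 := by simpa using hη
    obtain ⟨k, hk⟩ : ∃ k, C * eLpNorm (f - u k) (ENNReal.ofReal r) volume ≤
        ENNReal.ofReal (η / 3) := by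
      have h1 := ENNReal.Tendsto.const_mul hu2 (Or.inr ENNReal.coe_ne_top) (a := (C : ℝ≥0∞))
      rw [mul_zero] at h1
      exact (h1.eventually_le_const (pos_iff_ne_zero.2 hη')).exists
    obtain ⟨J₀, hJ₀⟩ := h.exists_trunc_small hn hr (hu1 k) (η := ENNReal.ofReal (η / 3) ^ r)
      (by simp [hη])
    refine ⟨J₀, fun J hJ => ?_⟩
    have huk := (hu1 k).memLp (ENNReal.ofReal r)
    have hm : Measurable (f - u k) := hf.sub (hu1 k).meas
    have h1 : D.trunc 1 J ε f =ᵐ[volume] D.trunc 1 J ε (f - u k) + D.trunc 1 J ε (u k) := by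
      have := trunc_add_ae (D := D) hm (hu1 k).meas hr.le (hfr.sub huk) huk 1 J ε
      simp only [Pi.sub_apply, sub_add_cancel] at this
      exact this
    have h2 : eLpNorm (D.trunc 1 J ε (u k)) (ENNReal.ofReal r) volume ≤ ENNReal.ofReal (η / 3) := by
      rw [eLpNorm_ofReal_eq _ hr0, ← ENNReal.rpow_le_rpow_iff hr0, ← ENNReal.rpow_mul,
        one_div, inv_mul_cancel₀ hr0.ne', ENNReal.rpow_one]
      exact hJ₀ 1 J ε (by simp) hε hJ
    have h3 : eLpNorm (D.trunc 1 J ε f) (ENNReal.ofReal r) volume ≤ ENNReal.ofReal (2 * η / 3) := by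
      rw [eLpNorm_congr_ae h1]
      refine (eLpNorm_add_le (measurable_trunc hm 1 J ε).aestronglyMeasurable
        (measurable_trunc (hu1 k).meas 1 J ε).aestronglyMeasurable h1r).trans ?_
      refine (add_le_add ((hC 1 J ε _ (by simp) hε hm (hfr.sub huk)).trans hk) h2).trans ?_
      rw [← ENNReal.ofReal_add (by positivity) (by positivity)]
      exact ENNReal.ofReal_le_ofReal (by linarith)
    rw [Lp.norm_def, eLpNorm_congr_ae (hsum J)]
    refine lt_of_le_of_lt (ENNReal.toReal_le_of_le_ofReal (by positivity) h3) (by linarith)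
  refine ⟨(∑' j, F j : Lp ℂ (ENNReal.ofReal r) volume), Lp.memLp _, ?_⟩
  have h1 := hvan.hasSum
  rw [HasSum, Lp.tendsto_Lp_iff_tendsto_eLpNorm'] at h1
  refine h1.congr fun J => eLpNorm_congr_ae ?_
  filter_upwards [hsum J] with x hx
  simp only [Pi.sub_apply, hx]

end DensityData

end

end SparseRadon

namespace SparseRadon

noncomputable section

variable {n : ℕ} {D : DensityData n} {β : ℝ} {B : ℝ≥0} {a : Fin n → ℝ}

/-! ### Unions of tripled cubes -/

/-- The union of the tripled cubes of side `2^i` around the points of `E`. -/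
def tripleSet (a : Fin n → ℝ) (i : ℤ) (E : Set (Euc n)) : Set (Euc n) :=
  {x | ∃ y ∈ E, x ∈ tripleCell a i (idx a i y)}

theorem sat_tripleSet (i : ℤ) (E : Set (Euc n)) : Sat a i (tripleSet a i E) := by
  rintro x y hxy ⟨z, hz, h⟩
  exact ⟨z, hz, sat_tripleCell i _ x y hxy h⟩

theorem exists_eq_idx_of_inter_nonempty {i : ℤ} {E : Set (Euc n)} {m : Fin n → ℤ}
    (h : (E ∩ cell a i m).Nonempty) : ∃ y ∈ E, m = idx a i y := by
  obtain ⟨y, hy, hm⟩ := h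
  rw [mem_cell] at hm
  exact ⟨y, hy, hm.symm⟩

theorem Sat.cell_subset {i : ℤ} {E : Set (Euc n)} (hE : Sat a i E) {y : Euc n} (hy : y ∈ E) :
    cell a i (idx a i y) ⊆ E := fun z hz => hE y z (by rw [mem_cell] at hz; exact hz.symm) hy

theorem setLIntegral_le_of_cell_le {i : ℤ} {E : Set (Euc n)} (hE : Sat a i E)
    {F : Euc n → ℝ≥0∞} {X : ℝ≥0∞} (h : ∀ y ∈ E, ∫⁻ x in cell a i (idx a i y), F x ≤ X * vol n i) :
    ∫⁻ x in E, F x ≤ X * volume E := by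
  rw [← setLIntegral_const, setLIntegral_eq_tsum_cell a i hE.measurableSet,
    setLIntegral_eq_tsum_cell a i hE.measurableSet (fun _ => X)]
  refine ENNReal.tsum_le_tsum fun m => ?_
  rcases (E ∩ cell a i m).eq_empty_or_nonempty with h0 | h0
  · simp [h0]
  · obtain ⟨y, hy, rfl⟩ := exists_eq_idx_of_inter_nonempty h0
    rw [Set.inter_eq_self_of_subset_right (hE.cell_subset hy), setLIntegral_const, volume_cell]
    exact h y hy

theorem setLIntegral_tripleSet_le {i : ℤ} {E : Set (Euc n)} (hE : Sat a i E)
    {F : Euc n → ℝ≥0∞} {X : ℝ≥0∞}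
    (h : ∀ y ∈ E, ∫⁻ x in tripleCell a i (idx a i y), F x ≤ X * vol n i) :
    ∫⁻ x in tripleSet a i E, F x ≤ X * volume E := by
  classical
  have h1 : tripleSet a i E ⊆ ⋃ m, if (E ∩ cell a i m).Nonempty then tripleCell a i m else ∅ := by
    rintro x ⟨y, hy, hx⟩
    refine Set.mem_iUnion.2 ⟨idx a i y, ?_⟩
    rw [if_pos ⟨y, hy, (mem_cell a).2 rfl⟩]
    exact hx
  refine (lintegral_mono_set h1).trans ((lintegral_iUnion_le _ _).trans ?_)
  rw [← setLIntegral_const, setLIntegral_eq_tsum_cell a i hE.measurableSet (fun _ => X)]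
  refine ENNReal.tsum_le_tsum fun m => ?_
  split_ifs with h0
  · obtain ⟨y, hy, rfl⟩ := exists_eq_idx_of_inter_nonempty h0
    rw [Set.inter_eq_self_of_subset_right (hE.cell_subset hy), setLIntegral_const, volume_cell]
    exact h y hy
  · simp

namespace DensityData

theorem op_eq_zero_of_notMem_tripleSet {u : Euc n → ℂ} {E : Set (Euc n)} (hu : ∀ x ∉ E, u x = 0)
    {s : ℝ} (hs : |s| = 1) {i j : ℤ} (hij : j ≤ i) {x : Euc n} (hx : x ∉ tripleSet a i E) :
    D.op (s * 2 ^ j) u x = 0 := by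
  by_contra hne
  obtain ⟨y, hy, hnear⟩ := exists_ne_zero_of_op_ne_zero hs hij hne a
  exact hx ⟨y, by_contra fun h => hy (hu y h), hnear⟩

end DensityData

/-! ### Pairings of stopped sums -/

theorem ENNReal.holder_split {C X Y V : ℝ≥0∞} {r r' : ℝ} (hr : r.HolderConjugate r') :
    (C * (X * V)) ^ (1 / r) * (Y * V) ^ (1 / r') =
      C ^ (1 / r) * X ^ (1 / r) * Y ^ (1 / r') * V := by
  have h1 := hr.one_div_nonneg
  have h2 := hr.symm.one_div_nonneg
  have h3 : V ^ (1 / r) * V ^ (1 / r') = V := by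
    rw [← ENNReal.rpow_add_of_nonneg _ _ h1 h2, one_div, one_div, hr.inv_add_inv_eq_one,
      ENNReal.rpow_one]
  rw [ENNReal.mul_rpow_of_nonneg _ _ h1, ENNReal.mul_rpow_of_nonneg _ _ h1,
    ENNReal.mul_rpow_of_nonneg _ _ h2]
  calc _ = C ^ (1 / r) * X ^ (1 / r) * Y ^ (1 / r') * (V ^ (1 / r) * V ^ (1 / r')) := by ring
    _ = _ := by rw [h3]

namespace DensityData

theorem integrable_trunc_mul {f g : Euc n → ℂ} (hf : Nice f) (hg : Nice g) (s : ℝ) (J : Finset ℤ)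
    (ε : ℤ → ℂ) : Integrable (fun x => D.trunc s J ε f x * g x) :=
  ((trunc_nice hf).mul hg).integrable

/-- The pairing of the part of a truncated sum kept by a stopping time with a function of bounded
local averages. -/
theorem enorm_sum_integral_stopped_le {r r' : ℝ} (hr : r.HolderConjugate r') {s : ℝ}
    (hs : |s| = 1) {J T : Finset ℤ} {ε : ℤ → ℂ} {C : ℝ≥0}
    (hC : ∀ (J : Finset ℤ) (f : Euc n → ℂ), Nice f →
      ∫⁻ x, ‖D.trunc s J ε f x‖ₑ ^ r ≤ C * ∫⁻ x, ‖f x‖ₑ ^ r)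
    {w z : Euc n → ℂ} (hw : Nice w) (hz : Nice z) {A : ℤ → Set (Euc n)} (hA : ∀ i, Sat a i (A i))
    (hsum : ∀ x, ∑ i ∈ T, (A i).indicator w x = w x) {X Y V : ℝ≥0∞}
    (hX : ∀ i ∈ T, ∀ y ∈ A i, ∫⁻ x in cell a i (idx a i y), ‖w x‖ₑ ^ r ≤ X * vol n i)
    (hY : ∀ i ∈ T, ∀ y ∈ A i, ∫⁻ x in tripleCell a i (idx a i y), ‖z x‖ₑ ^ r' ≤ Y * vol n i)
    (hXV : ∫⁻ x, ‖w x‖ₑ ^ r ≤ X * V) (hYV : ∫⁻ x, ‖z x‖ₑ ^ r' ≤ Y * V)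
    (hV : ∑ i ∈ T, volume (A i) ≤ V) :
    ‖∑ j ∈ J, ε j * ∫ x, D.op (s * 2 ^ j) (fun x => ∑ i ∈ T with i ≤ j, (A i).indicator w x) x *
      z x‖ₑ ≤ 2 * ((C : ℝ≥0∞) ^ (1 / r) * X ^ (1 / r) * Y ^ (1 / r') * V) := by
  have hr0 := hr.pos
  have hr0' := hr.symm.pos
  have hAm : ∀ i, MeasurableSet (A i) := fun i => (hA i).measurableSet
  have hwi : ∀ i, Nice ((A i).indicator w) := fun i => hw.indicator (hAm i)
  have hF : ∀ j, Nice (fun x => ∑ i ∈ T with i ≤ j, (A i).indicator w x) := fun j =>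
    Nice.sum fun i _ => hwi i
  -- The scales `j ≥ i` used on `A i` are all scales minus the scales `j < i`. The subtracted sums
  -- do not leave the triples of the cubes of side `2^i` in `A i`, where the local averages of `z`
  -- are controlled.
  have hpoint : ∀ x, ∑ j ∈ J, ε j *
      D.op (s * 2 ^ j) (fun x => ∑ i ∈ T with i ≤ j, (A i).indicator w x) x =
      D.trunc s J ε w x - ∑ i ∈ T, D.trunc s (J.filter (· < i)) ε ((A i).indicator w) x := by
    intro x
    have h1 : ∀ j, D.op (s * 2 ^ j) (fun x => ∑ i ∈ T with i ≤ j, (A i).indicator w x) x =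
        D.op (s * 2 ^ j) w x - ∑ i ∈ T with j < i, D.op (s * 2 ^ j) ((A i).indicator w) x := by
      intro j
      have h2 : (fun x => ∑ i ∈ T with i ≤ j, (A i).indicator w x) =
          fun x => w x - ∑ i ∈ T with j < i, (A i).indicator w x := by
        funext y
        rw [eq_sub_iff_add_eq, ← hsum y, ← Finset.sum_filter_add_sum_filter_not T (· ≤ j)]
        simp only [not_le]
      rw [h2, D.op_sub hw (Nice.sum fun i _ => hwi i), D.op_sum fun i _ => hwi i]
    simp only [h1, mul_sub, Finset.sum_sub_distrib, trunc, Finset.mul_sum]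
    congr 1
    simp only [Finset.sum_filter]
    rw [Finset.sum_comm]
  have hEq : ∑ j ∈ J, ε j * ∫ x, D.op (s * 2 ^ j)
      (fun x => ∑ i ∈ T with i ≤ j, (A i).indicator w x) x * z x =
      (∫ x, D.trunc s J ε w x * z x) -
        ∑ i ∈ T, ∫ x, D.trunc s (J.filter (· < i)) ε ((A i).indicator w) x * z x := by
    rw [← integral_finsetSum _ fun i _ => integrable_trunc_mul (hwi i) hz s _ ε, ← integral_sub
      (integrable_trunc_mul hw hz s J ε)
      (integrable_finsetSum _ fun i _ => integrable_trunc_mul (hwi i) hz s _ ε)]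
    simp_rw [← Finset.sum_mul, ← sub_mul, ← hpoint, Finset.sum_mul, mul_assoc]
    rw [integral_finsetSum]
    · simp_rw [integral_const_mul]
    · intro j _
      exact (((D.op_nice (hF j) _).mul hz).const_mul _).integrable
  set K : ℝ≥0∞ := (C : ℝ≥0∞) ^ (1 / r) * X ^ (1 / r) * Y ^ (1 / r') with hK
  have hp1 := hr.one_div_nonneg
  have hp2 := hr.symm.one_div_nonneg
  have hmain : ‖∫ x, D.trunc s J ε w x * z x‖ₑ ≤ K * V := by
    rw [hK, ← ENNReal.holder_split hr]
    refine (enorm_integral_mul_le_Lp (trunc_nice hw).meas hz.meas hr).trans ?_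
    refine mul_le_mul' (ENNReal.rpow_le_rpow ?_ hp1) (ENNReal.rpow_le_rpow hYV hp2)
    exact (hC J w hw).trans (mul_le_mul_right hXV _)
  have hloc : ∀ i ∈ T, ‖∫ x, D.trunc s (J.filter (· < i)) ε ((A i).indicator w) x * z x‖ₑ ≤
      K * volume (A i) := by
    intro i hi
    have hEm : MeasurableSet (tripleSet a i (A i)) := (sat_tripleSet i (A i)).measurableSet
    have h1 : ∀ x, D.trunc s (J.filter (· < i)) ε ((A i).indicator w) x * z x =
        D.trunc s (J.filter (· < i)) ε ((A i).indicator w) x *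
          (tripleSet a i (A i)).indicator z x := by
      intro x
      by_cases hx : x ∈ tripleSet a i (A i)
      · rw [Set.indicator_of_mem hx]
      · have h2 : D.trunc s (J.filter (· < i)) ε ((A i).indicator w) x = 0 := by
          refine Finset.sum_eq_zero fun j hj => ?_
          rw [Finset.mem_filter] at hj
          rw [op_eq_zero_of_notMem_tripleSet (fun y hy => Set.indicator_of_notMem hy w) hs
            hj.2.le hx, mul_zero]
        rw [h2, zero_mul, zero_mul]
    simp_rw [h1]
    rw [hK, ← ENNReal.holder_split hr]
    refine (enorm_integral_mul_le_Lp (trunc_nice (hwi i)).meas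
      (hz.indicator hEm).meas hr).trans ?_
    refine mul_le_mul' (ENNReal.rpow_le_rpow ?_ hp1) (ENNReal.rpow_le_rpow ?_ hp2)
    · refine (hC _ _ (hwi i)).trans (mul_le_mul_right ?_ _)
      simp_rw [enorm_indicator_rpow _ _ hr0]
      rw [lintegral_indicator (hAm i)]
      exact setLIntegral_le_of_cell_le (hA i) (hX i hi)
    · simp_rw [enorm_indicator_rpow _ _ hr0']
      rw [lintegral_indicator hEm]
      exact setLIntegral_tripleSet_le (hA i) (hY i hi)
  rw [hEq]
  calc _ ≤ K * V + ∑ i ∈ T, K * volume (A i) :=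
        enorm_sub_le.trans (add_le_add hmain ((enorm_sum_le _ _).trans (Finset.sum_le_sum hloc)))
    _ ≤ K * V + K * V := by
        rw [← Finset.mul_sum]
        exact add_le_add_right (mul_le_mul_right hV _) _
    _ = _ := by rw [two_mul]

/-! ### `L^p` improving and single scales -/

/-- The scale-invariant form of an `L^p → L^q` bound. -/
def Improves (D : DensityData n) (p q : ℝ) (A : ℝ≥0) : Prop :=
  ∀ (j : ℤ) (f : Euc n → ℂ), Nice f → (∫⁻ x, ‖D.op (1 * 2 ^ j) f x‖ₑ ^ q) ^ (1 / q) ≤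
    A * ((vol n j : ℝ≥0∞) ^ (1 / p - 1 / q))⁻¹ * (∫⁻ x, ‖f x‖ₑ ^ p) ^ (1 / p)

end DensityData

theorem Nice.exists_eq_sum_cell {h : Euc n → ℂ} (hh : Nice h) (a : Fin n → ℝ) (j : ℤ) :
    ∃ S : Finset (Fin n → ℤ), ∀ x, h x = ∑ m ∈ S, (cell a j m).indicator h x := by
  classical
  obtain ⟨R, hR⟩ := hh.supp
  refine ⟨Fintype.piFinset fun t => Finset.Icc ⌊(-R - a t) / 2 ^ j⌋ ⌊(R - a t) / 2 ^ j⌋,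
    fun x => ?_⟩
  rcases eq_or_ne (h x) 0 with h0 | h0
  · rw [h0, Finset.sum_eq_zero]
    intro m _
    rw [Set.indicator_apply, h0, ite_self]
  · have hx : ‖x‖ ≤ R := not_lt.1 fun hlt => h0 (hR x hlt)
    rw [Finset.sum_eq_single (idx a j x)]
    · rw [Set.indicator_of_mem ((mem_cell a).2 rfl)]
    · intro m _ hm
      exact Set.indicator_of_notMem (fun hx => hm ((mem_cell a).1 hx).symm) _
    · intro hx'
      refine absurd (Fintype.mem_piFinset.2 fun t => ?_) hx'
      have h1 := abs_le.1 ((abs_apply_le_norm x t).trans hx)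
      rw [Finset.mem_Icc, idx]
      constructor <;> refine Int.floor_le_floor ?_ <;> gcongr <;> linarith

namespace DensityData

variable {p q q' p' : ℝ} {A : ℝ≥0}

/-- Cut into cells of side `2^j`, each piece of `h` interacts only with `h'` on the triple of its
cell. The `L^p → L^q` bound followed by Hölder applies to each cell. -/
theorem Improves.enorm_integral_le (hI : D.Improves p q A) (hq : q.HolderConjugate q') (hp : 0 < p)
    {h h' : Euc n → ℂ} (hh : Nice h) (hh' : Nice h') (j : ℤ) {S : Finset (Fin n → ℤ)}
    (hS : ∀ x, h x = ∑ m ∈ S, (cell a j m).indicator h x) :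
    ‖∫ x, D.op (1 * 2 ^ j) h x * h' x‖ₑ ≤
      A * ∑ m ∈ S, ((vol n j : ℝ≥0∞) ^ (1 / p - 1 / q))⁻¹ *
        ((∫⁻ x in cell a j m, ‖h x‖ₑ ^ p) ^ (1 / p) *
          (∫⁻ x in tripleCell a j m, ‖h' x‖ₑ ^ q') ^ (1 / q')) := by
  have hhm : ∀ m, Nice ((cell a j m).indicator h) := fun m => hh.indicator (measurableSet_cell a j m)
  have h1 : ∀ x, D.op (1 * 2 ^ j) h x * h' x =
      ∑ m ∈ S, D.op (1 * 2 ^ j) ((cell a j m).indicator h) x * (tripleCell a j m).indicator h' x := by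
    intro x
    conv_lhs => rw [show h = _ from funext hS]
    rw [D.op_sum fun m _ => hhm m, Finset.sum_mul]
    refine Finset.sum_congr rfl fun m _ => ?_
    by_cases hx : x ∈ tripleCell a j m
    · rw [Set.indicator_of_mem hx]
    · have h2 : D.op (1 * 2 ^ j) ((cell a j m).indicator h) x = 0 := by
        refine op_eq_zero_of_notMem_tripleSet (a := a) (E := cell a j m)
          (fun y hy => Set.indicator_of_notMem hy h) (by simp) le_rfl ?_
        rintro ⟨y, hy, hxy⟩
        rw [mem_cell] at hy
        exact hx (hy ▸ hxy)
      rw [h2, zero_mul, zero_mul]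
  simp_rw [h1]
  have hm3 : ∀ m, Nice ((tripleCell a j m).indicator h') := fun m =>
    hh'.indicator (measurableSet_tripleCell a j m)
  rw [integral_finsetSum _ fun m _ => ((D.op_nice (hhm m) _).mul (hm3 m)).integrable, Finset.mul_sum]
  refine (enorm_sum_le _ _).trans (Finset.sum_le_sum fun m _ => ?_)
  refine (enorm_integral_mul_le_Lp (D.op_nice (hhm m) _).meas (hm3 m).meas hq).trans ?_
  refine (mul_le_mul_left (hI j _ (hhm m)) _).trans (le_of_eq ?_)
  simp_rw [enorm_indicator_rpow _ _ hp, enorm_indicator_rpow _ _ hq.symm.pos]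
  rw [lintegral_indicator (measurableSet_cell a j m),
    lintegral_indicator (measurableSet_tripleCell a j m)]
  ring

end DensityData

theorem ENNReal.sum_sum_holder {ι κ : Type*} (J : Finset ι) (S : ι → Finset κ) (F G : ι → κ → ℝ≥0∞)
    {r r' : ℝ} (hr : r.HolderConjugate r') :
    ∑ j ∈ J, ∑ m ∈ S j, F j m ^ (1 / r) * G j m ^ (1 / r') ≤
      (∑ j ∈ J, ∑ m ∈ S j, F j m) ^ (1 / r) * (∑ j ∈ J, ∑ m ∈ S j, G j m) ^ (1 / r') := by
  rw [Finset.sum_sigma', Finset.sum_sigma', Finset.sum_sigma']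
  refine (ENNReal.inner_le_Lp_mul_Lq (J.sigma S) (fun x => F x.1 x.2 ^ (1 / r))
    (fun x => G x.1 x.2 ^ (1 / r')) hr).trans (le_of_eq ?_)
  congr 2 <;> refine Finset.sum_congr rfl fun x _ => ?_
  · rw [← ENNReal.rpow_mul, one_div, inv_mul_cancel₀ hr.ne_zero, ENNReal.rpow_one]
  · rw [← ENNReal.rpow_mul, one_div, inv_mul_cancel₀ hr.symm.ne_zero, ENNReal.rpow_one]

/-- Interpolating a factor against its largest possible value. -/
theorem ENNReal.inv_rpow_mul_rpow_le {v G Y : ℝ≥0∞} {c d e : ℝ} (hv0 : v ≠ 0) (hv : v ≠ ∞)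
    (hc : 0 ≤ c) (he : 0 ≤ e) (hd : d = c + e) (hG : G ≤ Y * v) :
    (v ^ c)⁻¹ * G ^ d ≤ Y ^ c * G ^ e := by
  rw [hd, ENNReal.rpow_add_of_nonneg _ _ hc he, ← mul_assoc]
  refine mul_le_mul_left ?_ _
  calc (v ^ c)⁻¹ * G ^ c ≤ (v ^ c)⁻¹ * (Y * v) ^ c :=
        mul_le_mul_right (ENNReal.rpow_le_rpow hG hc) _
    _ = Y ^ c * ((v ^ c)⁻¹ * v ^ c) := by
        rw [ENNReal.mul_rpow_of_nonneg _ _ hc]; ring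
    _ = Y ^ c := by
        rw [ENNReal.inv_mul_cancel (by simp [hv0, hv]) (ENNReal.rpow_ne_top_of_nonneg hc hv), mul_one]

theorem sum_setLIntegral_cell_le (a : Fin n → ℝ) (j : ℤ) (S : Finset (Fin n → ℤ))
    (F : Euc n → ℝ≥0∞) : ∑ m ∈ S, ∫⁻ x in cell a j m, F x ≤ ∫⁻ x, F x := by
  rw [lintegral_eq_tsum_cell a j]
  exact ENNReal.sum_le_tsum _

theorem sum_setLIntegral_tripleCell_le (a : Fin n → ℝ) (j : ℤ) (S : Finset (Fin n → ℤ))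
    {F : Euc n → ℝ≥0∞} (hF : Measurable F) :
    ∑ m ∈ S, ∫⁻ x in tripleCell a j m, F x ≤ 3 ^ n * ∫⁻ x, F x := by
  rw [← tsum_setLIntegral_tripleCell a j hF]
  exact ENNReal.sum_le_tsum _

namespace DensityData

variable {p q q' p' : ℝ} {A : ℝ≥0}

/-- Since `1/q' = (1/p - 1/q) + 1/p'`, the power `1/p - 1/q` of the local integral of `h'` is traded
for `Y` and cancels the volume factor. The remaining exponents `1/p` and `1/p'` are conjugate, so
Hölder sums over cells and scales. -/
theorem Improves.sum_enorm_integral_le_left (hI : D.Improves p q A) (hq : q.HolderConjugate q')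
    (hp : p.HolderConjugate p') (hpq : p < q) {J : Finset ℤ} {h h' : ℤ → Euc n → ℂ}
    (hh : ∀ j, Nice (h j)) (hh' : ∀ j, Nice (h' j)) {Y : ℝ≥0∞}
    (hY : ∀ j ∈ J, ∀ x, h j x ≠ 0 →
      ∫⁻ y in tripleCell a j (idx a j x), ‖h' j y‖ₑ ^ q' ≤ Y * vol n j) :
    ∑ j ∈ J, ‖∫ x, D.op (1 * 2 ^ j) (h j) x * h' j x‖ₑ ≤
      A * (Y ^ (1 / p - 1 / q) * ((∑ j ∈ J, ∫⁻ x, ‖h j x‖ₑ ^ p) ^ (1 / p) *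
        (∑ j ∈ J, 3 ^ n * ∫⁻ x, ‖h' j x‖ₑ ^ q') ^ (1 / p'))) := by
  have hc : 0 ≤ 1 / p - 1 / q := sub_nonneg.2 (one_div_le_one_div_of_le hp.pos hpq.le)
  have hd : 1 / q' = (1 / p - 1 / q) + 1 / p' := by
    have h1 := hp.inv_add_inv_eq_one
    have h2 := hq.inv_add_inv_eq_one
    simp only [one_div]; linarith
  choose S hS using fun j => (hh j).exists_eq_sum_cell a j
  calc _ ≤ ∑ j ∈ J, A * ∑ m ∈ S j, Y ^ (1 / p - 1 / q) *
        ((∫⁻ x in cell a j m, ‖h j x‖ₑ ^ p) ^ (1 / p) *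
          (∫⁻ x in tripleCell a j m, ‖h' j x‖ₑ ^ q') ^ (1 / p')) := by
        refine Finset.sum_le_sum fun j hj => (hI.enorm_integral_le hq hp.pos (hh j) (hh' j) j
          (hS j)).trans (mul_le_mul_right (Finset.sum_le_sum fun m _ => ?_) _)
        by_cases h0 : ∀ x ∈ cell a j m, h j x = 0
        · have h1 : ∫⁻ x in cell a j m, ‖h j x‖ₑ ^ p = 0 := by
            rw [setLIntegral_congr_fun (g := fun _ => 0) (measurableSet_cell a j m)]
            · simp
            · intro x hx
              simp [h0 x hx, hp.pos]
          rw [h1, ENNReal.zero_rpow_of_pos hp.one_div_pos]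
          simp
        · push Not at h0
          obtain ⟨x, hx, hx0⟩ := h0
          have hYx := hY j hj x hx0
          rw [(mem_cell a).1 hx] at hYx
          rw [mul_left_comm, mul_left_comm (Y ^ _)]
          exact mul_le_mul_right (ENNReal.inv_rpow_mul_rpow_le (vol_ne_zero j) (by simp) hc
            hp.symm.one_div_nonneg hd hYx) _
    _ = A * (Y ^ (1 / p - 1 / q) * ∑ j ∈ J, ∑ m ∈ S j,
        ((∫⁻ x in cell a j m, ‖h j x‖ₑ ^ p) ^ (1 / p) *
          (∫⁻ x in tripleCell a j m, ‖h' j x‖ₑ ^ q') ^ (1 / p'))) := by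
        simp_rw [Finset.mul_sum]
    _ ≤ _ := by
        refine mul_le_mul_right (mul_le_mul_right ((ENNReal.sum_sum_holder J S
          (fun j m => ∫⁻ x in cell a j m, ‖h j x‖ₑ ^ p)
          (fun j m => ∫⁻ x in tripleCell a j m, ‖h' j x‖ₑ ^ q') hp).trans
          (mul_le_mul' (ENNReal.rpow_le_rpow (Finset.sum_le_sum fun j _ => ?_) hp.one_div_nonneg)
          (ENNReal.rpow_le_rpow (Finset.sum_le_sum fun j _ => ?_) hp.symm.one_div_nonneg))) _) _
        · exact sum_setLIntegral_cell_le a j _ _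
        · have := (hh' j).meas
          exact sum_setLIntegral_tripleCell_le a j _ (by fun_prop)

/-- Here the excess power is taken from `h` instead: `1/p = (1/p - 1/q) + 1/q`, and `1/q`, `1/q'`
are conjugate. The function that is above its threshold thus always keeps its own exponent. -/
theorem Improves.sum_enorm_integral_le_right (hI : D.Improves p q A) (hq : q.HolderConjugate q')
    (hp : p.HolderConjugate p') (hpq : p < q) {J : Finset ℤ} {h h' : ℤ → Euc n → ℂ}
    (hh : ∀ j, Nice (h j)) (hh' : ∀ j, Nice (h' j)) {X : ℝ≥0∞}
    (hX : ∀ j ∈ J, ∀ x, h j x ≠ 0 →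
      ∫⁻ y in cell a j (idx a j x), ‖h j y‖ₑ ^ p ≤ X * vol n j) :
    ∑ j ∈ J, ‖∫ x, D.op (1 * 2 ^ j) (h j) x * h' j x‖ₑ ≤
      A * (X ^ (1 / p - 1 / q) * ((∑ j ∈ J, ∫⁻ x, ‖h j x‖ₑ ^ p) ^ (1 / q) *
        (∑ j ∈ J, 3 ^ n * ∫⁻ x, ‖h' j x‖ₑ ^ q') ^ (1 / q'))) := by
  have hc : 0 ≤ 1 / p - 1 / q := sub_nonneg.2 (one_div_le_one_div_of_le hp.pos hpq.le)
  choose S hS using fun j => (hh j).exists_eq_sum_cell a j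
  calc _ ≤ ∑ j ∈ J, A * ∑ m ∈ S j, X ^ (1 / p - 1 / q) *
        ((∫⁻ x in cell a j m, ‖h j x‖ₑ ^ p) ^ (1 / q) *
          (∫⁻ x in tripleCell a j m, ‖h' j x‖ₑ ^ q') ^ (1 / q')) := by
        refine Finset.sum_le_sum fun j hj => (hI.enorm_integral_le hq hp.pos (hh j) (hh' j) j
          (hS j)).trans (mul_le_mul_right (Finset.sum_le_sum fun m _ => ?_) _)
        rw [← mul_assoc, ← mul_assoc]
        refine mul_le_mul_left (ENNReal.inv_rpow_mul_rpow_le (vol_ne_zero j) (by simp) hc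
            hq.one_div_nonneg (by ring) ?_) _
        by_cases h0 : ∀ x ∈ cell a j m, h j x = 0
        · have h1 : ∫⁻ x in cell a j m, ‖h j x‖ₑ ^ p = 0 := by
            rw [setLIntegral_congr_fun (g := fun _ => 0) (measurableSet_cell a j m)]
            · simp
            · intro x hx
              simp [h0 x hx, hp.pos]
          rw [h1]
          exact zero_le
        · push Not at h0
          obtain ⟨x, hx, hx0⟩ := h0
          have hXx := hX j hj x hx0
          rwa [(mem_cell a).1 hx] at hXx
    _ = A * (X ^ (1 / p - 1 / q) * ∑ j ∈ J, ∑ m ∈ S j,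
        ((∫⁻ x in cell a j m, ‖h j x‖ₑ ^ p) ^ (1 / q) *
          (∫⁻ x in tripleCell a j m, ‖h' j x‖ₑ ^ q') ^ (1 / q'))) := by
        simp_rw [Finset.mul_sum]
    _ ≤ _ := by
        refine mul_le_mul_right (mul_le_mul_right ((ENNReal.sum_sum_holder J S
          (fun j m => ∫⁻ x in cell a j m, ‖h j x‖ₑ ^ p)
          (fun j m => ∫⁻ x in tripleCell a j m, ‖h' j x‖ₑ ^ q') hq).trans
          (mul_le_mul' (ENNReal.rpow_le_rpow (Finset.sum_le_sum fun j _ => ?_) hq.one_div_nonneg)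
          (ENNReal.rpow_le_rpow (Finset.sum_le_sum fun j _ => ?_) hq.symm.one_div_nonneg))) _) _
        · exact sum_setLIntegral_cell_le a j _ _
        · have := (hh' j).meas
          exact sum_setLIntegral_tripleCell_le a j _ (by fun_prop)

theorem HasDecay.exists_op_osc_bound (h : D.HasDecay β B) : ∃ C : ℝ≥0,
    ∀ (s : ℝ) (j : ℤ) (k : ℕ) (a : Fin n → ℝ) (b : Euc n → ℂ), |s| = 1 → Nice b →
      ∫⁻ x, ‖D.op (s * 2 ^ j) (osc a (j - k) b) x‖ₑ ^ (2 : ℝ) ≤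
        C * ((2 : ℝ≥0∞) ^ (-β)) ^ k * ∫⁻ x, ‖b x‖ₑ ^ (2 : ℝ) := by
  obtain ⟨C, hC⟩ := h.exists_sum_op_osc_bound
  refine ⟨C, fun s j k a b hs hb => ?_⟩
  simpa using hC s {j} k a (fun _ => 1) (fun _ => b) hs (fun _ => by simp) fun _ => hb

/-- Cancellation on the finer of two scales. -/
theorem HasDecay.exists_sum_enorm_integral_osc_le (h : D.HasDecay β B) : ∃ C : ℝ≥0,
    ∀ (s : ℝ) (J : Finset ℤ) (k l : ℕ) (a : Fin n → ℝ) (b b' : ℤ → Euc n → ℂ), |s| = 1 →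
      (∀ j, Nice (b j)) → (∀ j, Nice (b' j)) →
      ∑ j ∈ J, ‖∫ x, D.op (s * 2 ^ j) (osc a (j - k) (b j)) x * osc a (j - l) (b' j) x‖ₑ ≤
        C * (((2 : ℝ≥0∞) ^ (-β)) ^ max k l) ^ (1 / 2 : ℝ) *
          ((∑ j ∈ J, ∫⁻ x, ‖b j x‖ₑ ^ (2 : ℝ)) ^ (1 / 2 : ℝ) *
            (∑ j ∈ J, ∫⁻ x, ‖b' j x‖ₑ ^ (2 : ℝ)) ^ (1 / 2 : ℝ)) := by
  obtain ⟨C, hC⟩ := h.exists_op_osc_bound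
  refine ⟨2 * C ^ (1 / 2 : ℝ), fun s J k l a b b' hs hb hb' => ?_⟩
  set ω : ℝ≥0∞ := ((2 : ℝ≥0∞) ^ (-β)) ^ max k l
  have h2 : (((2 : ℝ≥0∞) ^ (2 : ℝ))) ^ (1 / 2 : ℝ) = 2 := by
    rw [← ENNReal.rpow_mul]; norm_num
  have hsq : ∀ {X Y Z W : ℝ≥0∞}, X ≤ C * ω * Z → Y ≤ 2 ^ (2 : ℝ) * W →
      X ^ (1 / 2 : ℝ) * Y ^ (1 / 2 : ℝ) ≤ ((2 * C ^ (1 / 2 : ℝ) : ℝ≥0) : ℝ≥0∞) * ω ^ (1 / 2 : ℝ) *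
        (Z ^ (1 / 2 : ℝ) * W ^ (1 / 2 : ℝ)) := by
    intro X Y Z W hX hY
    refine (mul_le_mul' (ENNReal.rpow_le_rpow hX (by norm_num))
      (ENNReal.rpow_le_rpow hY (by norm_num))).trans (le_of_eq ?_)
    rw [ENNReal.mul_rpow_of_nonneg _ _ (by norm_num), ENNReal.mul_rpow_of_nonneg _ _ (by norm_num),
      ENNReal.mul_rpow_of_nonneg _ _ (by norm_num), h2, ENNReal.coe_mul,
      ENNReal.coe_rpow_of_nonneg _ (by norm_num)]
    push_cast; ring
  have hterm : ∀ j ∈ J,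
      ‖∫ x, D.op (s * 2 ^ j) (osc a (j - k) (b j)) x * osc a (j - l) (b' j) x‖ₑ ≤
      ((2 * C ^ (1 / 2 : ℝ) : ℝ≥0) : ℝ≥0∞) * ω ^ (1 / 2 : ℝ) *
        ((∫⁻ x, ‖b j x‖ₑ ^ (2 : ℝ)) ^ (1 / 2 : ℝ) *
          (∫⁻ x, ‖b' j x‖ₑ ^ (2 : ℝ)) ^ (1 / 2 : ℝ)) := by
    intro j _
    have hn1 := (hb j).osc a (j - k)
    have hn2 := (hb' j).osc a (j - l)
    -- The finer of the two oscillations supplies the gain; if it sits on the second factor, the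
    -- averaging operator is transposed first.
    rcases le_total l k with hkl | hkl
    · refine (enorm_integral_mul_le (D.op_nice hn1 _).meas hn2.meas).trans (hsq ?_ ?_)
      · have := hC s j k a (b j) hs (hb j)
        simpa only [ω, max_eq_left hkl] using this
      · exact lintegral_osc_rpow_le a _ (hb' j).meas (by norm_num)
    · rw [D.integral_op_mul hn1 hn2]
      refine (enorm_integral_mul_le hn1.meas (D.op_nice hn2 _).meas).trans ?_
      rw [mul_comm, mul_comm ((∫⁻ x, ‖b j x‖ₑ ^ (2 : ℝ)) ^ (1 / 2 : ℝ)), ← neg_mul]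
      refine hsq ?_ ?_
      · have := hC (-s) j l a (b' j) (by rwa [abs_neg]) (hb' j)
        simpa only [ω, max_eq_right hkl] using this
      · exact lintegral_osc_rpow_le a _ (hb j).meas (by norm_num)
  refine (Finset.sum_le_sum hterm).trans ?_
  rw [← Finset.mul_sum]
  refine mul_le_mul_right ((sum_mul_le_sqrt J _ _).trans (le_of_eq ?_)) _
  simp_rw [ENNReal.rpow_half_rpow_two]

end DensityData

end

end SparseRadon

namespace SparseRadon

noncomputable section

variable {n : ℕ}

/-! ### Level sets and the restricted-type average -/

theorem ENNReal.tsum_rpow_le {ι : Type*} (x : ι → ℝ≥0∞) {p : ℝ} (hp : 1 ≤ p) :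
    ∑' i, x i ^ p ≤ (∑' i, x i) ^ p := by
  have h1 : ∀ y : ℝ≥0∞, y ^ p = y ^ (p - 1) * y := fun y => by
    conv_lhs => rw [show p = (p - 1) + 1 by ring,
      ENNReal.rpow_add_of_nonneg _ _ (by linarith) zero_le_one, ENNReal.rpow_one]
  calc ∑' i, x i ^ p ≤ ∑' i, (∑' i, x i) ^ (p - 1) * x i := by
        refine ENNReal.tsum_le_tsum fun i => ?_
        rw [h1]
        exact mul_le_mul_left (ENNReal.rpow_le_rpow (ENNReal.le_tsum i) (by linarith)) _
    _ = _ := by rw [ENNReal.tsum_mul_left, ← h1]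

theorem volume_carrier_ne_zero (Q : Cube n) : volume Q.carrier ≠ 0 := by
  rw [volume_carrier]
  exact pow_ne_zero _ (by simpa using Q.side_pos)

theorem volume_carrier_ne_top (Q : Cube n) : volume Q.carrier ≠ ∞ := by
  rw [volume_carrier]
  exact ENNReal.pow_ne_top ENNReal.ofReal_ne_top

theorem measurableSet_carrier (Q : Cube n) : MeasurableSet Q.carrier := by
  have : Q.carrier = ⋂ i, ({x : Euc n | Q.corner i ≤ x i} ∩ {x | x i < Q.corner i + Q.side}) := by
    ext x; simp [Cube.carrier]
  rw [this]
  refine MeasurableSet.iInter fun i => ?_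
  have h : Measurable fun x : Euc n => x i := by fun_prop
  exact (measurableSet_le measurable_const h).inter (measurableSet_lt h measurable_const)

theorem levelSet_subset (p : ℝ) (f : Euc n → ℂ) (Q : Cube n) (m : ℕ) :
    levelSet p f Q m ⊆ Q.carrier := by
  cases m <;> exact fun x hx => hx.1

theorem measurableSet_levelSet (p : ℝ) {f : Euc n → ℂ} (hf : Measurable f) (Q : Cube n) (m : ℕ) :
    MeasurableSet (levelSet p f Q m) := by
  cases m with
  | zero => exact (measurableSet_carrier Q).inter (measurableSet_le hf.enorm measurable_const)
  | succ m =>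
    exact (measurableSet_carrier Q).inter ((measurableSet_lt measurable_const hf.enorm).inter
      (measurableSet_le hf.enorm measurable_const))

theorem avg_indicator_levelSet {p : ℝ} (hp : 0 < p) {f : Euc n → ℂ} (hf : Measurable f) (Q : Cube n)
    (m : ℕ) : avg p ((levelSet p f Q m).indicator f) Q =
      ((∫⁻ x in levelSet p f Q m, ‖f x‖ₑ ^ p) / volume Q.carrier) ^ (1 / p) := by
  rw [avg]
  congr 2
  simp_rw [enorm_indicator_rpow _ _ hp]
  rw [setLIntegral_indicator (measurableSet_levelSet p hf Q m),
    Set.inter_eq_self_of_subset_left (levelSet_subset p f Q m)]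

theorem exists_mem_levelSet {p : ℝ} {f : Euc n → ℂ} {Q : Cube n} (h0 : avg p f Q ≠ 0) {x : Euc n}
    (hx : x ∈ Q.carrier) : ∃ m, x ∈ levelSet p f Q m := by
  have h1 : ∃ m : ℕ, ‖f x‖ₑ ≤ 2 ^ m * avg p f Q := by
    have h2 : Tendsto (fun m : ℕ => (2 : ℝ≥0∞) ^ m * avg p f Q) atTop (𝓝 ∞) := by
      have h3 := ENNReal.Tendsto.mul_const (b := avg p f Q)
        (ENNReal.tendsto_pow_atTop_nhds_top_iff.2 ENNReal.one_lt_two) (Or.inl ENNReal.top_ne_zero)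
      rwa [ENNReal.top_mul h0] at h3
    exact ((h2.eventually_const_lt (enorm_lt_top (x := f x))).mono fun m hm => hm.le).exists
  classical
  have hspec := Nat.find_spec h1
  have hmin := fun k => Nat.find_min h1 (m := k)
  set m := Nat.find h1
  refine ⟨m, ?_⟩
  cases hm : m with
  | zero =>
    rw [hm, pow_zero, one_mul] at hspec
    exact ⟨hx, hspec⟩
  | succ k =>
    rw [hm] at hspec
    exact ⟨hx, not_le.1 (hmin k (by omega)), hspec⟩

theorem enorm_le_of_mem_levelSet {p : ℝ} {f : Euc n → ℂ} {Q : Cube n} {m : ℕ} {x : Euc n}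
    (hx : x ∈ levelSet p f Q m) : ‖f x‖ₑ ≤ 2 ^ m * avg p f Q := by
  cases m with
  | zero => rw [pow_zero, one_mul]; exact hx.2
  | succ m => exact hx.2.2

/-- The `p`-th powers add over the level sets that cover `E`, and an `ℓ^p` norm is at most the `ℓ¹`
norm. -/
theorem rpow_setLIntegral_le_tsum_level {p : ℝ} (hp : 1 ≤ p) {f : Euc n → ℂ} (hf : Measurable f)
    {Q : Cube n} (h0 : avg p f Q ≠ 0) {E : Set (Euc n)} (hE : E ⊆ Q.carrier) {P : ℕ → Prop}
    [DecidablePred P] (hP : ∀ x ∈ E, ∀ m, x ∈ levelSet p f Q m → P m) :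
    ((∫⁻ x in E, ‖f x‖ₑ ^ p) / volume Q.carrier) ^ (1 / p) ≤
      ∑' m, if P m then avg p ((levelSet p f Q m).indicator f) Q else 0 := by
  have hp0 : 0 < p := by linarith
  have h1 : ∫⁻ x in E, ‖f x‖ₑ ^ p ≤
      ∑' m, if P m then ∫⁻ x in levelSet p f Q m, ‖f x‖ₑ ^ p else 0 := by
    have hsub : E ⊆ ⋃ m, if P m then levelSet p f Q m else ∅ := by
      intro x hx
      obtain ⟨m, hm⟩ := exists_mem_levelSet h0 (hE hx)
      exact Set.mem_iUnion.2 ⟨m, by rwa [if_pos (hP x hx m hm)]⟩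
    refine (lintegral_mono_set hsub).trans ((lintegral_iUnion_le _ _).trans
      (ENNReal.tsum_le_tsum fun m => ?_))
    split_ifs <;> simp
  rw [one_div, ENNReal.rpow_inv_le_iff hp0]
  refine (ENNReal.div_le_div_right h1 _).trans (le_trans ?_ (ENNReal.tsum_rpow_le _ hp))
  rw [ENNReal.div_eq_inv_mul, ← ENNReal.tsum_mul_left]
  refine ENNReal.tsum_le_tsum fun m => ?_
  split_ifs
  · rw [avg_indicator_levelSet hp0 hf, ← ENNReal.rpow_mul, one_div, inv_mul_cancel₀ hp0.ne',
      ENNReal.rpow_one, ENNReal.div_eq_inv_mul]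
  · simp

theorem avg_le_avgPlus {p : ℝ} (hp : 1 ≤ p) {f : Euc n → ℂ} (hf : Measurable f) (Q : Cube n) :
    avg p f Q ≤ avgPlus p f Q := by
  rcases eq_or_ne (avg p f Q) 0 with h0 | h0
  · rw [h0]; exact zero_le
  refine (rpow_setLIntegral_le_tsum_level hp hf h0 (subset_refl Q.carrier) (P := fun _ => True)
    fun _ _ _ _ => trivial).trans (ENNReal.tsum_le_tsum fun m => ?_)
  rw [if_pos trivial]
  exact le_mul_of_one_le_left zero_le (one_le_pow₀ le_add_self)

/-- With `θ^N₀ > 2`, the `m`-th level set can exceed `θ^(max k l)` times the average only if `k` and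
`l` are both below `N₀ m`. Each level is thus counted at most `(N₀ m)²` times, which is within the
weight `(m+1)^4`, uniformly in `N`. -/
theorem exists_sum_tail_le {θ : ℝ≥0} (hθ : 1 < θ) {p : ℝ} (hp : 1 ≤ p) : ∃ C : ℝ≥0,
    ∀ (f : Euc n → ℂ) (Q : Cube n) (N : ℕ), Measurable f →
      ∑ k ∈ Finset.range N, ∑ l ∈ Finset.range N,
        ((∫⁻ x in Q.carrier ∩ {x | (θ : ℝ≥0∞) ^ max k l * avg p f Q < ‖f x‖ₑ}, ‖f x‖ₑ ^ p) /
          volume Q.carrier) ^ (1 / p) ≤ C * avgPlus p f Q := by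
  classical
  obtain ⟨N₀, hN₀⟩ := pow_unbounded_of_one_lt (2 : ℝ≥0) hθ
  refine ⟨N₀ ^ 2, fun f Q N hf => ?_⟩
  have hp0 : 0 < p := by linarith
  rcases eq_or_ne (avg p f Q) 0 with h0 | h0
  · refine le_of_eq_of_le (Finset.sum_eq_zero fun k _ => Finset.sum_eq_zero fun l _ => ?_) zero_le
    refine le_antisymm (le_trans (ENNReal.rpow_le_rpow (ENNReal.div_le_div_right
      (lintegral_mono_set Set.inter_subset_left) _) (by positivity)) h0.le) zero_le
  set α : ℕ → ℝ≥0∞ := fun m => avg p ((levelSet p f Q m).indicator f) Q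
  have hterm : ∀ k l : ℕ,
      ((∫⁻ x in Q.carrier ∩ {x | (θ : ℝ≥0∞) ^ max k l * avg p f Q < ‖f x‖ₑ}, ‖f x‖ₑ ^ p) /
          volume Q.carrier) ^ (1 / p) ≤
        ∑' m, if k < N₀ * m ∧ l < N₀ * m then α m else 0 := by
    intro k l
    refine rpow_setLIntegral_le_tsum_level hp hf h0 Set.inter_subset_left
      (P := fun m => k < N₀ * m ∧ l < N₀ * m) fun x hx m hm => ?_
    have h1 : (θ : ℝ≥0∞) ^ max k l * avg p f Q < 2 ^ m * avg p f Q :=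
      lt_of_lt_of_le hx.2 (enorm_le_of_mem_levelSet hm)
    have h2 : (θ : ℝ≥0∞) ^ max k l < 2 ^ m := lt_of_mul_lt_mul_right' h1
    have h3 : θ ^ max k l < 2 ^ m := by exact_mod_cast h2
    have h4 : θ ^ max k l < θ ^ (N₀ * m) := by
      rw [pow_mul]
      exact h3.trans_le (pow_le_pow_left₀ zero_le hN₀.le _)
    have h5 := (pow_lt_pow_iff_right₀ hθ).1 h4
    exact max_lt_iff.1 h5
  calc _ ≤ ∑ k ∈ Finset.range N, ∑ l ∈ Finset.range N,
        ∑' m, (if k < N₀ * m ∧ l < N₀ * m then α m else 0) :=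
        Finset.sum_le_sum fun k _ => Finset.sum_le_sum fun l _ => hterm k l
    _ = ∑' m, ∑ k ∈ Finset.range N, ∑ l ∈ Finset.range N,
        (if k < N₀ * m ∧ l < N₀ * m then α m else 0) := by
        rw [Summable.tsum_finsetSum fun _ _ => ENNReal.summable]
        refine Finset.sum_congr rfl fun k _ => ?_
        rw [Summable.tsum_finsetSum fun _ _ => ENNReal.summable]
    _ ≤ ∑' m : ℕ, ((N₀ ^ 2 : ℝ≥0) : ℝ≥0∞) * (((m : ℝ≥0∞) + 1) ^ 4 * α m) := by
        refine ENNReal.tsum_le_tsum fun m => ?_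
        calc _ = ∑ k ∈ Finset.range N, ∑ l ∈ Finset.range N,
              (if k < N₀ * m then 1 else 0) * ((if l < N₀ * m then 1 else 0) * α m) := by
              refine Finset.sum_congr rfl fun k _ => Finset.sum_congr rfl fun l _ => ?_
              by_cases h1 : k < N₀ * m <;> by_cases h2 : l < N₀ * m <;> simp [h1, h2]
          _ = (∑ k ∈ Finset.range N, if k < N₀ * m then (1 : ℝ≥0∞) else 0) *
              (∑ l ∈ Finset.range N, if l < N₀ * m then (1 : ℝ≥0∞) else 0) * α m := by
              simp_rw [← Finset.mul_sum, ← Finset.sum_mul]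
              ring
          _ ≤ (N₀ * m : ℕ) * (N₀ * m : ℕ) * α m := by
              have hcard : (∑ k ∈ Finset.range N, if k < N₀ * m then (1 : ℝ≥0∞) else 0) ≤
                  (N₀ * m : ℕ) := by
                rw [← Finset.sum_filter, Finset.sum_const, nsmul_eq_mul, mul_one]
                refine Nat.cast_le.2 ((Finset.card_le_card fun k hk => ?_).trans
                  (Finset.card_range (N₀ * m)).le)
                exact Finset.mem_range.2 (Finset.mem_filter.1 hk).2
              gcongr
          _ = ((N₀ ^ 2 : ℝ≥0) : ℝ≥0∞) * ((m : ℝ≥0∞) ^ 2 * α m) := by push_cast; ring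
          _ ≤ _ := by
              refine mul_le_mul_right (mul_le_mul_left ?_ _) _
              exact (pow_le_pow_left₀ zero_le le_self_add 2).trans
                (pow_le_pow_right₀ le_add_self (by norm_num))
    _ = _ := by rw [ENNReal.tsum_mul_left, avgPlus]

theorem setLIntegral_eq_avg_rpow {p : ℝ} (hp : 0 < p) (f : Euc n → ℂ) (Q : Cube n) :
    ∫⁻ x in Q.carrier, ‖f x‖ₑ ^ p = avg p f Q ^ p * volume Q.carrier := by
  rw [avg, ← ENNReal.rpow_mul, one_div, inv_mul_cancel₀ hp.ne', ENNReal.rpow_one,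
    ENNReal.div_mul_cancel (volume_carrier_ne_zero Q) (volume_carrier_ne_top Q)]

/-! ### Localized oscillation -/

variable {a : Fin n → ℝ}

theorem osc_indicator {i : ℤ} {E : Set (Euc n)} (hE : Sat a i E) (u : Euc n → ℂ) (x : Euc n) :
    osc a i (E.indicator u) x = E.indicator (osc a i u) x := by
  by_cases hx : x ∈ E
  · rw [Set.indicator_of_mem hx, osc, osc, condAvg_indicator_of_mem hE hx, Set.indicator_of_mem hx]
  · rw [Set.indicator_of_notMem hx, osc_eq_zero a i (indicator_eq_zero_of_sat hE u hx)]

theorem setLIntegral_osc_rpow_le {i : ℤ} {E : Set (Euc n)} (hE : Sat a i E) {u : Euc n → ℂ}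
    (hu : Measurable u) {r : ℝ} (hr : 1 ≤ r) :
    ∫⁻ x in E, ‖osc a i u x‖ₑ ^ r ≤ 2 ^ r * ∫⁻ x in E, ‖u x‖ₑ ^ r := by
  have hr0 : 0 < r := by linarith
  have h := lintegral_osc_rpow_le a i (hu.indicator hE.measurableSet) hr
  simp_rw [osc_indicator hE, enorm_indicator_rpow _ _ hr0] at h
  rwa [lintegral_indicator hE.measurableSet, lintegral_indicator hE.measurableSet] at h

end

end SparseRadon

namespace SparseRadon

noncomputable section

variable {n : ℕ}

/-! ### One step of the sparse domination -/

/-- A dyadic cube with a stopping rule that controls the local averages of `f₁` and `f₂`, and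
bounded functions `u`, `v` dominated by `f₁`, `f₂`. -/
structure StepData (n : ℕ) (p q' : ℝ) where
  a : Fin n → ℝ
  L : ℤ
  i₀ : ℤ
  m₀ : Fin n → ℤ
  f₁ : Euc n → ℂ
  f₂ : Euc n → ℂ
  u : Euc n → ℂ
  v : Euc n → ℂ
  S : ℤ → (Fin n → ℤ) → Prop
  X : ℝ≥0∞
  Y : ℝ≥0∞
  one_le_p : 1 ≤ p
  one_le_q' : 1 ≤ q'
  hL : L < i₀
  meas₁ : Measurable f₁
  meas₂ : Measurable f₂
  nice_u : Nice u
  nice_v : Nice v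
  le₁ : ∀ x, ‖u x‖ₑ ≤ ‖f₁ x‖ₑ
  le₂ : ∀ x, ‖v x‖ₑ ≤ ‖f₂ x‖ₑ
  top₁ : ∫⁻ x in cell a i₀ m₀, ‖f₁ x‖ₑ ^ p ≤ X * vol n i₀
  top₂ : ∫⁻ x in tripleCell a i₀ m₀, ‖f₂ x‖ₑ ^ q' ≤ Y * vol n i₀
  not_stop₁ : ∀ i < i₀, ∀ m, ¬ S i m → ∫⁻ x in cell a i m, ‖f₁ x‖ₑ ^ p ≤ X * vol n i
  not_stop₂ : ∀ i < i₀, ∀ m, ¬ S i m → ∫⁻ x in tripleCell a i m, ‖f₂ x‖ₑ ^ q' ≤ Y * vol n i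

namespace StepData

variable {p q' : ℝ} (H : StepData n p q')

/-- The scales of the stopping cubes. -/
def T : Finset ℤ := Finset.Icc H.L (H.i₀ - 1)

/-- The dyadic cube on which the step takes place. -/
def Q₀ : Set (Euc n) := cell H.a H.i₀ H.m₀

/-- The tripled cube. -/
def Q₃ : Set (Euc n) := tripleCell H.a H.i₀ H.m₀

/-- The restriction of `u` to the cube. -/
def w : Euc n → ℂ := H.Q₀.indicator H.u

/-- The restriction of `v` to the tripled cube. -/
def z : Euc n → ℂ := H.Q₃.indicator H.v

/-- The union of the stopping cubes of side `2^i`. -/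
def A (i : ℤ) : Set (Euc n) := topSet H.a (H.i₀ - 1) (withFloor H.L H.S) i

/-- The cubes on which the average of `f₂` is large. -/
def S' (i : ℤ) (m : Fin n → ℤ) : Prop :=
  2 ^ n * H.Y * vol n i < ∫⁻ x in cell H.a i m, ‖H.f₂ x‖ₑ ^ q'

/-- The union of the maximal cubes of side `2^i` on which the average of `f₂` is large. -/
def A' (i : ℤ) : Set (Euc n) := topSet H.a (H.i₀ - 1) (withFloor H.L H.S') i

/-- The good part of `w`. -/
def g : Euc n → ℂ := goodPart H.a (H.i₀ - 1) H.L H.S H.w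

/-- The good part of `z`. -/
def g' : Euc n → ℂ := goodPart H.a (H.i₀ - 1) H.L H.S' H.z

theorem sat_Q₀ {i : ℤ} (hi : i ≤ H.i₀) : Sat H.a i H.Q₀ := (sat_cell _ _).mono hi

theorem sat_Q₃ {i : ℤ} (hi : i ≤ H.i₀) : Sat H.a i H.Q₃ := (sat_tripleCell _ _).mono hi

theorem sat_A (i : ℤ) : Sat H.a i (H.A i) := sat_topSet i

theorem sat_A' (i : ℤ) : Sat H.a i (H.A' i) := sat_topSet i

theorem nice_w : Nice H.w := H.nice_u.indicator (measurableSet_cell _ _ _)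

theorem nice_z : Nice H.z := H.nice_v.indicator (measurableSet_tripleCell _ _ _)

theorem nice_g : Nice H.g := goodPart_nice H.nice_w

theorem nice_g' : Nice H.g' := goodPart_nice H.nice_z

theorem w_eq_zero {x : Euc n} (hx : x ∉ H.Q₀) : H.w x = 0 := Set.indicator_of_notMem hx _

theorem z_eq_zero {x : Euc n} (hx : x ∉ H.Q₃) : H.z x = 0 := Set.indicator_of_notMem hx _

theorem enorm_w_le (x : Euc n) : ‖H.w x‖ₑ ≤ ‖H.f₁ x‖ₑ :=
  (enorm_indicator_le_enorm_self _ _).trans (H.le₁ x)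

theorem enorm_z_le (x : Euc n) : ‖H.z x‖ₑ ≤ ‖H.f₂ x‖ₑ :=
  (enorm_indicator_le_enorm_self _ _).trans (H.le₂ x)

theorem mem_T_of_mem_A {i : ℤ} {x : Euc n} (hx : x ∈ H.A i) : i ∈ H.T :=
  Finset.mem_Icc.2 ⟨hx.2.1.1, hx.1⟩

theorem mem_T_of_mem_A' {i : ℤ} {x : Euc n} (hx : x ∈ H.A' i) : i ∈ H.T :=
  Finset.mem_Icc.2 ⟨hx.2.1.1, hx.1⟩

theorem pow_mul_vol_succ (X : ℝ≥0∞) (i : ℤ) : X * vol n (i + 1) = 2 ^ n * X * vol n i := by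
  rw [vol_succ]; push_cast; ring

theorem le_two_pow_mul (X : ℝ≥0∞) : X ≤ 2 ^ n * X :=
  le_mul_of_one_le_left zero_le (one_le_pow₀ one_le_two)

theorem cell_subset_tripleCell_of_mem {i : ℤ} {x y : Euc n}
    (h : x ∈ tripleCell H.a i (idx H.a i y)) :
    cell H.a i (idx H.a i x) ⊆ tripleCell H.a i (idx H.a i y) :=
  (sat_tripleCell i _).cell_subset h

theorem tripleCell_subset_tripleCell {i j : ℤ} (hij : i ≤ j) (y : Euc n) :
    tripleCell H.a i (idx H.a i y) ⊆ tripleCell H.a j (idx H.a j y) :=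
  fun _ hx => idx_near_of_le H.a hij hx

variable {H}

/-- A strict ancestor of a stopping cube is not stopped while it is smaller than `Q₀`, and at `Q₀`
itself the bounds are part of the data. Both functions are thus controlled at all scales strictly
above the stopping cube. -/
theorem parent {y : Euc n} (hyQ : y ∈ H.Q₀) {i j : ℤ} (hy : y ∈ H.A i) (hij : i < j)
    (hj : j ≤ H.i₀) :
    (∫⁻ x in cell H.a j (idx H.a j y), ‖H.f₁ x‖ₑ ^ p ≤ H.X * vol n j) ∧
    ∫⁻ x in tripleCell H.a j (idx H.a j y), ‖H.f₂ x‖ₑ ^ q' ≤ H.Y * vol n j := by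
  rcases hj.eq_or_lt with rfl | hj
  · rw [(mem_cell H.a).1 hyQ]
    exact ⟨H.top₁, H.top₂⟩
  · have h := not_of_mem_topSet_withFloor hy hij (by omega)
    exact ⟨H.not_stop₁ j hj _ h, H.not_stop₂ j hj _ h⟩

theorem setLIntegral_cell_le {y : Euc n} (hyQ : y ∈ H.Q₀) {i j : ℤ} (hy : y ∈ H.A i) (hij : i ≤ j)
    (hj : j < H.i₀) :
    ∫⁻ x in cell H.a j (idx H.a j y), ‖H.f₁ x‖ₑ ^ p ≤ 2 ^ n * H.X * vol n j := by
  rw [← pow_mul_vol_succ]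
  exact (lintegral_mono_set (cell_subset_cell (by omega) y)).trans
    (parent hyQ hy (by omega) (by omega)).1

theorem setLIntegral_tripleCell_le {y : Euc n} (hyQ : y ∈ H.Q₀) {i j : ℤ} (hy : y ∈ H.A i)
    (hij : i ≤ j) (hj : j < H.i₀) :
    ∫⁻ x in tripleCell H.a j (idx H.a j y), ‖H.f₂ x‖ₑ ^ q' ≤ 2 ^ n * H.Y * vol n j := by
  rw [← pow_mul_vol_succ]
  exact (lintegral_mono_set (H.tripleCell_subset_tripleCell (by omega) y)).trans
    (parent hyQ hy (by omega) (by omega)).2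

/-- A cell of scale `i' > j` near `y` lies in the triple of the ancestor of `y` at scale `i'`, where
the integral of `|f₂|^q'` is at most `2^n Y` times the volume. That is the threshold in `S'`, so the
cell is not selected. -/
theorem notMem_A' {y : Euc n} (hyQ : y ∈ H.Q₀) {i j i' : ℤ} (hy : y ∈ H.A i) (hij : i ≤ j)
    {x : Euc n} (hx : x ∈ tripleCell H.a j (idx H.a j y)) (hji' : j < i') :
    x ∉ H.A' i' := by
  intro hx'
  have h1 := Finset.mem_Icc.1 (H.mem_T_of_mem_A hy)
  have h2 := Finset.mem_Icc.1 (H.mem_T_of_mem_A' hx')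
  rcases hx'.2.1.2 with h | h
  · omega
  · refine absurd h (not_lt.2 ?_)
    refine le_trans (lintegral_mono_set ?_) (setLIntegral_tripleCell_le hyQ hy
      (j := i') (by omega) (by omega))
    exact H.cell_subset_tripleCell_of_mem (H.tripleCell_subset_tripleCell hji'.le y hx)

/-- One factor `2^n` is the threshold in `S'`, the other comes from passing to the parent cell. -/
theorem setLIntegral_cell_le' {x : Euc n} (hxQ : x ∈ H.Q₃) {i : ℤ} (hx : x ∈ H.A' i) :
    ∫⁻ y in cell H.a i (idx H.a i x), ‖H.f₂ y‖ₑ ^ q' ≤ 4 ^ n * H.Y * vol n i := by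
  have h2 := Finset.mem_Icc.1 (H.mem_T_of_mem_A' hx)
  have h3 : (4 : ℝ≥0∞) ^ n * H.Y = 2 ^ n * (2 ^ n * H.Y) := by
    rw [← mul_assoc, ← mul_pow]; norm_num
  rw [h3, ← pow_mul_vol_succ]
  refine (lintegral_mono_set (cell_subset_cell (Int.le_add_one le_rfl) x)).trans ?_
  rcases (show i + 1 ≤ H.i₀ by omega).eq_or_lt with h | h
  · rw [h]
    refine (lintegral_mono_set ?_).trans (H.top₂.trans (mul_le_mul_left (le_two_pow_mul _) _))
    exact (sat_tripleCell _ _).cell_subset hxQ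
  · exact not_lt.1 (not_of_mem_topSet_withFloor hx (lt_add_one i) (by omega))

variable (H)

theorem exists_mem_A (x : Euc n) : ∃ i, x ∈ H.A i := by
  obtain ⟨i, -, -, h⟩ := exists_mem_topSet_withFloor (a := H.a) (S := H.S)
    (show H.L ≤ H.i₀ - 1 by have := H.hL; omega) x
  exact ⟨i, h⟩

theorem exists_mem_A' (x : Euc n) : ∃ i, x ∈ H.A' i := by
  obtain ⟨i, -, -, h⟩ := exists_mem_topSet_withFloor (a := H.a) (S := H.S')
    (show H.L ≤ H.i₀ - 1 by have := H.hL; omega) x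
  exact ⟨i, h⟩

theorem g_eq_zero {x : Euc n} (hx : x ∉ H.Q₀) : H.g x = 0 := by
  obtain ⟨i, hi⟩ := H.exists_mem_A x
  have h1 := Finset.mem_Icc.1 (H.mem_T_of_mem_A hi)
  rw [g, goodPart_of_mem hi]
  exact condAvg_eq_zero _ _ (indicator_eq_zero_of_sat (H.sat_Q₀ (by omega)) _ hx)

theorem g'_eq_zero {x : Euc n} (hx : x ∉ H.Q₃) : H.g' x = 0 := by
  obtain ⟨i, hi⟩ := H.exists_mem_A' x
  have h1 := Finset.mem_Icc.1 (H.mem_T_of_mem_A' hi)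
  rw [g', goodPart_of_mem hi]
  exact condAvg_eq_zero _ _ (indicator_eq_zero_of_sat (H.sat_Q₃ (by omega)) _ hx)

theorem enorm_condAvg_le_of_setLIntegral_le {a : Fin n → ℝ} {i : ℤ} {f h : Euc n → ℂ} {x : Euc n}
    (hf : Measurable f) (hfh : ∀ x, ‖f x‖ₑ ≤ ‖h x‖ₑ) {r : ℝ} (hr : 1 ≤ r) {X : ℝ≥0∞}
    (hX : ∫⁻ y in cell a i (idx a i x), ‖h y‖ₑ ^ r ≤ X * vol n i) :
    ‖condAvg a i f x‖ₑ ≤ X ^ (1 / r) := by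
  have hr0 : 0 < r := by linarith
  rw [one_div, ENNReal.le_rpow_inv_iff hr0]
  refine (enorm_condAvg_rpow_le a i hf x hr).trans ?_
  rw [← ENNReal.div_eq_inv_mul]
  refine ENNReal.div_le_of_le_mul (le_trans (lintegral_mono fun y => ?_) hX)
  exact ENNReal.rpow_le_rpow (hfh y) hr0.le

theorem enorm_g_le (x : Euc n) : ‖H.g x‖ₑ ≤ (2 ^ n * H.X) ^ (1 / p) := by
  by_cases hx : x ∈ H.Q₀
  · obtain ⟨i, hi⟩ := H.exists_mem_A x
    have h1 := Finset.mem_Icc.1 (H.mem_T_of_mem_A hi)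
    rw [g, goodPart_of_mem hi]
    exact enorm_condAvg_le_of_setLIntegral_le H.nice_w.meas H.enorm_w_le H.one_le_p
      (setLIntegral_cell_le hx hi le_rfl (by omega))
  · rw [H.g_eq_zero hx, enorm_zero]; exact zero_le

theorem enorm_g'_le (x : Euc n) : ‖H.g' x‖ₑ ≤ (4 ^ n * H.Y) ^ (1 / q') := by
  by_cases hx : x ∈ H.Q₃
  · obtain ⟨i, hi⟩ := H.exists_mem_A' x
    rw [g', goodPart_of_mem hi]
    exact enorm_condAvg_le_of_setLIntegral_le H.nice_z.meas H.enorm_z_le H.one_le_q'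
      (setLIntegral_cell_le' hx hi)
  · rw [H.g'_eq_zero hx, enorm_zero]; exact zero_le

theorem indicator_inter_w {f : Euc n → ℂ} (hf : ∀ x ∉ H.Q₀, f x = 0) (i : ℤ) :
    (H.A i ∩ H.Q₀).indicator f = (H.A i).indicator f := by
  funext x
  by_cases h1 : x ∈ H.Q₀
  · by_cases h2 : x ∈ H.A i <;> simp [h1, h2]
  · have := hf x h1
    by_cases h2 : x ∈ H.A i <;> simp [h1, h2, this]

theorem sum_indicator_A (f : Euc n → ℂ) (x : Euc n) : ∑ i ∈ H.T, (H.A i).indicator f x = f x :=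
  sum_indicator_topSet (show H.L ≤ H.i₀ - 1 by have := H.hL; omega) f x

/-- The part of `f` that is kept at scale `j`. -/
def kept (f : Euc n → ℂ) (j : ℤ) (x : Euc n) : ℂ :=
  ∑ i ∈ H.T with i ≤ j, (H.A i).indicator f x

theorem nice_kept {f : Euc n → ℂ} (hf : Nice f) (j : ℤ) : Nice (H.kept f j) :=
  Nice.sum fun i _ => hf.indicator (measurableSet_topSet i)

theorem volume_Q₀ : volume H.Q₀ = vol n H.i₀ := volume_cell _ _ _

theorem volume_Q₃ : volume H.Q₃ = 3 ^ n * vol n H.i₀ := volume_tripleCell _ _ _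

theorem sum_volume_A_le : ∑ i ∈ H.T, volume (H.A i ∩ H.Q₀) ≤ vol n H.i₀ := by
  rw [← H.volume_Q₀, ← measure_biUnion_finset]
  · exact measure_mono (Set.iUnion₂_subset fun i _ => Set.inter_subset_right)
  · exact fun i _ j _ hij => (disjoint_topSet hij).mono Set.inter_subset_left Set.inter_subset_left
  · exact fun i _ => (measurableSet_topSet i).inter (measurableSet_cell _ _ _)

theorem setLIntegral_rpow_le_const {f : Euc n → ℂ} {M : ℝ≥0∞} (hM : ∀ x, ‖f x‖ₑ ≤ M) {r : ℝ}
    (hr : 0 ≤ r) (E : Set (Euc n)) : ∫⁻ x in E, ‖f x‖ₑ ^ r ≤ M ^ r * volume E := by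
  rw [← setLIntegral_const]
  exact lintegral_mono fun x => ENNReal.rpow_le_rpow (hM x) hr

theorem lintegral_eq_setLIntegral {f : Euc n → ℂ} {E : Set (Euc n)} (hE : MeasurableSet E)
    (hf : ∀ x ∉ E, f x = 0) {r : ℝ} (hr : 0 < r) :
    ∫⁻ x, ‖f x‖ₑ ^ r = ∫⁻ x in E, ‖f x‖ₑ ^ r := by
  rw [← lintegral_indicator hE]
  refine lintegral_congr fun x => ?_
  by_cases hx : x ∈ E
  · rw [Set.indicator_of_mem hx]
  · rw [Set.indicator_of_notMem hx, hf x hx, enorm_zero, ENNReal.zero_rpow_of_pos hr]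

theorem measurableSet_Q₀ : MeasurableSet H.Q₀ := measurableSet_cell _ _ _

theorem measurableSet_Q₃ : MeasurableSet H.Q₃ := measurableSet_tripleCell _ _ _

theorem setLIntegral_w_le (E : Set (Euc n)) :
    ∫⁻ x in E, ‖H.w x‖ₑ ^ p ≤ ∫⁻ x in E, ‖H.f₁ x‖ₑ ^ p :=
  lintegral_mono fun x => ENNReal.rpow_le_rpow (H.enorm_w_le x) (by linarith [H.one_le_p])

theorem setLIntegral_z_le (E : Set (Euc n)) :
    ∫⁻ x in E, ‖H.z x‖ₑ ^ q' ≤ ∫⁻ x in E, ‖H.f₂ x‖ₑ ^ q' :=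
  lintegral_mono fun x => ENNReal.rpow_le_rpow (H.enorm_z_le x) (by linarith [H.one_le_q'])

theorem lintegral_w_le : ∫⁻ x, ‖H.w x‖ₑ ^ p ≤ H.X * vol n H.i₀ := by
  rw [lintegral_eq_setLIntegral H.measurableSet_Q₀ (fun x => H.w_eq_zero)
    (by linarith [H.one_le_p])]
  exact (H.setLIntegral_w_le _).trans H.top₁

theorem lintegral_z_le : ∫⁻ x, ‖H.z x‖ₑ ^ q' ≤ H.Y * vol n H.i₀ := by
  rw [lintegral_eq_setLIntegral H.measurableSet_Q₃ (fun x => H.z_eq_zero)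
    (by linarith [H.one_le_q'])]
  exact (H.setLIntegral_z_le _).trans H.top₂

variable {D : DensityData n}

theorem enorm_sum_integral_kept_le {r r' : ℝ} (hr : r.HolderConjugate r')
    {J : Finset ℤ} {ε : ℤ → ℂ} {C : ℝ≥0}
    (hC : ∀ (J : Finset ℤ) (f : Euc n → ℂ), Nice f →
      ∫⁻ x, ‖D.trunc 1 J ε f x‖ₑ ^ r ≤ C * ∫⁻ x, ‖f x‖ₑ ^ r)
    {f h : Euc n → ℂ} (hf : Nice f) (hh : Nice h) (hf0 : ∀ x ∉ H.Q₀, f x = 0) {X Y : ℝ≥0∞}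
    (hX : ∀ i, ∀ y ∈ H.A i ∩ H.Q₀, ∫⁻ x in cell H.a i (idx H.a i y), ‖f x‖ₑ ^ r ≤ X * vol n i)
    (hY : ∀ i, ∀ y ∈ H.A i ∩ H.Q₀,
      ∫⁻ x in tripleCell H.a i (idx H.a i y), ‖h x‖ₑ ^ r' ≤ Y * vol n i)
    (hXV : ∫⁻ x, ‖f x‖ₑ ^ r ≤ X * vol n H.i₀) (hYV : ∫⁻ x, ‖h x‖ₑ ^ r' ≤ Y * vol n H.i₀) :
    ‖∑ j ∈ J, ε j * ∫ x, D.op (1 * 2 ^ j) (H.kept f j) x * h x‖ₑ ≤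
      2 * ((C : ℝ≥0∞) ^ (1 / r) * X ^ (1 / r) * Y ^ (1 / r') * vol n H.i₀) := by
  have h1 : ∀ j, H.kept f j = fun x => ∑ i ∈ H.T with i ≤ j, (H.A i ∩ H.Q₀).indicator f x := by
    intro j
    funext x
    simp only [kept, H.indicator_inter_w hf0]
  simp_rw [h1]
  classical
  -- restrict to the scales of the stopping cubes, where the cubes are unions of smaller cells
  set A₀ : ℤ → Set (Euc n) := fun i => H.A i ∩ H.Q₀
  have hA₀ : ∀ i, Sat H.a i (A₀ i) := by
    intro i
    by_cases hi : i ≤ H.i₀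
    · exact (H.sat_A i).inter (H.sat_Q₀ hi)
    · have h2 : A₀ i = ∅ := by
        refine Set.eq_empty_of_forall_notMem fun x hx => ?_
        have := Finset.mem_Icc.1 (H.mem_T_of_mem_A hx.1)
        omega
      rw [h2]
      exact fun _ _ _ h => h
  refine DensityData.enorm_sum_integral_stopped_le hr (by simp) hC hf hh hA₀ (fun x => ?_)
    (fun i _ => hX i) (fun i _ => hY i) hXV hYV H.sum_volume_A_le
  simp only [A₀, H.indicator_inter_w hf0]
  exact H.sum_indicator_A f x

/-- `g'` is bounded, so it can be measured in `L^(p')`, dual to the natural space of `w`; the `L^p`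
bound for truncated sums then suffices. -/
theorem enorm_pairing_good'_le {p' : ℝ} (hp : p.HolderConjugate p')
    {J : Finset ℤ} {ε : ℤ → ℂ} {C : ℝ≥0}
    (hC : ∀ (J : Finset ℤ) (f : Euc n → ℂ), Nice f →
      ∫⁻ x, ‖D.trunc 1 J ε f x‖ₑ ^ p ≤ C * ∫⁻ x, ‖f x‖ₑ ^ p) :
    ‖∑ j ∈ J, ε j * ∫ x, D.op (1 * 2 ^ j) (H.kept H.w j) x * H.g' x‖ₑ ≤
      2 * ((C : ℝ≥0∞) ^ (1 / p) * (2 ^ n * H.X) ^ (1 / p) *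
        (((4 ^ n * H.Y) ^ (1 / q')) ^ p' * 3 ^ n) ^ (1 / p') * vol n H.i₀) := by
  refine H.enorm_sum_integral_kept_le hp hC H.nice_w H.nice_g' (fun x => H.w_eq_zero)
    (fun i y hy => ?_) (fun i y hy => ?_) ?_ ?_
  · have h1 := Finset.mem_Icc.1 (H.mem_T_of_mem_A hy.1)
    exact (H.setLIntegral_w_le _).trans (setLIntegral_cell_le hy.2 hy.1 le_rfl (by omega))
  · refine (setLIntegral_rpow_le_const H.enorm_g'_le hp.symm.nonneg _).trans (le_of_eq ?_)
    rw [volume_tripleCell]; ring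
  · exact H.lintegral_w_le.trans (mul_le_mul_left (le_two_pow_mul _) _)
  · rw [lintegral_eq_setLIntegral H.measurableSet_Q₃ (fun x => H.g'_eq_zero) hp.symm.pos]
    refine (setLIntegral_rpow_le_const H.enorm_g'_le hp.symm.nonneg _).trans (le_of_eq ?_)
    rw [H.volume_Q₃]; ring

theorem nice_bad' : Nice (fun x => H.z x - H.g' x) := H.nice_z.sub H.nice_g'

theorem setLIntegral_bad'_le {E : Set (Euc n)} {V : ℝ≥0∞}
    (hE : ∫⁻ x in E, ‖H.f₂ x‖ₑ ^ q' ≤ 2 ^ n * H.Y * V) (hV : volume E ≤ 3 ^ n * V) :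
    ∫⁻ x in E, ‖H.z x - H.g' x‖ₑ ^ q' ≤
      2 ^ (q' - 1) * (2 ^ n * H.Y + 4 ^ n * H.Y * 3 ^ n) * V := by
  have hq0 : 0 < q' := by linarith [H.one_le_q']
  calc ∫⁻ x in E, ‖H.z x - H.g' x‖ₑ ^ q'
      ≤ ∫⁻ x in E, 2 ^ (q' - 1) * (‖H.z x‖ₑ ^ q' + ‖H.g' x‖ₑ ^ q') := by
        refine lintegral_mono fun x => ?_
        refine (ENNReal.rpow_le_rpow enorm_sub_le hq0.le).trans ?_
        exact ENNReal.rpow_add_le_mul_rpow_add_rpow _ _ H.one_le_q'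
    _ = 2 ^ (q' - 1) * ((∫⁻ x in E, ‖H.z x‖ₑ ^ q') + ∫⁻ x in E, ‖H.g' x‖ₑ ^ q') := by
        have h1 := H.nice_z.meas
        have h2 := H.nice_g'.meas
        rw [lintegral_const_mul _ (by fun_prop), lintegral_add_left (by fun_prop)]
    _ ≤ 2 ^ (q' - 1) * (2 ^ n * H.Y * V + ((4 ^ n * H.Y) ^ (1 / q')) ^ q' * (3 ^ n * V)) := by
        refine mul_le_mul_right (add_le_add ((H.setLIntegral_z_le E).trans hE) ?_) _
        exact (setLIntegral_rpow_le_const H.enorm_g'_le hq0.le E).trans (mul_le_mul_right hV _)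
    _ = _ := by
        rw [← ENNReal.rpow_mul, one_div, inv_mul_cancel₀ hq0.ne', ENNReal.rpow_one]; ring

/-- `g` is bounded, so it can be measured in `L^q`, while `z - g'` is controlled only in `L^(q')`;
here the `L^q` bound is used. -/
theorem enorm_pairing_good_le {q : ℝ} (hq : q.HolderConjugate q')
    {J : Finset ℤ} {ε : ℤ → ℂ} {C : ℝ≥0}
    (hC : ∀ (J : Finset ℤ) (f : Euc n → ℂ), Nice f →
      ∫⁻ x, ‖D.trunc 1 J ε f x‖ₑ ^ q ≤ C * ∫⁻ x, ‖f x‖ₑ ^ q) :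
    ‖∑ j ∈ J, ε j * ∫ x, D.op (1 * 2 ^ j) (H.kept H.g j) x * (H.z x - H.g' x)‖ₑ ≤
      2 * ((C : ℝ≥0∞) ^ (1 / q) * (((2 ^ n * H.X) ^ (1 / p)) ^ q) ^ (1 / q) *
        (2 ^ (q' - 1) * (2 ^ n * H.Y + 4 ^ n * H.Y * 3 ^ n)) ^ (1 / q') * vol n H.i₀) := by
  refine H.enorm_sum_integral_kept_le hq hC H.nice_g H.nice_bad' (fun x => H.g_eq_zero)
    (fun i y hy => ?_) (fun i y hy => ?_) ?_ ?_
  · refine (setLIntegral_rpow_le_const H.enorm_g_le hq.nonneg _).trans (le_of_eq ?_)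
    rw [volume_cell]
  · have h1 := Finset.mem_Icc.1 (H.mem_T_of_mem_A hy.1)
    exact H.setLIntegral_bad'_le (setLIntegral_tripleCell_le hy.2 hy.1 le_rfl (by omega))
      (volume_tripleCell _ _ _).le
  · rw [lintegral_eq_setLIntegral H.measurableSet_Q₀ (fun x => H.g_eq_zero) hq.pos]
    refine (setLIntegral_rpow_le_const H.enorm_g_le hq.nonneg _).trans (le_of_eq ?_)
    rw [H.volume_Q₀]
  · rw [lintegral_eq_setLIntegral H.measurableSet_Q₃ (f := fun x => H.z x - H.g' x)
      (fun x hx => by simp only [H.z_eq_zero hx, H.g'_eq_zero hx, sub_zero]) hq.symm.pos]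
    exact H.setLIntegral_bad'_le (H.top₂.trans (mul_le_mul_left (le_two_pow_mul _) _))
      H.volume_Q₃.le

end StepData

end

end SparseRadon

/-! ### Oscillating parts in one step -/

namespace SparseRadon

noncomputable section

variable {n : ℕ}

namespace StepData

variable {p q p' q' : ℝ} (H : StepData n p q')

/-- The oscillating part of `w` at scale `i`, restricted to `E`. -/
def bad (E : Set (Euc n)) (i : ℤ) : Euc n → ℂ := osc H.a i ((H.A i ∩ E).indicator H.w)

/-- The oscillating part of `z` at scale `i`, restricted to `E`. -/
def bad' (E : Set (Euc n)) (i : ℤ) : Euc n → ℂ := osc H.a i ((H.A' i ∩ E).indicator H.z)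

variable {E E' : Set (Euc n)}

theorem nice_pre (hE : MeasurableSet E) (i : ℤ) : Nice ((H.A i ∩ E).indicator H.w) :=
  H.nice_w.indicator ((measurableSet_topSet i).inter hE)

theorem nice_pre' (hE : MeasurableSet E) (i : ℤ) : Nice ((H.A' i ∩ E).indicator H.z) :=
  H.nice_z.indicator ((measurableSet_topSet i).inter hE)

theorem nice_bad (hE : MeasurableSet E) (i : ℤ) : Nice (H.bad E i) := (H.nice_pre hE i).osc _ _

theorem nice_osc' (hE : MeasurableSet E) (i : ℤ) : Nice (H.bad' E i) := (H.nice_pre' hE i).osc _ _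

variable {H}

theorem mem_of_bad_ne_zero {i : ℤ} {x : Euc n} (hx : H.bad E i x ≠ 0) : x ∈ H.A i ∩ H.Q₀ := by
  have h1 : x ∈ H.A i := by
    by_contra h
    refine hx (osc_eq_zero _ _ fun y hy => Set.indicator_of_notMem (fun hy' => h ?_) _)
    exact H.sat_A i y x hy hy'.1
  have hi := Finset.mem_Icc.1 (H.mem_T_of_mem_A h1)
  refine ⟨h1, by_contra fun h => hx (osc_eq_zero _ _ fun y hy => ?_)⟩
  have h2 : H.w y = 0 := H.w_eq_zero fun hy' => h (H.sat_Q₀ (by omega) y x hy hy')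
  exact Set.indicator_apply_eq_zero.2 fun _ => h2

theorem mem_of_bad'_ne_zero {i : ℤ} {x : Euc n} (hx : H.bad' E i x ≠ 0) : x ∈ H.A' i := by
  by_contra h
  refine hx (osc_eq_zero _ _ fun y hy => Set.indicator_of_notMem (fun hy' => h ?_) _)
  exact H.sat_A' i y x hy hy'.1

variable (H)

theorem bad_eq_zero {i : ℤ} (hi : i < H.L) : H.bad E i = fun _ => 0 := by
  funext x
  by_contra h
  have := Finset.mem_Icc.1 (H.mem_T_of_mem_A (mem_of_bad_ne_zero h).1)
  omega

theorem bad'_eq_zero {i : ℤ} (hi : i < H.L) : H.bad' E i = fun _ => 0 := by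
  funext x
  by_contra h
  have := Finset.mem_Icc.1 (H.mem_T_of_mem_A' (mem_of_bad'_ne_zero h))
  omega

theorem indicator_w_eq (i : ℤ) (x : Euc n) :
    (H.A i).indicator H.w x = (H.A i).indicator H.g x + H.bad Set.univ i x := by
  rw [bad, Set.inter_univ, osc_indicator (H.sat_A i)]
  by_cases hx : x ∈ H.A i
  · rw [Set.indicator_of_mem hx, Set.indicator_of_mem hx, Set.indicator_of_mem hx, g,
      goodPart_of_mem hx, osc]
    ring
  · simp [hx]

theorem kept_w_eq (j : ℤ) (x : Euc n) :
    H.kept H.w j x = H.kept H.g j x + ∑ i ∈ H.T with i ≤ j, H.bad Set.univ i x := by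
  rw [kept, kept, ← Finset.sum_add_distrib]
  exact Finset.sum_congr rfl fun i _ => H.indicator_w_eq i x

theorem z_sub_g'_eq (x : Euc n) : H.z x - H.g' x = ∑ i ∈ H.T, H.bad' Set.univ i x := by
  rw [sub_eq_iff_eq_add', g', T]
  simp only [bad', Set.inter_univ]
  exact eq_goodPart_add (show H.L ≤ H.i₀ - 1 by have := H.hL; omega) x

theorem bad_add_compl (hE : MeasurableSet E) (i : ℤ) (x : Euc n) :
    H.bad Set.univ i x = H.bad E i x + H.bad Eᶜ i x := by
  rw [bad, bad, bad, ← osc_add _ _ (H.nice_pre hE i) (H.nice_pre hE.compl i), Set.inter_univ]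
  congr 1
  funext y
  exact indicator_eq_inter_add_inter_compl _ _ _ _

theorem bad'_add_compl (hE : MeasurableSet E) (i : ℤ) (x : Euc n) :
    H.bad' Set.univ i x = H.bad' E i x + H.bad' Eᶜ i x := by
  rw [bad', bad', bad', ← osc_add _ _ (H.nice_pre' hE i) (H.nice_pre' hE.compl i), Set.inter_univ]
  congr 1
  funext y
  exact indicator_eq_inter_add_inter_compl _ _ _ _

variable {D : DensityData n} {A : ℝ≥0}

/-- By `notMem_A'` the supports are separated. Both depths `j - i` and `j - i'` are therefore
nonnegative in all surviving terms. -/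
theorem integral_op_bad_mul_bad'_eq_zero {i j i' : ℤ} (hij : i ≤ j) (hji' : j < i') :
    ∫ x, D.op (1 * 2 ^ j) (H.bad E i) x * H.bad' E' i' x = 0 := by
  have h : ∀ x, D.op (1 * 2 ^ j) (H.bad E i) x * H.bad' E' i' x = 0 := by
    intro x
    by_contra hne
    obtain ⟨y, hy, hxy⟩ := DensityData.exists_ne_zero_of_op_ne_zero (by simp) le_rfl
      (left_ne_zero_of_mul hne) H.a
    have h1 := mem_of_bad_ne_zero hy
    exact notMem_A' h1.2 h1.1 hij hxy hji' (mem_of_bad'_ne_zero (right_ne_zero_of_mul hne))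
  simp only [h, integral_zero]

theorem integral_bad_eq {j : ℤ} (hj : j < H.i₀) {N : ℕ} (hN : H.i₀ ≤ H.L + N) :
    ∫ x, D.op (1 * 2 ^ j) (fun x => ∑ i ∈ H.T with i ≤ j, H.bad Set.univ i x) x *
        (H.z x - H.g' x) =
      ∑ k ∈ Finset.range N, ∑ l ∈ Finset.range N,
        ∫ x, D.op (1 * 2 ^ j) (H.bad Set.univ (j - k)) x * H.bad' Set.univ (j - l) x := by
  have hb := fun i => H.nice_bad MeasurableSet.univ i
  have hb' := fun i => H.nice_osc' MeasurableSet.univ i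
  have hint : ∀ i i', Integrable (fun x => D.op (1 * 2 ^ j) (H.bad Set.univ i) x *
      H.bad' Set.univ i' x) := fun i i' => ((D.op_nice (hb i) _).mul (hb' i')).integrable
  simp_rw [z_sub_g'_eq, D.op_sum fun i _ => hb i, Finset.sum_mul_sum]
  rw [integral_finsetSum _ fun i _ => integrable_finsetSum _ fun i' _ => hint i i']
  have h1 : ∀ i ∈ H.T.filter (· ≤ j), ∫ x, ∑ i' ∈ H.T, D.op (1 * 2 ^ j) (H.bad Set.univ i) x *
      H.bad' Set.univ i' x = ∑ l ∈ Finset.range N,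
        ∫ x, D.op (1 * 2 ^ j) (H.bad Set.univ i) x * H.bad' Set.univ (j - l) x := by
    intro i hi
    rw [integral_finsetSum _ fun i' _ => hint i i']
    rw [← sum_range_sub_eq (L := H.L) (U := H.i₀ - 1) (j := j) (N := N)
      (F := fun i' => ∫ x, D.op (1 * 2 ^ j) (H.bad Set.univ i) x * H.bad' Set.univ i' x)
      (fun i' hi' => by simp [H.bad'_eq_zero hi']) (by omega) (by omega), Finset.sum_filter]
    refine Finset.sum_congr rfl fun i' _ => ?_
    split_ifs with h
    · rfl
    · exact H.integral_op_bad_mul_bad'_eq_zero (Finset.mem_filter.1 hi).2 (not_le.1 h)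
  rw [Finset.sum_congr rfl h1]
  exact sum_range_sub_eq (L := H.L) (U := H.i₀ - 1) (j := j) (N := N)
    (F := fun i => ∑ l ∈ Finset.range N,
      ∫ x, D.op (1 * 2 ^ j) (H.bad Set.univ i) x * H.bad' Set.univ (j - l) x)
    (fun i hi => by simp [H.bad_eq_zero hi, D.op_zero]) (by omega) (by omega)

theorem sum_lintegral_bad_le (hE : MeasurableSet E) (J : Finset ℤ) (k : ℤ) {r : ℝ} (hr : 1 ≤ r) :
    ∑ j ∈ J, ∫⁻ x, ‖H.bad E (j - k) x‖ₑ ^ r ≤ 2 ^ r * ∫⁻ x in E, ‖H.w x‖ₑ ^ r := by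
  refine (Finset.sum_le_sum fun j _ => lintegral_osc_rpow_le _ _ (H.nice_pre hE _).meas hr).trans ?_
  rw [← Finset.mul_sum]
  exact mul_le_mul_right (sum_lintegral_indicator_topSet_le hE _ (by linarith) J k) _

theorem sum_lintegral_bad'_le (hE : MeasurableSet E) (J : Finset ℤ) (k : ℤ) {r : ℝ} (hr : 1 ≤ r) :
    ∑ j ∈ J, ∫⁻ x, ‖H.bad' E (j - k) x‖ₑ ^ r ≤ 2 ^ r * ∫⁻ x in E, ‖H.z x‖ₑ ^ r := by
  refine (Finset.sum_le_sum fun j _ =>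
    lintegral_osc_rpow_le _ _ (H.nice_pre' hE _).meas hr).trans ?_
  rw [← Finset.mul_sum]
  exact mul_le_mul_right (sum_lintegral_indicator_topSet_le hE _ (by linarith) J k) _

theorem setLIntegral_w_inter_le (E : Set (Euc n)) :
    ∫⁻ x in E, ‖H.w x‖ₑ ^ p ≤ ∫⁻ x in H.Q₀ ∩ E, ‖H.f₁ x‖ₑ ^ p := by
  have hp0 : 0 < p := by linarith [H.one_le_p]
  simp only [w, enorm_indicator_rpow _ _ hp0]
  rw [setLIntegral_indicator H.measurableSet_Q₀]
  exact lintegral_mono fun x => ENNReal.rpow_le_rpow (H.le₁ x) hp0.le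

theorem setLIntegral_z_inter_le (E : Set (Euc n)) :
    ∫⁻ x in E, ‖H.z x‖ₑ ^ q' ≤ ∫⁻ x in H.Q₃ ∩ E, ‖H.f₂ x‖ₑ ^ q' := by
  have hp0 : 0 < q' := by linarith [H.one_le_q']
  simp only [z, enorm_indicator_rpow _ _ hp0]
  rw [setLIntegral_indicator H.measurableSet_Q₃]
  exact lintegral_mono fun x => ENNReal.rpow_le_rpow (H.le₂ x) hp0.le

variable {J : Finset ℤ}

theorem sum_large_left_le (hI : D.Improves p q A) (hq : q.HolderConjugate q')
    (hp : p.HolderConjugate p') (hpq : p < q) (hJ : ∀ j ∈ J, j < H.i₀) (hE : MeasurableSet E)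
    (hE' : MeasurableSet E') (k l : ℕ) :
    ∑ j ∈ J, ‖∫ x, D.op (1 * 2 ^ j) (H.bad E (j - k)) x * H.bad' E' (j - l) x‖ₑ ≤
      A * ((2 ^ q' * (2 ^ n * H.Y)) ^ (1 / p - 1 / q) *
        ((2 ^ p * ∫⁻ x in H.Q₀ ∩ E, ‖H.f₁ x‖ₑ ^ p) ^ (1 / p) *
          (3 ^ n * (2 ^ q' * (H.Y * vol n H.i₀))) ^ (1 / p'))) := by
  refine (hI.sum_enorm_integral_le_left (a := H.a) hq hp hpq (fun j => H.nice_bad hE (j - k))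
    (fun j => H.nice_osc' hE' (j - l)) (Y := 2 ^ q' * (2 ^ n * H.Y))
    (fun j hj x hx => ?_)).trans ?_
  · have h1 := mem_of_bad_ne_zero hx
    have h2 : Sat H.a (j - l) (tripleCell H.a j (idx H.a j x)) :=
      (sat_tripleCell j _).mono (by omega)
    refine (setLIntegral_osc_rpow_le h2 (H.nice_pre' hE' _).meas H.one_le_q').trans ?_
    rw [mul_assoc]
    refine mul_le_mul_right (le_trans (lintegral_mono fun y => ?_)
      (setLIntegral_tripleCell_le h1.2 h1.1 (by omega) (hJ j hj))) _
    exact ENNReal.rpow_le_rpow ((enorm_indicator_le_enorm_self _ _).trans (H.enorm_z_le y))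
      (by linarith [H.one_le_q'])
  · refine mul_le_mul_right (mul_le_mul_right (mul_le_mul' (ENNReal.rpow_le_rpow ?_
      hp.one_div_nonneg) (ENNReal.rpow_le_rpow ?_ hp.symm.one_div_nonneg)) _) _
    · exact (H.sum_lintegral_bad_le hE J k H.one_le_p).trans
        (mul_le_mul_right (H.setLIntegral_w_inter_le E) _)
    · rw [← Finset.mul_sum]
      refine mul_le_mul_right ((H.sum_lintegral_bad'_le hE' J l H.one_le_q').trans
        (mul_le_mul_right ?_ _)) _
      exact (setLIntegral_le_lintegral _ _).trans H.lintegral_z_le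

theorem sum_large_right_le (hI : D.Improves p q A) (hq : q.HolderConjugate q')
    (hp : p.HolderConjugate p') (hpq : p < q) (hJ : ∀ j ∈ J, j < H.i₀) (hE : MeasurableSet E)
    (hE' : MeasurableSet E') (k l : ℕ) :
    ∑ j ∈ J, ‖∫ x, D.op (1 * 2 ^ j) (H.bad E (j - k)) x * H.bad' E' (j - l) x‖ₑ ≤
      A * ((2 ^ p * (2 ^ n * H.X)) ^ (1 / p - 1 / q) *
        ((2 ^ p * (H.X * vol n H.i₀)) ^ (1 / q) *
          (3 ^ n * (2 ^ q' * ∫⁻ x in H.Q₃ ∩ E', ‖H.f₂ x‖ₑ ^ q')) ^ (1 / q'))) := by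
  refine (hI.sum_enorm_integral_le_right (a := H.a) hq hp hpq (fun j => H.nice_bad hE (j - k))
    (fun j => H.nice_osc' hE' (j - l)) (X := 2 ^ p * (2 ^ n * H.X))
    (fun j hj x hx => ?_)).trans ?_
  · have h1 := mem_of_bad_ne_zero hx
    have h2 : Sat H.a (j - k) (cell H.a j (idx H.a j x)) := (sat_cell j _).mono (by omega)
    refine (setLIntegral_osc_rpow_le h2 (H.nice_pre hE _).meas H.one_le_p).trans ?_
    rw [mul_assoc]
    refine mul_le_mul_right (le_trans (lintegral_mono fun y => ?_)
      (setLIntegral_cell_le h1.2 h1.1 (by omega) (hJ j hj))) _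
    exact ENNReal.rpow_le_rpow ((enorm_indicator_le_enorm_self _ _).trans (H.enorm_w_le y))
      (by linarith [H.one_le_p])
  · refine mul_le_mul_right (mul_le_mul_right (mul_le_mul' (ENNReal.rpow_le_rpow ?_
      hq.one_div_nonneg) (ENNReal.rpow_le_rpow ?_ hq.symm.one_div_nonneg)) _) _
    · refine (H.sum_lintegral_bad_le hE J k H.one_le_p).trans (mul_le_mul_right ?_ _)
      exact (setLIntegral_le_lintegral _ _).trans H.lintegral_w_le
    · rw [← Finset.mul_sum]
      exact mul_le_mul_right ((H.sum_lintegral_bad'_le hE' J l H.one_le_q').trans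
        (mul_le_mul_right (H.setLIntegral_z_inter_le E') _)) _

/-- For fixed depth `k` the sets `A (j - k)` are disjoint in `j`, so the number of scales does not
enter. -/
theorem sum_lintegral_pre_sq_le (hE : MeasurableSet E) {t : ℝ≥0∞} (ht : ∀ x ∈ E, ‖H.f₁ x‖ₑ ≤ t)
    (k : ℤ) : ∑ j ∈ J, ∫⁻ x, ‖(H.A (j - k) ∩ E).indicator H.w x‖ₑ ^ (2 : ℝ) ≤
      t ^ (2 : ℝ) * vol n H.i₀ := by
  refine (sum_lintegral_indicator_topSet_le hE _ two_pos J k).trans ?_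
  simp only [w, enorm_indicator_rpow _ _ (two_pos : (0 : ℝ) < 2)]
  rw [setLIntegral_indicator H.measurableSet_Q₀, ← H.volume_Q₀]
  calc ∫⁻ x in H.Q₀ ∩ E, ‖H.u x‖ₑ ^ (2 : ℝ) ≤ ∫⁻ _ in H.Q₀ ∩ E, t ^ (2 : ℝ) := by
        refine setLIntegral_mono' (H.measurableSet_Q₀.inter hE) fun x hx => ?_
        exact ENNReal.rpow_le_rpow ((H.le₁ x).trans (ht x hx.2)) two_pos.le
    _ ≤ _ := by
        rw [setLIntegral_const]
        exact mul_le_mul_right (measure_mono Set.inter_subset_left) _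

theorem sum_lintegral_pre'_sq_le (hE : MeasurableSet E) {t : ℝ≥0∞} (ht : ∀ x ∈ E, ‖H.f₂ x‖ₑ ≤ t)
    (k : ℤ) : ∑ j ∈ J, ∫⁻ x, ‖(H.A' (j - k) ∩ E).indicator H.z x‖ₑ ^ (2 : ℝ) ≤
      t ^ (2 : ℝ) * (3 ^ n * vol n H.i₀) := by
  refine (sum_lintegral_indicator_topSet_le hE _ two_pos J k).trans ?_
  simp only [z, enorm_indicator_rpow _ _ (two_pos : (0 : ℝ) < 2)]
  rw [setLIntegral_indicator H.measurableSet_Q₃, ← H.volume_Q₃]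
  calc ∫⁻ x in H.Q₃ ∩ E, ‖H.v x‖ₑ ^ (2 : ℝ) ≤ ∫⁻ _ in H.Q₃ ∩ E, t ^ (2 : ℝ) := by
        refine setLIntegral_mono' (H.measurableSet_Q₃.inter hE) fun x hx => ?_
        exact ENNReal.rpow_le_rpow ((H.le₂ x).trans (ht x hx.2)) two_pos.le
    _ ≤ _ := by
        rw [setLIntegral_const]
        exact mul_le_mul_right (measure_mono Set.inter_subset_left) _

/-- `E` and `E'` will be the sets where `f₁` and `f₂` are below their thresholds: either both are
below, or only `f₂` is above, or `f₁` is above and `f₂` may remain uncut. -/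
theorem sum_bad_le_add (hE : MeasurableSet E) (hE' : MeasurableSet E') (k l : ℤ) :
    ∑ j ∈ J, ‖∫ x, D.op (1 * 2 ^ j) (H.bad Set.univ (j - k)) x * H.bad' Set.univ (j - l) x‖ₑ ≤
      (∑ j ∈ J, ‖∫ x, D.op (1 * 2 ^ j) (H.bad E (j - k)) x * H.bad' E' (j - l) x‖ₑ) +
      ((∑ j ∈ J, ‖∫ x, D.op (1 * 2 ^ j) (H.bad E (j - k)) x * H.bad' E'ᶜ (j - l) x‖ₑ) +
      ∑ j ∈ J, ‖∫ x, D.op (1 * 2 ^ j) (H.bad Eᶜ (j - k)) x * H.bad' Set.univ (j - l) x‖ₑ) := by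
  rw [← Finset.sum_add_distrib, ← Finset.sum_add_distrib]
  refine Finset.sum_le_sum fun j _ => ?_
  have n1 := D.op_nice (H.nice_bad hE (j - k)) (1 * 2 ^ j)
  have n2 := D.op_nice (H.nice_bad hE.compl (j - k)) (1 * 2 ^ j)
  have n3 := H.nice_osc' hE' (j - l)
  have n4 := H.nice_osc' hE'.compl (j - l)
  have n5 := H.nice_osc' MeasurableSet.univ (j - l)
  have h1 : ∀ x, D.op (1 * 2 ^ j) (H.bad Set.univ (j - k)) x * H.bad' Set.univ (j - l) x =
      D.op (1 * 2 ^ j) (H.bad E (j - k)) x * H.bad' E' (j - l) x +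
      (D.op (1 * 2 ^ j) (H.bad E (j - k)) x * H.bad' E'ᶜ (j - l) x +
      D.op (1 * 2 ^ j) (H.bad Eᶜ (j - k)) x * H.bad' Set.univ (j - l) x) := by
    intro x
    have h2 : H.bad Set.univ (j - k) = fun x => H.bad E (j - k) x + H.bad Eᶜ (j - k) x :=
      funext fun x => H.bad_add_compl hE _ x
    rw [h2, D.op_add (H.nice_bad hE _) (H.nice_bad hE.compl _), H.bad'_add_compl hE']
    ring
  simp_rw [h1]
  rw [integral_add (n1.mul n3).integrable ((n1.mul n4).add (n2.mul n5)).integrable,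
    integral_add (n1.mul n4).integrable (n2.mul n5).integrable]
  exact (enorm_add_le _ _).trans (add_le_add_right (enorm_add_le _ _) _)

end StepData

end

end SparseRadon

/-! ### Assembling the bound for one step -/

namespace SparseRadon

noncomputable section

variable {n : ℕ}

theorem ENNReal.rpow_one_div_le_of_le {p : ℝ} (hp : 0 < p) {X t : ℝ≥0∞} {c : ℝ≥0}
    (h : X ≤ c * t ^ p) : X ^ (1 / p) ≤ (c ^ (1 / p) : ℝ≥0) * t := by
  refine (ENNReal.rpow_le_rpow h (by positivity)).trans (le_of_eq ?_)
  rw [ENNReal.mul_rpow_of_nonneg _ _ (by positivity), ENNReal.coe_rpow_of_nonneg _ (by positivity),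
    ← ENNReal.rpow_mul, mul_one_div_cancel hp.ne', ENNReal.rpow_one]

theorem ENNReal.sqrt_mul_sqrt_eq (s t c v : ℝ≥0∞) :
    (s ^ (2 : ℝ) * v) ^ (1 / 2 : ℝ) * (t ^ (2 : ℝ) * (c * v)) ^ (1 / 2 : ℝ) =
      s * t * c ^ (1 / 2 : ℝ) * v := by
  have h1 : ∀ x : ℝ≥0∞, (x ^ (2 : ℝ)) ^ (1 / 2 : ℝ) = x := fun x => by
    rw [← ENNReal.rpow_mul]; norm_num
  have h2 : v ^ (1 / 2 : ℝ) * v ^ (1 / 2 : ℝ) = v := by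
    rw [← ENNReal.rpow_add_of_nonneg _ _ (by norm_num) (by norm_num)]; norm_num
  rw [ENNReal.mul_rpow_of_nonneg _ _ (by norm_num), ENNReal.mul_rpow_of_nonneg _ _ (by norm_num),
    ENNReal.mul_rpow_of_nonneg _ _ (by norm_num), h1, h1]
  calc _ = s * t * c ^ (1 / 2 : ℝ) * (v ^ (1 / 2 : ℝ) * v ^ (1 / 2 : ℝ)) := by ring
    _ = _ := by rw [h2]

namespace StepData

variable {p q p' q' : ℝ} (H : StepData n p q') {D : DensityData n} {A : ℝ≥0}

/-- The dyadic cube on which the step takes place, as a cube. -/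
def Q : Cube n := dyadic H.a H.i₀ H.m₀

theorem carrier_Q : H.Q.carrier = H.Q₀ := carrier_dyadic _ _ _

theorem carrier_triple_Q : H.Q.triple.carrier = H.Q₃ := carrier_triple_dyadic _ _ _

variable {J : Finset ℤ} {κ : ℝ≥0} {t₁ t₂ : ℝ≥0∞}

theorem sum_large_left_le' (hI : D.Improves p q A) (hq : q.HolderConjugate q')
    (hp : p.HolderConjugate p') (hpq : p < q) (hJ : ∀ j ∈ J, j < H.i₀)
    (hY : H.Y ≤ κ * t₂ ^ q') {E E' : Set (Euc n)} (hE : MeasurableSet E) (hE' : MeasurableSet E')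
    (k l : ℕ) :
    ∑ j ∈ J, ‖∫ x, D.op (1 * 2 ^ j) (H.bad E (j - k)) x * H.bad' E' (j - l) x‖ₑ ≤
      (A * ((2 ^ p) ^ (1 / p) * (6 ^ n * 2 ^ q' * κ) ^ (1 / q')) : ℝ≥0) * (vol n H.i₀ * t₂ *
        ((∫⁻ x in H.Q.carrier ∩ E, ‖H.f₁ x‖ₑ ^ p) / volume H.Q.carrier) ^ (1 / p)) := by
  have hp0 := hp.pos
  have hq0 := hq.symm.pos
  have hc : 0 ≤ 1 / p - 1 / q := sub_nonneg.2 (one_div_le_one_div_of_le hp.pos hpq.le)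
  set v : ℝ≥0∞ := (vol n H.i₀ : ℝ≥0∞)
  set Tl := (∫⁻ x in H.Q.carrier ∩ E, ‖H.f₁ x‖ₑ ^ p) / volume H.Q.carrier with hTl
  have hT : ∫⁻ x in H.Q₀ ∩ E, ‖H.f₁ x‖ₑ ^ p = Tl * v := by
    rw [hTl, H.carrier_Q, H.volume_Q₀, ENNReal.div_mul_cancel (vol_ne_zero _) (by simp)]
  -- A common majorant for the local and the global constant of `f₂`, so that their powers recombine
  -- to the exponent `1/q'`.
  set Z : ℝ≥0∞ := 6 ^ n * 2 ^ q' * H.Y with hZ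
  have h23 : (6 : ℝ≥0∞) ^ n = 3 ^ n * 2 ^ n := by rw [← mul_pow]; norm_num
  have h3 : (1 : ℝ≥0∞) ≤ 3 ^ n := one_le_pow₀ (by norm_num)
  have h2 : (1 : ℝ≥0∞) ≤ 2 ^ n := one_le_pow₀ (by norm_num)
  have hZ1 : 2 ^ q' * (2 ^ n * H.Y) ≤ Z := by
    rw [hZ, h23]
    calc _ = 1 * 2 ^ n * 2 ^ q' * H.Y := by ring
      _ ≤ _ := by gcongr
  have hZ2 : 3 ^ n * (2 ^ q' * (H.Y * v)) ≤ Z * v := by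
    rw [hZ, h23]
    calc _ = 3 ^ n * 1 * 2 ^ q' * H.Y * v := by ring
      _ ≤ _ := by gcongr
  have hZle : Z ^ (1 / q') ≤ ((6 ^ n * 2 ^ q' * κ) ^ (1 / q') : ℝ≥0) * t₂ := by
    refine ENNReal.rpow_one_div_le_of_le hq0 ((mul_le_mul_right hY _).trans (le_of_eq ?_))
    push_cast
    rw [ENNReal.coe_rpow_of_nonneg _ hq0.le]
    push_cast; ring
  have hexp : 1 / q' = (1 / p - 1 / q) + 1 / p' := by
    have h1 := hp.inv_add_inv_eq_one
    have h2 := hq.inv_add_inv_eq_one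
    simp only [one_div]; linarith
  refine (H.sum_large_left_le hI hq hp hpq hJ hE hE' k l).trans ?_
  rw [hT]
  calc _ ≤ A * (Z ^ (1 / p - 1 / q) * ((2 ^ p * (Tl * v)) ^ (1 / p) * (Z * v) ^ (1 / p'))) :=
        mul_le_mul_right (mul_le_mul' (ENNReal.rpow_le_rpow hZ1 hc)
          (mul_le_mul_right (ENNReal.rpow_le_rpow hZ2 hp.symm.one_div_nonneg) _)) _
    _ = A * ((2 ^ p) ^ (1 / p) * Z ^ (1 / q') * (v * Tl ^ (1 / p))) := by
        rw [ENNReal.holder_split hp, hexp,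
          ENNReal.rpow_add_of_nonneg _ _ hc hp.symm.one_div_nonneg]
        ring
    _ ≤ A * ((2 ^ p) ^ (1 / p) * (((6 ^ n * 2 ^ q' * κ) ^ (1 / q') : ℝ≥0) * t₂) *
        (v * Tl ^ (1 / p))) := by gcongr
    _ = _ := by
        have h5 : (((2 ^ p) ^ (1 / p) : ℝ≥0) : ℝ≥0∞) = (2 ^ p) ^ (1 / p) := by
          rw [ENNReal.coe_rpow_of_nonneg _ (by positivity), ENNReal.coe_rpow_of_nonneg _ hp0.le]
          rfl
        rw [ENNReal.coe_mul, ENNReal.coe_mul, h5]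
        ring

theorem sum_large_right_le' (hI : D.Improves p q A) (hq : q.HolderConjugate q')
    (hp : p.HolderConjugate p') (hpq : p < q) (hJ : ∀ j ∈ J, j < H.i₀)
    (hX : H.X ≤ κ * t₁ ^ p) {E E' : Set (Euc n)} (hE : MeasurableSet E) (hE' : MeasurableSet E')
    (k l : ℕ) :
    ∑ j ∈ J, ‖∫ x, D.op (1 * 2 ^ j) (H.bad E (j - k)) x * H.bad' E' (j - l) x‖ₑ ≤
      (A * ((9 ^ n * 2 ^ q') ^ (1 / q') * (2 ^ n * 2 ^ p * κ) ^ (1 / p)) : ℝ≥0) *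
        (vol n H.i₀ * t₁ *
        ((∫⁻ x in H.Q.triple.carrier ∩ E', ‖H.f₂ x‖ₑ ^ q') /
          volume H.Q.triple.carrier) ^ (1 / q')) := by
  have hp0 := hp.pos
  have hq0 := hq.symm.pos
  have hc : 0 ≤ 1 / p - 1 / q := sub_nonneg.2 (one_div_le_one_div_of_le hp.pos hpq.le)
  set v : ℝ≥0∞ := (vol n H.i₀ : ℝ≥0∞) with hv
  set Tl := (∫⁻ x in H.Q.triple.carrier ∩ E', ‖H.f₂ x‖ₑ ^ q') / volume H.Q.triple.carrier with hTl
  have hT : ∫⁻ x in H.Q₃ ∩ E', ‖H.f₂ x‖ₑ ^ q' = Tl * (3 ^ n * v) := by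
    rw [hTl, ← H.volume_Q₃, ← H.carrier_triple_Q, ENNReal.div_mul_cancel
      (volume_carrier_ne_zero _) (volume_carrier_ne_top _)]
  set Z : ℝ≥0∞ := 2 ^ n * 2 ^ p * H.X with hZ
  have h2 : (1 : ℝ≥0∞) ≤ 2 ^ n := one_le_pow₀ (by norm_num)
  have hZ1 : 2 ^ p * (2 ^ n * H.X) = Z := by rw [hZ]; ring
  have hZ2 : 2 ^ p * (H.X * v) ≤ Z * v := by
    rw [hZ]
    calc _ = 1 * 2 ^ p * H.X * v := by ring
      _ ≤ _ := by gcongr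
  have hZle : Z ^ (1 / p) ≤ ((2 ^ n * 2 ^ p * κ) ^ (1 / p) : ℝ≥0) * t₁ := by
    refine ENNReal.rpow_one_div_le_of_le hp0 ((mul_le_mul_right hX _).trans (le_of_eq ?_))
    push_cast
    rw [ENNReal.coe_rpow_of_nonneg _ hp0.le]
    push_cast; ring
  have hexp : 1 / p = (1 / p - 1 / q) + 1 / q := by ring
  have h9 : (9 : ℝ≥0∞) ^ n = 3 ^ n * 3 ^ n := by rw [← mul_pow]; norm_num
  refine (H.sum_large_right_le hI hq hp hpq hJ hE hE' k l).trans ?_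
  rw [hT, hZ1, ← hv]
  have h6 : 3 ^ n * (2 ^ q' * (Tl * (3 ^ n * v))) = (9 ^ n * 2 ^ q') * (Tl * v) := by
    rw [h9]; ring
  rw [h6]
  calc _ ≤ A * (Z ^ (1 / p - 1 / q) * ((Z * v) ^ (1 / q) *
        ((9 ^ n * 2 ^ q') * (Tl * v)) ^ (1 / q'))) :=
        mul_le_mul_right (mul_le_mul_right
          (mul_le_mul_left (ENNReal.rpow_le_rpow hZ2 hq.one_div_nonneg) _) _) _
    _ = A * ((9 ^ n * 2 ^ q') ^ (1 / q') * Z ^ (1 / p) * (v * Tl ^ (1 / q'))) := by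
        rw [mul_comm ((Z * v) ^ (1 / q)), ENNReal.holder_split hq.symm, hexp,
          ENNReal.rpow_add_of_nonneg _ _ hc hq.one_div_nonneg]
        ring_nf
    _ ≤ A * ((9 ^ n * 2 ^ q') ^ (1 / q') * (((2 ^ n * 2 ^ p * κ) ^ (1 / p) : ℝ≥0) * t₁) *
        (v * Tl ^ (1 / q'))) := by gcongr
    _ = _ := by
        have h5 : (((9 ^ n * 2 ^ q') ^ (1 / q') : ℝ≥0) : ℝ≥0∞) = (9 ^ n * 2 ^ q') ^ (1 / q') := by
          rw [ENNReal.coe_rpow_of_nonneg _ (by positivity), ENNReal.coe_mul,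
            ENNReal.coe_rpow_of_nonneg _ hq0.le]
          push_cast; rfl
        rw [ENNReal.coe_mul, ENNReal.coe_mul, h5]
        ring

theorem pairing_good_le {p' : ℝ} (hp : p.HolderConjugate p') (hq : q.HolderConjugate q')
    (κ C₁ C₂ : ℝ≥0) : ∃ C : ℝ≥0, ∀ (H : StepData n p q') (J : Finset ℤ) (ε : ℤ → ℂ)
      (t₁ t₂ : ℝ≥0∞), H.X ≤ κ * t₁ ^ p → H.Y ≤ κ * t₂ ^ q' →
      (∀ (J : Finset ℤ) (f : Euc n → ℂ), Nice f →
        ∫⁻ x, ‖D.trunc 1 J ε f x‖ₑ ^ p ≤ C₁ * ∫⁻ x, ‖f x‖ₑ ^ p) →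
      (∀ (J : Finset ℤ) (f : Euc n → ℂ), Nice f →
        ∫⁻ x, ‖D.trunc 1 J ε f x‖ₑ ^ q ≤ C₂ * ∫⁻ x, ‖f x‖ₑ ^ q) →
      ‖∑ j ∈ J, ε j * ∫ x, D.op (1 * 2 ^ j) (H.kept H.w j) x * H.g' x‖ₑ +
      ‖∑ j ∈ J, ε j * ∫ x, D.op (1 * 2 ^ j) (H.kept H.g j) x * (H.z x - H.g' x)‖ₑ ≤
        C * (vol n H.i₀ * t₁ * t₂) := by
  have hp0 := hp.pos
  have hq0 := hq.symm.pos
  set a₁ : ℝ≥0 := (2 ^ n * κ) ^ (1 / p)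
  set a₂ : ℝ≥0 := (4 ^ n * κ) ^ (1 / q')
  set a₃ : ℝ≥0 := (3 ^ n * a₂ ^ p') ^ (1 / p')
  set a₄ : ℝ≥0 := (2 ^ (q' - 1) * (2 ^ n + 12 ^ n) * κ) ^ (1 / q')
  refine ⟨2 * (C₁ ^ (1 / p) * a₁ * a₃) + 2 * (C₂ ^ (1 / q) * a₁ * a₄),
    fun H J ε t₁ t₂ hX hY hC₁ hC₂ => ?_⟩
  have h1 : (2 ^ n * H.X) ^ (1 / p) ≤ a₁ * t₁ := by
    refine ENNReal.rpow_one_div_le_of_le hp0 ((mul_le_mul_right hX _).trans (le_of_eq ?_))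
    push_cast; ring
  have h2 : (4 ^ n * H.Y) ^ (1 / q') ≤ a₂ * t₂ := by
    refine ENNReal.rpow_one_div_le_of_le hq0 ((mul_le_mul_right hY _).trans (le_of_eq ?_))
    push_cast; ring
  have h3 : (((4 ^ n * H.Y) ^ (1 / q')) ^ p' * 3 ^ n) ^ (1 / p') ≤ a₃ * t₂ := by
    refine ENNReal.rpow_one_div_le_of_le hp.symm.pos
      ((mul_le_mul_left (ENNReal.rpow_le_rpow h2 hp.symm.nonneg) _).trans (le_of_eq ?_))
    rw [ENNReal.mul_rpow_of_nonneg _ _ hp.symm.nonneg, ENNReal.coe_mul,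
      ENNReal.coe_rpow_of_nonneg _ hp.symm.nonneg]
    push_cast; ring
  have h4 : (2 ^ (q' - 1) * (2 ^ n * H.Y + 4 ^ n * H.Y * 3 ^ n)) ^ (1 / q') ≤ a₄ * t₂ := by
    refine ENNReal.rpow_one_div_le_of_le hq0 ?_
    have h5 : (12 : ℝ≥0∞) ^ n = 4 ^ n * 3 ^ n := by rw [← mul_pow]; norm_num
    calc _ = 2 ^ (q' - 1) * (2 ^ n + 12 ^ n) * H.Y := by rw [h5]; ring
      _ ≤ 2 ^ (q' - 1) * (2 ^ n + 12 ^ n) * (κ * t₂ ^ q') := mul_le_mul_right hY _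
      _ = _ := by
          rw [ENNReal.coe_mul, ENNReal.coe_mul,
            ENNReal.coe_rpow_of_nonneg _ (by linarith [H.one_le_q'])]
          push_cast; ring
  have h6 : (((2 ^ n * H.X) ^ (1 / p)) ^ q) ^ (1 / q) ≤ a₁ * t₁ := by
    rwa [← ENNReal.rpow_mul _ q, mul_one_div_cancel hq.ne_zero, ENNReal.rpow_one]
  have h7 : ((C₁ ^ (1 / p) : ℝ≥0) : ℝ≥0∞) = (C₁ : ℝ≥0∞) ^ (1 / p) :=
    ENNReal.coe_rpow_of_nonneg _ hp.one_div_nonneg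
  have h8 : ((C₂ ^ (1 / q) : ℝ≥0) : ℝ≥0∞) = (C₂ : ℝ≥0∞) ^ (1 / q) :=
    ENNReal.coe_rpow_of_nonneg _ hq.one_div_nonneg
  refine (add_le_add (H.enorm_pairing_good'_le hp hC₁) (H.enorm_pairing_good_le hq hC₂)).trans ?_
  calc _ ≤ 2 * ((C₁ : ℝ≥0∞) ^ (1 / p) * (a₁ * t₁) * (a₃ * t₂) * vol n H.i₀) +
        2 * ((C₂ : ℝ≥0∞) ^ (1 / q) * (a₁ * t₁) * (a₄ * t₂) * vol n H.i₀) := by gcongr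
    _ = _ := by
        rw [← h7, ← h8]
        push_cast; ring

/-- With `M = max k l`, the gain is `θ^(-4M)` and each of the two truncation heights costs `θ^M`.
What remains is `θ^(-2M) ≤ θ^(-k) θ^(-l)`, summable in both depths. -/
theorem sum_small_le {C : ℝ≥0} {θ : ℝ≥0} {β : ℝ} (hθ0 : θ ≠ 0)
    (hθ : ((2 : ℝ≥0∞) ^ (-β)) ^ (1 / 2 : ℝ) = ((θ : ℝ≥0∞)⁻¹) ^ 4)
    (hC : ∀ (s : ℝ) (J : Finset ℤ) (k l : ℕ) (a : Fin n → ℝ) (b b' : ℤ → Euc n → ℂ), |s| = 1 →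
      (∀ j, Nice (b j)) → (∀ j, Nice (b' j)) →
      ∑ j ∈ J, ‖∫ x, D.op (s * 2 ^ j) (osc a (j - k) (b j)) x * osc a (j - l) (b' j) x‖ₑ ≤
        C * (((2 : ℝ≥0∞) ^ (-β)) ^ max k l) ^ (1 / 2 : ℝ) *
          ((∑ j ∈ J, ∫⁻ x, ‖b j x‖ₑ ^ (2 : ℝ)) ^ (1 / 2 : ℝ) *
            (∑ j ∈ J, ∫⁻ x, ‖b' j x‖ₑ ^ (2 : ℝ)) ^ (1 / 2 : ℝ))) (hθ1 : 1 ≤ θ) (k l : ℕ)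
    {E E' : Set (Euc n)} (hE : MeasurableSet E) (hE' : MeasurableSet E')
    (ht₁ : ∀ x ∈ E, ‖H.f₁ x‖ₑ ≤ (θ : ℝ≥0∞) ^ max k l * t₁)
    (ht₂ : ∀ x ∈ E', ‖H.f₂ x‖ₑ ≤ (θ : ℝ≥0∞) ^ max k l * t₂) :
    ∑ j ∈ J, ‖∫ x, D.op (1 * 2 ^ j) (H.bad E (j - k)) x * H.bad' E' (j - l) x‖ₑ ≤
      (C * (3 ^ n) ^ (1 / 2 : ℝ) : ℝ≥0) * (vol n H.i₀ * t₁ * t₂) *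
        (((θ : ℝ≥0∞)⁻¹) ^ k * ((θ : ℝ≥0∞)⁻¹) ^ l) := by
  have hθ0' : (θ : ℝ≥0∞) ≠ 0 := by simpa using hθ0
  refine (hC 1 J k l H.a _ _ (by simp) (fun j => H.nice_pre hE (j - k))
    (fun j => H.nice_pre' hE' (j - l))).trans ?_
  refine (mul_le_mul_right (mul_le_mul'
    (ENNReal.rpow_le_rpow (H.sum_lintegral_pre_sq_le hE ht₁ k) (by norm_num))
    (ENNReal.rpow_le_rpow (H.sum_lintegral_pre'_sq_le hE' ht₂ l) (by norm_num))) _).trans ?_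
  have hcomm : (((2 : ℝ≥0∞) ^ (-β)) ^ max k l) ^ (1 / 2 : ℝ) =
      (((2 : ℝ≥0∞) ^ (-β)) ^ (1 / 2 : ℝ)) ^ max k l := by
    rw [← ENNReal.rpow_natCast, ← ENNReal.rpow_natCast, ← ENNReal.rpow_mul, ← ENNReal.rpow_mul,
      ← ENNReal.rpow_mul, ← ENNReal.rpow_mul]
    congr 1; ring
  rw [ENNReal.sqrt_mul_sqrt_eq, hcomm, hθ]
  set M := max k l
  set τ : ℝ≥0∞ := (θ : ℝ≥0∞)⁻¹
  have hτ1 : τ ≤ 1 := ENNReal.inv_le_one.2 (by exact_mod_cast hθ1)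
  have h1 : (τ ^ 4) ^ M * (θ : ℝ≥0∞) ^ M * (θ : ℝ≥0∞) ^ M = τ ^ M * τ ^ M := by
    have h2 : τ * θ = 1 := ENNReal.inv_mul_cancel hθ0' (by simp)
    calc _ = τ ^ M * τ ^ M * (τ * θ) ^ M * (τ * θ) ^ M := by
          rw [mul_pow, ← pow_mul]; ring
      _ = _ := by rw [h2]; simp
  have h2 : τ ^ M * τ ^ M ≤ τ ^ k * τ ^ l :=
    mul_le_mul' (pow_le_pow_right_of_le_one' hτ1 (le_max_left _ _))
      (pow_le_pow_right_of_le_one' hτ1 (le_max_right _ _))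
  calc _ = (C * (3 ^ n) ^ (1 / 2 : ℝ)) * (vol n H.i₀ * t₁ * t₂) *
        ((τ ^ 4) ^ M * (θ : ℝ≥0∞) ^ M * (θ : ℝ≥0∞) ^ M) := by ring
    _ ≤ (C * (3 ^ n) ^ (1 / 2 : ℝ)) * (vol n H.i₀ * t₁ * t₂) * (τ ^ k * τ ^ l) := by
        rw [h1]; exact mul_le_mul_right h2 _
    _ = _ := by
        rw [ENNReal.coe_mul, ENNReal.coe_rpow_of_nonneg _ (by norm_num)]
        push_cast; ring

end StepData

variable {p q p' q' : ℝ} {D : DensityData n} {A B : ℝ≥0} {β : ℝ}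

/-- The bound for the part of the pairing that is kept on one cube. -/
theorem DensityData.HasDecay.exists_step_bound (hn : 0 < n) (h : D.HasDecay β B)
    (hI : D.Improves p q A) (hp : 1 < p) (hpq : p < q) (hq : q.HolderConjugate q') (κ : ℝ≥0) :
    ∃ C : ℝ≥0, ∀ (H : StepData n p q') (J : Finset ℤ) (ε : ℤ → ℂ), (∀ j, ‖ε j‖ ≤ 1) →
      (∀ j ∈ J, j < H.i₀) → H.X ≤ κ * avg p H.f₁ H.Q ^ p → H.Y ≤ κ * avg q' H.f₂ H.Q.triple ^ q' →
      ‖∑ j ∈ J, ε j * ∫ x, D.op (1 * 2 ^ j) (H.kept H.w j) x * H.z x‖ₑ ≤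
        C * (vol n H.i₀ * avgPlus p H.f₁ H.Q * avgPlus q' H.f₂ H.Q.triple) := by
  have hpp := Real.HolderConjugate.conjExponent hp
  set p' := Real.conjExponent p
  obtain ⟨C₁, hC₁⟩ := h.exists_trunc_bound hn hp
  obtain ⟨C₂, hC₂⟩ := h.exists_trunc_bound hn hq.lt
  obtain ⟨C₃, hC₃⟩ := h.exists_sum_enorm_integral_osc_le
  obtain ⟨C₄, hC₄⟩ := StepData.pairing_good_le (D := D) hpp hq κ C₁ C₂
  set θ : ℝ≥0 := 2 ^ (β / 8) with hθ
  have hβ := h.pos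
  have hθ1 : 1 < θ := NNReal.one_lt_rpow one_lt_two (by positivity)
  have hθ0 : θ ≠ 0 := (zero_lt_one.trans hθ1).ne'
  have hθE : ((2 : ℝ≥0∞) ^ (-β)) ^ (1 / 2 : ℝ) = ((θ : ℝ≥0∞)⁻¹) ^ 4 := by
    rw [hθ, ENNReal.coe_rpow_of_nonneg _ (by positivity), ← ENNReal.rpow_neg,
      ← ENNReal.rpow_natCast, ← ENNReal.rpow_mul, ← ENNReal.rpow_mul]
    congr 1
    push_cast; ring
  have hG : ∑' k : ℕ, ((θ : ℝ≥0∞)⁻¹) ^ k ≠ ∞ := by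
    rw [ENNReal.tsum_geometric, ENNReal.inv_ne_top]
    refine (tsub_pos_iff_lt.2 (ENNReal.inv_lt_one.2 ?_)).ne'
    exact_mod_cast hθ1
  lift (∑' k : ℕ, ((θ : ℝ≥0∞)⁻¹) ^ k) to ℝ≥0 using hG with G hG'
  obtain ⟨C₅, hC₅⟩ := exists_sum_tail_le (n := n) hθ1 hp.le
  obtain ⟨C₆, hC₆⟩ := exists_sum_tail_le (n := n) hθ1 hq.symm.lt.le
  set K₁ : ℝ≥0 := C₃ * (3 ^ n) ^ (1 / 2 : ℝ)
  set K₂ : ℝ≥0 := A * ((2 ^ p) ^ (1 / p) * (6 ^ n * 2 ^ q' * κ) ^ (1 / q'))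
  set K₃ : ℝ≥0 := A * ((9 ^ n * 2 ^ q') ^ (1 / q') * (2 ^ n * 2 ^ p * κ) ^ (1 / p))
  refine ⟨C₄ + K₁ * G ^ 2 + K₃ * C₆ + K₂ * C₅, fun H J ε hε hJ hX hY => ?_⟩
  set t₁ := avg p H.f₁ H.Q
  set t₂ := avg q' H.f₂ H.Q.triple
  set P₁ := avgPlus p H.f₁ H.Q
  set P₂ := avgPlus q' H.f₂ H.Q.triple
  have ht₁ : t₁ ≤ P₁ := avg_le_avgPlus hp.le H.meas₁ _
  have ht₂ : t₂ ≤ P₂ := avg_le_avgPlus hq.symm.lt.le H.meas₂ _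
  set v : ℝ≥0∞ := (vol n H.i₀ : ℝ≥0∞)
  obtain ⟨N, hN⟩ : ∃ N : ℕ, H.i₀ ≤ H.L + N := ⟨(H.i₀ - H.L).toNat, by omega⟩
  have hkw := fun j => H.nice_kept H.nice_w j
  have hkg := fun j => H.nice_kept H.nice_g j
  have hbs : ∀ j, Nice (fun x => ∑ i ∈ H.T with i ≤ j, H.bad Set.univ i x) := fun j =>
    Nice.sum fun i _ => H.nice_bad MeasurableSet.univ i
  -- With `z = g' + (z - g')` and `w` split only in the second term, three pairings arise: `(w,
  -- g')`, `(g, z - g')` and (bad, bad'). Splitting `w` against `g'` is unnecessary, as the `L^p`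
  -- bound handles it whole.
  have hdec : ∑ j ∈ J, ε j * ∫ x, D.op (1 * 2 ^ j) (H.kept H.w j) x * H.z x =
      (∑ j ∈ J, ε j * ∫ x, D.op (1 * 2 ^ j) (H.kept H.w j) x * H.g' x) +
      (∑ j ∈ J, ε j * ∫ x, D.op (1 * 2 ^ j) (H.kept H.g j) x * (H.z x - H.g' x)) +
      ∑ j ∈ J, ε j * ∑ k ∈ Finset.range N, ∑ l ∈ Finset.range N,
        ∫ x, D.op (1 * 2 ^ j) (H.bad Set.univ (j - k)) x * H.bad' Set.univ (j - l) x := by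
    rw [← Finset.sum_add_distrib, ← Finset.sum_add_distrib]
    refine Finset.sum_congr rfl fun j hj => ?_
    rw [← H.integral_bad_eq (hJ j hj) hN, ← mul_add, ← mul_add]
    congr 1
    rw [← integral_add ((D.op_nice (hkw j) _).mul H.nice_g').integrable
      ((D.op_nice (hkg j) _).mul H.nice_bad').integrable, ← integral_add
      (((D.op_nice (hkw j) _).mul H.nice_g').add
        ((D.op_nice (hkg j) _).mul H.nice_bad')).integrable
      ((D.op_nice (hbs j) _).mul H.nice_bad').integrable]
    refine integral_congr_ae (ae_of_all _ fun x => ?_)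
    have h1 : H.kept H.w j = fun x => H.kept H.g j x +
        ∑ i ∈ H.T with i ≤ j, H.bad Set.univ i x := funext fun x => H.kept_w_eq j x
    simp only [h1, D.op_add (hkg j) (hbs j)]
    ring
  have hbad : ‖∑ j ∈ J, ε j * ∑ k ∈ Finset.range N, ∑ l ∈ Finset.range N,
      ∫ x, D.op (1 * 2 ^ j) (H.bad Set.univ (j - k)) x * H.bad' Set.univ (j - l) x‖ₑ ≤
      ∑ k ∈ Finset.range N, ∑ l ∈ Finset.range N, ∑ j ∈ J,
        ‖∫ x, D.op (1 * 2 ^ j) (H.bad Set.univ (j - k)) x * H.bad' Set.univ (j - l) x‖ₑ := by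
    have h1 : ∀ j ∈ J, ‖ε j * ∑ k ∈ Finset.range N, ∑ l ∈ Finset.range N,
        ∫ x, D.op (1 * 2 ^ j) (H.bad Set.univ (j - k)) x * H.bad' Set.univ (j - l) x‖ₑ ≤
        ∑ k ∈ Finset.range N, ∑ l ∈ Finset.range N,
        ‖∫ x, D.op (1 * 2 ^ j) (H.bad Set.univ (j - k)) x * H.bad' Set.univ (j - l) x‖ₑ := by
      intro j _
      rw [enorm_mul]
      refine (mul_le_of_le_one_left zero_le ?_).trans ((enorm_sum_le _ _).trans
        (Finset.sum_le_sum fun k _ => enorm_sum_le _ _))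
      rw [← ofReal_norm]; exact ENNReal.ofReal_le_one.2 (hε j)
    refine (enorm_sum_le _ _).trans ((Finset.sum_le_sum h1).trans (le_of_eq ?_))
    rw [Finset.sum_comm]
    exact Finset.sum_congr rfl fun k _ => Finset.sum_comm
  set τ : ℝ≥0∞ := (θ : ℝ≥0∞)⁻¹
  set tail₁ : ℕ → ℕ → ℝ≥0∞ := fun k l =>
    ((∫⁻ x in H.Q.carrier ∩ {x | (θ : ℝ≥0∞) ^ max k l * t₁ < ‖H.f₁ x‖ₑ}, ‖H.f₁ x‖ₑ ^ p) /
      volume H.Q.carrier) ^ (1 / p)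
  set tail₂ : ℕ → ℕ → ℝ≥0∞ := fun k l =>
    ((∫⁻ x in H.Q.triple.carrier ∩ {x | (θ : ℝ≥0∞) ^ max k l * t₂ < ‖H.f₂ x‖ₑ}, ‖H.f₂ x‖ₑ ^ q') /
      volume H.Q.triple.carrier) ^ (1 / q')
  have hkl : ∀ k l : ℕ, ∑ j ∈ J,
      ‖∫ x, D.op (1 * 2 ^ j) (H.bad Set.univ (j - k)) x * H.bad' Set.univ (j - l) x‖ₑ ≤
      K₁ * (v * t₁ * t₂) * (τ ^ k * τ ^ l) + (K₃ * (v * t₁ * tail₂ k l) +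
        K₂ * (v * t₂ * tail₁ k l)) := by
    intro k l
    set E : Set (Euc n) := {x | ‖H.f₁ x‖ₑ ≤ (θ : ℝ≥0∞) ^ max k l * t₁} with hEdef
    set E' : Set (Euc n) := {x | ‖H.f₂ x‖ₑ ≤ (θ : ℝ≥0∞) ^ max k l * t₂} with hEdef'
    have hE : MeasurableSet E := measurableSet_le H.meas₁.enorm measurable_const
    have hE' : MeasurableSet E' := measurableSet_le H.meas₂.enorm measurable_const
    have hEc : Eᶜ = {x | (θ : ℝ≥0∞) ^ max k l * t₁ < ‖H.f₁ x‖ₑ} := by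
      ext x; simp [hEdef]
    have hEc' : E'ᶜ = {x | (θ : ℝ≥0∞) ^ max k l * t₂ < ‖H.f₂ x‖ₑ} := by
      ext x; simp [hEdef']
    refine (H.sum_bad_le_add hE hE' k l).trans (add_le_add ?_ (add_le_add ?_ ?_))
    · exact H.sum_small_le hθ0 hθE hC₃ hθ1.le k l hE hE' (fun x hx => hx) (fun x hx => hx)
    · change _ ≤ (K₃ : ℝ≥0∞) * (v * t₁ * ((∫⁻ x in H.Q.triple.carrier ∩
        {x | (θ : ℝ≥0∞) ^ max k l * t₂ < ‖H.f₂ x‖ₑ}, ‖H.f₂ x‖ₑ ^ q') /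
          volume H.Q.triple.carrier) ^ (1 / q'))
      rw [← hEc']
      exact H.sum_large_right_le' hI hq hpp hpq hJ hX hE hE'.compl k l
    · change _ ≤ (K₂ : ℝ≥0∞) * (v * t₂ * ((∫⁻ x in H.Q.carrier ∩
        {x | (θ : ℝ≥0∞) ^ max k l * t₁ < ‖H.f₁ x‖ₑ}, ‖H.f₁ x‖ₑ ^ p) /
          volume H.Q.carrier) ^ (1 / p))
      rw [← hEc]
      exact H.sum_large_left_le' hI hq hpp hpq hJ hY hE.compl MeasurableSet.univ k l
  have hsum : ∑ k ∈ Finset.range N, ∑ l ∈ Finset.range N, ∑ j ∈ J,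
      ‖∫ x, D.op (1 * 2 ^ j) (H.bad Set.univ (j - k)) x * H.bad' Set.univ (j - l) x‖ₑ ≤
      K₁ * (v * t₁ * t₂) * (G * G) + (K₃ * (v * t₁ * (C₆ * P₂)) + K₂ * (v * t₂ * (C₅ * P₁))) := by
    refine (Finset.sum_le_sum fun k _ => Finset.sum_le_sum fun l _ => hkl k l).trans ?_
    simp_rw [Finset.sum_add_distrib, ← Finset.mul_sum]
    refine add_le_add (mul_le_mul_right ?_ _) (add_le_add
      (mul_le_mul_right (mul_le_mul_right (hC₆ H.f₂ H.Q.triple N H.meas₂) _) _)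
      (mul_le_mul_right (mul_le_mul_right (hC₅ H.f₁ H.Q N H.meas₁) _) _))
    rw [← Finset.sum_mul, hG']
    exact mul_le_mul' (ENNReal.sum_le_tsum _) (ENNReal.sum_le_tsum _)
  rw [hdec]
  refine (enorm_add_le _ _).trans (add_le_add ((enorm_add_le _ _).trans
    (hC₄ H J ε t₁ t₂ hX hY (fun J f hf => hC₁ 1 J ε f (by simp) hε hf)
      fun J f hf => hC₂ 1 J ε f (by simp) hε hf)) (hbad.trans hsum)) |>.trans ?_
  calc _ ≤ C₄ * (v * P₁ * P₂) + (K₁ * (v * P₁ * P₂) * (G * G) +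
        (K₃ * (v * P₁ * (C₆ * P₂)) + K₂ * (v * P₂ * (C₅ * P₁)))) := by gcongr
    _ = _ := by push_cast; ring

end

end SparseRadon

namespace SparseRadon

noncomputable section

variable {n : ℕ}

/-! ### The sparse collection -/

/-- A grid and two functions, which determine the stopping cubes of every dyadic cube. -/
structure SparseData (n : ℕ) (p q' : ℝ) where
  a : Fin n → ℝ
  f₁ : Euc n → ℂ
  f₂ : Euc n → ℂ
  one_le_p : 1 ≤ p
  one_le_q' : 1 ≤ q'
  meas₁ : Measurable f₁
  meas₂ : Measurable f₂

/-- The factor by which an average has to grow for a cube to be selected. -/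
def stopFactor (n : ℕ) : ℝ≥0 := 4 * 9 ^ n

theorem one_le_stopFactor : (1 : ℝ≥0∞) ≤ stopFactor n := by
  have h1 : (1 : ℝ≥0) ≤ 9 ^ n := one_le_pow₀ (by norm_num)
  have h2 : (1 : ℝ≥0) ≤ stopFactor n := by
    unfold stopFactor
    calc (1 : ℝ≥0) ≤ 4 * 1 := by norm_num
      _ ≤ _ := by gcongr
  exact_mod_cast h2

namespace SparseData

variable {p q' : ℝ} (H : SparseData n p q')

/-- The dyadic cube with a given scale and index. -/
def cube (c : ℤ × (Fin n → ℤ)) : Cube n := dyadic H.a c.1 c.2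

theorem carrier_cube (c : ℤ × (Fin n → ℤ)) : (H.cube c).carrier = cell H.a c.1 c.2 :=
  carrier_dyadic _ _ _

theorem carrier_triple_cube (c : ℤ × (Fin n → ℤ)) :
    (H.cube c).triple.carrier = tripleCell H.a c.1 c.2 := carrier_triple_dyadic _ _ _

theorem cube_injective : Function.Injective H.cube := by
  intro c d h
  have h1 : (2 : ℝ) ^ c.1 = 2 ^ d.1 := congrArg Cube.side h
  have h2 : c.1 = d.1 := zpow_right_injective₀ (by norm_num) (by norm_num) h1
  refine Prod.ext h2 ?_
  obtain ⟨x, hx⟩ := nonempty_cell H.a c.1 c.2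
  have h3 : x ∈ cell H.a d.1 d.2 := by rwa [← H.carrier_cube, ← h, H.carrier_cube]
  rw [mem_cell] at hx h3
  rw [← hx, ← h3, h2]

/-- The first stopping threshold of a dyadic cube. -/
def X (c : ℤ × (Fin n → ℤ)) : ℝ≥0∞ := stopFactor n * avg p H.f₁ (H.cube c) ^ p

/-- The second stopping threshold of a dyadic cube. -/
def Y (c : ℤ × (Fin n → ℤ)) : ℝ≥0∞ := stopFactor n * 3 ^ n * avg q' H.f₂ (H.cube c).triple ^ q'

/-- The stopping rule of a dyadic cube. -/
def Stop (c : ℤ × (Fin n → ℤ)) (i : ℤ) (m : Fin n → ℤ) : Prop :=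
  H.X c * vol n i < ∫⁻ x in cell H.a i m, ‖H.f₁ x‖ₑ ^ p ∨
  H.Y c * vol n i < ∫⁻ x in tripleCell H.a i m, ‖H.f₂ x‖ₑ ^ q'

/-- The maximal stopping cubes inside a dyadic cube. -/
def Child (c d : ℤ × (Fin n → ℤ)) : Prop :=
  ∃ x, x ∈ cell H.a d.1 d.2 ∧ x ∈ cell H.a c.1 c.2 ∧ x ∈ topSet H.a (c.1 - 1) (H.Stop c) d.1

variable {H} {c d e : ℤ × (Fin n → ℤ)}

theorem Child.lt (h : H.Child c d) : d.1 < c.1 := by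
  obtain ⟨x, -, -, h⟩ := h
  have := h.1
  omega

theorem Child.stop_rule (h : H.Child c d) : H.Stop c d.1 d.2 := by
  obtain ⟨x, h1, -, h⟩ := h
  rw [mem_cell] at h1
  exact h1 ▸ h.2.1

theorem Child.subset (h : H.Child c d) : cell H.a d.1 d.2 ⊆ cell H.a c.1 c.2 := by
  have h0 := h.lt
  obtain ⟨x, h1, h2, -⟩ := h
  rw [mem_cell] at h1
  exact h1 ▸ ((sat_cell c.1 c.2).mono h0.le).cell_subset h2

theorem Child.subset_topSet (h : H.Child c d) :
    cell H.a d.1 d.2 ⊆ topSet H.a (c.1 - 1) (H.Stop c) d.1 := by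
  obtain ⟨x, h1, -, h⟩ := h
  rw [mem_cell] at h1
  exact h1 ▸ (sat_topSet d.1).cell_subset h

theorem Child.unique (hd : H.Child c d) (he : H.Child c e) {x : Euc n}
    (hxd : x ∈ cell H.a d.1 d.2) (hxe : x ∈ cell H.a e.1 e.2) : d = e := by
  have h1 := topSet_unique (hd.subset_topSet hxd) (he.subset_topSet hxe)
  refine Prod.ext h1 ?_
  rw [mem_cell] at hxd hxe
  rw [← hxd, ← hxe, h1]

variable (H) in
/-- The cubes reached from a given one by passing to stopping cubes. -/
def desc (c : ℤ × (Fin n → ℤ)) : Set (ℤ × (Fin n → ℤ)) := {d | Relation.ReflTransGen H.Child c d}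

theorem self_mem_desc : c ∈ H.desc c := Relation.ReflTransGen.refl

theorem desc_le (h : d ∈ H.desc c) : d.1 ≤ c.1 := by
  induction h with
  | refl => exact le_rfl
  | tail _ h ih => exact h.lt.le.trans ih

theorem desc_subset (h : d ∈ H.desc c) : cell H.a d.1 d.2 ⊆ cell H.a c.1 c.2 := by
  induction h with
  | refl => exact subset_rfl
  | tail _ h ih => exact h.subset.trans ih

theorem Child.desc_subset_desc (h : H.Child c d) : H.desc d ⊆ H.desc c :=
  fun _ he => Relation.ReflTransGen.head h he

theorem Child.notMem_desc (h : H.Child c d) : c ∉ H.desc d := fun hc => by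
  have h1 := desc_le hc
  have h2 := h.lt
  omega

theorem Child.eq_of_mem_desc {c d d' e : ℤ × (Fin n → ℤ)} (hd : H.Child c d) (hd' : H.Child c d')
    (h : e ∈ H.desc d) (h' : e ∈ H.desc d') : d = d' := by
  obtain ⟨x, hx⟩ := nonempty_cell H.a e.1 e.2
  exact hd.unique hd' (desc_subset h hx) (desc_subset h' hx)

theorem finite_child (c : ℤ × (Fin n → ℤ)) (i : ℤ) : {m | H.Child c (i, m)}.Finite := by
  refine (Set.finite_Icc (fun t => c.2 t * 2 ^ (c.1 - i).toNat)
    (fun t => c.2 t * 2 ^ (c.1 - i).toNat + 2 ^ (c.1 - i).toNat)).subset fun m hm => ?_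
  have h0 : i ≤ c.1 := le_of_lt (Child.lt hm)
  obtain ⟨x, h1, h2, -⟩ := hm
  rw [mem_cell] at h1 h2
  have h3 : ∀ t, c.2 t = m t / 2 ^ (c.1 - i).toNat := fun t => by
    rw [← h2, idx_of_le H.a h0, h1]
  have h4 : (0 : ℤ) < 2 ^ (c.1 - i).toNat := by positivity
  constructor <;> intro t <;> simp only [h3]
  · exact Int.ediv_mul_le _ h4.ne'
  · exact (Int.lt_ediv_add_one_mul_self (m t) h4).le.trans (by rw [add_mul, one_mul])

/-- The part of a cube outside its stopping cubes. -/
def rest (H : SparseData n p q') (c : ℤ × (Fin n → ℤ)) : Set (Euc n) :=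
  cell H.a c.1 c.2 \ ⋃ (d) (_ : H.Child c d), cell H.a d.1 d.2

/-- The descendants that contain a given point `x` form a chain, since a cube has at most one child
through `x`. A cube whose `rest` contains `x` has no such child, so it is the end of the chain. -/
theorem disjoint_rest {c₀ : ℤ × (Fin n → ℤ)} (hc : c ∈ H.desc c₀) (hd : d ∈ H.desc c₀)
    (hne : c ≠ d) : Disjoint (H.rest c) (H.rest d) := by
  refine Set.disjoint_left.2 fun x hxc hxd => hne ?_
  have hchain : ∀ e ∈ H.desc c₀, x ∈ cell H.a e.1 e.2 →
      Relation.ReflTransGen (fun b b' => H.Child b b' ∧ x ∈ cell H.a b'.1 b'.2) c₀ e := by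
    intro e he hx
    induction he with
    | refl => exact .refl
    | tail _ h ih => exact (ih (h.subset hx)).tail ⟨h, hx⟩
  have hend : ∀ b b', x ∈ H.rest b →
      Relation.ReflTransGen (fun b b' => H.Child b b' ∧ x ∈ cell H.a b'.1 b'.2) b b' → b = b' := by
    intro b b' hx h
    rcases h.cases_head with h | ⟨e, ⟨h1, h2⟩, -⟩
    · exact h
    · exact absurd (Set.mem_iUnion₂.2 ⟨e, h1, h2⟩) hx.2
  rcases Relation.ReflTransGen.total_of_right_unique (fun b b₁ b₂ h₁ h₂ =>
    h₁.1.unique h₂.1 h₁.2 h₂.2) (hchain c hc hxc.1) (hchain d hd hxd.1) with h | h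
  · exact hend c d hxc h
  · exact (hend d c hxd h).symm

/-- In `stopFactor`, the `9^n` absorbs a factor `3^n` from the tripled maximal function and another
from averaging `f₂` over a triple; the `4` leaves a quarter of the volume for each of the two
stopping conditions. -/
theorem volume_le_quarter {t s : ℝ≥0∞} (ht0 : t ≠ 0) (ht : t ≠ ∞) {V : ℝ≥0∞}
    (h : stopFactor n * t * s ≤ 9 ^ n * (t * V)) : s ≤ V / 4 := by
  have h9 : ((9 : ℝ≥0∞) ^ n) ≠ 0 := by simp
  have h9' : ((9 : ℝ≥0∞) ^ n) ≠ ∞ := by simp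
  rw [ENNReal.le_div_iff_mul_le (by simp) (by simp)]
  have h1 : (9 : ℝ≥0∞) ^ n * t * (s * 4) ≤ 9 ^ n * t * V := by
    calc _ = stopFactor n * t * s := by unfold stopFactor; push_cast; ring
      _ ≤ _ := h
      _ = _ := by ring
  exact (ENNReal.mul_le_mul_iff_right (mul_ne_zero h9 ht0) (ENNReal.mul_ne_top h9' ht)).1 h1

theorem setLIntegral_cube (f : Euc n → ℂ) (hp : 0 < p) (c : ℤ × (Fin n → ℤ)) :
    ∫⁻ x in cell H.a c.1 c.2, ‖f x‖ₑ ^ p = avg p f (H.cube c) ^ p * vol n c.1 := by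
  rw [← H.carrier_cube, setLIntegral_eq_avg_rpow hp, H.carrier_cube, volume_cell]

theorem setLIntegral_triple_cube (f : Euc n → ℂ) (hq : 0 < q') (c : ℤ × (Fin n → ℤ)) :
    ∫⁻ x in tripleCell H.a c.1 c.2, ‖f x‖ₑ ^ q' =
      avg q' f (H.cube c).triple ^ q' * (3 ^ n * vol n c.1) := by
  rw [← H.carrier_triple_cube, setLIntegral_eq_avg_rpow hq, H.carrier_triple_cube,
    volume_tripleCell]

variable (H)

theorem volume_stop₁_le (c : ℤ × (Fin n → ℤ)) :
    volume (⋃ (i : ℤ) (m : Fin n → ℤ) (_ : i ≤ c.1 - 1 ∧ cell H.a i m ⊆ cell H.a c.1 c.2 ∧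
      H.X c * vol n i < ∫⁻ x in cell H.a i m, ‖H.f₁ x‖ₑ ^ p), tripleCell H.a i m) ≤
        vol n c.1 / 4 := by
  have hp : 0 < p := by linarith [H.one_le_p]
  set t := avg p H.f₁ (H.cube c) ^ p with ht
  have hX : H.X c = stopFactor n * t := rfl
  -- The cancellation in `volume_le_quarter` needs a finite nonzero average. If the average is zero
  -- or infinite, no cube satisfies the strict inequality.
  by_cases ht0 : t = 0
  · refine (le_of_eq ?_).trans zero_le
    convert measure_empty (μ := (volume : Measure (Euc n)))
    simp only [Set.iUnion_eq_empty]
    rintro i m ⟨-, h1, h2⟩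
    refine absurd h2 (not_lt.2 ((lintegral_mono_set h1).trans ?_))
    rw [setLIntegral_cube _ hp, ← ht, ht0, zero_mul]
    exact zero_le
  by_cases htt : t = ∞
  · refine (le_of_eq ?_).trans zero_le
    convert measure_empty (μ := (volume : Measure (Euc n)))
    simp only [Set.iUnion_eq_empty]
    rintro i m ⟨-, h1, h2⟩
    rw [hX, htt, ENNReal.mul_top (by simp [stopFactor]), ENNReal.top_mul (vol_ne_zero _)] at h2
    exact absurd h2 not_top_lt
  refine volume_le_quarter (n := n) ht0 htt ((mul_volume_iUnion_tripleCell_le (U := c.1 - 1)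
    (w := fun x => (cell H.a c.1 c.2).indicator (fun x => ‖H.f₁ x‖ₑ ^ p) x)
    (fun i m h => h.1) fun i m h => ?_).trans ?_)
  · rw [setLIntegral_indicator (measurableSet_cell _ _ _), Set.inter_eq_self_of_subset_right h.2.1]
    exact h.2.2.le
  · rw [lintegral_indicator (measurableSet_cell _ _ _), setLIntegral_cube _ hp, ← ht]
    gcongr
    norm_num

/-- Pigeonhole over the `3^n` cells of a triple. It explains the factor `3^n` in the threshold `Y`:
a large tripled integral yields a single cell that is still above `stopFactor`. -/
theorem exists_near_of_lt {a : Fin n → ℝ} {i : ℤ} {m : Fin n → ℤ} {F : Euc n → ℝ≥0∞} {t : ℝ≥0∞}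
    (h : 3 ^ n * t < ∫⁻ x in tripleCell a i m, F x) :
    ∃ m', (∀ k, |m k - m' k| ≤ 1) ∧ t < ∫⁻ x in cell a i m', F x := by
  classical
  by_contra! hc
  refine absurd h (not_lt.2 ?_)
  rw [setLIntegral_tripleCell_eq, ← card_near m, ← ENNReal.tsum_mul_right]
  refine ENNReal.tsum_le_tsum fun m' => ?_
  split_ifs with h1
  · rw [one_mul]; exact hc m' h1
  · exact zero_le

theorem volume_stop₂_le (c : ℤ × (Fin n → ℤ)) :
    volume (⋃ (i : ℤ) (m : Fin n → ℤ) (_ : i ≤ c.1 - 1 ∧ cell H.a i m ⊆ tripleCell H.a c.1 c.2 ∧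
      stopFactor n * avg q' H.f₂ (H.cube c).triple ^ q' * vol n i <
        ∫⁻ x in cell H.a i m, ‖H.f₂ x‖ₑ ^ q'), tripleCell H.a i m) ≤ vol n c.1 / 4 := by
  have hq : 0 < q' := by linarith [H.one_le_q']
  set t := avg q' H.f₂ (H.cube c).triple ^ q' with ht
  by_cases ht0 : t = 0
  · refine (le_of_eq ?_).trans zero_le
    convert measure_empty (μ := (volume : Measure (Euc n)))
    simp only [Set.iUnion_eq_empty]
    rintro i m ⟨-, h1, h2⟩
    refine absurd h2 (not_lt.2 ((lintegral_mono_set h1).trans ?_))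
    rw [setLIntegral_triple_cube _ hq, ← ht, ht0, zero_mul]
    exact zero_le
  by_cases htt : t = ∞
  · refine (le_of_eq ?_).trans zero_le
    convert measure_empty (μ := (volume : Measure (Euc n)))
    simp only [Set.iUnion_eq_empty]
    rintro i m ⟨-, h1, h2⟩
    rw [htt, ENNReal.mul_top (by simp [stopFactor]), ENNReal.top_mul (vol_ne_zero _)] at h2
    exact absurd h2 not_top_lt
  refine volume_le_quarter (n := n) ht0 htt ((mul_volume_iUnion_tripleCell_le (U := c.1 - 1)
    (w := fun x => (tripleCell H.a c.1 c.2).indicator (fun x => ‖H.f₂ x‖ₑ ^ q') x)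
    (fun i m h => h.1) fun i m h => ?_).trans ?_)
  · rw [setLIntegral_indicator (measurableSet_tripleCell _ _ _),
      Set.inter_eq_self_of_subset_right h.2.1]
    exact h.2.2.le
  · rw [lintegral_indicator (measurableSet_tripleCell _ _ _), setLIntegral_triple_cube _ hq, ← ht]
    have h9 : (9 : ℝ≥0∞) ^ n = 3 ^ n * 3 ^ n := by rw [← mul_pow]; norm_num
    rw [h9]
    exact le_of_eq (by ring)

theorem volume_children_le (c : ℤ × (Fin n → ℤ)) :
    volume (⋃ (d) (_ : H.Child c d), cell H.a d.1 d.2) ≤ vol n c.1 / 2 := by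
  have h4 : (vol n c.1 / 4 + vol n c.1 / 4 : ℝ≥0∞) = vol n c.1 / 2 := by
    rw [← mul_two, ENNReal.div_eq_inv_mul, ENNReal.div_eq_inv_mul, mul_right_comm,
      show (4 : ℝ≥0∞) = 2 * 2 by norm_num, ENNReal.mul_inv (by simp) (by simp), mul_assoc 2⁻¹,
      ENNReal.inv_mul_cancel (by simp) (by simp), mul_one]
  rw [← h4]
  refine (measure_mono ?_).trans ((measure_union_le _ _).trans
    (add_le_add (H.volume_stop₁_le c) (H.volume_stop₂_le c)))
  refine Set.iUnion₂_subset fun d hd x hx => ?_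
  have hlt := hd.lt
  rcases hd.stop_rule with h | h
  · refine Or.inl ?_
    simp only [Set.mem_iUnion]
    exact ⟨d.1, d.2, ⟨by omega, hd.subset, h⟩, cell_subset_tripleCell _ _ _ hx⟩
  · refine Or.inr ?_
    simp only [Set.mem_iUnion]
    have h' : 3 ^ n * (stopFactor n * avg q' H.f₂ (H.cube c).triple ^ q' * vol n d.1) <
        ∫⁻ x in tripleCell H.a d.1 d.2, ‖H.f₂ x‖ₑ ^ q' := by
      refine lt_of_eq_of_lt ?_ h
      rw [Y]; ring
    -- The neighbour `m'` lies in the triple of `c`, and the child lies in the triple of `m'`; the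
    -- maximal function bound covers triples for this reason.
    obtain ⟨m', hm', hlarge⟩ := exists_near_of_lt h'
    have hxd := hx
    rw [mem_cell] at hxd
    refine ⟨d.1, m', ⟨by omega, fun y hy => ?_, hlarge⟩, fun k => ?_⟩
    · have hxc := hd.subset hx
      rw [mem_cell] at hxc hy
      intro k
      rw [← hxc]
      refine idx_near_of_le H.a hlt.le (fun k => ?_) k
      rw [hxd, hy, abs_sub_comm]
      exact hm' k
    · rw [hxd]; exact hm' k

theorem measurableSet_rest (c : ℤ × (Fin n → ℤ)) : MeasurableSet (H.rest c) :=
  (measurableSet_cell _ _ _).diff (MeasurableSet.iUnion fun _ => MeasurableSet.iUnion fun _ =>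
    measurableSet_cell _ _ _)

theorem half_volume_le_rest (c : ℤ × (Fin n → ℤ)) : vol n c.1 / 2 ≤ volume (H.rest c) := by
  refine le_trans ?_ (le_measure_sdiff)
  rw [volume_cell]
  refine le_trans (le_of_eq ?_) (tsub_le_tsub_left (H.volume_children_le c) _)
  rw [ENNReal.sub_half (by simp)]

theorem isSparse (c : ℤ × (Fin n → ℤ)) : IsSparse (H.cube '' H.desc c) := by
  refine ⟨Function.extend H.cube H.rest fun _ => ∅, ?_, ?_⟩
  · rintro _ ⟨d, -, rfl⟩
    rw [H.cube_injective.extend_apply, H.carrier_cube, volume_cell]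
    exact ⟨H.measurableSet_rest d, Set.sdiff_subset, H.half_volume_le_rest d⟩
  · rintro _ ⟨d, hd, rfl⟩ _ ⟨e, he, rfl⟩ hne
    rw [Function.onFun, H.cube_injective.extend_apply, H.cube_injective.extend_apply]
    exact disjoint_rest hd he fun h => hne (by rw [h])

end SparseData

end

end SparseRadon

/-! ### Recursion over the stopping cubes -/

namespace SparseRadon

noncomputable section

variable {n : ℕ}

theorem topSet_withFloor_eq {a : Fin n → ℝ} {U L : ℤ} {S : ℤ → (Fin n → ℤ) → Prop} {i : ℤ}
    (h : L < i) : topSet a U (withFloor L S) i = topSet a U S i := by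
  ext x
  refine ⟨fun ⟨h1, h2, h3⟩ => ⟨h1, ?_, fun i' hi' hU hS => h3 i' hi' hU ⟨by omega, Or.inr hS⟩⟩,
    fun ⟨h1, h2, h3⟩ => ⟨h1, ⟨h.le, Or.inr h2⟩, fun i' hi' hU hS => ?_⟩⟩
  · rcases h2.2 with h' | h'
    · omega
    · exact h'
  · rcases hS.2 with h' | h'
    · omega
    · exact h3 i' hi' hU h'

namespace SparseData

variable {p q' : ℝ} (H : SparseData n p q') {D : DensityData n}

/-- The contribution of a cube to the sparse form. -/
def cost (c : ℤ × (Fin n → ℤ)) : ℝ≥0∞ :=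
  vol n c.1 * avgPlus p H.f₁ (H.cube c) * avgPlus q' H.f₂ (H.cube c).triple

/-- The step of the sparse domination on a given cube. -/
def step (c : ℤ × (Fin n → ℤ)) {L : ℤ} (hL : L < c.1) {u v : Euc n → ℂ} (hu : Nice u) (hv : Nice v)
    (h₁ : ∀ x, ‖u x‖ₑ ≤ ‖H.f₁ x‖ₑ) (h₂ : ∀ x, ‖v x‖ₑ ≤ ‖H.f₂ x‖ₑ) : StepData n p q' where
  a := H.a
  L := L
  i₀ := c.1
  m₀ := c.2
  f₁ := H.f₁
  f₂ := H.f₂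
  u := u
  v := v
  S := H.Stop c
  X := H.X c
  Y := H.Y c
  one_le_p := H.one_le_p
  one_le_q' := H.one_le_q'
  hL := hL
  meas₁ := H.meas₁
  meas₂ := H.meas₂
  nice_u := hu
  nice_v := hv
  le₁ := h₁
  le₂ := h₂
  top₁ := by
    rw [setLIntegral_cube _ (by linarith [H.one_le_p]), X]
    exact mul_le_mul_left (le_mul_of_one_le_left zero_le one_le_stopFactor) _
  top₂ := by
    rw [setLIntegral_triple_cube _ (by linarith [H.one_le_q']), Y]
    calc _ = 1 * 3 ^ n * avg q' H.f₂ (H.cube c).triple ^ q' * vol n c.1 := by ring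
      _ ≤ _ := mul_le_mul_left (mul_le_mul_left (mul_le_mul_left one_le_stopFactor _) _) _
  not_stop₁ i _ m h := not_lt.1 fun h' => h (Or.inl h')
  not_stop₂ i _ m h := not_lt.1 fun h' => h (Or.inr h')

variable {H} {c : ℤ × (Fin n → ℤ)} {L : ℤ} {hL : L < c.1} {u v : Euc n → ℂ} {hu : Nice u}
  {hv : Nice v} {h₁ : ∀ x, ‖u x‖ₑ ≤ ‖H.f₁ x‖ₑ} {h₂ : ∀ x, ‖v x‖ₑ ≤ ‖H.f₂ x‖ₑ}

/-- Above the floor, the stopping cubes inside the given cube are exactly its children, so whatever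
is not kept is a sum over children. -/
theorem indicator_A_step_eq {i : ℤ} (hi : L < i) :
    ((H.step c hL hu hv h₁ h₂).A i).indicator (H.step c hL hu hv h₁ h₂).w =
      fun x => ∑ m ∈ (finite_child (H := H) c i).toFinset, (cell H.a i m).indicator u x := by
  have hA : (H.step c hL hu hv h₁ h₂).A i = topSet H.a (c.1 - 1) (H.Stop c) i :=
    topSet_withFloor_eq hi
  have hw : (H.step c hL hu hv h₁ h₂).w = (cell H.a c.1 c.2).indicator u := rfl
  rw [hA, hw]
  funext x
  by_cases hx : x ∈ topSet H.a (c.1 - 1) (H.Stop c) i ∧ x ∈ cell H.a c.1 c.2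
  · rw [Set.indicator_of_mem hx.1, Set.indicator_of_mem hx.2,
      Finset.sum_eq_single (idx H.a i x)]
    · rw [Set.indicator_of_mem ((mem_cell H.a).2 rfl)]
    · intro m _ hm
      exact Set.indicator_of_notMem (fun h => hm ((mem_cell H.a).1 h).symm) _
    · intro h
      exact absurd ((finite_child c i).mem_toFinset.2 ⟨x, (mem_cell H.a).2 rfl, hx.2, hx.1⟩) h
  · rw [Finset.sum_eq_zero]
    · by_cases h1 : x ∈ topSet H.a (c.1 - 1) (H.Stop c) i
      · rw [Set.indicator_of_mem h1, Set.indicator_of_notMem fun h => hx ⟨h1, h⟩]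
      · rw [Set.indicator_of_notMem h1]
    · intro m hm
      have hm := (finite_child c i).mem_toFinset.1 hm
      exact Set.indicator_of_notMem (fun h => hx ⟨Child.subset_topSet hm h, Child.subset hm h⟩) _

-- Stopping cubes of side at most `2^j` are kept and larger ones are passed to the recursion. Since
-- `j` is below the scale of `c`, the kept part reaches only the triple of `c`, where `z = v`.
variable (hu hv h₁ h₂) in
theorem integral_op_eq_step_add (hL : L < c.1) {j : ℤ} (hLj : L ≤ j) (hj : j < c.1) :
    ∫ x, D.op (1 * 2 ^ j) ((cell H.a c.1 c.2).indicator u) x * v x =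
      (∫ x, D.op (1 * 2 ^ j) ((H.step c hL hu hv h₁ h₂).kept (H.step c hL hu hv h₁ h₂).w j) x *
        (H.step c hL hu hv h₁ h₂).z x) +
      ∑ i ∈ Finset.Icc L (c.1 - 1) with j < i, ∑ m ∈ (finite_child (H := H) c i).toFinset,
        ∫ x, D.op (1 * 2 ^ j) ((cell H.a i m).indicator u) x * v x := by
  set G := H.step c hL hu hv h₁ h₂ with hG
  have hcell : ∀ i m, Nice ((cell H.a i m).indicator u) := fun i m =>
    hu.indicator (measurableSet_cell _ _ _)
  have hsum : ∀ i, Nice (fun x => ∑ m ∈ (finite_child (H := H) c i).toFinset,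
      (cell H.a i m).indicator u x) := fun i => Nice.sum fun m _ => hcell i m
  have hw : (cell H.a c.1 c.2).indicator u = fun x => G.kept G.w j x +
      ∑ i ∈ Finset.Icc L (c.1 - 1) with j < i, ∑ m ∈ (finite_child (H := H) c i).toFinset,
        (cell H.a i m).indicator u x := by
    funext x
    have h3 := G.sum_indicator_A G.w x
    rw [← Finset.sum_filter_add_sum_filter_not _ (fun i => i ≤ j)] at h3
    refine h3.symm.trans (congrArg₂ (· + ·) rfl ?_)
    simp only [not_le]
    refine Finset.sum_congr rfl fun i hi => ?_
    have h4 : L < i := by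
      have := (Finset.mem_filter.1 hi).2
      omega
    exact congrFun (indicator_A_step_eq h4) x
  have hz : ∀ x, D.op (1 * 2 ^ j) (G.kept G.w j) x * G.z x =
      D.op (1 * 2 ^ j) (G.kept G.w j) x * v x := by
    intro x
    by_cases hx : x ∈ tripleCell H.a c.1 c.2
    · have : G.z x = v x := Set.indicator_of_mem hx _
      rw [this]
    · rw [DensityData.op_eq_zero_of_notMem_tripleSet (a := H.a) (E := cell H.a c.1 c.2)
        (fun y hy => ?_) (by simp) hj.le, zero_mul, zero_mul]
      · rintro ⟨y, hy, hxy⟩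
        rw [mem_cell] at hy
        exact hx (hy ▸ hxy)
      · refine Finset.sum_eq_zero fun i _ => ?_
        have h3 : G.w y = 0 := G.w_eq_zero hy
        by_cases h4 : y ∈ G.A i
        · rw [Set.indicator_of_mem h4, h3]
        · rw [Set.indicator_of_notMem h4]
  have hk := G.nice_kept G.nice_w j
  have hrest : Nice (fun x => ∑ i ∈ Finset.Icc L (c.1 - 1) with j < i,
      ∑ m ∈ (finite_child (H := H) c i).toFinset, (cell H.a i m).indicator u x) :=
    Nice.sum fun i _ => hsum i
  simp_rw [hz]
  rw [hw]
  have hpair : ∀ i m, Integrable (fun x => D.op (1 * 2 ^ j) ((cell H.a i m).indicator u) x * v x) :=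
    fun i m => ((D.op_nice (hcell i m) _).mul hv).integrable
  rw [Finset.sum_congr rfl fun i _ => (integral_finsetSum _ fun m _ => hpair i m).symm,
    ← integral_finsetSum _ fun i _ => integrable_finsetSum _ fun m _ => hpair i m,
    ← integral_add ((D.op_nice hk _).mul hv).integrable
      (integrable_finsetSum _ fun i _ => integrable_finsetSum _ fun m _ => hpair i m)]
  refine integral_congr_ae (ae_of_all _ fun x => ?_)
  simp only
  rw [D.op_add hk hrest, D.op_sum fun i _ => hsum i, add_mul, Finset.sum_mul]
  refine congrArg₂ (· + ·) rfl (Finset.sum_congr rfl fun i _ => ?_)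
  rw [D.op_sum fun m _ => hcell i m, Finset.sum_mul]

/-- Distinct children have disjoint sets of descendants, none of which contains `c`, so no cube is
counted twice. This is why the constant does not grow along the recursion. -/
theorem cost_add_sum_le {T : Finset ℤ} :
    H.cost c + ∑ i ∈ T, ∑ m ∈ (finite_child (H := H) c i).toFinset,
      ∑' d, (H.desc (i, m)).indicator H.cost d ≤ ∑' d, (H.desc c).indicator H.cost d := by
  classical
  rw [Finset.sum_sigma', ← Summable.tsum_finsetSum fun _ _ => ENNReal.summable,
    ← tsum_ite_eq c H.cost, ← ENNReal.tsum_add]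
  refine ENNReal.tsum_le_tsum fun d => ?_
  have hch : ∀ s ∈ T.sigma fun i => (finite_child (H := H) c i).toFinset, H.Child c (s.1, s.2) :=
    fun s hs => (finite_child c s.1).mem_toFinset.1 (Finset.mem_sigma.1 hs).2
  by_cases hex : ∃ s ∈ T.sigma fun i => (finite_child (H := H) c i).toFinset, d ∈ H.desc (s.1, s.2)
  · obtain ⟨s, hs, hd⟩ := hex
    have hdc : d ≠ c := fun h => (hch s hs).notMem_desc (h ▸ hd)
    rw [if_neg hdc, zero_add, Finset.sum_eq_single s]
    · rw [Set.indicator_of_mem hd, Set.indicator_of_mem ((hch s hs).desc_subset_desc hd)]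
    · intro s' hs' hne
      refine Set.indicator_of_notMem (fun hd' => hne ?_) _
      have h3 := (hch s' hs').eq_of_mem_desc (hch s hs) hd' hd
      have h4 : s'.1 = s.1 := congrArg Prod.fst h3
      have h5 : s'.2 = s.2 := congrArg Prod.snd h3
      exact Sigma.ext h4 (heq_of_eq h5)
    · exact fun h => absurd hs h
  · push Not at hex
    rw [Finset.sum_eq_zero fun s hs => Set.indicator_of_notMem (hex s hs) _, add_zero]
    split_ifs with h
    · rw [h, Set.indicator_of_mem self_mem_desc]
    · exact zero_le

/-- The sparse bound for the scales below that of a given cube. -/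
theorem enorm_sum_le_tsum_cost {C : ℝ≥0} {ε : ℤ → ℂ}
    (hC : ∀ (H : StepData n p q') (J : Finset ℤ), (∀ j ∈ J, j < H.i₀) →
      H.X ≤ (stopFactor n * 3 ^ n : ℝ≥0) * avg p H.f₁ H.Q ^ p →
      H.Y ≤ (stopFactor n * 3 ^ n : ℝ≥0) * avg q' H.f₂ H.Q.triple ^ q' →
      ‖∑ j ∈ J, ε j * ∫ x, D.op (1 * 2 ^ j) (H.kept H.w j) x * H.z x‖ₑ ≤
        C * (vol n H.i₀ * avgPlus p H.f₁ H.Q * avgPlus q' H.f₂ H.Q.triple))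
    (hu : Nice u) (hv : Nice v) (h₁ : ∀ x, ‖u x‖ₑ ≤ ‖H.f₁ x‖ₑ) (h₂ : ∀ x, ‖v x‖ₑ ≤ ‖H.f₂ x‖ₑ)
    {J : Finset ℤ} (hJ : ∀ j ∈ J, L ≤ j) (N : ℕ) (c : ℤ × (Fin n → ℤ)) (hN : c.1 ≤ L + N) :
    ‖∑ j ∈ J with j < c.1, ε j *
      ∫ x, D.op (1 * 2 ^ j) ((cell H.a c.1 c.2).indicator u) x * v x‖ₑ ≤
        C * ∑' d, (H.desc c).indicator H.cost d := by
  -- `N` bounds the number of scales between the least scale `L` and that of the cube; a cube of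
  -- scale at most `L` has none left to treat.
  induction N generalizing c with
  | zero =>
    rw [Finset.filter_false_of_mem fun j hj => ?_, Finset.sum_empty, enorm_zero]
    · exact zero_le
    · have := hJ j hj
      push_cast at hN
      omega
  | succ N ih =>
    rcases le_or_gt c.1 L with hL | hL
    · rw [Finset.filter_false_of_mem fun j hj => ?_, Finset.sum_empty, enorm_zero]
      · exact zero_le
      · have := hJ j hj
        omega
    set G := H.step c hL hu hv h₁ h₂ with hG
    set M : ℤ → Finset (Fin n → ℤ) := fun i => (finite_child (H := H) c i).toFinset with hM
    -- A child of side `2^i` inherits exactly the scales `j < i`, which is the same problem for that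
    -- child.
    have hdec : ∑ j ∈ J with j < c.1, ε j *
        ∫ x, D.op (1 * 2 ^ j) ((cell H.a c.1 c.2).indicator u) x * v x =
        (∑ j ∈ J with j < c.1, ε j * ∫ x, D.op (1 * 2 ^ j) (G.kept G.w j) x * G.z x) +
        ∑ i ∈ Finset.Icc L (c.1 - 1), ∑ m ∈ M i, ∑ j ∈ J with j < i, ε j *
          ∫ x, D.op (1 * 2 ^ j) ((cell H.a i m).indicator u) x * v x := by
      have h3 : ∀ i, ∑ m ∈ M i, ∑ j ∈ J with j < i, ε j *
          ∫ x, D.op (1 * 2 ^ j) ((cell H.a i m).indicator u) x * v x =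
          ∑ j ∈ J with j < i, ∑ m ∈ M i, ε j *
          ∫ x, D.op (1 * 2 ^ j) ((cell H.a i m).indicator u) x * v x := fun i => Finset.sum_comm
      simp_rw [h3]
      rw [Finset.sum_comm' (s' := fun j => (Finset.Icc L (c.1 - 1)).filter (j < ·))
        (t' := J.filter (· < c.1)), ← Finset.sum_add_distrib]
      · refine Finset.sum_congr rfl fun j hj => ?_
        obtain ⟨hj1, hj2⟩ := Finset.mem_filter.1 hj
        rw [integral_op_eq_step_add hu hv h₁ h₂ hL (hJ j hj1) hj2, mul_add, Finset.mul_sum]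
        simp_rw [Finset.mul_sum]
        rfl
      · intro i j
        simp only [Finset.mem_filter, Finset.mem_Icc]
        constructor
        · rintro ⟨⟨h4, h5⟩, h6, h7⟩
          exact ⟨⟨⟨h4, h5⟩, h7⟩, h6, by omega⟩
        · rintro ⟨⟨⟨h4, h5⟩, h7⟩, h6, -⟩
          exact ⟨⟨h4, h5⟩, h6, h7⟩
    have hstep := hC G (J.filter (· < c.1)) (fun j hj => (Finset.mem_filter.1 hj).2)
      (by
        change stopFactor n * avg p H.f₁ (H.cube c) ^ p ≤ _ * avg p H.f₁ (H.cube c) ^ p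
        refine mul_le_mul_left ?_ _
        push_cast
        exact le_mul_of_one_le_right zero_le (one_le_pow₀ (by norm_num)))
      (by
        change stopFactor n * 3 ^ n * avg q' H.f₂ (H.cube c).triple ^ q' ≤
          _ * avg q' H.f₂ (H.cube c).triple ^ q'
        push_cast
        exact le_rfl)
    rw [hdec]
    refine (enorm_add_le _ _).trans ((add_le_add hstep ((enorm_sum_le _ _).trans
      (Finset.sum_le_sum fun i hi => (enorm_sum_le _ _).trans
        (Finset.sum_le_sum fun m hm => ih (i, m) ?_)))).trans ?_)
    · have := (Finset.mem_Icc.1 hi).2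
      push_cast at hN
      simp only
      omega
    · simp_rw [← Finset.mul_sum]
      rw [← mul_add]
      exact mul_le_mul_right cost_add_sum_le _

theorem tsum_cost_eq (c : ℤ × (Fin n → ℤ)) :
    ∑' d, (H.desc c).indicator H.cost d = ∑' Q : (H.cube '' H.desc c : Set (Cube n)),
      volume (Q : Cube n).carrier * avgPlus p H.f₁ (Q : Cube n) *
        avgPlus q' H.f₂ (Q : Cube n).triple := by
  rw [tsum_image (fun Q : Cube n => volume Q.carrier * avgPlus p H.f₁ Q * avgPlus q' H.f₂ Q.triple)
    H.cube_injective.injOn, ← tsum_subtype]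
  refine tsum_congr fun d => ?_
  rw [H.carrier_cube, volume_cell, cost]

end SparseData

end

end SparseRadon

namespace SparseRadon

noncomputable section

variable {n : ℕ} {D : DensityData n} {p q q' β : ℝ} {A B : ℝ≥0}

/-! ### The sparse bound for truncated sums -/

namespace SparseData

variable {H : SparseData n p q'} {c : ℤ × (Fin n → ℤ)} {u v : Euc n → ℂ}

theorem cost_le_tsum : H.cost c ≤ ∑' d, (H.desc c).indicator H.cost d := by
  refine le_trans (le_of_eq ?_) (ENNReal.le_tsum c)
  rw [Set.indicator_of_mem self_mem_desc]

theorem vol_add_nat (i : ℤ) (k : ℕ) : vol n (i + k) = vol n i * (2 ^ n) ^ k := by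
  rw [vol_add, zpow_natCast, ← pow_mul, ← pow_mul, mul_comm n]

/-- At `k` scales above the cube, the `L^p → L^q` constant is smaller by `2^(-nk(1/p - 1/q))`.
Hölder therefore bounds the pairing by the cost of the single cube `c`, with geometric decay in `k`
once `p < q` and `n > 0`. -/
theorem enorm_integral_op_le (hI : D.Improves p q A) (hp : 0 < p) (hpq : p < q)
    (hq : q.HolderConjugate q') (hu : Nice u) (hv : Nice v) (h₁ : ∀ x, ‖u x‖ₑ ≤ ‖H.f₁ x‖ₑ)
    (h₂ : ∀ x, ‖v x‖ₑ ≤ ‖H.f₂ x‖ₑ) (hu0 : ∀ x ∉ cell H.a c.1 c.2, u x = 0)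
    (hv0 : ∀ x ∉ tripleCell H.a c.1 c.2, v x = 0) (k : ℕ) :
    ‖∫ x, D.op (1 * 2 ^ (c.1 + k)) u x * v x‖ₑ ≤
      (A * 3 ^ n) * ((((2 ^ n) ^ (1 / p - 1 / q))⁻¹) ^ k * H.cost c) := by
  have hq0 := hq.symm.pos
  have hδ : 0 ≤ 1 / p - 1 / q := sub_nonneg.2 (one_div_le_one_div_of_le hp hpq.le)
  set δ := 1 / p - 1 / q with hδdef
  set t₁ := avg p H.f₁ (H.cube c)
  set t₂ := avg q' H.f₂ (H.cube c).triple
  set V : ℝ≥0∞ := (vol n c.1 : ℝ≥0∞) with hV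
  set W : ℝ≥0∞ := 2 ^ n with hW
  have hV0 : V ≠ 0 := vol_ne_zero _
  have hVt : V ≠ ∞ := ENNReal.coe_ne_top
  have e1 : (∫⁻ x, ‖u x‖ₑ ^ p) ^ (1 / p) ≤ t₁ * V ^ (1 / p) := by
    rw [StepData.lintegral_eq_setLIntegral (measurableSet_cell _ _ _) hu0 hp]
    refine (ENNReal.rpow_le_rpow (lintegral_mono fun x => ENNReal.rpow_le_rpow (h₁ x) hp.le)
      (by positivity)).trans (le_of_eq ?_)
    rw [setLIntegral_cube _ hp, ENNReal.mul_rpow_of_nonneg _ _ (by positivity), ← ENNReal.rpow_mul,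
      mul_one_div_cancel hp.ne', ENNReal.rpow_one]
  have e2 : (∫⁻ x, ‖v x‖ₑ ^ q') ^ (1 / q') ≤ t₂ * (3 ^ n * V ^ (1 / q')) := by
    rw [StepData.lintegral_eq_setLIntegral (measurableSet_tripleCell _ _ _) hv0 hq0]
    refine (ENNReal.rpow_le_rpow (lintegral_mono fun x => ENNReal.rpow_le_rpow (h₂ x) hq0.le)
      (by positivity)).trans ?_
    rw [setLIntegral_triple_cube _ hq0, ENNReal.mul_rpow_of_nonneg _ _ (by positivity),
      ← ENNReal.rpow_mul, mul_one_div_cancel hq0.ne', ENNReal.rpow_one,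
      ENNReal.mul_rpow_of_nonneg _ _ (by positivity)]
    refine mul_le_mul_right (mul_le_mul_left ?_ _) _
    have h3 : (3 ^ n : ℝ≥0∞) ^ (1 / q') ≤ (3 ^ n : ℝ≥0∞) ^ (1 : ℝ) := by
      refine ENNReal.rpow_le_rpow_of_exponent_le (one_le_pow₀ (by norm_num)) ?_
      rw [div_le_one hq0]
      exact hq.symm.lt.le
    rwa [ENNReal.rpow_one] at h3
  have e3 : ((vol n (c.1 + k) : ℝ≥0) : ℝ≥0∞) = V * W ^ k := by
    rw [vol_add_nat]; push_cast; rfl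
  have e4 : ((V * W ^ k) ^ δ)⁻¹ = (V ^ δ)⁻¹ * ((W ^ δ)⁻¹) ^ k := by
    rw [ENNReal.mul_rpow_of_nonneg _ _ hδ, ENNReal.mul_inv
      (Or.inl (ENNReal.rpow_pos (pos_iff_ne_zero.2 hV0) hVt).ne')
      (Or.inl (ENNReal.rpow_ne_top_of_nonneg hδ hVt)), ← ENNReal.inv_pow, ← ENNReal.rpow_natCast,
      ← ENNReal.rpow_natCast, ← ENNReal.rpow_mul, ← ENNReal.rpow_mul, mul_comm δ]
  have e5 : (V ^ δ)⁻¹ * (V ^ (1 / p) * V ^ (1 / q')) = V := by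
    rw [← ENNReal.rpow_neg, ← ENNReal.rpow_add _ _ hV0 hVt, ← ENNReal.rpow_add _ _ hV0 hVt]
    have h3 : -δ + (1 / p + 1 / q') = 1 := by
      have := hq.inv_add_inv_eq_one
      simp only [hδdef, one_div]
      linarith
    rw [h3, ENNReal.rpow_one]
  refine (enorm_integral_mul_le_Lp (D.op_nice hu _).meas hv.meas hq).trans ?_
  refine (mul_le_mul' ((hI (c.1 + k) u hu).trans (mul_le_mul_right e1 _)) e2).trans ?_
  rw [e3, e4]
  calc _ = (A * 3 ^ n) * (((W ^ δ)⁻¹) ^ k * (((V ^ δ)⁻¹ * (V ^ (1 / p) * V ^ (1 / q'))) *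
        t₁ * t₂)) := by ring
    _ ≤ _ := by
        rw [e5]
        refine mul_le_mul_right (mul_le_mul_right ?_ _) _
        exact mul_le_mul' (mul_le_mul_right (avg_le_avgPlus H.one_le_p H.meas₁ _) _)
          (avg_le_avgPlus H.one_le_q' H.meas₂ _)

end SparseData

theorem sum_filter_le_tsum_nat {i : ℤ} (J : Finset ℤ) {F : ℤ → ℝ≥0∞} {G : ℕ → ℝ≥0∞}
    (h : ∀ k : ℕ, F (i + k) ≤ G k) : ∑ j ∈ J with ¬ j < i, F j ≤ ∑' k, G k := by
  classical
  have hinj : Set.InjOn (fun j : ℤ => (j - i).toNat) (J.filter fun j => ¬ j < i) := by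
    intro j hj k hk hjk
    have h1 := (Finset.mem_filter.1 hj).2
    have h2 := (Finset.mem_filter.1 hk).2
    simp only at hjk
    omega
  refine le_trans ?_ (ENNReal.sum_le_tsum ((J.filter fun j => ¬ j < i).image
    fun j => (j - i).toNat))
  rw [Finset.sum_image hinj]
  refine Finset.sum_le_sum fun j hj => ?_
  have h1 := (Finset.mem_filter.1 hj).2
  have h2 := h (j - i).toNat
  rwa [show i + ((j - i).toNat : ℤ) = j by omega] at h2

/-- Scales below that of `c` are handled by the recursion, the others by a geometric series at `c`.
The right side refers to the data `H` and not to `u`, `v`, `J`, which the passage to the limit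
relies on. -/
theorem DensityData.HasDecay.exists_sparse_bound_nice (hn : 0 < n) (h : D.HasDecay β B)
    (hI : D.Improves p q A) (hp : 1 < p) (hpq : p < q) (hq : q.HolderConjugate q') :
    ∃ C : ℝ≥0, ∀ (H : SparseData n p q') (c : ℤ × (Fin n → ℤ)) (u v : Euc n → ℂ) (J : Finset ℤ)
      (ε : ℤ → ℂ), (∀ j, ‖ε j‖ ≤ 1) → Nice u → Nice v → (∀ x, ‖u x‖ₑ ≤ ‖H.f₁ x‖ₑ) →
      (∀ x, ‖v x‖ₑ ≤ ‖H.f₂ x‖ₑ) → (∀ x ∉ cell H.a c.1 c.2, u x = 0) →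
      (∀ x ∉ tripleCell H.a c.1 c.2, v x = 0) →
      ‖∫ x, D.trunc 1 J ε u x * v x‖ₑ ≤ C * ∑' d, (H.desc c).indicator H.cost d := by
  obtain ⟨C, hC⟩ := h.exists_step_bound hn hI hp hpq hq (stopFactor n * 3 ^ n)
  have hp0 : 0 < p := by linarith
  set τ : ℝ≥0∞ := ((2 ^ n) ^ (1 / p - 1 / q))⁻¹ with hτ
  have hτ1 : τ < 1 := by
    refine ENNReal.inv_lt_one.2 (ENNReal.one_lt_rpow (one_lt_pow₀ (by norm_num) hn.ne') ?_)
    exact sub_pos.2 (one_div_lt_one_div_of_lt hp0 hpq)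
  have hG : ∑' k : ℕ, τ ^ k ≠ ∞ := by
    rw [ENNReal.tsum_geometric, ENNReal.inv_ne_top]
    exact (tsub_pos_iff_lt.2 hτ1).ne'
  lift (∑' k : ℕ, τ ^ k) to ℝ≥0 using hG with G hG'
  refine ⟨C + A * 3 ^ n * G, fun H c u v J ε hε hu hv h₁ h₂ hu0 hv0 => ?_⟩
  obtain ⟨L, hL⟩ : ∃ L, ∀ j ∈ J, L ≤ j := J.bddBelow
  have hcell : (cell H.a c.1 c.2).indicator u = u := by
    funext x
    by_cases hx : x ∈ cell H.a c.1 c.2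
    · rw [Set.indicator_of_mem hx]
    · rw [Set.indicator_of_notMem hx, hu0 x hx]
  have hlow := SparseData.enorm_sum_le_tsum_cost (H := H) (D := D) (ε := ε)
    (fun G J => hC G J ε hε) hu hv h₁ h₂ hL (c.1 - L).toNat c (by omega)
  rw [hcell] at hlow
  have hhigh : ‖∑ j ∈ J with ¬ j < c.1, ε j * ∫ x, D.op (1 * 2 ^ j) u x * v x‖ₑ ≤
      (A * 3 ^ n * G : ℝ≥0) * ∑' d, (H.desc c).indicator H.cost d := by
    calc ‖∑ j ∈ J with ¬ j < c.1, ε j * ∫ x, D.op (1 * 2 ^ j) u x * v x‖ₑ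
        ≤ ∑ j ∈ J with ¬ j < c.1, ‖∫ x, D.op (1 * 2 ^ j) u x * v x‖ₑ := by
          refine (enorm_sum_le _ _).trans (Finset.sum_le_sum fun j _ => ?_)
          rw [enorm_mul]
          refine mul_le_of_le_one_left zero_le ?_
          rw [← ofReal_norm]
          exact ENNReal.ofReal_le_one.2 (hε j)
      _ ≤ ∑' k : ℕ, (A * 3 ^ n) * (τ ^ k * H.cost c) := sum_filter_le_tsum_nat J fun k =>
          SparseData.enorm_integral_op_le hI hp0 hpq hq hu hv h₁ h₂ hu0 hv0 k
      _ = (A * 3 ^ n * G : ℝ≥0) * H.cost c := by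
          rw [ENNReal.tsum_mul_left, ENNReal.tsum_mul_right, ← hG']
          push_cast; ring
      _ ≤ _ := mul_le_mul_right SparseData.cost_le_tsum _
  have hsum : ∫ x, D.trunc 1 J ε u x * v x =
      ∑ j ∈ J, ε j * ∫ x, D.op (1 * 2 ^ j) u x * v x := by
    simp only [DensityData.trunc, Finset.sum_mul]
    rw [integral_finsetSum _ fun j _ => (((D.op_nice hu _).const_mul _).mul hv).integrable]
    refine Finset.sum_congr rfl fun j _ => ?_
    simp_rw [mul_assoc]
    exact integral_const_mul _ _
  rw [hsum, ← Finset.sum_filter_add_sum_filter_not J (fun j => j < c.1)]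
  refine (enorm_add_le _ _).trans ((add_le_add hlow hhigh).trans (le_of_eq ?_))
  push_cast; ring

/-! ### Passage to the limit -/

theorem enorm_integral_mul_le_eLpNorm {f g : Euc n → ℂ} (hf : AEStronglyMeasurable f volume)
    (hg : AEStronglyMeasurable g volume) {r r' : ℝ} (hr : r.HolderConjugate r') :
    ‖∫ x, f x * g x‖ₑ ≤
      eLpNorm f (ENNReal.ofReal r) volume * eLpNorm g (ENNReal.ofReal r') volume := by
  rw [eLpNorm_ofReal_eq _ hr.pos, eLpNorm_ofReal_eq _ hr.symm.pos]
  refine (enorm_integral_le_lintegral_enorm _).trans ?_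
  simp_rw [enorm_mul]
  exact ENNReal.lintegral_mul_le_Lp_mul_Lq volume hr hf.enorm hg.enorm

/-- The approximant is `f` cut to zero where it is large. Unlike a smooth approximation it satisfies
`|u| ≤ |f|`, so the averages of `f` still dominate. -/
theorem exists_nice_le {f : Euc n → ℂ} {r : ℝ} (hf : Measurable f)
    (hfr : MemLp f (ENNReal.ofReal r) volume) (hs : ∃ R, ∀ x, R < ‖x‖ → f x = 0) {η : ℝ}
    (hη : 0 < η) : ∃ u : Euc n → ℂ, Nice u ∧ (∀ x, ‖u x‖ₑ ≤ ‖f x‖ₑ) ∧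
      eLpNorm (fun x => f x - u x) (ENNReal.ofReal r) volume ≤ ENNReal.ofReal η := by
  obtain ⟨M, hM⟩ := hfr.eLpNorm_indicator_norm_ge_le hf.stronglyMeasurable hη
  obtain ⟨R, hR⟩ := hs
  set E : Set (Euc n) := {x | M ≤ ‖f x‖₊} with hE
  have hEm : MeasurableSet E := measurableSet_le measurable_const (by fun_prop)
  refine ⟨Eᶜ.indicator f, ⟨hf.indicator hEm.compl, ⟨max M 0, fun x => ?_⟩, ⟨R, fun x hx => ?_⟩⟩,
    fun x => enorm_indicator_le_enorm_self _ _, ?_⟩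
  · by_cases hx : x ∈ E
    · rw [Set.indicator_of_notMem (Set.notMem_compl_iff.2 hx), norm_zero]
      exact le_max_right _ _
    · rw [Set.indicator_of_mem hx]
      have : ‖f x‖ < M := by simpa [hE] using hx
      exact this.le.trans (le_max_left _ _)
  · by_cases hxE : x ∈ Eᶜ
    · rw [Set.indicator_of_mem hxE, hR x hx]
    · rw [Set.indicator_of_notMem hxE]
  · refine le_trans (le_of_eq ?_) hM
    congr 1
    funext x
    by_cases hx : x ∈ E
    · rw [Set.indicator_of_notMem (Set.notMem_compl_iff.2 hx), Set.indicator_of_mem hx, sub_zero]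
    · rw [Set.indicator_of_mem hx, Set.indicator_of_notMem hx, sub_self]

theorem ENNReal.le_of_forall_le_add_ofReal_mul {a b M : ℝ≥0∞} (hM : M ≠ ∞)
    (h : ∀ η : ℝ, 0 < η → a ≤ b + ENNReal.ofReal η * M) : a ≤ b := by
  have h1 : Tendsto (fun k : ℕ => b + ENNReal.ofReal (1 / ((k : ℝ) + 1)) * M) atTop (𝓝 b) := by
    have h2 := ENNReal.tendsto_ofReal (tendsto_one_div_add_atTop_nhds_zero_nat (𝕜 := ℝ))
    have h3 := (ENNReal.Tendsto.mul_const h2 (Or.inr hM)).const_add b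
    simpa using h3
  exact ge_of_tendsto' h1 fun k => h _ (by positivity)

/-- The pairing of the limit of truncated sums is controlled by the pairings of truncated sums of
bounded functions. -/
theorem DensityData.HasDecay.enorm_integral_mul_le (hn : 0 < n) (h : D.HasDecay β B) {r r' : ℝ}
    (hr : r.HolderConjugate r') {f₁ f₂ g : Euc n → ℂ} (hf₁ : Measurable f₁)
    (hf₂ : Measurable f₂) (hfr₁ : MemLp f₁ (ENNReal.ofReal r) volume)
    (hfr₂ : MemLp f₂ (ENNReal.ofReal r') volume) (hs₁ : ∃ R, ∀ x, R < ‖x‖ → f₁ x = 0)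
    (hs₂ : ∃ R, ∀ x, R < ‖x‖ → f₂ x = 0) {ε : ℤ → ℂ} (hε : ∀ j, ‖ε j‖ ≤ 1)
    (hg : MemLp g (ENNReal.ofReal r) volume)
    (hlim : Tendsto (fun J : Finset ℤ => eLpNorm (fun x => D.trunc 1 J ε f₁ x - g x)
      (ENNReal.ofReal r) volume) atTop (𝓝 0)) {S : ℝ≥0∞}
    (hS : ∀ (J : Finset ℤ) (u v : Euc n → ℂ), Nice u → Nice v → (∀ x, ‖u x‖ₑ ≤ ‖f₁ x‖ₑ) →
      (∀ x, ‖v x‖ₑ ≤ ‖f₂ x‖ₑ) → ‖∫ x, D.trunc 1 J ε u x * v x‖ₑ ≤ S) :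
    ‖∫ x, g x * f₂ x‖ₑ ≤ S := by
  have hr1 : 1 ≤ ENNReal.ofReal r := by simpa using hr.lt.le
  have : (ENNReal.ofReal r).HolderConjugate (ENNReal.ofReal r') := hr.ennrealOfReal
  obtain ⟨K, hK⟩ := h.exists_eLpNorm_trunc_le hn hr.lt
  set N₁ := eLpNorm f₁ (ENNReal.ofReal r) volume
  set N₂ := eLpNorm f₂ (ENNReal.ofReal r') volume
  have hM : (1 + K) * N₂ + K * N₁ ≠ ∞ :=
    ENNReal.add_ne_top.2 ⟨ENNReal.mul_ne_top (by simp) hfr₂.2.ne,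
      ENNReal.mul_ne_top (by simp) hfr₁.2.ne⟩
  -- The limit is replaced by a finite sum, `f₁` by `u` and `f₂` by `v`. Each replacement costs a
  -- multiple of `η`, and neither `S` nor `M` depends on `η`.
  refine ENNReal.le_of_forall_le_add_ofReal_mul hM fun η hη => ?_
  obtain ⟨J, hJ⟩ := (hlim.eventually_le_const (ENNReal.ofReal_pos.2 hη)).exists
  obtain ⟨u, hu, hu1, hu2⟩ := exists_nice_le hf₁ hfr₁ hs₁ hη
  obtain ⟨v, hv, hv1, hv2⟩ := exists_nice_le hf₂ hfr₂ hs₂ hη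
  set F := D.trunc 1 J ε u with hF
  have hur := hu.memLp (ENNReal.ofReal r)
  have hvr := hv.memLp (ENNReal.ofReal r')
  have hFr : MemLp F (ENNReal.ofReal r) volume := (trunc_nice hu).memLp _
  have hd := hfr₁.sub hur
  have e1 : eLpNorm (fun x => g x - F x) (ENNReal.ofReal r) volume ≤
      ENNReal.ofReal η + K * ENNReal.ofReal η := by
    have h1 : (fun x => g x - F x) =ᵐ[volume] fun x => D.trunc 1 J ε (fun x => f₁ x - u x) x -
        (D.trunc 1 J ε f₁ x - g x) := by
      have h2 := trunc_add_ae (D := D) (hf₁.sub hu.meas) hu.meas hr.lt.le hd hur 1 J ε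
      simp only [Pi.sub_apply, sub_add_cancel] at h2
      filter_upwards [h2] with x hx
      have hx' : D.trunc 1 J ε f₁ x = D.trunc 1 J ε (fun x => f₁ x - u x) x + F x := hx
      rw [hx']; ring
    rw [eLpNorm_congr_ae h1, add_comm (ENNReal.ofReal η)]
    refine (eLpNorm_sub_le (measurable_trunc (hf₁.sub hu.meas) 1 J ε).aestronglyMeasurable
      ((measurable_trunc hf₁ 1 J ε).aestronglyMeasurable.sub hg.1) hr1).trans (add_le_add ?_ hJ)
    exact (hK 1 J ε _ (by simp) hε (hf₁.sub hu.meas) hd).trans (mul_le_mul_right hu2 _)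
  have e2 : eLpNorm F (ENNReal.ofReal r) volume ≤ K * N₁ := by
    refine (hK 1 J ε u (by simp) hε hu.meas hur).trans (mul_le_mul_right ?_ _)
    exact eLpNorm_mono_enorm hu1
  have hsplit : ∫ x, g x * f₂ x = (∫ x, (g x - F x) * f₂ x) + (∫ x, F x * (f₂ x - v x)) +
      ∫ x, F x * v x := by
    have i1 : Integrable (fun x => (g x - F x) * f₂ x) := (hg.sub hFr).integrable_mul hfr₂
    have i2 : Integrable (fun x => F x * (f₂ x - v x)) := hFr.integrable_mul (hfr₂.sub hvr)
    have i3 : Integrable (fun x => F x * v x) := hFr.integrable_mul hvr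
    have i4 : Integrable (fun x => (g x - F x) * f₂ x + F x * (f₂ x - v x)) := i1.add i2
    rw [← integral_add i1 i2, ← integral_add i4 i3]
    refine integral_congr_ae (ae_of_all _ fun x => ?_)
    simp only
    ring
  rw [hsplit]
  refine (enorm_add_le _ _).trans ((add_le_add ((enorm_add_le _ _).trans (add_le_add
    (enorm_integral_mul_le_eLpNorm (hg.sub hFr).1 hfr₂.1 hr)
    (enorm_integral_mul_le_eLpNorm hFr.1 (hfr₂.sub hvr).1 hr))) (hS J u v hu hv hu1 hv1)).trans ?_)
  refine (add_le_add (add_le_add (mul_le_mul_left e1 _) (mul_le_mul' e2 hv2)) le_rfl).trans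
    (le_of_eq ?_)
  ring

end

end SparseRadon

namespace SparseRadon

noncomputable section

open scoped RealInnerProductSpace

variable {n : ℕ} {p q : ℝ}

/-! ### Signed measures with bounded density -/

namespace DensityData

variable (D : DensityData n)

/-- The signed measure `ρ dσ`. -/
def signed : SignedMeasure (Euc n) := D.σ.withDensityᵥ D.ρ

theorem integrable_rho : Integrable D.ρ D.σ :=
  Integrable.of_bound D.meas.aestronglyMeasurable D.K (ae_of_all _ D.bound)

theorem variation_signed_le : D.signed.variation ≤ D.K • D.σ := by
  refine VectorMeasure.variation_le_of_forall_enorm_le fun E hE => ?_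
  rw [signed, withDensityᵥ_apply D.integrable_rho hE]
  refine (enorm_integral_le_lintegral_enorm _).trans ?_
  calc ∫⁻ x in E, ‖D.ρ x‖ₑ ∂D.σ ≤ ∫⁻ _ in E, (D.K : ℝ≥0∞) ∂D.σ := by
        refine lintegral_mono fun x => ?_
        rw [← ofReal_norm, Real.norm_eq_abs]
        exact (ENNReal.ofReal_le_ofReal (D.bound x)).trans (by simp)
    _ = _ := by rw [setLIntegral_const]; rfl

variable {D}

theorem integrable_signed {F : Euc n → ℂ} (hF : Integrable F D.σ) : D.signed.Integrable F :=
  (hF.smul_measure_nnreal (c := D.K)).mono_measure D.variation_signed_le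

theorem withDensity_ofReal_le {ρ : Euc n → ℝ} (h : ∀ x, |ρ x| ≤ D.K) :
    D.σ.withDensity (fun x => ENNReal.ofReal (ρ x)) ≤ D.K • D.σ := by
  refine Measure.le_iff.2 fun E hE => ?_
  rw [withDensity_apply _ hE]
  calc ∫⁻ x in E, ENNReal.ofReal (ρ x) ∂D.σ ≤ ∫⁻ _ in E, (D.K : ℝ≥0∞) ∂D.σ := by
        refine lintegral_mono fun x => ?_
        exact (ENNReal.ofReal_le_ofReal ((le_abs_self _).trans (h x))).trans (by simp)
    _ = _ := by rw [setLIntegral_const]; rfl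

theorem integral_signed {F : Euc n → ℂ} (hF : Integrable F D.σ) :
    ∫ᵛ y, F y ∂<•D.signed = ∫ y, (D.ρ y : ℂ) * F y ∂D.σ := by
  have hρ := D.meas
  have hb : ∀ x, |-D.ρ x| ≤ D.K := fun x => by rw [abs_neg]; exact D.bound x
  have := isFiniteMeasure_withDensity_ofReal D.integrable_rho.2
  have := isFiniteMeasure_withDensity_ofReal D.integrable_rho.neg.2
  have h1 : Integrable F (D.σ.withDensity fun x => ENNReal.ofReal (D.ρ x)) :=
    (hF.smul_measure_nnreal (c := D.K)).mono_measure (withDensity_ofReal_le D.bound)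
  have h2 : Integrable F (D.σ.withDensity fun x => ENNReal.ofReal (-D.ρ x)) :=
    (hF.smul_measure_nnreal (c := D.K)).mono_measure (withDensity_ofReal_le hb)
  rw [signed, withDensityᵥ_eq_withDensity_pos_part_sub_withDensity_neg_part D.integrable_rho,
    VectorMeasure.integral_sub_vectorMeasure, VectorMeasure.integral_toSignedMeasure,
    VectorMeasure.integral_toSignedMeasure,
    integral_withDensity_eq_integral_toReal_smul (by fun_prop) (by simp),
    integral_withDensity_eq_integral_toReal_smul (by fun_prop) (by simp), ← integral_sub]
  · refine integral_congr_ae (ae_of_all _ fun x => ?_)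
    simp only [Complex.real_smul, ← sub_mul, ENNReal.toReal_ofReal', ← Complex.ofReal_sub]
    rcases le_total 0 (D.ρ x) with h | h
    · rw [max_eq_left h, max_eq_right (by linarith), sub_zero]
    · rw [max_eq_right h, max_eq_left (by linarith), zero_sub, neg_neg]
  · exact (integrable_withDensity_iff_integrable_smul' (by fun_prop) (by simp)).1 h1
  · exact (integrable_withDensity_iff_integrable_smul' (by fun_prop) (by simp)).1 h2
  · rwa [VectorMeasure.Integrable, Measure.variation_toSignedMeasure]
  · rwa [VectorMeasure.Integrable, Measure.variation_toSignedMeasure]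

/-- `σ` may be singular, so a Lebesgue-null set can be charged after a particular translation; by
Fubini this happens only for a null set of `x`. -/
theorem ae_ae_translate {f g : Euc n → ℂ} (h : f =ᵐ[volume] g) (c : ℝ) :
    ∀ᵐ x, ∀ᵐ y ∂D.σ, f (x - c • y) = g (x - c • y) := by
  set N := toMeasurable volume {x | f x ≠ g x}
  have hN : MeasurableSet N := measurableSet_toMeasurable _ _
  have hN0 : volume N = 0 := by rw [measure_toMeasurable]; exact h
  have h1 : ∫⁻ x, ∫⁻ y, N.indicator 1 (x - c • y) ∂D.σ = 0 := by
    have hm : Measurable (N.indicator (1 : Euc n → ℝ≥0∞)) := measurable_one.indicator hN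
    rw [lintegral_lintegral_swap (Measurable.aemeasurable (by fun_prop))]
    have h2 : ∀ y, ∫⁻ x, N.indicator (1 : Euc n → ℝ≥0∞) (x - c • y) = 0 := fun y => by
      rw [lintegral_sub_right_eq_self (fun x => N.indicator (1 : Euc n → ℝ≥0∞) x) (c • y),
        lintegral_indicator_one hN, hN0]
    simp_rw [h2, lintegral_zero]
  have hm : Measurable (N.indicator (1 : Euc n → ℝ≥0∞)) := measurable_one.indicator hN
  rw [lintegral_eq_zero_iff (Measurable.lintegral_prod_right' (f := fun z : Euc n × Euc n =>
    N.indicator (1 : Euc n → ℝ≥0∞) (z.1 - c • z.2)) (ν := D.σ) (by fun_prop))] at h1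
  filter_upwards [h1] with x hx
  have hx' : ∫⁻ y, N.indicator (1 : Euc n → ℝ≥0∞) (x - c • y) ∂D.σ = 0 := hx
  rw [lintegral_eq_zero_iff (by fun_prop)] at hx'
  filter_upwards [hx'] with y hy
  by_contra hne
  have : x - c • y ∈ N := subset_toMeasurable _ _ hne
  simp [Set.indicator_of_mem this] at hy

theorem conv_dilate_ae_eq {f g : Euc n → ℂ} (hfg : f =ᵐ[volume] g) (hg : Measurable g) {r : ℝ}
    (hr : 1 ≤ r) (hgr : MemLp g (ENNReal.ofReal r) volume) (j : ℤ) :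
    conv (dilate D.signed j) f =ᵐ[volume] D.op (1 * 2 ^ j) g := by
  filter_upwards [ae_ae_translate (D := D) hfg (2 ^ j),
    ae_integrable_translate (D := D) hg hr hgr (2 ^ j)] with x h1 h2
  have hφ : Measurable fun y : Euc n => (2 : ℝ) ^ j • y := by fun_prop
  have hac : D.signed.variation ≪ D.σ :=
    (Measure.absolutelyContinuous_of_le D.variation_signed_le).trans
      (Measure.smul_absolutelyContinuous)
  have h3 : (fun y => f (x - y)) =ᵐ[(dilate D.signed j).variation] fun y => g (x - y) := by
    have h4 : ∀ᵐ y ∂D.signed.variation, f (x - (2 : ℝ) ^ j • y) = g (x - (2 : ℝ) ^ j • y) :=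
      hac.ae_le h1
    have hemb : MeasurableEmbedding fun y : Euc n => (2 : ℝ) ^ j • y :=
      measurableEmbedding_const_smul₀ (by positivity)
    rw [dilate, hemb.variation_map]
    exact hemb.ae_map_iff.2 h4
  rw [conv, VectorMeasure.integral_congr_ae h3, dilate, VectorMeasure.integral_map hφ
    (f := fun y => g (x - y)) (Measurable.aestronglyMeasurable (by fun_prop)) (integrable_signed h2), integral_signed h2]
  simp only [op, one_mul]

theorem conv_eq_op {f : Euc n → ℂ} (hf : Nice f) (x : Euc n) :
    conv D.signed f x = D.op 1 f x := by
  have h1 : Integrable (fun y => f (x - y)) D.σ := by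
    obtain ⟨C, hC⟩ := hf.bdd
    have := hf.meas
    exact Integrable.of_bound (Measurable.aestronglyMeasurable (by fun_prop)) C
      (ae_of_all _ fun y => hC _)
  rw [conv, integral_signed h1]
  simp only [op, one_smul]

theorem op_comp_smul (f : Euc n → ℂ) (c : ℝ) (x : Euc n) :
    D.op 1 (fun y => f (c • y)) x = D.op c f (c • x) := by
  simp only [op, one_smul, smul_sub]

theorem lintegral_comp_two_zpow_smul {F : Euc n → ℝ≥0∞} (hF : Measurable F) (j : ℤ) :
    ∫⁻ x, F ((2 : ℝ) ^ j • x) = (vol n j : ℝ≥0∞)⁻¹ * ∫⁻ x, F x := by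
  have h2 : (2 : ℝ) ^ j ≠ 0 := by positivity
  rw [← lintegral_map (f := F) hF (measurable_const_smul _), Measure.map_addHaar_smul _ h2,
    lintegral_smul_measure, finrank_euclideanSpace, Fintype.card_fin, smul_eq_mul]
  congr 1
  rw [abs_inv, abs_of_pos (by positivity), ENNReal.ofReal_inv_of_pos (by positivity)]
  congr 1
  rw [ENNReal.ofReal_pow (by positivity), vol]
  push_cast
  congr 1
  rw [← ENNReal.ofReal_coe_nnreal]
  simp

/-- Dilation by `2^j` conjugates the operator at scale `j` to convolution with `μ`. The changes of
variables in the two norms leave the power `1/q - 1/p` of the volume. -/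
theorem exists_improves (h : ConvBounded D.signed p q) (hp : 0 < p) (hpq : p < q) :
    ∃ A : ℝ≥0, D.Improves p q A := by
  obtain ⟨A, hA⟩ := h
  refine ⟨A, fun j f hf => ?_⟩
  have hq : 0 < q := hp.trans hpq
  have h2 : (0 : ℝ) < 2 ^ j := by positivity
  have hn : Nice fun x => f ((2 : ℝ) ^ j • x) := by
    obtain ⟨C, hC⟩ := hf.bdd
    obtain ⟨R, hR⟩ := hf.supp
    have := hf.meas
    refine ⟨by fun_prop, ⟨C, fun x => hC _⟩, ⟨R / 2 ^ j, fun x hx => hR _ ?_⟩⟩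
    rw [norm_smul, Real.norm_of_nonneg h2.le, mul_comm]
    exact (div_lt_iff₀ h2).1 hx
  have h1 := hA _ (hn.memLp (ENNReal.ofReal p))
  have e : conv D.signed (fun x => f ((2 : ℝ) ^ j • x)) =
      fun x => D.op (1 * 2 ^ j) f ((2 : ℝ) ^ j • x) := by
    funext x
    rw [conv_eq_op hn, op_comp_smul f, one_mul]
  rw [e, eLpNorm_ofReal_eq _ hq, eLpNorm_ofReal_eq _ hp] at h1
  have m1 := (D.op_nice hf (1 * 2 ^ j)).meas
  have m2 := hf.meas
  rw [lintegral_comp_two_zpow_smul (F := fun x => ‖D.op (1 * 2 ^ j) f x‖ₑ ^ q) (by fun_prop),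
    lintegral_comp_two_zpow_smul (F := fun x => ‖f x‖ₑ ^ p) (by fun_prop),
    ENNReal.mul_rpow_of_nonneg _ _ (by positivity),
    ENNReal.mul_rpow_of_nonneg _ _ (by positivity)] at h1
  set V : ℝ≥0∞ := (vol n j : ℝ≥0∞) with hV
  have hV0 : V ≠ 0 := vol_ne_zero _
  have hVt : V ≠ ∞ := ENNReal.coe_ne_top
  set a := (∫⁻ x, ‖D.op (1 * 2 ^ j) f x‖ₑ ^ q) ^ (1 / q)
  set b := (∫⁻ x, ‖f x‖ₑ ^ p) ^ (1 / p)
  have e1 : V ^ (1 / q) * V⁻¹ ^ (1 / q) = 1 := by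
    rw [← ENNReal.mul_rpow_of_nonneg _ _ (by positivity), ENNReal.mul_inv_cancel hV0 hVt,
      ENNReal.one_rpow]
  have e2 : V ^ (1 / q) * V⁻¹ ^ (1 / p) = (V ^ (1 / p - 1 / q))⁻¹ := by
    rw [ENNReal.inv_rpow, ← ENNReal.rpow_neg, ← ENNReal.rpow_add _ _ hV0 hVt, ← ENNReal.rpow_neg]
    congr 1; ring
  calc a = V ^ (1 / q) * V⁻¹ ^ (1 / q) * a := by rw [e1, one_mul]
    _ = V ^ (1 / q) * (V⁻¹ ^ (1 / q) * a) := by ring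
    _ ≤ V ^ (1 / q) * (A * (V⁻¹ ^ (1 / p) * b)) := mul_le_mul_right h1 _
    _ = A * (V ^ (1 / q) * V⁻¹ ^ (1 / p)) * b := by ring
    _ = _ := by rw [e2]

theorem integrable_echar (ξ : Euc n) : Integrable (fun y => echar (-⟪y, ξ⟫)) D.σ := by
  refine Integrable.of_bound (C := 1) (Measurable.aestronglyMeasurable ?_)
    (ae_of_all _ fun y => (norm_echar _).le)
  unfold echar
  fun_prop

theorem symbol_eq_measureFourier (ξ : Euc n) : D.symbol ξ = measureFourier D.signed ξ := by
  have h1 : ∀ x : Euc n, Complex.exp (-(2 * Real.pi * inner ℝ x ξ : ℝ) * Complex.I) =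
      echar (-⟪x, ξ⟫) := by
    intro x
    rw [echar]; congr 1; push_cast; ring
  simp only [measureFourier, h1]
  rw [integral_signed (integrable_echar ξ), symbol]
  simp_rw [mul_comm]

/-- As the total mass is zero, `1` may be subtracted from the character, which is Lipschitz in `⟪y,
ξ⟫`, and `|y| ≤ 1` almost everywhere. -/
theorem norm_symbol_le (h0 : D.signed Set.univ = 0) (ξ : Euc n) :
    ‖D.symbol ξ‖ ≤ 2 * Real.pi * ‖ξ‖ * (D.K * D.σ.real Set.univ) := by
  have hi : Integrable (fun y => (D.ρ y : ℂ)) D.σ := D.integrable_rho.ofReal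
  have h1 : ∫ y, (D.ρ y : ℂ) ∂D.σ = 0 := by
    rw [signed, withDensityᵥ_apply D.integrable_rho MeasurableSet.univ, setIntegral_univ] at h0
    rw [integral_complex_ofReal, h0, Complex.ofReal_zero]
  have h2 : D.symbol ξ = -∫ y, (1 - echar (-⟪y, ξ⟫)) * (D.ρ y : ℂ) ∂D.σ := by
    have h3 : Integrable (fun y => echar (-⟪y, ξ⟫) * (D.ρ y : ℂ)) D.σ := by
      simp_rw [mul_comm]
      exact integrable_rho_mul (integrable_echar ξ)
    simp_rw [sub_mul, one_mul]
    rw [integral_sub hi h3, h1, zero_sub, neg_neg, symbol]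
  rw [h2, norm_neg]
  refine (norm_integral_le_of_norm_le_const (C := 2 * Real.pi * ‖ξ‖ * D.K) ?_).trans
    (le_of_eq (by ring))
  filter_upwards [D.ae_mem_ball] with y hy
  rw [norm_mul, Complex.norm_real, Real.norm_eq_abs]
  refine mul_le_mul ((norm_one_sub_echar_le _).trans ?_) (D.bound y) (abs_nonneg _) (by positivity)
  refine mul_le_mul_of_nonneg_left ?_ (by positivity)
  rw [abs_neg]
  refine (abs_real_inner_le_norm _ _).trans ?_
  exact mul_le_of_le_one_left (norm_nonneg _) (by simpa using hy)

/-- Mean zero gives first order vanishing on `|ξ| ≤ 1`, the hypothesis gives decay on `|ξ| ≥ 1`. The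
exponent is capped at `1` since only first order vanishing is known. -/
theorem exists_hasDecay (h0 : D.signed Set.univ = 0) {α : ℝ} (hα : 0 < α) {A : ℝ}
    (hA : ∀ ξ : Euc n, ξ ≠ 0 → ‖measureFourier D.signed ξ‖ ≤ A * ‖ξ‖ ^ (-α)) :
    ∃ (β : ℝ) (B : ℝ≥0), D.HasDecay β B := by
  set B₀ : ℝ := max (2 * Real.pi * (D.K * D.σ.real Set.univ)) A with hB₀
  have hBnn : 0 ≤ B₀ := le_max_of_le_left (by positivity)
  have hβ : 0 < min 1 α := lt_min one_pos hα
  refine ⟨min 1 α, NNReal.mk B₀ hBnn, hβ, min_le_left _ _, fun ξ => ?_⟩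
  rw [NNReal.coe_mk]
  set β := min 1 α
  by_cases hξ : ξ = 0
  · have h1 := norm_symbol_le h0 ξ
    rw [hξ, norm_zero, mul_zero, zero_mul] at h1
    rw [hξ]
    exact h1.trans (by positivity)
  have hpos : 0 < ‖ξ‖ := norm_pos_iff.2 hξ
  rcases le_total ‖ξ‖ 1 with h | h
  · have h1 : ‖ξ‖ ≤ ‖ξ‖ ^ β := by
      simpa using Real.rpow_le_rpow_of_exponent_ge hpos h (min_le_left 1 α)
    have h2 : ‖ξ‖ ^ β ≤ ‖ξ‖ ^ (-β) := Real.rpow_le_rpow_of_exponent_ge hpos h (by linarith)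
    rw [min_eq_left h2]
    calc ‖D.symbol ξ‖ ≤ (2 * Real.pi * (D.K * D.σ.real Set.univ)) * ‖ξ‖ :=
          (norm_symbol_le h0 ξ).trans (le_of_eq (by ring))
      _ ≤ B₀ * ‖ξ‖ ^ β := mul_le_mul (le_max_left _ _) h1 (norm_nonneg _) hBnn
  · have h2 : ‖ξ‖ ^ (-β) ≤ ‖ξ‖ ^ β := Real.rpow_le_rpow_of_exponent_le h (by linarith)
    rw [min_eq_right h2, symbol_eq_measureFourier]
    refine (hA ξ hξ).trans (mul_le_mul (le_max_right _ _) ?_ (by positivity) hBnn)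
    exact Real.rpow_le_rpow_of_exponent_le h (neg_le_neg (min_le_right _ _))

end DensityData

end

end SparseRadon

namespace SparseRadon

noncomputable section

variable {n : ℕ} {p q' : ℝ} {f g : Euc n → ℂ}

/-! ### Change of representatives and initial cube -/

theorem avg_congr (h : f =ᵐ[volume] g) (Q : Cube n) : avg p f Q = avg p g Q := by
  unfold avg
  congr 2
  refine lintegral_congr_ae ((ae_restrict_of_ae h).mono fun x hx => ?_)
  simp only [hx]

theorem avgPlus_congr (h : f =ᵐ[volume] g) (Q : Cube n) : avgPlus p f Q = avgPlus p g Q := by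
  unfold avgPlus
  refine tsum_congr fun m => ?_
  congr 1
  refine avg_congr ?_ Q
  filter_upwards [h] with x hx
  have h1 : x ∈ levelSet p f Q m ↔ x ∈ levelSet p g Q m := by
    cases m <;> simp only [levelSet, Set.mem_ofPred_eq, hx, avg_congr h]
  by_cases h2 : x ∈ levelSet p f Q m
  · rw [Set.indicator_of_mem h2, Set.indicator_of_mem (h1.1 h2), hx]
  · rw [Set.indicator_of_notMem h2, Set.indicator_of_notMem fun h3 => h2 (h1.2 h3)]

/-- This is the reason for a movable corner `a`: in the grid with corner `0`, no cell contains a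
ball around the origin, however large the cell. -/
theorem exists_closedBall_subset_cell (R : ℝ) : ∃ (a : Fin n → ℝ) (c : ℤ × (Fin n → ℤ)),
    Metric.closedBall (0 : Euc n) R ⊆ cell a c.1 c.2 := by
  obtain ⟨k, hk⟩ := pow_unbounded_of_one_lt (2 * R) (one_lt_two (α := ℝ))
  refine ⟨fun _ => -R, ((k : ℤ), 0), fun x hx => ?_⟩
  rw [mem_cell]
  funext t
  have h1 : |x t| ≤ R := (abs_apply_le_norm x t).trans (by simpa using hx)
  have h2 := abs_le.1 h1
  have h3 : (0 : ℝ) < 2 ^ k := by positivity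
  simp only [idx, zpow_natCast, Pi.zero_apply, Int.floor_eq_zero_iff, Set.mem_Ico]
  exact ⟨div_nonneg (by linarith) h3.le, (div_lt_one h3).2 (by linarith)⟩

theorem exists_measurable_rep {r : ℝ} (hf : MemLp f (ENNReal.ofReal r) volume) {E : Set (Euc n)}
    (hE : MeasurableSet E) (hs : ∀ x ∉ E, f x = 0) : ∃ h : Euc n → ℂ, Measurable h ∧
      f =ᵐ[volume] h ∧ MemLp h (ENNReal.ofReal r) volume ∧ ∀ x ∉ E, h x = 0 := by
  have h1 : f =ᵐ[volume] E.indicator (hf.1.mk f) := by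
    filter_upwards [hf.1.ae_eq_mk] with x hx
    by_cases h2 : x ∈ E
    · rw [Set.indicator_of_mem h2, hx]
    · rw [Set.indicator_of_notMem h2, hs x h2]
  exact ⟨_, hf.1.stronglyMeasurable_mk.measurable.indicator hE, h1, hf.ae_eq h1,
    fun x hx => Set.indicator_of_notMem hx _⟩

theorem isSingularRadon_of_eq_zero {μ : SignedMeasure (Euc 0)} (h : μ = 0) {ε : ℤ → ℂ} {r : ℝ}
    {f : Euc 0 → ℂ} : IsSingularRadon μ ε r f (fun _ => 0) := by
  have h1 : ∀ j, dilate μ j = 0 := fun j => by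
    rw [dilate, h, VectorMeasure.map_zero]
  refine ⟨MemLp.zero', ?_⟩
  simp only [h1, conv, VectorMeasure.integral_zero_vectorMeasure, mul_zero, Finset.sum_const_zero,
    sub_zero]
  simp

theorem isSparse_empty : IsSparse (∅ : Set (Cube n)) :=
  ⟨fun _ => ∅, fun _ h => absurd h (Set.notMem_empty _), Set.pairwiseDisjoint_empty⟩

theorem signedMeasure_eq_zero_of_dim_zero {μ : SignedMeasure (Euc 0)} (h : μ Set.univ = 0) :
    μ = 0 := by
  ext E _
  rcases E.eq_empty_or_nonempty with h1 | h1
  · simp [h1]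
  · rw [Subsingleton.eq_univ_of_nonempty h1, h]; rfl

variable {D : DensityData n} {q β : ℝ} {A B : ℝ≥0}

/-- Sparse domination of the singular Radon transform. -/
theorem DensityData.HasDecay.exists_sparse_domination (hn : 0 < n) (h : D.HasDecay β B)
    (hI : D.Improves p q A) (hp : 1 < p) (hpq : p < q) (hq : q.HolderConjugate q') :
    ∃ C : ℝ≥0, ∀ ε : ℤ → ℂ, (∀ j, ‖ε j‖ ≤ 1) → ∀ r r' : ℝ, 1 < r → r.HolderConjugate r' →
      ∀ f₁ f₂ : Euc n → ℂ, HasCompactSupport f₁ → HasCompactSupport f₂ →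
        MemLp f₁ (ENNReal.ofReal r) volume → MemLp f₂ (ENNReal.ofReal r') volume →
        ∃ Tf₁ : Euc n → ℂ, IsSingularRadon D.signed ε r f₁ Tf₁ ∧
          ∃ 𝒬 : Set (Cube n), IsSparse 𝒬 ∧
            ‖∫ x, Tf₁ x * (starRingEnd ℂ) (f₂ x)‖ₑ ≤
              C * ∑' Q : 𝒬, volume (Q : Cube n).carrier *
                avgPlus p f₁ (Q : Cube n) * avgPlus q' f₂ (Q : Cube n).triple := by
  obtain ⟨C, hC⟩ := h.exists_sparse_bound_nice hn hI hp hpq hq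
  refine ⟨C, fun ε hε r r' hr hrr f₁ f₂ hc₁ hc₂ hf₁ hf₂ => ?_⟩
  obtain ⟨R, hR⟩ := (hc₁.isCompact.union hc₂.isCompact).isBounded.subset_closedBall (0 : Euc n)
  obtain ⟨a, c, hcell⟩ := exists_closedBall_subset_cell (n := n) R
  have hz₁ : ∀ x ∉ Metric.closedBall 0 R, f₁ x = 0 := fun x hx => by
    by_contra hne
    exact hx (hR (Or.inl (subset_tsupport _ hne)))
  have hz₂ : ∀ x ∉ Metric.closedBall 0 R, f₂ x = 0 := fun x hx => by
    by_contra hne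
    exact hx (hR (Or.inr (subset_tsupport _ hne)))
  obtain ⟨g₁, hm₁, he₁, hg₁, hb₁⟩ := exists_measurable_rep hf₁ measurableSet_closedBall hz₁
  obtain ⟨g₂, hm₂, he₂, hg₂, hb₂⟩ := exists_measurable_rep hf₂ measurableSet_closedBall hz₂
  have hs₁ : ∀ x ∉ cell a c.1 c.2, g₁ x = 0 := fun x hx => hb₁ x fun h => hx (hcell h)
  have hs₂ : ∀ x ∉ cell a c.1 c.2, g₂ x = 0 := fun x hx => hb₂ x fun h => hx (hcell h)
  obtain ⟨T, hT, hlim⟩ := h.exists_tendsto_trunc hn hr hm₁ hg₁ hε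
  refine ⟨T, ⟨hT, hlim.congr fun J => eLpNorm_congr_ae ?_⟩, ?_⟩
  · have h1 : ∀ᵐ x, ∀ j : ℤ, conv (dilate D.signed j) f₁ x = D.op (1 * 2 ^ j) g₁ x :=
      ae_all_iff.2 fun j => DensityData.conv_dilate_ae_eq he₁ hm₁ hr.le hg₁ j
    filter_upwards [h1] with x hx
    simp only [DensityData.trunc, hx]
  set H : SparseData n p q' := ⟨a, g₁, g₂, hp.le, hq.symm.lt.le, hm₁, hm₂⟩ with hH
  refine ⟨H.cube '' H.desc c, H.isSparse c, ?_⟩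
  have hsum : ∑' Q : (H.cube '' H.desc c : Set (Cube n)), volume (Q : Cube n).carrier *
      avgPlus p f₁ (Q : Cube n) * avgPlus q' f₂ (Q : Cube n).triple =
      ∑' d, (H.desc c).indicator H.cost d := by
    rw [SparseData.tsum_cost_eq]
    refine tsum_congr fun Q => ?_
    rw [avgPlus_congr he₁, avgPlus_congr he₂]
  have hint : ∫ x, T x * (starRingEnd ℂ) (f₂ x) = ∫ x, T x * (starRingEnd ℂ) (g₂ x) := by
    refine integral_congr_ae (he₂.mono fun x hx => ?_)
    simp only [hx]
  rw [hsum, hint]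
  have hball : ∀ x : Euc n, R < ‖x‖ → x ∉ Metric.closedBall 0 R := fun x hx h => by
    rw [mem_closedBall_zero_iff] at h
    linarith
  -- The limit argument is bilinear, so it is applied to the conjugate of `g₂`, which has the same
  -- modulus and hence the same averages.
  refine h.enorm_integral_mul_le hn hrr hm₁ (Complex.continuous_conj.measurable.comp hm₂) hg₁
    hg₂.star ⟨R, fun x hx => hb₁ x (hball x hx)⟩ ⟨R, fun x hx => by simp [hb₂ x (hball x hx)]⟩
    hε hT hlim fun J u v hu hv hu1 hv1 => ?_
  have hv1' : ∀ x, ‖v x‖ₑ ≤ ‖g₂ x‖ₑ := fun x => (hv1 x).trans (le_of_eq (by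
    rw [← ofReal_norm, ← ofReal_norm, Function.comp_apply, RCLike.norm_conj]))
  refine hC H c u v J ε hε hu hv hu1 hv1' (fun x hx => ?_) fun x hx => ?_
  · have := hu1 x
    rw [hs₁ x hx, enorm_zero] at this
    exact enorm_eq_zero.1 (le_antisymm this zero_le)
  · have := hv1' x
    rw [hs₂ x fun hx' => hx (cell_subset_tripleCell _ _ _ hx'), enorm_zero] at this
    exact enorm_eq_zero.1 (le_antisymm this zero_le)

end

end SparseRadon

/-! ### Proof of the theorem from the sparse domination of `ρ dσ` -/

open SparseRadon in
theorem theorem2 {n : ℕ}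
    (σ : Measure (EuclideanSpace ℝ (Fin n))) [IsFiniteMeasure σ]
    (μ : SignedMeasure (EuclideanSpace ℝ (Fin n)))
    (ρ : EuclideanSpace ℝ (Fin n) → ℝ) (hρ : Measurable ρ) (hρb : ∃ K : ℝ, ∀ x, |ρ x| ≤ K)
    (hμ : μ = σ.withDensityᵥ ρ)
    (hσ : σ (Metric.closedBall 0 1)ᶜ = 0)
    (hμ0 : μ Set.univ = 0)
    (α : ℝ) (hα : 0 < α)
    (hdecay : ∃ A : ℝ, ∀ ξ : EuclideanSpace ℝ (Fin n), ξ ≠ 0 →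
      max ‖measureFourier σ.toSignedMeasure ξ‖ ‖measureFourier μ ξ‖ ≤ A * ‖ξ‖ ^ (-α))
    (p q q' : ℝ) (hp : 1 < p) (hpq : p < q) (hq' : q.HolderConjugate q')
    (hbdd : ConvBounded μ p q) :
    ∃ C : ℝ≥0, ∀ ε : ℤ → ℂ, (∀ j, ‖ε j‖ ≤ 1) →
      ∀ r r' : ℝ, 1 < r → r.HolderConjugate r' →
      ∀ f₁ f₂ : EuclideanSpace ℝ (Fin n) → ℂ,
        HasCompactSupport f₁ → HasCompactSupport f₂ →
        MemLp f₁ (ENNReal.ofReal r) volume → MemLp f₂ (ENNReal.ofReal r') volume →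
        ∃ Tf₁ : EuclideanSpace ℝ (Fin n) → ℂ,
          IsSingularRadon μ ε r f₁ Tf₁ ∧
          ∃ 𝒬 : Set (Cube n), IsSparse 𝒬 ∧
            ‖∫ x, Tf₁ x * (starRingEnd ℂ) (f₂ x)‖ₑ ≤
              C * ∑' Q : 𝒬, volume (Q : Cube n).carrier *
                avgPlus p f₁ (Q : Cube n) * avgPlus q' f₂ (Q : Cube n).triple := by
  obtain ⟨K, hK⟩ := hρb
  obtain ⟨A, hA⟩ := hdecay
  -- In dimension zero all cubes have volume one and the geometric series over large scales fails.
  -- But a signed measure of total mass zero on a point is zero, and the empty collection suffices.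
  rcases n.eq_zero_or_pos with rfl | hn
  · have hμz := signedMeasure_eq_zero_of_dim_zero hμ0
    refine ⟨0, fun ε _ r r' _ _ f₁ f₂ _ _ _ _ =>
      ⟨fun _ => 0, isSingularRadon_of_eq_zero hμz, ∅, isSparse_empty, ?_⟩⟩
    simp
  have hK0 : 0 ≤ K := (abs_nonneg _).trans (hK 0)
  set D : DensityData n := ⟨σ, inferInstance, ρ, hρ, NNReal.mk K hK0, hK, hσ⟩
  have hD : D.signed = μ := hμ.symm
  rw [← hD] at hμ0 hA hbdd ⊢
  obtain ⟨β, B, hdec⟩ := DensityData.exists_hasDecay hμ0 hα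
    fun ξ hξ => (le_max_right _ _).trans (hA ξ hξ)
  obtain ⟨A', hI⟩ := DensityData.exists_improves hbdd (by linarith) hpq
  exact hdec.exists_sparse_domination hn hI hp hpq hq'
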